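/- Let $M$ be a complex manifold of dimension $n$ with local holomorphic coordinates $z^k,\bar z^l$ and dual fibre coordinates $\zeta_k,\bar\zeta_l$ on $T^*M$; functions are complex valued, $\nu$ is a formal parameter, $\epsilon^2=0$, repeated indices are summed, and $\partial_k=\partial/\partial z^k$, $\bar\partial_l=\partial/\partial\bar z^l$. *Definitions.* A formal differential operator $A=\sum_{r\ge0}\nu^rA_r$ on $M$ is natural if $A_r$ has order at most $r$ for all $r$; its $\sigma$-symbol is $\sigma(A)=\sum_r\sigma_r(A_r)$, where $\sigma_r(D)(df_x)=\frac1{r!}D\big((f-f(x))^r\big)(x)$ is the principal symbol of order $r$. It is an element of $C^\infty(T^*M,Z)$, the algebra of formal functions near the zero section $Z$ (in coordinates, formal series in $\zeta_k,\bar\zeta_l$ with smooth coefficients), which carries the canonical bracket $\{\cdot,\cdot\}_{T^*M}$ with $\{\zeta_k,z^k\}=1$; $E$ denotes restriction to $Z$. A Kähler–Poisson tensor is a smooth tensor $g^{lk}$ of type $(1,1)$ with $g^{lk}\partial_kg^{qp}=g^{qk}\partial_kg^{lp}$ and $g^{lk}\bar\partial_lg^{qp}=g^{lp}\bar\partial_lg^{qk}$;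 its bracket is $\{u,v\}_g=g^{lk}(\bar\partial_lu\,\partial_kv-\partial_ku\,\bar\partial_lv)$. An infinitesimal deformation $g^{lk}+\epsilon h^{lk}$ of it is given by a tensor $h^{lk}$ of type $(1,1)$ such that these identities hold for $g+\epsilon h$ modulo $\epsilon^2$; its bracket on $C^\infty(M)[\epsilon]$ is $\{\cdot,\cdot\}_g+\epsilon\{\cdot,\cdot\}_h$. A star product with separation of variables on $(M,g)$ is an associative product $u*v=\sum_r\nu^rC_r(u,v)$ on $C^\infty(M)[[\nu]]$ with unit $1$, where the $C_r$ are bidifferential operators that differentiate the first argument only in antiholomorphic and the second only in holomorphic directions, $C_0(u,v)=uv$ and $C_1(u,v)-C_1(v,u)=\{u,v\}_g$. Its formal Berezin transform is the formal differential operator $B$ with $B(ab)=b*a$ for all local holomorphic $a$ and local antiholomorphic $b$. A deformation formal symplectic groupoid with separation of variables over $(M,g+\epsilon h)$ is given by its source and target mappings, that is, $\epsilon$-linear mappings $S,T:C^\infty(M)[\epsilon]\to C^\infty(T^*M,Z)[\epsilon]$ such that $E(Sf)=E(Tf)=f$, $S(uv)=Su\,Sv$, $T(uv)=Tu\,Tv$,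 $S\{u,v\}=\{Su,Sv\}_{T^*M}$, $T\{u,v\}=-\{Tu,Tv\}_{T^*M}$, $\{Su,Tv\}_{T^*M}=0$, and $Sa=a$, $Tb=b$ for local holomorphic $a$ and local antiholomorphic $b$. $\mathcal K[\epsilon]$ is the set of $F=K+\epsilon J\in C^\infty(T^*M,Z)[\epsilon]$ whose expansion into components homogeneous in the fibre variables starts in degree at least $2$ and for which $\{e^{H_F}a,\tilde a\}_{T^*M}=0$ and $\{e^{H_F}b,\tilde b\}_{T^*M}=0$ for all local holomorphic $a,\tilde a$ and local antiholomorphic $b,\tilde b$, where $H_FQ=\{F,Q\}_{T^*M}$. **Theorem.** Let $*$ be a star product with separation of variables on a Kähler–Poisson manifold $(M,g^{lk})$ with formal Berezin transform $B=\exp\left(\frac1\nu X\right)$, $X=\nu^2X_2+\nu^3X_3+\dots$. Then the formal differential operator $Y=\nu^2X_3+\nu^4X_5+\dots$ is natural, and there is a tensor $h^{lk}$ of type $(1,1)$ on $M$ such that $$X_3=\tfrac12\,h^{lk}\frac{\partial^2}{\partial z^k\,\partial\bar z^l}$$ and $g^{lk}+\epsilon h^{lk}$ is an infinitesimal deformation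 of $g^{lk}$. There is a unique deformation formal symplectic groupoid with separation of variables over $(M,g^{lk}+\epsilon h^{lk})$, with source and target mappings $S,T$, and a unique element $F=K+\epsilon J\in\mathcal K[\epsilon]$ whose components of degree two are $K_2=g^{lk}\zeta_k\bar\zeta_l$ and $J_2=h^{lk}\zeta_k\bar\zeta_l$. This $F$ corresponds to the groupoid, in the sense that $S(ab)=a\,(e^{H_F}b)$ and $T(ab)=(e^{H_F}a)\,b$ for local holomorphic $a$ and local antiholomorphic $b$, and $$\sigma(Y)=\tfrac12 J.$$ -/

import Mathlib

open scoped Manifold ContDiff Topology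

noncomputable section

namespace BerezinLog

/-- Indices of the local coordinates: `Sum.inl k` stands for `z^k` (fibre coordinate `ζ_k`),
`Sum.inr l` stands for `z̄^l` (fibre coordinate `ζ̄_l`). -/
abbrev Idx (n : ℕ) : Type := Fin n ⊕ Fin n

/-! ### Smooth functions on open subsets of `ℂⁿ` and Wirtinger derivatives -/

/-- Extension by zero of a function on an open set. -/
def zeroExt {n : ℕ} {U : TopologicalSpace.Opens (Fin n → ℂ)} (f : U → ℂ) : (Fin n → ℂ) → ℂ :=
  Function.extend Subtype.val f 0

theorem zeroExt_apply {n : ℕ} {U : TopologicalSpace.Opens (Fin n → ℂ)} (f : U → ℂ) (z : U) :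
    zeroExt f z = f z :=
  Subtype.val_injective.extend_apply f 0 z

theorem contDiffOn_zeroExt {n : ℕ} {U : TopologicalSpace.Opens (Fin n → ℂ)} {f : U → ℂ}
    {F : (Fin n → ℂ) → ℂ} (hF : ContDiffOn ℝ ∞ F U) (h : ∀ z : U, f z = F z) :
    ContDiffOn ℝ ∞ (zeroExt f) U :=
  hF.congr fun z hz => by rw [zeroExt_apply f ⟨z, hz⟩, h]

/-- `C^∞(U)`: complex valued functions on the open set `U ⊆ ℂⁿ`, smooth in the real sense. -/
def LocSmooth {n : ℕ} (U : TopologicalSpace.Opens (Fin n → ℂ)) : Subalgebra ℂ (U → ℂ) where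
  carrier := {f | ContDiffOn ℝ ∞ (zeroExt f) U}
  mul_mem' {a b} ha hb := contDiffOn_zeroExt (ContDiffOn.mul ha hb) fun z => by
    simp [zeroExt_apply]
  add_mem' {a b} ha hb := contDiffOn_zeroExt (ContDiffOn.add ha hb) fun z => by
    simp [zeroExt_apply]
  algebraMap_mem' r := contDiffOn_zeroExt (contDiffOn_const (c := r)) fun z => by simp

theorem zeroExt_of_notMem {n : ℕ} {U : TopologicalSpace.Opens (Fin n → ℂ)} (f : U → ℂ)
    {w : Fin n → ℂ} (hw : w ∉ U) : zeroExt f w = 0 :=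
  Function.extend_apply' f (0 : (Fin n → ℂ) → ℂ) w fun ⟨a, ha⟩ => hw (ha ▸ a.2)

theorem zeroExt_add {n : ℕ} {U : TopologicalSpace.Opens (Fin n → ℂ)} (f g : U → ℂ) :
    zeroExt (f + g) = zeroExt f + zeroExt g := by
  funext w
  by_cases hw : w ∈ U
  · simpa [zeroExt_apply f ⟨w, hw⟩, zeroExt_apply g ⟨w, hw⟩] using zeroExt_apply (f + g) ⟨w, hw⟩
  · simp [zeroExt_of_notMem _ hw]

theorem zeroExt_smul {n : ℕ} {U : TopologicalSpace.Opens (Fin n → ℂ)} (c : ℂ) (f : U → ℂ) :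
    zeroExt (c • f) = c • zeroExt f := by
  funext w
  by_cases hw : w ∈ U
  · have h1 := zeroExt_apply (c • f) ⟨w, hw⟩
    have h2 := zeroExt_apply f ⟨w, hw⟩
    simp only [Pi.smul_apply] at h1 h2 ⊢
    rw [h1, h2]
  · simp [zeroExt_of_notMem _ hw]

/-- `∂F/∂z^k` (for `Sum.inl k`) and `∂F/∂z̄^l` (for `Sum.inr l`) at a point. -/
def wirtinger {n : ℕ} (s : Idx n) (F : (Fin n → ℂ) → ℂ) (z : Fin n → ℂ) : ℂ :=
  match s with
  | Sum.inl k => (1 / 2 : ℂ) *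
      (fderiv ℝ F z (Pi.single k 1) - Complex.I * fderiv ℝ F z (Pi.single k Complex.I))
  | Sum.inr l => (1 / 2 : ℂ) *
      (fderiv ℝ F z (Pi.single l 1) + Complex.I * fderiv ℝ F z (Pi.single l Complex.I))

theorem contDiffOn_wirtinger {n : ℕ} {U : TopologicalSpace.Opens (Fin n → ℂ)} (s : Idx n)
    {F : (Fin n → ℂ) → ℂ} (hF : ContDiffOn ℝ ∞ F U) : ContDiffOn ℝ ∞ (wirtinger s F) U := by
  have h1 : ContDiffOn ℝ ∞ (fderiv ℝ F) U := hF.fderiv_of_isOpen U.isOpen (by simp)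
  have h2 : ∀ v : Fin n → ℂ, ContDiffOn ℝ ∞ (fun z => fderiv ℝ F z v) U := fun v =>
    h1.clm_apply contDiffOn_const
  rcases s with k | l
  · exact contDiffOn_const.mul ((h2 _).sub (contDiffOn_const.mul (h2 _)))
  · exact contDiffOn_const.mul ((h2 _).add (contDiffOn_const.mul (h2 _)))

theorem differentiableAt_zeroExt {n : ℕ} {U : TopologicalSpace.Opens (Fin n → ℂ)}
    (f : LocSmooth U) (z : U) : DifferentiableAt ℝ (zeroExt f.1) z :=
  (f.2.contDiffAt (U.isOpen.mem_nhds z.2)).differentiableAt (by simp)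

/-- The operators `∂/∂z^k`, `∂/∂z̄^l` on `C^∞(U)`. -/
def pd {n : ℕ} {U : TopologicalSpace.Opens (Fin n → ℂ)} (s : Idx n) :
    Module.End ℂ (LocSmooth U) where
  toFun f := ⟨fun z => wirtinger s (zeroExt f.1) z,
    contDiffOn_zeroExt (contDiffOn_wirtinger s f.2) fun _ => rfl⟩
  map_add' f g := by
    ext z
    have h : zeroExt (f + g).1 = zeroExt f.1 + zeroExt g.1 := zeroExt_add f.1 g.1
    have hf := differentiableAt_zeroExt f z
    have hg := differentiableAt_zeroExt g z
    change wirtinger s (zeroExt (f + g).1) z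
      = wirtinger s (zeroExt f.1) z + wirtinger s (zeroExt g.1) z
    rw [h]
    rcases s with k | l <;> simp [wirtinger, fderiv_add hf hg] <;> ring
  map_smul' c f := by
    ext z
    have h : zeroExt (c • f).1 = c • zeroExt f.1 := zeroExt_smul c f.1
    have hf := differentiableAt_zeroExt f z
    change wirtinger s (zeroExt (c • f).1) z = c * wirtinger s (zeroExt f.1) z
    rw [h]
    rcases s with k | l <;> simp [wirtinger, fderiv_const_smul hf] <;> ring

/-- The iterated derivative `∂_{s₁} ⋯ ∂_{s_m}` for the word `w = [s₁, …, s_m]`. -/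
def pdWord {n : ℕ} {U : TopologicalSpace.Opens (Fin n → ℂ)} (w : List (Idx n)) :
    Module.End ℂ (LocSmooth U) :=
  (w.map pd).prod

/-! ### Formal functions near the zero section of `T*U`, with the canonical Poisson bracket -/

/-- `C^∞(T*U, Z) = C^∞(U)[[ζ_k, ζ̄_l]]`. -/
abbrev LocFormal {n : ℕ} (U : TopologicalSpace.Opens (Fin n → ℂ)) : Type :=
  MvPowerSeries (Idx n) (LocSmooth U)

/-- Derivative of a formal function along the base coordinate `z^k` or `z̄^l`. -/
def baseDeriv {n : ℕ} {U : TopologicalSpace.Opens (Fin n → ℂ)} (s : Idx n) (P : LocFormal U) :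
    LocFormal U :=
  fun α => pd s (MvPowerSeries.coeff α P)

/-- Derivative of a formal function along the fibre coordinate `ζ_k` or `ζ̄_l`. -/
def fibreDeriv {n : ℕ} {U : TopologicalSpace.Opens (Fin n → ℂ)} (s : Idx n) (P : LocFormal U) :
    LocFormal U :=
  MvPowerSeries.pderiv (LocSmooth U) s P

/-- The canonical Poisson bracket of the cotangent bundle, with the sign `{ζ_k, z^k} = 1`. -/
def cotBracket {n : ℕ} {U : TopologicalSpace.Opens (Fin n → ℂ)} (P Q : LocFormal U) :
    LocFormal U :=
  ∑ s : Idx n, (fibreDeriv s P * baseDeriv s Q - baseDeriv s P * fibreDeriv s Q)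

/-- `R[ε]` with `ε² = 0`: the pair `(P₀, P₁)` stands for `P₀ + ε P₁`. The product of `R[ε]` is
`epsMul`; the componentwise product of pairs is never used. -/
abbrev Eps (R : Type*) : Type _ := R × R

/-- `(P₀ + ε P₁)(Q₀ + ε Q₁) = P₀ Q₀ + ε (P₀ Q₁ + P₁ Q₀)`. -/
def epsMul {R : Type*} [Mul R] [Add R] (P Q : Eps R) : Eps R :=
  (P.1 * Q.1, P.1 * Q.2 + P.2 * Q.1)

/-- The `ε`-bilinear extension of the canonical bracket to `C^∞(T*U, Z)[ε]`, `ε² = 0`. -/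
def cotBracketEps {n : ℕ} {U : TopologicalSpace.Opens (Fin n → ℂ)}
    (P Q : Eps (LocFormal U)) : Eps (LocFormal U) :=
  (cotBracket P.fst Q.fst, cotBracket P.fst Q.snd + cotBracket P.snd Q.fst)

/-- `e^{H_F} Q`, where `H_F Q = {F, Q}`. When `F` starts in degree `≥ 2` in the fibre variables,
`H_F^j Q` starts in degree `≥ j`, so the coefficient of a monomial of degree `d` is exactly the
sum of the contributions with `j ≤ d`. -/
def expHam {n : ℕ} {U : TopologicalSpace.Opens (Fin n → ℂ)} (F Q : Eps (LocFormal U)) :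
    Eps (LocFormal U) :=
  (fun α => ∑ j ∈ Finset.range (α.degree + 1),
      ((j.factorial : ℂ)⁻¹) • MvPowerSeries.coeff α ((cotBracketEps F)^[j] Q).fst,
    fun α => ∑ j ∈ Finset.range (α.degree + 1),
      ((j.factorial : ℂ)⁻¹) • MvPowerSeries.coeff α ((cotBracketEps F)^[j] Q).snd)

/-- The value at the point `z` and the covector `v = (ζ_k, ζ̄_l)` of the component of `P` that is
homogeneous of degree `r` in the fibre variables. -/
def homEval {n : ℕ} {U : TopologicalSpace.Opens (Fin n → ℂ)} (r : ℕ) (P : LocFormal U) (z : U)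
    (v : Idx n → ℂ) : ℂ :=
  ∑ α ∈ Finset.finsuppAntidiag Finset.univ r,
    (MvPowerSeries.coeff α P).1 z * ∏ s : Idx n, v s ^ α s

/-! ### The complex manifold -/

section Manifold

variable (n : ℕ) (M : Type*) [TopologicalSpace M] [ChartedSpace (Fin n → ℂ) M]

/-- `C^∞(M)`: complex valued functions, smooth for the underlying real structure. -/
def Smooth : Subalgebra ℂ (M → ℂ) where
  carrier := {f | ContMDiff 𝓘(ℝ, Fin n → ℂ) 𝓘(ℝ, ℂ) ∞ f}
  mul_mem' {a b} ha hb := by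
    have h : ContMDiff (𝓘(ℝ, ℂ).prod 𝓘(ℝ, ℂ)) 𝓘(ℝ, ℂ) ∞ (fun p : ℂ × ℂ => p.1 * p.2) := by
      rw [← modelWithCornersSelf_prod, chartedSpaceSelf_prod]
      exact contDiff_mul.contMDiff
    exact h.comp (ContMDiff.prodMk ha hb)
  add_mem' {a b} ha hb := ContMDiff.add ha hb
  algebraMap_mem' r := contMDiff_const

/-- The given holomorphic charts of `M`. -/
abbrev Chart : Type _ := ↥(atlas (Fin n → ℂ) M)

end Manifold

section

variable {n : ℕ} {M : Type*} [TopologicalSpace M] [ChartedSpace (Fin n → ℂ) M]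

/-- The open subset of `ℂⁿ` onto which a chart maps. -/
def dom (φ : Chart n M) : TopologicalSpace.Opens (Fin n → ℂ) := ⟨φ.1.target, φ.1.open_target⟩

/-- The point of `M` with coordinates `z` in the chart `φ`. -/
def pt (φ : Chart n M) (z : dom φ) : M := φ.1.symm z

/-- The coordinates of a point `x` in the chart `φ`. -/
def coord (φ : Chart n M) (x : M) (hx : x ∈ φ.1.source) : dom φ := ⟨φ.1 x, φ.1.map_source hx⟩

/-- The preferred chart at a point. -/
def chartOf (x : M) : Chart n M := ⟨chartAt (Fin n → ℂ) x, chart_mem_atlas _ x⟩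

/-- `a` is holomorphic on the set `U`. -/
def HolOn (a : M → ℂ) (U : Set M) : Prop :=
  MDifferentiableOn 𝓘(ℂ, Fin n → ℂ) 𝓘(ℂ, ℂ) a U

/-- `b` is antiholomorphic on the set `U`. -/
def AntiholOn (b : M → ℂ) (U : Set M) : Prop :=
  MDifferentiableOn 𝓘(ℂ, Fin n → ℂ) 𝓘(ℂ, ℂ) (fun x => starRingEnd ℂ (b x)) U

variable [IsManifold 𝓘(ℂ, Fin n → ℂ) ω M]

theorem isManifold_real : IsManifold 𝓘(ℝ, Fin n → ℂ) ∞ M := by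
  refine isManifold_of_contDiffOn _ _ _ fun e e' he he' => ?_
  have h := (contDiffGroupoid ω 𝓘(ℂ, Fin n → ℂ)).compatible he he'
  rw [contDiffGroupoid, mem_groupoid_of_pregroupoid] at h
  have h1 := h.1
  simp only [contDiffPregroupoid, modelWithCornersSelf_coe, modelWithCornersSelf_coe_symm,
    Function.id_comp, Function.comp_id, Set.preimage_id, Set.range_id, Set.inter_univ] at h1 ⊢
  exact (ContDiffOn.restrict_scalars ℝ h1).of_le le_top

/-- The local representative `f ∘ φ⁻¹` of a smooth function, in the chart `φ`. -/
def loc (φ : Chart n M) : Smooth n M →ₐ[ℂ] LocSmooth (dom φ) where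
  toFun f := ⟨fun z => f.1 (pt φ z), by
    have : IsManifold 𝓘(ℝ, Fin n → ℂ) ∞ M := isManifold_real
    have h1 : ContMDiffOn 𝓘(ℝ, Fin n → ℂ) 𝓘(ℝ, Fin n → ℂ) ∞ φ.1.symm φ.1.target :=
      contMDiffOn_symm_of_mem_maximalAtlas (IsManifold.subset_maximalAtlas φ.2)
    have h2 : ContMDiffOn 𝓘(ℝ, Fin n → ℂ) 𝓘(ℝ, ℂ) ∞ (f.1 ∘ φ.1.symm) φ.1.target :=
      ContMDiff.comp_contMDiffOn f.2 h1
    exact contDiffOn_zeroExt (contMDiffOn_iff_contDiffOn.1 h2) fun _ => rfl⟩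
  map_one' := rfl
  map_mul' _ _ := rfl
  map_zero' := rfl
  map_add' _ _ := rfl
  commutes' _ := rfl

/-- The components `(∂f/∂z^k, ∂f/∂z̄^l)` of the covector `df` at the point with coordinates `z`. -/
def grad (φ : Chart n M) (f : Smooth n M) (z : dom φ) : Idx n → ℂ :=
  fun s => (pd s (loc φ f)).1 z

/-! ### Differential operators on `M` and formal differential operators -/

/-- `D` is, near each point of each chart, a finite sum `∑ c_w ∂_w` with smooth coefficients. -/
def IsDiffOp (D : Module.End ℂ (Smooth n M)) : Prop :=
  ∀ (φ : Chart n M) (z₀ : dom φ), ∃ c : List (Idx n) →₀ LocSmooth (dom φ),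
    ∀ᶠ z in 𝓝 z₀, ∀ f : Smooth n M,
      (loc φ (D f)).1 z = c.sum fun w a => a.1 z * (pdWord w (loc φ f)).1 z

/-- `D` is a differential operator of order not greater than `r`. -/
def IsDiffOpOfOrderLE (r : ℕ) (D : Module.End ℂ (Smooth n M)) : Prop :=
  ∀ (φ : Chart n M) (z₀ : dom φ), ∃ c : List (Idx n) →₀ LocSmooth (dom φ),
    (∀ w ∈ c.support, w.length ≤ r) ∧
    ∀ᶠ z in 𝓝 z₀, ∀ f : Smooth n M,
      (loc φ (D f)).1 z = c.sum fun w a => a.1 z * (pdWord w (loc φ f)).1 z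

/-- A bidifferential operator on `M`. -/
def IsBidiffOp (C : Smooth n M →ₗ[ℂ] Smooth n M →ₗ[ℂ] Smooth n M) : Prop :=
  ∀ (φ : Chart n M) (z₀ : dom φ), ∃ c : (List (Idx n) × List (Idx n)) →₀ LocSmooth (dom φ),
    ∀ᶠ z in 𝓝 z₀, ∀ u v : Smooth n M,
      (loc φ (C u v)).1 z =
        c.sum fun w a => a.1 z * (pdWord w.1 (loc φ u)).1 z * (pdWord w.2 (loc φ v)).1 z

/-- A bidifferential operator that differentiates its first argument only in antiholomorphic
directions and its second argument only in holomorphic directions. -/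
def SeparatesVariables (C : Smooth n M →ₗ[ℂ] Smooth n M →ₗ[ℂ] Smooth n M) : Prop :=
  ∀ (φ : Chart n M) (z₀ : dom φ), ∃ c : (List (Fin n) × List (Fin n)) →₀ LocSmooth (dom φ),
    ∀ᶠ z in 𝓝 z₀, ∀ u v : Smooth n M,
      (loc φ (C u v)).1 z =
        c.sum fun w a => a.1 z * (pdWord (w.1.map Sum.inr) (loc φ u)).1 z *
          (pdWord (w.2.map Sum.inl) (loc φ v)).1 z

variable (n M) in
/-- Formal series in `ν` of operators; the product is composition. -/
abbrev FormalOp : Type _ := PowerSeries (Module.End ℂ (Smooth n M))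

/-- `A = A₀ + ν A₁ + …` is natural if the order of `A_r` is not greater than `r` for all `r`. -/
def IsNatural (A : FormalOp n M) : Prop :=
  ∀ r : ℕ, IsDiffOpOfOrderLE r (PowerSeries.coeff r A)

/-- `exp P = ∑ P^j / j!`, for a series `P` without constant term (then `P^j` only contributes to
the coefficient of `ν^m` if `j ≤ m`). -/
def formalExp (P : FormalOp n M) : FormalOp n M :=
  PowerSeries.mk fun m => ∑ j ∈ Finset.range (m + 1),
    ((j.factorial : ℂ)⁻¹) • PowerSeries.coeff m (P ^ j)

/-- `ν⁻¹ X`, for a series `X` without constant term. -/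
def divNu (X : FormalOp n M) : FormalOp n M :=
  PowerSeries.mk fun r => PowerSeries.coeff (r + 1) X

/-- `Y = ν² X₃ + ν⁴ X₅ + …`. -/
def oddPart (X : FormalOp n M) : FormalOp n M :=
  PowerSeries.mk fun r => if 2 ≤ r ∧ Even r then PowerSeries.coeff (r + 1) X else 0

/-! ### Formal functions near the zero section of `T*M` and `σ`-symbols -/

variable (n M) in
/-- `C^∞(T*M, Z)`: a formal function is given in each chart by a formal series in the fibre
coordinates such that the value of each homogeneous component on a covector does not depend on
the chart (every complex covector at a point is the differential of a smooth function). -/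
def FormalFn : Submodule ℂ (∀ φ : Chart n M, LocFormal (dom φ)) where
  carrier := {P | ∀ (φ ψ : Chart n M) (z : dom φ) (w : dom ψ), pt φ z = pt ψ w →
    ∀ (r : ℕ) (f : Smooth n M),
      homEval r (P φ) z (grad φ f z) = homEval r (P ψ) w (grad ψ f w)}
  add_mem' {P Q} hP hQ φ ψ z w h r f := by
    have h1 := hP φ ψ z w h r f
    have h2 := hQ φ ψ z w h r f
    simp only [homEval] at h1 h2
    have key : ∀ (χ : Chart n M) (α : Idx n →₀ ℕ) (y : dom χ),
        (MvPowerSeries.coeff α ((P + Q) χ)).1 y =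
          (MvPowerSeries.coeff α (P χ)).1 y + (MvPowerSeries.coeff α (Q χ)).1 y :=
      fun _ _ _ => rfl
    simp only [homEval, key, add_mul, Finset.sum_add_distrib, h1, h2]
  zero_mem' φ ψ z w _ r f := by simp [homEval]
  smul_mem' c P hP φ ψ z w h r f := by
    have h1 := hP φ ψ z w h r f
    simp only [homEval] at h1
    have key : ∀ (χ : Chart n M) (α : Idx n →₀ ℕ) (y : dom χ),
        (MvPowerSeries.coeff α ((c • P) χ)).1 y = c * (MvPowerSeries.coeff α (P χ)).1 y :=
      fun _ _ _ => rfl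
    simp only [homEval, key, mul_assoc, ← Finset.mul_sum, h1]

/-- `P` is the `σ`-symbol `∑_r σ_r(A_r)` of the natural formal differential operator `A`, where the
principal symbol of order `r` is `σ_r(D)(df_x) = (1/r!) D((f - f(x))^r)(x)`. -/
def IsSigmaSymbol (A : FormalOp n M) (P : FormalFn n M) : Prop :=
  ∀ (r : ℕ) (φ : Chart n M) (z : dom φ) (f : Smooth n M),
    homEval r (P.1 φ) z (grad φ f z) =
      ((r.factorial : ℂ)⁻¹) *
        (PowerSeries.coeff r A ((f - algebraMap ℂ (Smooth n M) (f.1 (pt φ z))) ^ r)).1 (pt φ z)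

/-- The expression in the chart `φ` of an element of `C^∞(T*M, Z)[ε]`. -/
def locEps (φ : Chart n M) (F : Eps (FormalFn n M)) : Eps (LocFormal (dom φ)) :=
  (F.fst.1 φ, F.snd.1 φ)

/-- A function on `M` as a formal function on `T*M`, constant along the fibres. -/
def liftFn (φ : Chart n M) (f : Smooth n M) : Eps (LocFormal (dom φ)) :=
  (MvPowerSeries.C (loc φ f), 0)

/-- Equality of two elements of `C^∞(T*M, Z)[ε]`, written in the chart `φ`, over the part of the
chart that lies in the open set `U ⊆ M`. -/
def EqOver (φ : Chart n M) (U : Set M) (P Q : Eps (LocFormal (dom φ))) : Prop :=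
  ∀ z : dom φ, pt φ z ∈ U → ∀ α : Idx n →₀ ℕ,
    (MvPowerSeries.coeff α P.fst).1 z = (MvPowerSeries.coeff α Q.fst).1 z ∧
    (MvPowerSeries.coeff α P.snd).1 z = (MvPowerSeries.coeff α Q.snd).1 z

/-! ### Tensors `g^{lk}`, Kähler-Poisson structures and their infinitesimal deformations -/

variable (n M) in
/-- A smooth tensor field of type `(1,1)` on `M`, with components `t^{lk}` in each chart (`l`
antiholomorphic, `k` holomorphic); the contraction `t^{lk} ∂̄_l u ∂_k v` with two differentials
does not depend on the chart. -/
structure Tensor11 where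
  comp : ∀ φ : Chart n M, Fin n → Fin n → LocSmooth (dom φ)
  compat : ∀ (φ ψ : Chart n M) (z : dom φ) (w : dom ψ), pt φ z = pt ψ w →
    ∀ u v : Smooth n M,
      ∑ l, ∑ k, (comp φ l k).1 z * grad φ u z (Sum.inr l) * grad φ v z (Sum.inl k) =
        ∑ l, ∑ k, (comp ψ l k).1 w * grad ψ u w (Sum.inr l) * grad ψ v w (Sum.inl k)

/-- `t^{lk} (∂̄_l u ∂_k v - ∂_k u ∂̄_l v)` in the chart `φ`. -/
def locBracket (t : Tensor11 n M) (φ : Chart n M) (u v : Smooth n M) : LocSmooth (dom φ) :=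
  ∑ l, ∑ k, t.comp φ l k * (pd (Sum.inr l) (loc φ u) * pd (Sum.inl k) (loc φ v) -
    pd (Sum.inl k) (loc φ u) * pd (Sum.inr l) (loc φ v))

theorem locBracket_apply (t : Tensor11 n M) (φ : Chart n M) (u v : Smooth n M) (z : dom φ) :
    (locBracket t φ u v).1 z =
      ∑ l, ∑ k, (t.comp φ l k).1 z * grad φ u z (Sum.inr l) * grad φ v z (Sum.inl k) -
        ∑ l, ∑ k, (t.comp φ l k).1 z * grad φ v z (Sum.inr l) * grad φ u z (Sum.inl k) := by
  simp only [locBracket, grad, AddSubmonoidClass.coe_finsetSum, Finset.sum_apply,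
    ← Finset.sum_sub_distrib]
  refine Finset.sum_congr rfl fun l _ => Finset.sum_congr rfl fun k _ => ?_
  simp only [MulMemClass.coe_mul, AddSubgroupClass.coe_sub, Pi.mul_apply, Pi.sub_apply]
  ring

theorem locBracket_compat (t : Tensor11 n M) (φ ψ : Chart n M) (u v : Smooth n M) (z : dom φ)
    (w : dom ψ) (h : pt φ z = pt ψ w) : (locBracket t φ u v).1 z = (locBracket t ψ u v).1 w := by
  rw [locBracket_apply, locBracket_apply, t.compat φ ψ z w h u v, t.compat φ ψ z w h v u]

/-- The bracket `{u, v} = t^{lk} (∂̄_l u ∂_k v - ∂_k u ∂̄_l v)` on `C^∞(M)`. -/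
def bracket (t : Tensor11 n M) (u v : Smooth n M) : Smooth n M :=
  ⟨fun x => (locBracket t (chartOf x) u v).1 (coord (chartOf x) x (mem_chart_source _ x)), by
    have : IsManifold 𝓘(ℝ, Fin n → ℂ) ∞ M := isManifold_real
    intro x
    have hs : (chartAt (Fin n → ℂ) x).source ∈ 𝓝 x :=
      (chartAt (Fin n → ℂ) x).open_source.mem_nhds (mem_chart_source _ x)
    have h1 : ContMDiffOn 𝓘(ℝ, Fin n → ℂ) 𝓘(ℝ, Fin n → ℂ) ∞ (chartAt (Fin n → ℂ) x)
        (chartAt (Fin n → ℂ) x).source :=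
      contMDiffOn_of_mem_maximalAtlas (IsManifold.chart_mem_maximalAtlas x)
    have h2 : ContMDiffOn 𝓘(ℝ, Fin n → ℂ) 𝓘(ℝ, ℂ) ∞
        (zeroExt (locBracket t (chartOf x) u v).1) (chartAt (Fin n → ℂ) x).target :=
      contMDiffOn_iff_contDiffOn.2 (locBracket t (chartOf x) u v).2
    have h3 := (h2.comp h1 fun y hy => (chartAt (Fin n → ℂ) x).map_source hy).contMDiffAt hs
    refine h3.congr_of_eventuallyEq ?_
    filter_upwards [hs] with y hy
    rw [Function.comp_apply]
    have h4 := zeroExt_apply (locBracket t (chartOf x) u v).1 (coord (chartOf x) y hy)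
    refine Eq.trans ?_ h4.symm
    apply locBracket_compat
    simp only [pt, coord, chartOf]
    rw [OpenPartialHomeomorph.left_inv _ (mem_chart_source _ y),
      OpenPartialHomeomorph.left_inv _ hy]⟩

/-- `g^{lk}` is a Kähler-Poisson tensor: the Jacobi identity
`g^{lk} ∂_k g^{qp} = g^{qk} ∂_k g^{lp}` and `g^{lk} ∂̄_l g^{qp} = g^{lp} ∂̄_l g^{qk}`. -/
def IsKahlerPoisson (g : Tensor11 n M) : Prop :=
  ∀ φ : Chart n M,
    (∀ l q p : Fin n,
      ∑ k, g.comp φ l k * pd (Sum.inl k) (g.comp φ q p) =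
        ∑ k, g.comp φ q k * pd (Sum.inl k) (g.comp φ l p)) ∧
    (∀ k p q : Fin n,
      ∑ l, g.comp φ l k * pd (Sum.inr l) (g.comp φ q p) =
        ∑ l, g.comp φ l p * pd (Sum.inr l) (g.comp φ q k))

/-- `g^{lk} + ε h^{lk}` is an infinitesimal deformation of `g^{lk}`: the Jacobi identity holds
for it modulo `ε²`, the tensor `g^{lk}` being Kähler-Poisson. -/
def IsInfinitesimalDeformation (g h : Tensor11 n M) : Prop :=
  ∀ φ : Chart n M,
    (∀ l q p : Fin n,
      ∑ k, (g.comp φ l k * pd (Sum.inl k) (h.comp φ q p) +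
          h.comp φ l k * pd (Sum.inl k) (g.comp φ q p)) =
        ∑ k, (g.comp φ q k * pd (Sum.inl k) (h.comp φ l p) +
          h.comp φ q k * pd (Sum.inl k) (g.comp φ l p))) ∧
    (∀ k p q : Fin n,
      ∑ l, (g.comp φ l k * pd (Sum.inr l) (h.comp φ q p) +
          h.comp φ l k * pd (Sum.inr l) (g.comp φ q p)) =
        ∑ l, (g.comp φ l p * pd (Sum.inr l) (h.comp φ q k) +
          h.comp φ l p * pd (Sum.inr l) (g.comp φ q k)))

/-! ### Star products and the formal Berezin transform -/

/-- `f ∗ g = ∑ ν^r C_r(f, g)` is a star product on `M` with the bracket given by `g^{lk}`. -/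
structure IsStarProduct (g : Tensor11 n M)
    (C : ℕ → Smooth n M →ₗ[ℂ] Smooth n M →ₗ[ℂ] Smooth n M) : Prop where
  bidiff : ∀ r, IsBidiffOp (C r)
  zero : ∀ u v, C 0 u v = u * v
  one : ∀ u v, C 1 u v - C 1 v u = bracket g u v
  assoc : ∀ (r : ℕ) (u v w : Smooth n M),
    ∑ p ∈ Finset.HasAntidiagonal.antidiagonal r, C p.1 (C p.2 u v) w =
      ∑ p ∈ Finset.HasAntidiagonal.antidiagonal r, C p.1 u (C p.2 v w)
  one_left : ∀ r, 1 ≤ r → ∀ u, C r 1 u = 0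
  one_right : ∀ r, 1 ≤ r → ∀ u, C r u 1 = 0

/-- A star product with separation of variables. -/
structure IsStarProductSep (g : Tensor11 n M)
    (C : ℕ → Smooth n M →ₗ[ℂ] Smooth n M →ₗ[ℂ] Smooth n M) : Prop
    extends IsStarProduct g C where
  sep : ∀ r, SeparatesVariables (C r)

/-- `B` is the formal Berezin transform: the formal differential operator with `B(ab) = b ∗ a` for
local holomorphic `a` and local antiholomorphic `b`. Germs of local functions are germs of global
smooth functions, so local functions on `U` are represented by global smooth functions that are
holomorphic (antiholomorphic) on `U`, and the equality is required on `U`. -/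
structure IsBerezinTransform (C : ℕ → Smooth n M →ₗ[ℂ] Smooth n M →ₗ[ℂ] Smooth n M)
    (B : FormalOp n M) : Prop where
  diffOp : ∀ r, IsDiffOp (PowerSeries.coeff r B)
  apply_mul : ∀ (U : Set M), IsOpen U → ∀ a b : Smooth n M,
    HolOn (n := n) a.1 U → AntiholOn (n := n) b.1 U →
      ∀ r, ∀ x ∈ U, (PowerSeries.coeff r B (a * b)).1 x = (C r b a).1 x

/-! ### The set `𝒦[ε]` and deformation groupoids with separation of variables -/

/-- `F = K + ε J ∈ 𝒦[ε]`: the expansion of `F` starts at least with the quadratic term in the fibre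
variables, and `{e^{H_F} a, ã} = 0`, `{e^{H_F} b, b̃} = 0` for local holomorphic `a, ã` and local
antiholomorphic `b, b̃` (represented as for the Berezin transform). -/
structure MemKEps (F : Eps (FormalFn n M)) : Prop where
  quadratic : ∀ (φ : Chart n M) (α : Idx n →₀ ℕ), α.degree < 2 →
    MvPowerSeries.coeff α (F.fst.1 φ) = 0 ∧ MvPowerSeries.coeff α (F.snd.1 φ) = 0
  hol : ∀ (φ : Chart n M) (U : Set M), IsOpen U → ∀ a a' : Smooth n M,
    HolOn (n := n) a.1 U → HolOn (n := n) a'.1 U →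
      EqOver φ U (cotBracketEps (expHam (locEps φ F) (liftFn φ a)) (liftFn φ a')) 0
  antihol : ∀ (φ : Chart n M) (U : Set M), IsOpen U → ∀ b b' : Smooth n M,
    AntiholOn (n := n) b.1 U → AntiholOn (n := n) b'.1 U →
      EqOver φ U (cotBracketEps (expHam (locEps φ F) (liftFn φ b)) (liftFn φ b')) 0

/-- The component of `P` of degree two in the fibre variables is `t^{lk} ζ_k ζ̄_l`. -/
def HasQuadraticPart (P : FormalFn n M) (t : Tensor11 n M) : Prop :=
  ∀ (φ : Chart n M) (α : Idx n →₀ ℕ), α.degree = 2 →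
    MvPowerSeries.coeff α (P.1 φ) =
      MvPowerSeries.coeff α (∑ l, ∑ k, MvPowerSeries.C (t.comp φ l k) *
        MvPowerSeries.X (Sum.inl k : Idx n) * MvPowerSeries.X (Sum.inr l : Idx n))

/-- The deformed Poisson bracket `{·,·}₀ + ε {·,·}₁` of `g^{lk} + ε h^{lk}` on `C^∞(M)[ε]`. -/
def bracketEps (g h : Tensor11 n M) (u v : Eps (Smooth n M)) : Eps (Smooth n M) :=
  (bracket g u.fst v.fst,
    bracket g u.fst v.snd + bracket g u.snd v.fst + bracket h u.fst v.fst)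

/-- `S` and `T` are the source and target mappings of a deformation formal symplectic groupoid with
separation of variables over `(M, g^{lk} + ε h^{lk})`, on the formal neighbourhood of the zero
section of `T*M`: `ε`-linear unital mappings `C^∞(M)[ε] → C^∞(T*M, Z)[ε]`, Poisson and anti-Poisson
morphisms respectively, with Poisson commuting images, and such that `S a = a`, `T b = b` for local
holomorphic `a` and local antiholomorphic `b`. -/
structure IsDeformationGroupoidSep (g h : Tensor11 n M)
    (S T : Eps (Smooth n M) →ₗ[ℂ] Eps (FormalFn n M)) : Prop where
  eps_S : ∀ f, S (epsMul (0, 1) f) = (0, (S f).fst)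
  eps_T : ∀ f, T (epsMul (0, 1) f) = (0, (T f).fst)
  unit_S : ∀ f φ,
    MvPowerSeries.constantCoeff (locEps φ (S f)).fst = loc φ f.fst ∧
    MvPowerSeries.constantCoeff (locEps φ (S f)).snd = loc φ f.snd
  unit_T : ∀ f φ,
    MvPowerSeries.constantCoeff (locEps φ (T f)).fst = loc φ f.fst ∧
    MvPowerSeries.constantCoeff (locEps φ (T f)).snd = loc φ f.snd
  mul_S : ∀ u v φ, locEps φ (S (epsMul u v)) = epsMul (locEps φ (S u)) (locEps φ (S v))
  mul_T : ∀ u v φ, locEps φ (T (epsMul u v)) = epsMul (locEps φ (T u)) (locEps φ (T v))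
  bracket_S : ∀ u v φ,
    locEps φ (S (bracketEps g h u v)) = cotBracketEps (locEps φ (S u)) (locEps φ (S v))
  bracket_T : ∀ u v φ,
    locEps φ (T (bracketEps g h u v)) = -cotBracketEps (locEps φ (T u)) (locEps φ (T v))
  commute : ∀ u v φ, cotBracketEps (locEps φ (S u)) (locEps φ (T v)) = 0
  sep_S : ∀ (φ : Chart n M) (U : Set M), IsOpen U → ∀ a : Smooth n M, HolOn (n := n) a.1 U →
    EqOver φ U (locEps φ (S (a, 0))) (liftFn φ a)
  sep_T : ∀ (φ : Chart n M) (U : Set M), IsOpen U → ∀ b : Smooth n M, AntiholOn (n := n) b.1 U →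
    EqOver φ U (locEps φ (T (b, 0))) (liftFn φ b)

/-- `S` and `T` are expressed through `F`: `S(ab) = a (e^{H_F} b)` and `T(ab) = (e^{H_F} a) b` for
local holomorphic `a` and local antiholomorphic `b`. -/
def IsGeneratedBy (S T : Eps (Smooth n M) →ₗ[ℂ] Eps (FormalFn n M))
    (F : Eps (FormalFn n M)) : Prop :=
  ∀ (φ : Chart n M) (U : Set M), IsOpen U → ∀ a b : Smooth n M,
    HolOn (n := n) a.1 U → AntiholOn (n := n) b.1 U →
      EqOver φ U (locEps φ (S (a * b, 0)))
        (epsMul (liftFn φ a) (expHam (locEps φ F) (liftFn φ b))) ∧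
      EqOver φ U (locEps φ (T (a * b, 0)))
        (epsMul (expHam (locEps φ F) (liftFn φ a)) (liftFn φ b))

end

end BerezinLog

end

/-! Write `B = exp P` with `P = ν⁻¹X`, so that the coefficient of `ν^r` in `P` is `X_{r+1}`. Let
`L_u`, `R_u` be the operators of left and right star multiplication. Separation of variables gives
`L_a = a` and `R_b = b` for holomorphic `a` and antiholomorphic `b`. Associativity gives `L_b = B b
B⁻¹ = e^{ad P} b` and `R_a = B a B⁻¹ = e^{ad P} a`. Since left and right multiplications commute,
`[e^{ad P} z^k, z^p] = 0`, and likewise for the conjugate coordinates.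

The second ingredient is the dual product `B⁻¹(Bv * Bu)` with the sign of `ν` reversed. It is again
associative and separates variables, and the logarithm of its Berezin transform is `P' = -P(-ν)`.
The series `P` and `P'` agree in odd powers of `ν` and differ by `2X_{r+1}` in even powers `ν^r`,
which are exactly the operators that enter `Y`. The difference between the two products plays the
role of `ε`: a pair `(A, A')` is natural (`IsNat`) if both coefficients of index `r` have order at
most `r` and their difference has order at most `r - 1`. Its symbol `sig` is `∑ σ_r(A_r) + ε ∑
σ_r(A_{r+1} - A'_{r+1})`. A product of two differences falls two orders down and is not seen, which
is `ε² = 0`. Thus `sig` is multiplicative (`sig_mul`) and takes `ν⁻¹[·,·]` to the canonical bracket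
(`sig_br`).

Naturality of `(νP, νP')` (`coeff_mem_pairLE_of_commute`) is an induction on `r`. The commutation
relation bounds the double commutators of `P_r` with two coordinates of the same type, and every
monomial of degree three or more in the fibre variables contains two variables of the same type. For
even `r` the operator `2X_{r+1}` is a difference in this natural pair, so it has order at most `r`,
and `Y` is natural. The function `F` is `sig (νP, νP')`; its `ε` part is `2σ(Y)` by construction, so
what remains is to identify `F`.

The source and target mappings are the symbols of the pairs of left and of right multiplication
operators, extended `ε`-linearly. The groupoid axioms are associativity seen through `sig`, and
`e^{ad P}` becomes `e^{H_F}` (`sig_expAd`). The tensor `h` consists of the coefficients of `2X_3`.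
It describes the difference of the second coefficients of the product and its dual (`gm_two`), and
its Jacobi identities come from comparing order `ν³` of `[L_b, L_b'] = 0` and `[R_a, R_a'] = 0` for
the product and its dual.

Uniqueness of `F` uses the same-type argument again (`IsGenerating.step`). For `S` and `T`, the
fibre derivatives of `S x_t` are brackets with coordinates, which are prescribed by the axioms; in
the lowest degree where two solutions differ, the difference is a derivation at a point that kills
coordinates, so the Hadamard lemma makes it zero.

All computations take place over germs, treated as an abstract algebra with coordinates
(`CoordAlg`). The total symbol is `e^{-⟨ζ,x⟩} D e^{⟨ζ,x⟩}`; its `ζ_s`-derivative is the symbol of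
`[D, x_s]`, which turns statements about orders into inductions on degree. -/

noncomputable section
set_option linter.unusedSectionVars false
namespace BerezinLog

/-! ### Formal exponentials in power series over a noncommutative algebra -/

section FormalExp

open PowerSeries Finset

variable {A : Type*} [Ring A] [Algebra ℂ A]

/-- The sum of a sequence of power series whose `j`-th term has no coefficients below `ν^j`. -/
def formalSum (u : ℕ → PowerSeries A) : PowerSeries A :=
  PowerSeries.mk fun m => ∑ j ∈ range (m + 1), coeff m (u j)

/-- The `j`-th term starts at least with `ν^j`. -/
def Ascending (u : ℕ → PowerSeries A) : Prop :=
  ∀ j m, m < j → coeff m (u j) = 0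

theorem coeff_formalSum (u : ℕ → PowerSeries A) (m : ℕ) :
    coeff m (formalSum u) = ∑ j ∈ range (m + 1), coeff m (u j) := by
  simp [formalSum]

theorem coeff_formalSum_of_le {u : ℕ → PowerSeries A} (hu : Ascending u) {m N : ℕ} (h : m ≤ N) :
    coeff m (formalSum u) = ∑ j ∈ range (N + 1), coeff m (u j) := by
  rw [coeff_formalSum]
  refine Finset.sum_subset (fun j hj => ?_) fun j _ hj' => hu j m ?_
  · simp only [mem_range] at hj ⊢; omega
  · simp only [mem_range] at hj'; omega

theorem coeff_mul_eq_zero_of_vanish {f g : PowerSeries A} {a b : ℕ}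
    (hf : ∀ m, m < a → coeff m f = 0) (hg : ∀ m, m < b → coeff m g = 0) :
    ∀ m, m < a + b → coeff m (f * g) = 0 := by
  intro m hm
  rw [coeff_mul]
  refine Finset.sum_eq_zero fun p hp => ?_
  rw [HasAntidiagonal.mem_antidiagonal] at hp
  by_cases h : p.1 < a
  · rw [hf _ h, zero_mul]
  · rw [hg p.2 (by omega), mul_zero]

theorem sum_range_sum_range_eq {B : Type*} [AddCommMonoid B] (f : ℕ → ℕ → B) (m : ℕ)
    (hf : ∀ a b, m < a + b → f a b = 0) :
    ∑ a ∈ range (m + 1), ∑ b ∈ range (m + 1), f a b =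
      ∑ k ∈ range (m + 1), ∑ p ∈ antidiagonal k, f p.1 p.2 := by
  rw [← Finset.sum_product']
  have h1 : ∑ p ∈ range (m + 1) ×ˢ range (m + 1), f p.1 p.2 =
      ∑ p ∈ (range (m + 1) ×ˢ range (m + 1)).filter (fun p => p.1 + p.2 ≤ m), f p.1 p.2 := by
    symm
    refine Finset.sum_subset (Finset.filter_subset _ _) fun p hp hp' => hf _ _ ?_
    simp only [mem_filter, not_and, not_le] at hp'
    exact hp' hp
  rw [h1, ← Finset.sum_fiberwise_of_maps_to (g := fun p : ℕ × ℕ => p.1 + p.2) (t := range (m + 1))]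
  · refine Finset.sum_congr rfl fun k hk => Finset.sum_congr ?_ fun _ _ => rfl
    ext p
    simp only [mem_filter, mem_product, mem_range, HasAntidiagonal.mem_antidiagonal] at hk ⊢
    omega
  · intro p hp
    simp only [mem_filter, mem_product, mem_range] at hp ⊢
    omega

/-- In degree `m` both sums may be truncated at `m`, and the products with `a + b > m` in the
resulting square vanish, so the square can be regrouped along antidiagonals. -/
theorem formalSum_mul {u v : ℕ → PowerSeries A} (hu : Ascending u) (hv : Ascending v) :
    formalSum u * formalSum v = formalSum fun k => ∑ p ∈ antidiagonal k, u p.1 * v p.2 := by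
  ext m
  have h1 : coeff m (formalSum u * formalSum v) =
      ∑ a ∈ range (m + 1), ∑ b ∈ range (m + 1), coeff m (u a * v b) := by
    rw [coeff_mul]
    calc ∑ p ∈ antidiagonal m, coeff p.1 (formalSum u) * coeff p.2 (formalSum v)
        = ∑ p ∈ antidiagonal m, ∑ a ∈ range (m + 1), ∑ b ∈ range (m + 1),
            coeff p.1 (u a) * coeff p.2 (v b) := by
          refine Finset.sum_congr rfl fun p hp => ?_
          rw [HasAntidiagonal.mem_antidiagonal] at hp
          rw [coeff_formalSum_of_le hu (show p.1 ≤ m by omega),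
            coeff_formalSum_of_le hv (show p.2 ≤ m by omega), Finset.sum_mul_sum]
      _ = _ := by
          rw [Finset.sum_comm]
          refine Finset.sum_congr rfl fun a _ => ?_
          rw [Finset.sum_comm]
          refine Finset.sum_congr rfl fun b _ => ?_
          rw [coeff_mul]
  rw [h1, coeff_formalSum, sum_range_sum_range_eq]
  · simp only [map_sum]
  · intro a b hab
    exact coeff_mul_eq_zero_of_vanish (hu a) (hv b) m hab

theorem coeff_pow_of_lt {P : PowerSeries A} (hP : coeff 0 P = 0) (j : ℕ) :
    ∀ m, m < j → coeff m (P ^ j) = 0 := by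
  induction j with
  | zero => intro m hm; omega
  | succ j ih =>
    rw [pow_succ]
    exact coeff_mul_eq_zero_of_vanish ih (b := 1) (by intro m hm; interval_cases m; exact hP)

/-- `exp P = ∑ P^j / j!`. -/
def pexp (P : PowerSeries A) : PowerSeries A :=
  formalSum fun j => ((j.factorial : ℂ)⁻¹) • P ^ j

theorem ascending_exp {P : PowerSeries A} (hP : coeff 0 P = 0) :
    Ascending fun j => ((j.factorial : ℂ)⁻¹) • P ^ j := by
  intro j m hm
  rw [PowerSeries.coeff_smul, coeff_pow_of_lt hP j m hm, smul_zero]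

theorem inv_factorial_mul_choose {k : ℕ} {p : ℕ × ℕ} (hp : p ∈ antidiagonal k) :
    ((k.factorial : ℂ)⁻¹) * (k.choose p.1 : ℂ) =
      ((p.1.factorial : ℂ)⁻¹) * ((p.2.factorial : ℂ)⁻¹) := by
  rw [HasAntidiagonal.mem_antidiagonal] at hp
  subst hp
  rw [Nat.cast_add_choose]
  have := (p.1 + p.2).factorial_ne_zero
  have := p.1.factorial_ne_zero
  have := p.2.factorial_ne_zero
  field_simp

/-- Binomial theorem divided by `k!`. It is kept termwise so that it serves both for power series
and for commuting endomorphisms of power series. -/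
theorem sum_antidiagonal_factorial {B : Type*} [Ring B] [Algebra ℂ B] {x y : B}
    (h : Commute x y) (k : ℕ) :
    ∑ p ∈ antidiagonal k, (((p.1.factorial : ℂ)⁻¹) • x ^ p.1) * (((p.2.factorial : ℂ)⁻¹) • y ^ p.2)
      = ((k.factorial : ℂ)⁻¹) • (x + y) ^ k := by
  rw [h.add_pow', Finset.smul_sum]
  refine Finset.sum_congr rfl fun p hp => ?_
  rw [smul_mul_smul_comm, ← inv_factorial_mul_choose hp, mul_smul, Nat.cast_smul_eq_nsmul]

theorem pexp_mul_pexp_neg {P : PowerSeries A} (hP : coeff 0 P = 0) : pexp P * pexp (-P) = 1 := by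
  have hP' : coeff 0 (-P) = 0 := by rw [map_neg, hP, neg_zero]
  unfold pexp
  rw [formalSum_mul (ascending_exp hP) (ascending_exp hP')]
  have : ∀ k, ∑ p ∈ antidiagonal k, (((p.1.factorial : ℂ)⁻¹) • P ^ p.1) *
      (((p.2.factorial : ℂ)⁻¹) • (-P) ^ p.2) = if k = 0 then 1 else 0 := by
    intro k
    rw [sum_antidiagonal_factorial (Commute.neg_right (Commute.refl P)), add_neg_cancel]
    rcases k with _ | k <;> simp
  simp only [this]
  ext m
  rw [coeff_formalSum, Finset.sum_eq_single 0]
  · simp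
  · intro b _ hb; simp [hb]
  · simp

theorem pexp_neg_mul_pexp {P : PowerSeries A} (hP : coeff 0 P = 0) : pexp (-P) * pexp P = 1 := by
  simpa using pexp_mul_pexp_neg (P := -P) (by rw [map_neg, hP, neg_zero])

/-- The commutator with a power series. -/
def adS (P : PowerSeries A) : Module.End ℂ (PowerSeries A) :=
  LinearMap.mulLeft ℂ P - LinearMap.mulRight ℂ P

theorem adS_apply (P Q : PowerSeries A) : adS P Q = P * Q - Q * P := by
  simp [adS]

theorem ascending_adS {P : PowerSeries A} (hP : coeff 0 P = 0) (c : PowerSeries A) :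
    Ascending fun j => ((j.factorial : ℂ)⁻¹) • (adS P ^ j) c := by
  have h : ∀ j m, m < j → coeff m ((adS P ^ j) c) = 0 := by
    intro j
    induction j with
    | zero => intro m hm; omega
    | succ j ih =>
      intro m hm
      have h1 : ∀ m, m < 1 → coeff m P = 0 := by intro m hm; interval_cases m; exact hP
      rw [pow_succ', Module.End.mul_apply, adS_apply, map_sub,
        coeff_mul_eq_zero_of_vanish h1 ih m (by omega),
        coeff_mul_eq_zero_of_vanish ih h1 m (by omega), sub_zero]
  intro j m hm
  rw [PowerSeries.coeff_smul, h j m hm, smul_zero]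

/-- `e^{ad P} c`. -/
def expAd (P c : PowerSeries A) : PowerSeries A :=
  formalSum fun j => ((j.factorial : ℂ)⁻¹) • (adS P ^ j) c

/-- Left multiplication by `P` is `ad P` plus right multiplication by `P`, and these two commute;
exponentiating gives `e^P c = (e^{ad P} c) e^P`. -/
theorem expAd_mul_pexp {P : PowerSeries A} (hP : coeff 0 P = 0) (c : PowerSeries A) :
    expAd P c * pexp P = pexp P * c := by
  -- The constant factor is written as an ascending sum supported at `j = 0`, so that
  -- `formalSum_mul` applies to both sides.
  have hc : c = formalSum fun j => if j = 0 then c else 0 := by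
    ext m
    rw [coeff_formalSum, Finset.sum_eq_single 0]
    · simp
    · intro b _ hb; simp [hb]
    · simp
  have hc' : Ascending fun j => if j = 0 then c else 0 := by
    intro j m hm
    simp [show j ≠ 0 by omega]
  conv_rhs => rw [hc]
  unfold expAd pexp
  rw [formalSum_mul (ascending_adS hP c) (ascending_exp hP), formalSum_mul (ascending_exp hP) hc']
  congr 1
  funext k
  have h1 : ∑ p ∈ antidiagonal k, (((p.1.factorial : ℂ)⁻¹) • P ^ p.1) * (if p.2 = 0 then c else 0)
      = ((k.factorial : ℂ)⁻¹) • (P ^ k * c) := by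
    rw [Finset.sum_eq_single (k, 0)]
    · simp
    · rintro ⟨a, b⟩ hp hne
      rw [HasAntidiagonal.mem_antidiagonal] at hp
      rw [if_neg, mul_zero]
      rintro rfl
      exact hne (by simpa using hp)
    · simp
  rw [h1]
  have hcomm : Commute (adS P) (LinearMap.mulRight ℂ P) := by
    unfold adS
    exact Commute.sub_left (LinearMap.commute_mulLeft_right P P) (Commute.refl _)
  have h2 := sum_antidiagonal_factorial hcomm k
  have h3 := congrArg (fun f : Module.End ℂ (PowerSeries A) => f c) h2
  simp only [LinearMap.sum_apply, Module.End.mul_apply, LinearMap.smul_apply] at h3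
  have h4 : adS P + LinearMap.mulRight ℂ P = LinearMap.mulLeft ℂ P := by simp [adS]
  rw [h4, LinearMap.pow_mulLeft, LinearMap.mulLeft_apply] at h3
  rw [← h3]
  refine Finset.sum_congr rfl fun p _ => ?_
  have h5 : ∀ (i j : ℕ) (Q : PowerSeries A),
      (adS P ^ i) ((LinearMap.mulRight ℂ P ^ j) Q) = (adS P ^ i) Q * P ^ j := by
    intro i j Q
    have := congrArg (fun f : Module.End ℂ (PowerSeries A) => f Q) (hcomm.pow_pow i j).eq
    simp only [Module.End.mul_apply] at this
    rw [this, LinearMap.pow_mulRight, LinearMap.mulRight_apply]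
  rw [smul_mul_smul_comm, map_smul, h5, smul_smul]

/-- `exp P` is invertible, so the conjugation relation determines `V`. It is used with `V` a pair of
star multiplication operators and `c` a pointwise multiplication. -/
theorem expAd_eq {P : PowerSeries A} (hP : coeff 0 P = 0) {c V : PowerSeries A}
    (h : V * pexp P = pexp P * c) : V = expAd P c := by
  have h1 : (V * pexp P) * pexp (-P) = (expAd P c * pexp P) * pexp (-P) := by
    rw [h, expAd_mul_pexp hP]
  simpa only [mul_assoc, pexp_mul_pexp_neg hP, mul_one] using h1

theorem coeff_pexp (P : PowerSeries A) (m : ℕ) :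
    coeff m (pexp P) = ∑ j ∈ range (m + 1), ((j.factorial : ℂ)⁻¹) • coeff m (P ^ j) := by
  simp [pexp, coeff_formalSum]

theorem map_pexp {B : Type*} [Ring B] [Algebra ℂ B] (f : A →ₐ[ℂ] B) (P : PowerSeries A) :
    PowerSeries.map (f : A →+* B) (pexp P) = pexp (PowerSeries.map (f : A →+* B) P) := by
  ext m
  simp only [PowerSeries.coeff_map, coeff_pexp, map_sum, ← map_pow]
  refine Finset.sum_congr rfl fun j _ => ?_
  simp

/-- The automorphism `ν ↦ -ν`. -/
def negNu : PowerSeries A →+* PowerSeries A where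
  toFun f := PowerSeries.mk fun r => (-1) ^ r * coeff r f
  map_one' := by
    ext r
    rcases r with _ | r <;> simp [coeff_one]
  map_zero' := by ext; simp
  map_add' f g := by ext; simp [mul_add]
  map_mul' f g := by
    ext r
    simp only [coeff_mk, coeff_mul, Finset.mul_sum]
    refine Finset.sum_congr rfl fun p hp => ?_
    rw [HasAntidiagonal.mem_antidiagonal] at hp
    rw [← hp, pow_add]
    have : Commute (coeff p.1 f) ((-1 : A) ^ p.2) := (Commute.neg_one_right _).pow_right _
    rw [mul_assoc, mul_assoc, ← mul_assoc (coeff p.1 f), this.eq, mul_assoc]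

theorem coeff_negNu (f : PowerSeries A) (r : ℕ) : coeff r (negNu f) = (-1) ^ r * coeff r f := by
  simp [negNu]

theorem negNu_C (c : A) : negNu (C c) = C c := by
  ext r
  rw [coeff_negNu]
  rcases r with _ | r <;> simp [coeff_C]

theorem negNu_pexp (P : PowerSeries A) : negNu (pexp P) = pexp (negNu P) := by
  ext m
  rw [coeff_negNu, coeff_pexp, coeff_pexp, Finset.mul_sum]
  refine Finset.sum_congr rfl fun j _ => ?_
  rw [← map_pow, coeff_negNu, mul_smul_comm]

theorem map_negNu {B : Type*} [Ring B] [Algebra ℂ B] (f : A →+* B) (P : PowerSeries A) :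
    PowerSeries.map f (negNu P) = negNu (PowerSeries.map f P) := by
  ext m
  simp [coeff_negNu]

theorem coeff_pexp_eq {P : PowerSeries A} {m : ℕ} (hm : 1 ≤ m) :
    coeff m (pexp P) = coeff m P +
      ∑ j ∈ Ico 2 (m + 1), ((j.factorial : ℂ)⁻¹) • coeff m (P ^ j) := by
  rw [coeff_pexp, Finset.range_eq_Ico, Finset.sum_eq_sum_Ico_succ_bot (by omega),
    Finset.sum_eq_sum_Ico_succ_bot (by omega)]
  simp [coeff_one, show m ≠ 0 by omega]

theorem coeff_pow_mem {P : PowerSeries A} (D : Subalgebra ℂ A) {m : ℕ}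
    (h : ∀ i < m, coeff i P ∈ D) (j : ℕ) : ∀ k < m, coeff k (P ^ j) ∈ D := by
  induction j with
  | zero =>
    intro k _
    rw [pow_zero, coeff_one]
    split_ifs
    · exact D.one_mem
    · exact D.zero_mem
  | succ j ih =>
    intro k hk
    rw [pow_succ, coeff_mul]
    refine D.sum_mem fun p hp => ?_
    rw [HasAntidiagonal.mem_antidiagonal] at hp
    exact D.mul_mem (ih _ (by omega)) (h _ (by omega))

/-- If the coefficients of `exp P` lie in a subalgebra, then so do those of `P`. -/
theorem coeff_mem_of_pexp {P : PowerSeries A} (hP : coeff 0 P = 0) (D : Subalgebra ℂ A)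
    (h : ∀ m, coeff m (pexp P) ∈ D) (m : ℕ) : coeff m P ∈ D := by
  induction m using Nat.strong_induction_on with
  | _ m ih =>
    rcases Nat.eq_zero_or_pos m with rfl | hm
    · rw [hP]; exact D.zero_mem
    · have h1 := coeff_pexp_eq (P := P) hm
      have h2 : coeff m P = coeff m (pexp P) -
          ∑ j ∈ Ico 2 (m + 1), ((j.factorial : ℂ)⁻¹) • coeff m (P ^ j) := by rw [h1]; abel
      rw [h2]
      refine D.sub_mem (h m) (D.sum_mem fun j hj => D.smul_mem ?_ _)
      rw [mem_Ico] at hj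
      -- For `j ≥ 2` one factor `P` is split off. Neither remaining factor has a constant term, so
      -- only coefficients of index below `m` occur.
      obtain ⟨i, rfl⟩ : ∃ i, j = (i + 1) + 1 := ⟨j - 2, by omega⟩
      rw [pow_succ, coeff_mul]
      refine D.sum_mem fun p hp => ?_
      rw [HasAntidiagonal.mem_antidiagonal] at hp
      by_cases hp2 : p.2 = 0
      · rw [hp2, hP, mul_zero]; exact D.zero_mem
      · by_cases hp1 : p.1 = 0
        · rw [hp1, coeff_pow_of_lt hP _ _ (by omega), zero_mul]; exact D.zero_mem
        · exact D.mul_mem (coeff_pow_mem D ih _ _ (by omega)) (ih _ (by omega))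

/-- If `exp P` fixes `a`, then `P` annihilates `a`. -/
theorem coeff_apply_eq_zero_of_pexp {W : Type*} [AddCommGroup W] [Module ℂ W]
    {P : PowerSeries (Module.End ℂ W)} (hP : coeff 0 P = 0) {a : W}
    (h : ∀ m, 1 ≤ m → coeff m (pexp P) a = 0) (m : ℕ) : coeff m P a = 0 := by
  induction m using Nat.strong_induction_on with
  | _ m ih =>
    rcases Nat.eq_zero_or_pos m with rfl | hm
    · rw [hP]; rfl
    · have h1 := h m hm
      rw [coeff_pexp_eq hm, LinearMap.add_apply, LinearMap.sum_apply, Finset.sum_eq_zero,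
        add_zero] at h1
      · exact h1
      intro j hj
      rw [mem_Ico] at hj
      obtain ⟨i, rfl⟩ : ∃ i, j = (i + 1) + 1 := ⟨j - 2, by omega⟩
      rw [LinearMap.smul_apply, pow_succ, coeff_mul, LinearMap.sum_apply, Finset.sum_eq_zero,
        smul_zero]
      intro p hp
      rw [HasAntidiagonal.mem_antidiagonal] at hp
      rw [Module.End.mul_apply]
      by_cases hp1 : p.1 = 0
      · rw [hp1, coeff_pow_of_lt hP _ _ (by omega)]; rfl
      · rw [ih _ (by omega), map_zero]

end FormalExp

end BerezinLog
end
noncomputable section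
set_option linter.unusedSectionVars false
namespace BerezinLog

/-! ### Algebras with coordinates and their differential operators -/

/-- A commutative algebra with commuting derivations `∂_s` and coordinates `x_s`. -/
structure CoordAlg (n : ℕ) (R : Type*) [CommRing R] [Algebra ℂ R] where
  d : Idx n → Derivation ℂ R R
  comm : ∀ s t f, d s (d t f) = d t (d s f)
  x : Idx n → R
  d_x : ∀ s t, d s (x t) = if s = t then 1 else 0

namespace CoordAlg

variable {n : ℕ} {R : Type*} [CommRing R] [Algebra ℂ R] (𝔠 : CoordAlg n R)

/-- The operator of multiplication by a function. -/
abbrev mulOp (f : R) : Module.End ℂ R := LinearMap.mulLeft ℂ f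

theorem smul_eq_mulOp_mul (f : R) (D : Module.End ℂ R) : f • D = mulOp f * D := by
  ext u; simp [Module.End.mul_apply]

/-- The derivation `∂_s` as an operator. -/
def dOp (s : Idx n) : Module.End ℂ R := (𝔠.d s : R →ₗ[ℂ] R)

theorem dOp_apply (s : Idx n) (f : R) : 𝔠.dOp s f = 𝔠.d s f := rfl

theorem dOp_comm (s t : Idx n) : 𝔠.dOp s * 𝔠.dOp t = 𝔠.dOp t * 𝔠.dOp s := by
  ext f; exact 𝔠.comm s t f

theorem dOp_mul_smul (s : Idx n) (a : R) (E : Module.End ℂ R) :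
    𝔠.dOp s * (a • E) = 𝔠.d s a • E + a • (𝔠.dOp s * E) := by
  ext u
  simp [Module.End.mul_apply, dOp_apply, add_comm, mul_comm]

/-- The operator `∂_{s₁} ⋯ ∂_{s_m}`. -/
def dWord (w : List (Idx n)) : Module.End ℂ R := (w.map 𝔠.dOp).prod

theorem dWord_nil : 𝔠.dWord [] = 1 := rfl

theorem dWord_cons (s : Idx n) (w : List (Idx n)) :
    𝔠.dWord (s :: w) = 𝔠.dOp s * 𝔠.dWord w := by simp [dWord]

theorem dOp_dWord_comm (s : Idx n) (w : List (Idx n)) :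
    𝔠.dOp s * 𝔠.dWord w = 𝔠.dWord w * 𝔠.dOp s := by
  induction w with
  | nil => simp [dWord_nil]
  | cons t w ih => rw [dWord_cons, ← mul_assoc, dOp_comm, mul_assoc, ih, mul_assoc]

theorem dWord_perm {w v : List (Idx n)} (h : w.Perm v) : 𝔠.dWord w = 𝔠.dWord v := by
  induction h with
  | nil => rfl
  | cons s _ ih => rw [dWord_cons, dWord_cons, ih]
  | swap s t w =>
    simp only [dWord_cons]
    rw [← mul_assoc, dOp_comm, mul_assoc]
  | trans _ _ h1 h2 => exact h1.trans h2

/-- Differential operators of order not greater than `r`. -/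
def ordLE (r : ℤ) : Submodule R (Module.End ℂ R) :=
  Submodule.span R {D | ∃ w : List (Idx n), (w.length : ℤ) ≤ r ∧ D = 𝔠.dWord w}

theorem dWord_mem {w : List (Idx n)} {r : ℤ} (h : (w.length : ℤ) ≤ r) : 𝔠.dWord w ∈ 𝔠.ordLE r :=
  Submodule.subset_span ⟨w, h, rfl⟩

theorem ordLE_mono {r s : ℤ} (h : r ≤ s) : 𝔠.ordLE r ≤ 𝔠.ordLE s :=
  Submodule.span_mono fun _ ⟨w, hw, hD⟩ => ⟨w, hw.trans h, hD⟩

/-- No word has negative length. Orders are integers so that the drop by one in a commutator makes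
sense at order zero, where it says that the commutator vanishes. -/
theorem ordLE_neg {r : ℤ} (hr : r < 0) {D : Module.End ℂ R} (hD : D ∈ 𝔠.ordLE r) : D = 0 := by
  have : {D | ∃ w : List (Idx n), (w.length : ℤ) ≤ r ∧ D = 𝔠.dWord w} = ∅ := by
    ext D
    simp only [Set.mem_ofPred_eq, Set.mem_empty_iff_false, iff_false, not_exists, not_and]
    intro w hw
    omega
  rw [ordLE, this, Submodule.span_empty, Submodule.mem_bot] at hD
  exact hD

theorem one_mem_ordLE {r : ℤ} (hr : 0 ≤ r) : (1 : Module.End ℂ R) ∈ 𝔠.ordLE r :=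
  𝔠.dWord_mem (w := []) (by simpa using hr)

theorem mulOp_mem (f : R) {r : ℤ} (hr : 0 ≤ r) : mulOp f ∈ 𝔠.ordLE r := by
  have : mulOp f = f • (1 : Module.End ℂ R) := by ext u; simp
  rw [this]
  exact Submodule.smul_mem _ _ (𝔠.one_mem_ordLE hr)

theorem ordLE_induction {r : ℤ} {p : (D : Module.End ℂ R) → D ∈ 𝔠.ordLE r → Prop}
    (word : ∀ (w : List (Idx n)) (h : (w.length : ℤ) ≤ r), p (𝔠.dWord w) (𝔠.dWord_mem h))
    (add : ∀ D E hD hE, p D hD → p E hE → p (D + E) (Submodule.add_mem _ hD hE))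
    (zero : p 0 (Submodule.zero_mem _))
    (smul : ∀ (a : R) D hD, p D hD → p (a • D) (Submodule.smul_mem _ a hD))
    {D : Module.End ℂ R} (hD : D ∈ 𝔠.ordLE r) : p D hD := by
  refine Submodule.span_induction (p := p) ?_ zero add smul hD
  rintro _ ⟨w, hw, rfl⟩
  exact word w hw

theorem dOp_mul_mem (s : Idx n) {r : ℤ} {E : Module.End ℂ R} (hE : E ∈ 𝔠.ordLE r) :
    𝔠.dOp s * E ∈ 𝔠.ordLE (r + 1) := by
  induction hE using ordLE_induction with
  | word w h =>
    rw [← dWord_cons]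
    exact 𝔠.dWord_mem (by push_cast [List.length_cons]; omega)
  | add D E _ _ h1 h2 => rw [mul_add]; exact Submodule.add_mem _ h1 h2
  | zero => rw [mul_zero]; exact Submodule.zero_mem _
  | smul a D hD h =>
    rw [dOp_mul_smul]
    exact Submodule.add_mem _ (Submodule.smul_mem _ _ (𝔠.ordLE_mono (by omega) hD))
      (Submodule.smul_mem _ _ h)

theorem mul_mem {r s : ℤ} {D E : Module.End ℂ R} (hD : D ∈ 𝔠.ordLE r) (hE : E ∈ 𝔠.ordLE s) :
    D * E ∈ 𝔠.ordLE (r + s) := by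
  induction hD using ordLE_induction with
  | word w h =>
    refine 𝔠.ordLE_mono (show (w.length : ℤ) + s ≤ r + s by omega) ?_
    clear h
    induction w with
    | nil => simpa [dWord_nil] using hE
    | cons t w ih =>
      rw [dWord_cons, mul_assoc]
      exact 𝔠.ordLE_mono (by push_cast [List.length_cons]; omega) (𝔠.dOp_mul_mem t ih)
  | add D E _ _ h1 h2 => rw [add_mul]; exact Submodule.add_mem _ h1 h2
  | zero => rw [zero_mul]; exact Submodule.zero_mem _
  | smul a D hD h => rw [smul_mul_assoc]; exact Submodule.smul_mem _ _ h

/-- `∂_s` commutes with words, so the commutator only differentiates coefficients and the order does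
not rise. -/
theorem dOp_comm_mem (s : Idx n) {r : ℤ} {E : Module.End ℂ R} (hE : E ∈ 𝔠.ordLE r) :
    𝔠.dOp s * E - E * 𝔠.dOp s ∈ 𝔠.ordLE r := by
  induction hE using ordLE_induction with
  | word w h => rw [dOp_dWord_comm, sub_self]; exact Submodule.zero_mem _
  | add D E _ _ h1 h2 =>
    rw [mul_add, add_mul, add_sub_add_comm]; exact Submodule.add_mem _ h1 h2
  | zero => simp
  | smul a D hD h =>
    have h1 : 𝔠.dOp s * a • D - a • D * 𝔠.dOp s =
        𝔠.d s a • D + a • (𝔠.dOp s * D - D * 𝔠.dOp s) := by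
      ext u
      simp [Module.End.mul_apply, dOp_apply]
      ring
    rw [h1]
    exact Submodule.add_mem _ (Submodule.smul_mem _ _ hD) (Submodule.smul_mem _ _ h)

theorem mulOp_comm_mem (f : R) {r : ℤ} {E : Module.End ℂ R} (hE : E ∈ 𝔠.ordLE r) :
    mulOp f * E - E * mulOp f ∈ 𝔠.ordLE (r - 1) := by
  induction hE using ordLE_induction with
  | word w h =>
    refine 𝔠.ordLE_mono (show (w.length : ℤ) - 1 ≤ r - 1 by omega) ?_
    clear h
    induction w with
    | nil => simp [dWord_nil]
    | cons t w ih =>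
      have h1 : mulOp f * 𝔠.dWord (t :: w) - 𝔠.dWord (t :: w) * mulOp f =
          𝔠.dOp t * (mulOp f * 𝔠.dWord w - 𝔠.dWord w * mulOp f) - 𝔠.d t f • 𝔠.dWord w := by
        rw [dWord_cons]
        ext u
        simp [Module.End.mul_apply, dOp_apply]
        ring
      rw [h1]
      refine Submodule.sub_mem _ ?_ (Submodule.smul_mem _ _ (𝔠.dWord_mem ?_))
      · exact 𝔠.ordLE_mono (by push_cast [List.length_cons]; omega) (𝔠.dOp_mul_mem t ih)
      · push_cast [List.length_cons]; omega
  | add D E _ _ h1 h2 =>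
    rw [mul_add, add_mul, add_sub_add_comm]; exact Submodule.add_mem _ h1 h2
  | zero => simp
  | smul a D hD h =>
    have h1 : mulOp f * a • D - a • D * mulOp f = a • (mulOp f * D - D * mulOp f) := by
      ext u
      simp [Module.End.mul_apply]
      ring
    rw [h1]
    exact Submodule.smul_mem _ _ h

/-- Moving one derivative past `E` keeps the order of `E` but uses up a letter of the word; moving a
coefficient past `E` lowers the order of `E` by one. -/
theorem comm_mem {r s : ℤ} {D E : Module.End ℂ R} (hD : D ∈ 𝔠.ordLE r) (hE : E ∈ 𝔠.ordLE s) :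
    D * E - E * D ∈ 𝔠.ordLE (r + s - 1) := by
  induction hD using ordLE_induction with
  | word w h =>
    refine 𝔠.ordLE_mono (show (w.length : ℤ) + s - 1 ≤ r + s - 1 by omega) ?_
    clear h
    induction w with
    | nil => simp [dWord_nil]
    | cons t w ih =>
      have h1 : 𝔠.dWord (t :: w) * E - E * 𝔠.dWord (t :: w) =
          𝔠.dOp t * (𝔠.dWord w * E - E * 𝔠.dWord w) + (𝔠.dOp t * E - E * 𝔠.dOp t) * 𝔠.dWord w := by
        simp only [dWord_cons, mul_sub, sub_mul, mul_assoc]; abel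
      rw [h1]
      refine Submodule.add_mem _ ?_ ?_
      · exact 𝔠.ordLE_mono (by push_cast [List.length_cons]; omega) (𝔠.dOp_mul_mem t ih)
      · exact 𝔠.ordLE_mono (by push_cast [List.length_cons]; omega)
          (𝔠.mul_mem (𝔠.dOp_comm_mem t hE) (𝔠.dWord_mem le_rfl))
  | add D E _ _ h1 h2 =>
    rw [mul_add, add_mul, add_sub_add_comm]; exact Submodule.add_mem _ h1 h2
  | zero => simp
  | smul a D hD h =>
    have h1 : a • D * E - E * a • D =
        a • (D * E - E * D) + (mulOp a * E - E * mulOp a) * D := by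
      simp only [smul_eq_mulOp_mul, mul_sub, sub_mul, mul_assoc]; abel
    rw [h1]
    refine Submodule.add_mem _ (Submodule.smul_mem _ _ h) ?_
    exact 𝔠.ordLE_mono (by omega) (𝔠.mul_mem (𝔠.mulOp_comm_mem a hE) hD)

/-! ### Total symbols -/

open MvPowerSeries Finset

/-- `e^{⟨ζ, y⟩}` as a formal series in `ζ`. -/
def expSeries (y : Idx n → R) : MvPowerSeries (Idx n) R :=
  fun α => (∏ s, ((α s).factorial : ℂ)⁻¹) • ∏ s, y s ^ α s

theorem coeff_expSeries (y : Idx n → R) (α : Idx n →₀ ℕ) :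
    coeff α (expSeries y) = (∏ s, ((α s).factorial : ℂ)⁻¹) • ∏ s, y s ^ α s := rfl

theorem pderiv_expSeries (y : Idx n → R) (s : Idx n) :
    pderiv R s (expSeries y) = C (y s) * expSeries y := by
  ext α
  rw [coeff_pderiv, coeff_C_mul, coeff_expSeries, coeff_expSeries]
  rw [← Finset.mul_prod_erase univ _ (mem_univ s), ← Finset.mul_prod_erase univ _ (mem_univ s),
    ← Finset.mul_prod_erase univ (fun t => ((α t).factorial : ℂ)⁻¹) (mem_univ s),
    ← Finset.mul_prod_erase univ (fun t => y t ^ α t) (mem_univ s)]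
  have h1 : ∏ t ∈ univ.erase s, ((((α + Finsupp.single s 1 : Idx n →₀ ℕ) t).factorial : ℂ)⁻¹) =
      ∏ t ∈ univ.erase s, ((α t).factorial : ℂ)⁻¹ := by
    refine Finset.prod_congr rfl fun t ht => ?_
    simp [(Finset.ne_of_mem_erase ht).symm]
  have h2 : ∏ t ∈ univ.erase s, y t ^ ((α + Finsupp.single s 1 : Idx n →₀ ℕ) t) =
      ∏ t ∈ univ.erase s, y t ^ α t := by
    refine Finset.prod_congr rfl fun t ht => ?_
    simp [(Finset.ne_of_mem_erase ht).symm]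
  rw [h1, h2]
  have h3 : (α + Finsupp.single s 1 : Idx n →₀ ℕ) s = α s + 1 := by simp
  rw [h3, Nat.factorial_succ]
  have h4 : ((α s : R) + 1) = algebraMap ℂ R ((α s : ℂ) + 1) := by simp
  rw [h4, mul_comm _ (algebraMap ℂ R _), ← Algebra.smul_def, smul_smul, mul_smul_comm, pow_succ]
  have h5 : ((α s : ℂ) + 1) ≠ 0 := by exact_mod_cast Nat.succ_ne_zero (α s)
  have h6 : ((α s : ℂ) + 1) * ((((α s + 1) * (α s).factorial : ℕ) : ℂ)⁻¹ *
      ∏ t ∈ univ.erase s, ((α t).factorial : ℂ)⁻¹) =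
      ((α s).factorial : ℂ)⁻¹ * ∏ t ∈ univ.erase s, ((α t).factorial : ℂ)⁻¹ := by
    push_cast
    rw [mul_inv, ← mul_assoc, ← mul_assoc, mul_inv_cancel₀ h5, one_mul]
  rw [h6]
  congr 1
  ring

theorem constantCoeff_expSeries (y : Idx n → R) : constantCoeff (expSeries y) = 1 := by
  rw [← coeff_zero_eq_constantCoeff_apply, coeff_expSeries]
  simp

theorem natCast_mul_cancel {m : ℕ} (hm : m ≠ 0) {a b : R} (h : a * (m : R) = b * (m : R)) :
    a = b := by
  have h1 : (m : R) = algebraMap ℂ R (m : ℂ) := by simp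
  rw [h1, mul_comm, ← Algebra.smul_def, mul_comm, ← Algebra.smul_def] at h
  have h2 := congrArg (fun c => ((m : ℂ)⁻¹) • c) h
  simpa [smul_smul, hm] using h2

/-- The factor `α s + 1` is invertible in characteristic zero. Together with `pderiv_sym` this
reduces symbol coefficients of positive degree to those of commutators with coordinates. -/
theorem coeff_add_single_eq {P Q : MvPowerSeries (Idx n) R} {s : Idx n} {α : Idx n →₀ ℕ}
    (h : coeff α (pderiv R s P) = coeff α (pderiv R s Q)) :
    coeff (α + Finsupp.single s 1) P = coeff (α + Finsupp.single s 1) Q := by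
  rw [coeff_pderiv, coeff_pderiv] at h
  exact natCast_mul_cancel (m := α s + 1) (Nat.succ_ne_zero _) (by push_cast; exact h)

theorem exists_eq_add_single {α : Idx n →₀ ℕ} (h : α ≠ 0) :
    ∃ s β, α = β + Finsupp.single s 1 := by
  obtain ⟨s, hs⟩ := Finsupp.ne_iff.1 h
  refine ⟨s, α - Finsupp.single s 1, ?_⟩
  rw [tsub_add_cancel_of_le]
  rw [Finsupp.single_le_iff]
  exact Nat.one_le_iff_ne_zero.2 hs

theorem eq_of_pderiv_eq {P Q : MvPowerSeries (Idx n) R}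
    (h0 : constantCoeff P = constantCoeff Q) (h : ∀ s, pderiv R s P = pderiv R s Q) : P = Q := by
  ext α
  by_cases hα : α = 0
  · rw [hα]; exact h0
  · obtain ⟨s, β, rfl⟩ := exists_eq_add_single hα
    exact coeff_add_single_eq (by rw [h s])

theorem expSeries_neg_mul (y : Idx n → R) : expSeries (-y) * expSeries y = 1 := by
  refine eq_of_pderiv_eq (by simp [constantCoeff_expSeries]) fun s => ?_
  rw [Derivation.leibniz, pderiv_expSeries, pderiv_expSeries, pderiv_one]
  simp
  ring

/-- An operator applied to the coefficients of a formal series. -/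
def mapCoeff (D : Module.End ℂ R) (P : MvPowerSeries (Idx n) R) : MvPowerSeries (Idx n) R :=
  fun α => D (coeff α P)

theorem coeff_mapCoeff (D : Module.End ℂ R) (P : MvPowerSeries (Idx n) R) (α : Idx n →₀ ℕ) :
    coeff α (mapCoeff D P) = D (coeff α P) := rfl

theorem pderiv_mapCoeff (D : Module.End ℂ R) (P : MvPowerSeries (Idx n) R) (s : Idx n) :
    pderiv R s (mapCoeff D P) = mapCoeff D (pderiv R s P) := by
  ext α
  rw [coeff_pderiv, coeff_mapCoeff, coeff_mapCoeff, coeff_pderiv]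
  have h4 : ((α s : R) + 1) = algebraMap ℂ R ((α s : ℂ) + 1) := by simp
  rw [h4, mul_comm, ← Algebra.smul_def, mul_comm, ← Algebra.smul_def, map_smul]

theorem mapCoeff_mulOp (D : Module.End ℂ R) (f : R) (P : MvPowerSeries (Idx n) R) :
    mapCoeff D (C f * P) = mapCoeff (D * mulOp f) P := by
  ext α; simp [coeff_mapCoeff, coeff_C_mul, Module.End.mul_apply]

/-- The total symbol `∑ a_α ζ^α` of the operator `∑ a_α ∂^α`. -/
def sym (D : Module.End ℂ R) : MvPowerSeries (Idx n) R :=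
  expSeries (-𝔠.x) * mapCoeff D (expSeries 𝔠.x)

theorem sym_add (D E : Module.End ℂ R) : 𝔠.sym (D + E) = 𝔠.sym D + 𝔠.sym E := by
  rw [sym, sym, sym, ← mul_add]
  rfl

theorem sym_smul (a : R) (D : Module.End ℂ R) : 𝔠.sym (a • D) = C a * 𝔠.sym D := by
  have : mapCoeff (a • D) (expSeries 𝔠.x) = C a * mapCoeff D (expSeries 𝔠.x) := by
    ext α; simp [coeff_mapCoeff, coeff_C_mul]
  rw [sym, sym, this]; ring

/-- The total symbol as a linear mapping. -/
def symL : Module.End ℂ R →ₗ[R] MvPowerSeries (Idx n) R where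
  toFun := 𝔠.sym
  map_add' := 𝔠.sym_add
  map_smul' a D := by rw [sym_smul, RingHom.id_apply, smul_eq_C_mul]

theorem sym_zero : 𝔠.sym (0 : Module.End ℂ R) = 0 := 𝔠.symL.map_zero

theorem sym_sub (D E : Module.End ℂ R) : 𝔠.sym (D - E) = 𝔠.sym D - 𝔠.sym E := 𝔠.symL.map_sub D E

theorem sym_sum {ι : Type*} (t : Finset ι) (D : ι → Module.End ℂ R) :
    𝔠.sym (∑ i ∈ t, D i) = ∑ i ∈ t, 𝔠.sym (D i) := map_sum 𝔠.symL D t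

theorem sym_csmul (c : ℂ) (D : Module.End ℂ R) : 𝔠.sym (c • D) = c • 𝔠.sym D := by
  have : c • D = (algebraMap ℂ R c) • D := by ext; simp
  rw [this, sym_smul, ← algebraMap_smul R c (𝔠.sym D), smul_eq_C_mul]

theorem constantCoeff_sym (D : Module.End ℂ R) : constantCoeff (𝔠.sym D) = D 1 := by
  rw [sym, map_mul, constantCoeff_expSeries, one_mul, ← coeff_zero_eq_constantCoeff_apply,
    coeff_mapCoeff, coeff_zero_eq_constantCoeff_apply, constantCoeff_expSeries]

/-- Differentiating `e^{-⟨ζ,x⟩} D e^{⟨ζ,x⟩}` in `ζ_s` brings down `x_s` to the right of `D` and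
`-x_s` to its left. -/
theorem pderiv_sym (D : Module.End ℂ R) (s : Idx n) :
    pderiv R s (𝔠.sym D) = 𝔠.sym (D * mulOp (𝔠.x s) - mulOp (𝔠.x s) * D) := by
  rw [sym, Derivation.leibniz, pderiv_mapCoeff, pderiv_expSeries, pderiv_expSeries, sym_sub,
    mapCoeff_mulOp, ← smul_eq_mulOp_mul, sym_smul, sym, sym]
  simp only [smul_eq_mul, Pi.neg_apply, map_neg]
  ring

theorem sym_one : 𝔠.sym (1 : Module.End ℂ R) = 1 := by
  have : mapCoeff (1 : Module.End ℂ R) (expSeries 𝔠.x) = expSeries 𝔠.x := rfl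
  rw [sym, this, expSeries_neg_mul]

theorem sym_mulOp (f : R) : 𝔠.sym (mulOp f) = C f := by
  have : mulOp f = f • (1 : Module.End ℂ R) := by ext u; simp
  rw [this, sym_smul, sym_one, mul_one]

theorem dOp_comm_x (s t : Idx n) :
    𝔠.dOp s * mulOp (𝔠.x t) - mulOp (𝔠.x t) * 𝔠.dOp s = if s = t then 1 else 0 := by
  ext u
  have := 𝔠.d_x s t
  split_ifs with h
  · rw [if_pos h] at this
    simp [Module.End.mul_apply, dOp_apply, this]
  · rw [if_neg h] at this
    simp [Module.End.mul_apply, dOp_apply, this]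

theorem sym_dOp (s : Idx n) : 𝔠.sym (𝔠.dOp s) = X s := by
  refine eq_of_pderiv_eq ?_ fun t => ?_
  · rw [constantCoeff_sym, constantCoeff_X, dOp_apply]
    exact (𝔠.d s).map_one_eq_zero
  · rw [pderiv_sym, dOp_comm_x]
    by_cases h : s = t
    · subst h; simp [sym_one]
    · rw [if_neg h, sym_zero, pderiv_X_of_ne h]

theorem mapCoeff_X_mul (D : Module.End ℂ R) (s : Idx n) (P : MvPowerSeries (Idx n) R) :
    mapCoeff D (X s * P) = X s * mapCoeff D P := by
  ext α
  rw [coeff_mapCoeff, X_def, coeff_monomial_mul, coeff_monomial_mul]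
  split_ifs <;> simp [coeff_mapCoeff]

theorem mapCoeff_expSeries (D : Module.End ℂ R) :
    mapCoeff D (expSeries 𝔠.x) = 𝔠.sym D * expSeries 𝔠.x := by
  rw [sym, mul_right_comm, expSeries_neg_mul, one_mul]

/-- The monomial `ζ_{s₁} ⋯ ζ_{s_m}`. -/
def wordMon (w : List (Idx n)) : MvPowerSeries (Idx n) R := (w.map fun s => X s).prod

theorem sym_dWord (w : List (Idx n)) : 𝔠.sym (𝔠.dWord w) = wordMon w := by
  have h : mapCoeff (𝔠.dWord w) (expSeries 𝔠.x) = wordMon w * expSeries 𝔠.x := by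
    induction w with
    | nil => simp [wordMon, dWord_nil]; rfl
    | cons s w ih =>
      have h1 : mapCoeff (𝔠.dWord (s :: w)) (expSeries 𝔠.x) =
          mapCoeff (𝔠.dOp s) (mapCoeff (𝔠.dWord w) (expSeries 𝔠.x)) := by
        rw [dWord_cons]; rfl
      have h2 : ∀ (v : List (Idx n)) (P : MvPowerSeries (Idx n) R),
          mapCoeff (𝔠.dOp s) (wordMon v * P) = wordMon v * mapCoeff (𝔠.dOp s) P := by
        intro v P
        induction v with
        | nil => simp [wordMon]
        | cons t v ihv =>
          simp only [wordMon, List.map_cons, List.prod_cons, mul_assoc] at ihv ⊢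
          rw [mapCoeff_X_mul, ihv]
      rw [h1, ih, h2, mapCoeff_expSeries, sym_dOp]
      simp only [wordMon, List.map_cons, List.prod_cons]
      ring
  rw [sym, h, mul_left_comm, expSeries_neg_mul, mul_one]

/-- The exponent of the monomial of a word. -/
def wordExp (w : List (Idx n)) : Idx n →₀ ℕ := Multiset.toFinsupp (w : Multiset (Idx n))

theorem wordExp_cons (s : Idx n) (w : List (Idx n)) :
    wordExp (s :: w) = Finsupp.single s 1 + wordExp w := by
  rw [wordExp, ← Multiset.cons_coe, ← Multiset.singleton_add, map_add,
    Multiset.toFinsupp_singleton]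
  rfl

theorem degree_wordExp (w : List (Idx n)) : (wordExp w).degree = w.length := by
  induction w with
  | nil => simp [wordExp]
  | cons s w ih => rw [wordExp_cons, map_add, ih, Finsupp.degree_single, List.length_cons, add_comm]

theorem wordMon_eq (w : List (Idx n)) :
    (wordMon w : MvPowerSeries (Idx n) R) = monomial (wordExp w) 1 := by
  induction w with
  | nil => simp [wordMon, wordExp]
  | cons s w ih =>
    have : (wordMon (s :: w) : MvPowerSeries (Idx n) R) = X s * wordMon w := by simp [wordMon]
    rw [this, ih, X_def, monomial_mul_monomial, wordExp_cons, one_mul]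

/-- A word with a given exponent. -/
def expWord (α : Idx n →₀ ℕ) : List (Idx n) := (Finsupp.toMultiset α).toList

theorem length_expWord (α : Idx n →₀ ℕ) : (expWord α).length = α.degree := by
  rw [expWord, Multiset.length_toList, Finsupp.card_toMultiset, Finsupp.degree]
  rfl

theorem expWord_perm (w : List (Idx n)) : (expWord (wordExp w)).Perm w := by
  rw [← Multiset.coe_eq_coe, expWord, Multiset.coe_toList, wordExp, Multiset.toFinsupp_toMultiset]

/-- The exponents of degree at most `N`. -/
def degLE (N : ℕ) : Finset (Idx n →₀ ℕ) :=
  (Finset.range (N + 1)).biUnion fun r => Finset.finsuppAntidiag Finset.univ r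

theorem mem_degLE {N : ℕ} {α : Idx n →₀ ℕ} : α ∈ degLE N ↔ α.degree ≤ N := by
  simp only [degLE, Finset.mem_biUnion, Finset.mem_range, Finset.mem_finsuppAntidiag]
  constructor
  · rintro ⟨r, hr, h, _⟩
    rw [Finsupp.degree_eq_sum]
    exact le_trans (le_of_eq h) (by omega)
  · intro h
    exact ⟨α.degree, by omega, by rw [Finsupp.degree_eq_sum], Finset.subset_univ _⟩

/-- Both sides are linear over functions, and on a single word the claim is only a reordering of
commuting derivatives. -/
theorem eq_sum_sym {N : ℕ} {D : Module.End ℂ R} (hD : D ∈ 𝔠.ordLE N) :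
    D = ∑ α ∈ degLE N, coeff α (𝔠.sym D) • 𝔠.dWord (expWord α) := by
  induction hD using ordLE_induction with
  | word w h =>
    rw [sym_dWord, wordMon_eq, Finset.sum_eq_single (wordExp w)]
    · rw [coeff_monomial_same, one_smul]
      exact (𝔠.dWord_perm (expWord_perm w)).symm
    · intro α _ hα
      rw [coeff_monomial_ne hα, zero_smul]
    · intro hw
      rw [mem_degLE, degree_wordExp] at hw
      omega
  | add D E _ _ h1 h2 =>
    conv_lhs => rw [h1, h2]
    simp only [sym_add, map_add, add_smul, Finset.sum_add_distrib]
  | zero => simp [sym_zero]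
  | smul a D hD h =>
    conv_lhs => rw [h]
    simp only [sym_smul, coeff_C_mul, Finset.smul_sum, smul_smul]

theorem coeff_sym_eq_zero {r : ℤ} {D : Module.End ℂ R} (hD : D ∈ 𝔠.ordLE r) {α : Idx n →₀ ℕ}
    (hα : r < α.degree) : coeff α (𝔠.sym D) = 0 := by
  induction hD using ordLE_induction with
  | word w h =>
    rw [sym_dWord, wordMon_eq, coeff_monomial_ne]
    rintro rfl
    rw [degree_wordExp] at hα
    omega
  | add D E _ _ h1 h2 => rw [sym_add, map_add, h1, h2, add_zero]
  | zero => rw [sym_zero, map_zero]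
  | smul a D hD h => rw [sym_smul, coeff_C_mul, h, mul_zero]

/-- In the expansion `eq_sum_sym` only words of length at most `r` survive. That expansion is
available only for operators already known to be differential, hence the a priori bound `N`. -/
theorem mem_ordLE_of_coeff {N : ℤ} {D : Module.End ℂ R} (hD : D ∈ 𝔠.ordLE N) {r : ℤ}
    (h : ∀ α : Idx n →₀ ℕ, r < α.degree → coeff α (𝔠.sym D) = 0) : D ∈ 𝔠.ordLE r := by
  have hD' : D ∈ 𝔠.ordLE (N.toNat : ℤ) := 𝔠.ordLE_mono (by omega) hD
  rw [𝔠.eq_sum_sym hD']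
  refine Submodule.sum_mem _ fun α _ => ?_
  by_cases hα : r < α.degree
  · rw [h α hα, zero_smul]; exact Submodule.zero_mem _
  · refine Submodule.smul_mem _ _ (𝔠.dWord_mem ?_)
    rw [length_expWord]; omega

/-- The algebra of all differential operators. -/
def diffOps : Subalgebra ℂ (Module.End ℂ R) where
  carrier := {D | ∃ N : ℤ, D ∈ 𝔠.ordLE N}
  mul_mem' := fun ⟨N, hN⟩ ⟨K, hK⟩ => ⟨N + K, 𝔠.mul_mem hN hK⟩
  add_mem' := fun ⟨N, hN⟩ ⟨K, hK⟩ => ⟨max N K, Submodule.add_mem _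
    (𝔠.ordLE_mono (le_max_left _ _) hN) (𝔠.ordLE_mono (le_max_right _ _) hK)⟩
  algebraMap_mem' c := ⟨0, by
    have : algebraMap ℂ (Module.End ℂ R) c = mulOp (algebraMap ℂ R c) := by
      ext u; simp [Algebra.smul_def]
    rw [this]
    exact 𝔠.mulOp_mem _ le_rfl⟩

theorem mulOp_mem_diffOps (f : R) : mulOp f ∈ 𝔠.diffOps := ⟨0, 𝔠.mulOp_mem f le_rfl⟩

theorem eq_zero_of_sym {D : Module.End ℂ R} (hD : D ∈ 𝔠.diffOps) (h : 𝔠.sym D = 0) : D = 0 := by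
  obtain ⟨N, hN⟩ := hD
  exact 𝔠.ordLE_neg (r := -1) (by omega) (𝔠.mem_ordLE_of_coeff hN fun α _ => by rw [h, map_zero])

/-- A differential operator that annihilates all monomials in the coordinates is zero. -/
theorem eq_zero_of_monomials {D : Module.End ℂ R} (hD : D ∈ 𝔠.diffOps)
    (h : ∀ α : Idx n →₀ ℕ, D (∏ s, 𝔠.x s ^ α s) = 0) : D = 0 := by
  refine 𝔠.eq_zero_of_sym hD ?_
  have : mapCoeff D (expSeries 𝔠.x) = 0 := by
    ext α
    rw [coeff_mapCoeff, coeff_expSeries, map_smul, h, smul_zero, map_zero]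
  rw [sym, this, mul_zero]

/-- The commutator of an operator with a function. -/
def adx (D : Module.End ℂ R) (f : R) : Module.End ℂ R := D * mulOp f - mulOp f * D

theorem mem_ordLE_of_adx {D : Module.End ℂ R} (hD : D ∈ 𝔠.diffOps) {r : ℤ} (hr : 0 ≤ r)
    (h : ∀ s, adx D (𝔠.x s) ∈ 𝔠.ordLE (r - 1)) : D ∈ 𝔠.ordLE r := by
  obtain ⟨N, hN⟩ := hD
  refine 𝔠.mem_ordLE_of_coeff hN fun α hα => ?_
  have hα0 : α ≠ 0 := by rintro rfl; simp at hα; omega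
  obtain ⟨s, β, rfl⟩ := exists_eq_add_single hα0
  rw [map_add, Finsupp.degree_single] at hα
  have h1 : coeff β (pderiv R s (𝔠.sym D)) = coeff β (pderiv R s (0 : MvPowerSeries (Idx n) R)) := by
    rw [pderiv_sym, map_zero, map_zero]
    exact 𝔠.coeff_sym_eq_zero (h s) (by push_cast at hα; omega)
  rw [coeff_add_single_eq h1, map_zero]

/-- Both indices are holomorphic or both are antiholomorphic. -/
def SameType (s t : Idx n) : Prop := s.isLeft = t.isLeft

/-- Pigeonhole: among three letters two have the same type. This is the combinatorial source both of
the naturality of the logarithm and of the uniqueness of `F`. -/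
theorem exists_eq_add_sameType {α : Idx n →₀ ℕ} (h : 3 ≤ α.degree) :
    ∃ s t β, SameType s t ∧ α = β + Finsupp.single t 1 + Finsupp.single s 1 := by
  have h0 : α ≠ 0 := by rintro rfl; simp at h
  obtain ⟨s, α₁, rfl⟩ := exists_eq_add_single h0
  rw [map_add, Finsupp.degree_single] at h
  have h1 : α₁ ≠ 0 := by rintro rfl; simp at h
  obtain ⟨t, α₂, rfl⟩ := exists_eq_add_single h1
  rw [map_add, Finsupp.degree_single] at h
  have h2 : α₂ ≠ 0 := by rintro rfl; simp at h
  obtain ⟨u, α₃, rfl⟩ := exists_eq_add_single h2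
  by_cases hst : SameType s t
  · exact ⟨s, t, _, hst, rfl⟩
  by_cases hsu : SameType s u
  · exact ⟨s, u, α₃ + Finsupp.single t 1, hsu, by abel⟩
  · refine ⟨t, u, α₃ + Finsupp.single s 1, ?_, by abel⟩
    simp only [SameType] at *
    cases h1 : s.isLeft <;> cases h2 : t.isLeft <;> cases h3 : u.isLeft <;> simp_all

/-- A symbol coefficient of degree above `r ≥ 2` can be read off a second fibre derivative in two
directions of the same type, that is, off the symbol of a double commutator. -/
theorem mem_ordLE_of_adx_adx {D : Module.End ℂ R} (hD : D ∈ 𝔠.diffOps) {r : ℤ} (hr : 2 ≤ r)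
    (h : ∀ s t, SameType s t → adx (adx D (𝔠.x s)) (𝔠.x t) ∈ 𝔠.ordLE (r - 2)) :
    D ∈ 𝔠.ordLE r := by
  obtain ⟨N, hN⟩ := hD
  refine 𝔠.mem_ordLE_of_coeff hN fun α hα => ?_
  obtain ⟨s, t, β, hst, rfl⟩ := exists_eq_add_sameType (α := α) (by omega)
  simp only [map_add, Finsupp.degree_single] at hα
  have h1 : coeff β (pderiv R t (pderiv R s (𝔠.sym D))) =
      coeff β (pderiv R t (0 : MvPowerSeries (Idx n) R)) := by
    rw [pderiv_sym, pderiv_sym, map_zero, map_zero]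
    exact 𝔠.coeff_sym_eq_zero (h s t hst) (by push_cast at hα; omega)
  have h2 := coeff_add_single_eq h1
  have h3 : coeff (β + Finsupp.single t 1) (pderiv R s (𝔠.sym D)) =
      coeff (β + Finsupp.single t 1) (pderiv R s (0 : MvPowerSeries (Idx n) R)) := by
    rw [h2]; simp
  rw [coeff_add_single_eq h3, map_zero]

/-- The action of an operator of order at most one. -/
theorem apply_of_ordLE_one {D : Module.End ℂ R} (hD : D ∈ 𝔠.ordLE 1) (f : R) :
    D f = f * D 1 + ∑ s, (D (𝔠.x s) - 𝔠.x s * D 1) * 𝔠.d s f := by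
  induction hD using ordLE_induction with
  | word w h =>
    rcases w with _ | ⟨t, w⟩
    · simp [dWord_nil]
    · have : w = [] := by
        rw [← List.length_eq_zero_iff]; push_cast [List.length_cons] at h; omega
      subst this
      simp [dWord_cons, dWord_nil, dOp_apply, 𝔠.d_x, Finset.sum_ite_eq]
  | add D E _ _ h1 h2 =>
    simp only [LinearMap.add_apply]
    rw [h1, h2, mul_add]
    have : ∀ s, (D (𝔠.x s) + E (𝔠.x s) - 𝔠.x s * (D 1 + E 1)) * 𝔠.d s f =
      (D (𝔠.x s) - 𝔠.x s * D 1) * 𝔠.d s f + (E (𝔠.x s) - 𝔠.x s * E 1) * 𝔠.d s f := by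
      intro s; ring
    simp only [this, Finset.sum_add_distrib]
    ring
  | zero => simp
  | smul a D hD h =>
    simp only [LinearMap.smul_apply, smul_eq_mul]
    rw [h, mul_add, Finset.mul_sum]
    congr 1
    · ring
    · exact Finset.sum_congr rfl fun s _ => by ring

theorem apply_of_ordLE_zero {D : Module.End ℂ R} (hD : D ∈ 𝔠.ordLE 0) : D = mulOp (D 1) := by
  induction hD using ordLE_induction with
  | word w h =>
    have : w = [] := by rw [← List.length_eq_zero_iff]; omega
    subst this
    ext; simp [dWord_nil]
  | add D E _ _ h1 h2 => conv_lhs => rw [h1, h2]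
                         ext; simp [add_mul]
  | zero => ext; simp
  | smul a D hD h => conv_lhs => rw [h]
                     ext; simp

end CoordAlg
end BerezinLog
end
noncomputable section
set_option linter.unusedSectionVars false
namespace BerezinLog

/-! ### Division by the formal parameter -/

section Shift

open PowerSeries

variable {A : Type*} [Ring A]

/-- `ν⁻¹ (f - f₀)`. -/
def shift (f : PowerSeries A) : PowerSeries A := PowerSeries.mk fun r => coeff (r + 1) f

theorem coeff_shift (f : PowerSeries A) (r : ℕ) : coeff r (shift f) = coeff (r + 1) f := by
  simp [shift]

theorem X_mul_shift {f : PowerSeries A} (h : coeff 0 f = 0) : X * shift f = f := by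
  ext r
  rcases r with _ | r
  · rw [h]; simp
  · rw [coeff_succ_X_mul, coeff_shift]

theorem shift_X_mul (f : PowerSeries A) : shift (X * f) = f := by
  ext r; rw [coeff_shift, coeff_succ_X_mul]

theorem X_mul_injective : Function.Injective fun f : PowerSeries A => X * f := fun f g h => by
  rw [← shift_X_mul f, ← shift_X_mul g]
  exact congrArg shift h

/-- `ν⁻¹ [f, g]`. -/
def br (f g : PowerSeries A) : PowerSeries A := shift (f * g - g * f)

theorem coeff_br (f g : PowerSeries A) (r : ℕ) :
    coeff r (br f g) = coeff (r + 1) (f * g - g * f) := coeff_shift _ _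

/-- The constant terms commute. -/
def CommZero (f g : PowerSeries A) : Prop := coeff 0 f * coeff 0 g = coeff 0 g * coeff 0 f

theorem X_mul_br {f g : PowerSeries A} (h : CommZero f g) : X * br f g = f * g - g * f := by
  refine X_mul_shift ?_
  rw [map_sub, coeff_mul, coeff_mul]
  simpa [sub_eq_zero, CommZero] using h

theorem br_mul_left {f g c : PowerSeries A} (h1 : CommZero f c) (h2 : CommZero g c)
    (h3 : CommZero (f * g) c) : br (f * g) c = br f c * g + f * br g c := by
  apply X_mul_injective
  change X * br (f * g) c = X * (br f c * g + f * br g c)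
  rw [X_mul_br h3, mul_add, ← mul_assoc X, X_mul_br h1, ← mul_assoc X f, ← (commute_X f).eq,
    mul_assoc f X, X_mul_br h2]
  simp only [mul_sub, sub_mul, mul_assoc]
  abel

/-- This is the Jacobi identity for commutators after multiplication by `ν²`; the hypotheses say
that every commutator involved is divisible by `ν`. -/
theorem br_br {f g c : PowerSeries A} (h1 : CommZero f c) (h2 : CommZero g c) (h3 : CommZero f g)
    (h4 : CommZero (br f g) c) (h5 : CommZero (br f c) g) (h6 : CommZero f (br g c)) :
    br (br f g) c = br (br f c) g + br f (br g c) := by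
  apply X_mul_injective
  apply X_mul_injective
  change X * (X * br (br f g) c) = X * (X * (br (br f c) g + br f (br g c)))
  have key : ∀ u v : PowerSeries A, X * (u * v - v * u) = (X * u) * v - v * (X * u) := by
    intro u v
    rw [mul_sub, ← mul_assoc, ← mul_assoc, ← mul_assoc, (commute_X v).eq]
  have key' : ∀ u v : PowerSeries A, X * (u * v - v * u) = u * (X * v) - (X * v) * u := by
    intro u v
    rw [mul_sub, ← mul_assoc, ← mul_assoc, ← mul_assoc, (commute_X u).eq]
  rw [mul_add X (br (br f c) g), mul_add X (X * _), X_mul_br h4, X_mul_br h5, X_mul_br h6, key, key,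
    key', X_mul_br h1, X_mul_br h2, X_mul_br h3]
  simp only [mul_sub, sub_mul, mul_assoc]
  abel

/-- `[P, c] = ν⁻¹[νP, c]`. The series `νP` will be natural, whereas the coefficients of `P` have
order one too high. -/
theorem adS_eq_br [Algebra ℂ A] (P c : PowerSeries A) : adS P c = br (X * P) c := by
  rw [adS_apply, br, ← shift_X_mul (P * c - c * P), mul_sub, ← mul_assoc, ← mul_assoc, ← mul_assoc,
    (commute_X c).eq]

end Shift

namespace CoordAlg

open PowerSeries (coeff)

variable {n : ℕ} {R : Type*} [CommRing R] [Algebra ℂ R] (𝔠 : CoordAlg n R)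

/-! ### The Poisson bracket on formal series over an algebra with coordinates -/

/-- The canonical bracket of `R[[ζ]]`. -/
def pb (P Q : MvPowerSeries (Idx n) R) : MvPowerSeries (Idx n) R :=
  ∑ s : Idx n, (MvPowerSeries.pderiv R s P * mapCoeff (𝔠.dOp s) Q -
    mapCoeff (𝔠.dOp s) P * MvPowerSeries.pderiv R s Q)

/-- The extension of the canonical bracket to `R[[ζ]][ε]`. -/
def pbEps (P Q : Eps (MvPowerSeries (Idx n) R)) : Eps (MvPowerSeries (Idx n) R) :=
  (𝔠.pb P.1 Q.1, 𝔠.pb P.1 Q.2 + 𝔠.pb P.2 Q.1)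

theorem mapCoeff_add (D : Module.End ℂ R) (P Q : MvPowerSeries (Idx n) R) :
    mapCoeff D (P + Q) = mapCoeff D P + mapCoeff D Q := by
  ext α; simp [coeff_mapCoeff]

theorem mapCoeff_neg (D : Module.End ℂ R) (P : MvPowerSeries (Idx n) R) :
    mapCoeff D (-P) = -mapCoeff D P := by
  ext α; simp [coeff_mapCoeff]

theorem pb_add_left (P P' Q : MvPowerSeries (Idx n) R) :
    𝔠.pb (P + P') Q = 𝔠.pb P Q + 𝔠.pb P' Q := by
  simp only [pb, map_add, mapCoeff_add, ← Finset.sum_add_distrib]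
  exact Finset.sum_congr rfl fun s _ => by ring

theorem pb_add_right (P Q Q' : MvPowerSeries (Idx n) R) :
    𝔠.pb P (Q + Q') = 𝔠.pb P Q + 𝔠.pb P Q' := by
  simp only [pb, map_add, mapCoeff_add, ← Finset.sum_add_distrib]
  exact Finset.sum_congr rfl fun s _ => by ring

theorem pb_neg_left (P Q : MvPowerSeries (Idx n) R) : 𝔠.pb (-P) Q = -𝔠.pb P Q := by
  simp only [pb, map_neg, mapCoeff_neg, ← Finset.sum_neg_distrib]
  exact Finset.sum_congr rfl fun s _ => by ring

theorem pb_neg_right (P Q : MvPowerSeries (Idx n) R) : 𝔠.pb P (-Q) = -𝔠.pb P Q := by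
  simp only [pb, map_neg, mapCoeff_neg, ← Finset.sum_neg_distrib]
  exact Finset.sum_congr rfl fun s _ => by ring

theorem pb_sub_left (P P' Q : MvPowerSeries (Idx n) R) :
    𝔠.pb (P - P') Q = 𝔠.pb P Q - 𝔠.pb P' Q := by
  rw [sub_eq_add_neg, pb_add_left, pb_neg_left, ← sub_eq_add_neg]

theorem pb_sub_right (P Q Q' : MvPowerSeries (Idx n) R) :
    𝔠.pb P (Q - Q') = 𝔠.pb P Q - 𝔠.pb P Q' := by
  rw [sub_eq_add_neg, pb_add_right, pb_neg_right, ← sub_eq_add_neg]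

theorem pderiv_comm (s t : Idx n) (P : MvPowerSeries (Idx n) R) :
    MvPowerSeries.pderiv R s (MvPowerSeries.pderiv R t P) =
      MvPowerSeries.pderiv R t (MvPowerSeries.pderiv R s P) := by
  ext α
  simp only [MvPowerSeries.coeff_pderiv]
  by_cases h : s = t
  · rw [h]
  · have h1 : (α + Finsupp.single s 1 : Idx n →₀ ℕ) t = α t := by simp [Ne.symm h]
    have h2 : (α + Finsupp.single t 1 : Idx n →₀ ℕ) s = α s := by simp [h]
    rw [h1, h2, add_right_comm]
    ring

theorem pderiv_pb (t : Idx n) (P Q : MvPowerSeries (Idx n) R) :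
    MvPowerSeries.pderiv R t (𝔠.pb P Q) =
      𝔠.pb (MvPowerSeries.pderiv R t P) Q + 𝔠.pb P (MvPowerSeries.pderiv R t Q) := by
  simp only [pb, map_sum, map_sub, Derivation.leibniz, pderiv_mapCoeff, smul_eq_mul,
    ← Finset.sum_add_distrib]
  refine Finset.sum_congr rfl fun s _ => ?_
  rw [pderiv_comm t s P, pderiv_comm t s Q]
  ring

/-! ### Pairs of operators -/

/-- Pairs of operators of order at most `r` whose difference has order at most `r - 1`. -/
def pairLE (r : ℤ) : Submodule R (Module.End ℂ R × Module.End ℂ R) where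
  carrier := {p | p.1 ∈ 𝔠.ordLE r ∧ p.2 ∈ 𝔠.ordLE r ∧ p.1 - p.2 ∈ 𝔠.ordLE (r - 1)}
  add_mem' := fun ⟨h1, h2, h3⟩ ⟨k1, k2, k3⟩ => ⟨Submodule.add_mem _ h1 k1, Submodule.add_mem _ h2 k2,
    by rw [Prod.fst_add, Prod.snd_add, add_sub_add_comm]; exact Submodule.add_mem _ h3 k3⟩
  zero_mem' := ⟨Submodule.zero_mem _, Submodule.zero_mem _, by simp⟩
  smul_mem' a p := fun ⟨h1, h2, h3⟩ => ⟨Submodule.smul_mem _ a h1, Submodule.smul_mem _ a h2, by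
    have : (a • p).1 - (a • p).2 = a • (p.1 - p.2) := by ext; simp [mul_sub]
    rw [this]; exact Submodule.smul_mem _ a h3⟩

theorem pairLE_mono {r s : ℤ} (h : r ≤ s) : 𝔠.pairLE r ≤ 𝔠.pairLE s := fun _ ⟨h1, h2, h3⟩ =>
  ⟨𝔠.ordLE_mono h h1, 𝔠.ordLE_mono h h2, 𝔠.ordLE_mono (by omega) h3⟩

theorem pairLE_neg {r : ℤ} (hr : r < 0) {p : Module.End ℂ R × Module.End ℂ R}
    (hp : p ∈ 𝔠.pairLE r) : p = 0 :=
  Prod.ext (𝔠.ordLE_neg hr hp.1) (𝔠.ordLE_neg hr hp.2.1)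

theorem pairLE_csmul {r : ℤ} (c : ℂ) {p : Module.End ℂ R × Module.End ℂ R}
    (hp : p ∈ 𝔠.pairLE r) : c • p ∈ 𝔠.pairLE r := by
  have : c • p = (algebraMap ℂ R c) • p := by ext <;> simp
  rw [this]; exact Submodule.smul_mem _ _ hp

/-- Telescoping `pq - p'q' = (p - p')q + p'(q - q')`: each term contains one difference and
therefore loses one order. -/
theorem pairLE_mul {r s : ℤ} {p q : Module.End ℂ R × Module.End ℂ R} (hp : p ∈ 𝔠.pairLE r)
    (hq : q ∈ 𝔠.pairLE s) : p * q ∈ 𝔠.pairLE (r + s) := by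
  refine ⟨𝔠.mul_mem hp.1 hq.1, 𝔠.mul_mem hp.2.1 hq.2.1, ?_⟩
  have : (p * q).1 - (p * q).2 = (p.1 - p.2) * q.1 + p.2 * (q.1 - q.2) := by
    simp only [Prod.fst_mul, Prod.snd_mul, mul_sub, sub_mul]; abel
  rw [this]
  exact Submodule.add_mem _ (𝔠.ordLE_mono (by omega) (𝔠.mul_mem hp.2.2 hq.1))
    (𝔠.ordLE_mono (by omega) (𝔠.mul_mem hp.2.1 hq.2.2))

theorem pairLE_comm {r s : ℤ} {p q : Module.End ℂ R × Module.End ℂ R} (hp : p ∈ 𝔠.pairLE r)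
    (hq : q ∈ 𝔠.pairLE s) : p * q - q * p ∈ 𝔠.pairLE (r + s - 1) := by
  refine ⟨𝔠.comm_mem hp.1 hq.1, 𝔠.comm_mem hp.2.1 hq.2.1, ?_⟩
  have : (p * q - q * p).1 - (p * q - q * p).2 = ((p.1 - p.2) * q.1 - q.1 * (p.1 - p.2)) +
      (p.2 * (q.1 - q.2) - (q.1 - q.2) * p.2) := by
    simp only [Prod.fst_mul, Prod.snd_mul, Prod.fst_sub, Prod.snd_sub, mul_sub, sub_mul]; abel
  rw [this]
  exact Submodule.add_mem _ (𝔠.ordLE_mono (by omega) (𝔠.comm_mem hp.2.2 hq.1))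
    (𝔠.ordLE_mono (by omega) (𝔠.comm_mem hp.2.1 hq.2.2))

/-- Multiplication by a function, as a pair. -/
def mulPair (f : R) : Module.End ℂ R × Module.End ℂ R := (mulOp f, mulOp f)

theorem mulPair_mem (f : R) {r : ℤ} (hr : 0 ≤ r) : mulPair f ∈ 𝔠.pairLE r :=
  ⟨𝔠.mulOp_mem f hr, 𝔠.mulOp_mem f hr, by simp [mulPair]⟩

/-- A formal series of pairs of operators is natural if its `r`-th coefficient is a pair of
operators of order at most `r` whose difference has order at most `r - 1`. -/
def IsNat (A : PowerSeries (Module.End ℂ R × Module.End ℂ R)) : Prop :=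
  ∀ r : ℕ, coeff r A ∈ 𝔠.pairLE r

variable {𝔠}
variable {A B : PowerSeries (Module.End ℂ R × Module.End ℂ R)}

theorem IsNat.mul (hA : 𝔠.IsNat A) (hB : 𝔠.IsNat B) : 𝔠.IsNat (A * B) := by
  intro r
  rw [PowerSeries.coeff_mul]
  refine Submodule.sum_mem _ fun p hp => ?_
  rw [Finset.HasAntidiagonal.mem_antidiagonal] at hp
  rw [← hp]
  push_cast
  exact 𝔠.pairLE_mul (hA _) (hB _)

/-- The commutator of coefficients of indices `i + j = r + 1` has order at most `i + j - 1 = r`, so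
dividing by `ν` restores the balance between index and order. -/
theorem IsNat.br (hA : 𝔠.IsNat A) (hB : 𝔠.IsNat B) : 𝔠.IsNat (br A B) := by
  intro r
  have hsum : coeff (r + 1) (A * B - B * A) =
      ∑ p ∈ Finset.HasAntidiagonal.antidiagonal (r + 1),
        (coeff p.1 A * coeff p.2 B - coeff p.2 B * coeff p.1 A) := by
    rw [map_sub, PowerSeries.coeff_mul, PowerSeries.coeff_mul, Finset.sum_sub_distrib]
    congr 1
    exact (Finset.Nat.sum_antidiagonal_swap (n := r + 1)
      (f := fun p => coeff p.1 B * coeff p.2 A)).symm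
  rw [coeff_br, hsum]
  refine Submodule.sum_mem _ fun p hp => ?_
  rw [Finset.HasAntidiagonal.mem_antidiagonal] at hp
  exact 𝔠.pairLE_mono (by omega) (𝔠.pairLE_comm (hA p.1) (hB p.2))

theorem IsNat.commZero (hA : 𝔠.IsNat A) (hB : 𝔠.IsNat B) : CommZero A B := by
  have h := 𝔠.pairLE_neg (by norm_num) (𝔠.pairLE_comm (hA 0) (hB 0))
  exact sub_eq_zero.1 h

theorem isNat_C (f : R) : 𝔠.IsNat (PowerSeries.C (mulPair f)) := by
  intro r
  rw [PowerSeries.coeff_C]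
  split_ifs
  · exact 𝔠.mulPair_mem f (by omega)
  · exact Submodule.zero_mem _

variable (𝔠)

/-- The symbol of a natural series of pairs. -/
def sig (A : PowerSeries (Module.End ℂ R × Module.End ℂ R)) : Eps (MvPowerSeries (Idx n) R) :=
  (fun α => MvPowerSeries.coeff α (𝔠.sym (coeff α.degree A).1),
    fun α => MvPowerSeries.coeff α
      (𝔠.sym ((coeff (α.degree + 1) A).1 - (coeff (α.degree + 1) A).2)))

theorem coeff_sig_fst (A : PowerSeries (Module.End ℂ R × Module.End ℂ R)) (α : Idx n →₀ ℕ) :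
    MvPowerSeries.coeff α (𝔠.sig A).1 = MvPowerSeries.coeff α (𝔠.sym (coeff α.degree A).1) := rfl

theorem coeff_sig_snd (A : PowerSeries (Module.End ℂ R × Module.End ℂ R)) (α : Idx n →₀ ℕ) :
    MvPowerSeries.coeff α (𝔠.sig A).2 = MvPowerSeries.coeff α
      (𝔠.sym ((coeff (α.degree + 1) A).1 - (coeff (α.degree + 1) A).2)) := rfl

theorem sig_add (A B : PowerSeries (Module.End ℂ R × Module.End ℂ R)) :
    𝔠.sig (A + B) = 𝔠.sig A + 𝔠.sig B := by
  refine Prod.ext ?_ ?_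
  · ext α
    rw [Prod.fst_add, map_add, coeff_sig_fst, coeff_sig_fst, coeff_sig_fst, map_add, Prod.fst_add,
      sym_add, map_add]
  · ext α
    rw [Prod.snd_add, map_add, coeff_sig_snd, coeff_sig_snd, coeff_sig_snd, map_add, Prod.fst_add,
      Prod.snd_add, add_sub_add_comm, sym_add, map_add]

theorem sig_zero : 𝔠.sig (0 : PowerSeries (Module.End ℂ R × Module.End ℂ R)) = 0 := by
  have h := 𝔠.sig_add 0 0
  rw [add_zero] at h
  exact left_eq_add.1 h

theorem sig_C (f : R) : 𝔠.sig (PowerSeries.C (mulPair f)) = (MvPowerSeries.C f, 0) := by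
  refine Prod.ext ?_ ?_
  · ext α
    rw [coeff_sig_fst, PowerSeries.coeff_C]
    split_ifs with h
    · rw [mulPair, sym_mulOp]
    · rw [Prod.fst_zero, sym_zero, map_zero, MvPowerSeries.coeff_C, if_neg]
      rintro rfl
      simp at h
  · ext α
    rw [coeff_sig_snd, PowerSeries.coeff_C, if_neg (Nat.succ_ne_zero _)]
    simp [sym_zero]

/-- `ν⁻¹ [A, x_s]`. -/
def dz (s : Idx n) (A : PowerSeries (Module.End ℂ R × Module.End ℂ R)) :
    PowerSeries (Module.End ℂ R × Module.End ℂ R) := br A (PowerSeries.C (mulPair (𝔠.x s)))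

theorem coeff_dz (s : Idx n) (A : PowerSeries (Module.End ℂ R × Module.End ℂ R)) (r : ℕ) :
    coeff r (𝔠.dz s A) = (adx (coeff (r + 1) A).1 (𝔠.x s), adx (coeff (r + 1) A).2 (𝔠.x s)) := by
  rw [dz, coeff_br, map_sub, PowerSeries.coeff_mul_C, PowerSeries.coeff_C_mul]
  rfl

/-- The commutator with `x_s` divided by `ν` lowers index and degree together, so `sig` intertwines
`dz` with the fibre derivative. This drives the inductions in `sig_mul` and `sig_br`. -/
theorem pderiv_sig_fst (s : Idx n) (A : PowerSeries (Module.End ℂ R × Module.End ℂ R)) :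
    MvPowerSeries.pderiv R s (𝔠.sig A).1 = (𝔠.sig (𝔠.dz s A)).1 := by
  ext α
  rw [MvPowerSeries.coeff_pderiv, coeff_sig_fst, coeff_sig_fst, coeff_dz,
    map_add, Finsupp.degree_single, ← MvPowerSeries.coeff_pderiv, pderiv_sym]
  rfl

theorem pderiv_sig_snd (s : Idx n) (A : PowerSeries (Module.End ℂ R × Module.End ℂ R)) :
    MvPowerSeries.pderiv R s (𝔠.sig A).2 = (𝔠.sig (𝔠.dz s A)).2 := by
  ext α
  rw [MvPowerSeries.coeff_pderiv, coeff_sig_snd, coeff_sig_snd, coeff_dz,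
    map_add, Finsupp.degree_single, ← MvPowerSeries.coeff_pderiv, pderiv_sym]
  congr 2
  simp only [adx, mul_sub, sub_mul]
  abel

variable {𝔠}

theorem IsNat.dz (hA : 𝔠.IsNat A) (s : Idx n) : 𝔠.IsNat (𝔠.dz s A) := hA.br (isNat_C _)

theorem IsNat.coeff_zero (hA : 𝔠.IsNat A) : coeff 0 A = mulPair ((coeff 0 A).1 1) := by
  obtain ⟨h1, h2, h3⟩ := hA 0
  have h4 := 𝔠.ordLE_neg (by norm_num) h3
  refine Prod.ext ?_ ?_
  · exact 𝔠.apply_of_ordLE_zero h1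
  · rw [sub_eq_zero] at h4
    rw [← h4]; exact 𝔠.apply_of_ordLE_zero h1

theorem IsNat.coeff_one_sub (hA : 𝔠.IsNat A) : (coeff 1 A).1 - (coeff 1 A).2 =
    mulOp (((coeff 1 A).1 - (coeff 1 A).2) 1) := by
  obtain ⟨_, _, h3⟩ := hA 1
  exact 𝔠.apply_of_ordLE_zero (by simpa using h3)

theorem dz_mul (hA : 𝔠.IsNat A) (hB : 𝔠.IsNat B) (s : Idx n) :
    𝔠.dz s (A * B) = 𝔠.dz s A * B + A * 𝔠.dz s B :=
  br_mul_left (hA.commZero (isNat_C _)) (hB.commZero (isNat_C _)) ((hA.mul hB).commZero (isNat_C _))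

theorem dz_br (hA : 𝔠.IsNat A) (hB : 𝔠.IsNat B) (s : Idx n) :
    𝔠.dz s (br A B) = br (𝔠.dz s A) B + br A (𝔠.dz s B) :=
  br_br (hA.commZero (isNat_C _)) (hB.commZero (isNat_C _)) (hA.commZero hB)
    ((hA.br hB).commZero (isNat_C _)) ((hA.dz s).commZero hB) (hA.commZero (hB.dz s))

theorem constantCoeff_sig_fst (A : PowerSeries (Module.End ℂ R × Module.End ℂ R)) :
    MvPowerSeries.coeff 0 (𝔠.sig A).1 = (coeff 0 A).1 1 := by
  rw [coeff_sig_fst, map_zero, MvPowerSeries.coeff_zero_eq_constantCoeff_apply, constantCoeff_sym]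

theorem constantCoeff_sig_snd (A : PowerSeries (Module.End ℂ R × Module.End ℂ R)) :
    MvPowerSeries.coeff 0 (𝔠.sig A).2 = ((coeff 1 A).1 - (coeff 1 A).2) 1 := by
  rw [coeff_sig_snd, map_zero, MvPowerSeries.coeff_zero_eq_constantCoeff_apply, constantCoeff_sym]

theorem coeff_zero_mul' (P Q : MvPowerSeries (Idx n) R) :
    MvPowerSeries.coeff 0 (P * Q) = MvPowerSeries.coeff 0 P * MvPowerSeries.coeff 0 Q :=
  map_mul MvPowerSeries.constantCoeff P Q

theorem coeff_one_mul (A B : PowerSeries (Module.End ℂ R × Module.End ℂ R)) :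
    coeff 1 (A * B) = coeff 0 A * coeff 1 B + coeff 1 A * coeff 0 B := by
  rw [PowerSeries.coeff_mul, show (1 : ℕ) = 0 + 1 from rfl, Finset.Nat.antidiagonal_succ]
  simp

theorem coeff_two_mul (A B : PowerSeries (Module.End ℂ R × Module.End ℂ R)) :
    coeff 2 (A * B) = coeff 0 A * coeff 2 B + coeff 1 A * coeff 1 B + coeff 2 A * coeff 0 B := by
  rw [PowerSeries.coeff_mul, Finset.Nat.sum_antidiagonal_eq_sum_range_succ_mk]
  simp [Finset.sum_range_succ]

/-- The symbol mapping is multiplicative. -/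
theorem sig_mul (hA : 𝔠.IsNat A) (hB : 𝔠.IsNat B) :
    𝔠.sig (A * B) = epsMul (𝔠.sig A) (𝔠.sig B) := by
  have key : ∀ (d : ℕ) (A B : PowerSeries (Module.End ℂ R × Module.End ℂ R)), 𝔠.IsNat A →
      𝔠.IsNat B → ∀ α : Idx n →₀ ℕ, α.degree = d →
      MvPowerSeries.coeff α (𝔠.sig (A * B)).1 =
        MvPowerSeries.coeff α (epsMul (𝔠.sig A) (𝔠.sig B)).1 ∧
      MvPowerSeries.coeff α (𝔠.sig (A * B)).2 =
        MvPowerSeries.coeff α (epsMul (𝔠.sig A) (𝔠.sig B)).2 := by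
    intro d
    induction d with
    | zero =>
      intro A B hA hB α hα
      obtain rfl : α = 0 := (Finsupp.degree_eq_zero_iff α).1 hα
      have hA0 := hA.coeff_zero
      have hB0 := hB.coeff_zero
      -- The coefficients of index zero are multiplications by one function in both components, and
      -- the difference of the coefficients of index one is a multiplication too; degree zero needs
      -- nothing else.
      have hA1 := hA.coeff_one_sub
      constructor
      · rw [constantCoeff_sig_fst, epsMul, coeff_zero_mul', constantCoeff_sig_fst,
          constantCoeff_sig_fst]
        have : coeff 0 (A * B) = coeff 0 A * coeff 0 B := by simp [PowerSeries.coeff_mul]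
        rw [this, Prod.fst_mul, Module.End.mul_apply]
        conv_lhs => rw [hA0]
        simp [mulPair]
      · rw [constantCoeff_sig_snd, epsMul, map_add, coeff_zero_mul',
          coeff_zero_mul', constantCoeff_sig_fst,
          constantCoeff_sig_fst, constantCoeff_sig_snd, constantCoeff_sig_snd, coeff_one_mul]
        generalize hf : (coeff 0 A).1 1 = f at *
        generalize hg : (coeff 0 B).1 1 = g at *
        generalize hp : ((coeff 1 A).1 - (coeff 1 A).2) 1 = p at *
        have e1 : ((coeff 1 A).1 - (coeff 1 A).2) g = p * g := by rw [hA1]; simp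
        rw [hA0, hB0]
        simp only [LinearMap.sub_apply] at e1 hp ⊢
        simp [mulPair, Module.End.mul_apply]
        linear_combination e1
    | succ d ih =>
      intro A B hA hB α hα
      have hα0 : α ≠ 0 := by rintro rfl; simp at hα
      obtain ⟨s, β, rfl⟩ := exists_eq_add_single hα0
      have hβ : β.degree = d := by
        rw [map_add, Finsupp.degree_single] at hα; omega
      obtain ⟨h1, h2⟩ := ih _ _ (hA.dz s) hB β hβ
      obtain ⟨h3, h4⟩ := ih _ _ hA (hB.dz s) β hβ
      constructor
      · refine coeff_add_single_eq ?_
        rw [pderiv_sig_fst, dz_mul hA hB, sig_add, Prod.fst_add, map_add, h1, h3]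
        simp only [epsMul, Derivation.leibniz, pderiv_sig_fst, smul_eq_mul, ← map_add]
        congr 1; ring
      · refine coeff_add_single_eq ?_
        rw [pderiv_sig_snd, dz_mul hA hB, sig_add, Prod.snd_add, map_add, h2, h4]
        simp only [epsMul, Derivation.leibniz, map_add, pderiv_sig_fst, pderiv_sig_snd, smul_eq_mul]
        simp only [← map_add]
        congr 1; ring
  refine Prod.ext ?_ ?_
  · ext α; exact (key _ A B hA hB α rfl).1
  · ext α; exact (key _ A B hA hB α rfl).2

theorem coeff_zero_pb (P Q : MvPowerSeries (Idx n) R) :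
    MvPowerSeries.coeff 0 (𝔠.pb P Q) = ∑ s, (MvPowerSeries.coeff 0 (MvPowerSeries.pderiv R s P) *
      𝔠.d s (MvPowerSeries.coeff 0 Q) - 𝔠.d s (MvPowerSeries.coeff 0 P) *
      MvPowerSeries.coeff 0 (MvPowerSeries.pderiv R s Q)) := by
  rw [pb, map_sum]
  refine Finset.sum_congr rfl fun s _ => ?_
  rw [map_sub, coeff_zero_mul', coeff_zero_mul', coeff_mapCoeff,
    coeff_mapCoeff]
  rfl

/-- The action of the commutator of an operator of order at most one with a function. -/
theorem adx_apply_one {D : Module.End ℂ R} (hD : D ∈ 𝔠.ordLE 1) (f : R) :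
    D f - f * D 1 = ∑ s, adx D (𝔠.x s) 1 * 𝔠.d s f := by
  rw [𝔠.apply_of_ordLE_one hD f, add_sub_cancel_left]
  simp [adx, Module.End.mul_apply]

/-- The symbol mapping transforms `ν⁻¹ [A, B]` into the Poisson bracket. -/
theorem sig_br (hA : 𝔠.IsNat A) (hB : 𝔠.IsNat B) :
    𝔠.sig (br A B) = 𝔠.pbEps (𝔠.sig A) (𝔠.sig B) := by
  have key : ∀ (d : ℕ) (A B : PowerSeries (Module.End ℂ R × Module.End ℂ R)), 𝔠.IsNat A →
      𝔠.IsNat B → ∀ α : Idx n →₀ ℕ, α.degree = d →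
      MvPowerSeries.coeff α (𝔠.sig (br A B)).1 =
        MvPowerSeries.coeff α (𝔠.pbEps (𝔠.sig A) (𝔠.sig B)).1 ∧
      MvPowerSeries.coeff α (𝔠.sig (br A B)).2 =
        MvPowerSeries.coeff α (𝔠.pbEps (𝔠.sig A) (𝔠.sig B)).2 := by
    intro d
    induction d with
    | zero =>
      intro A B hA hB α hα
      obtain rfl : α = 0 := (Finsupp.degree_eq_zero_iff α).1 hα
      have hA0 := hA.coeff_zero
      have hB0 := hB.coeff_zero
      have hA1 := hA.coeff_one_sub
      have hB1 := hB.coeff_one_sub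
      -- In degree zero the bracket sees the coefficients of index one and the differences of index
      -- two. All have order at most one, so `adx_apply_one` expresses their action through first
      -- derivatives.
      have a1 := (hA 1).1
      have b1 := (hB 1).1
      have a2 := (hA 2).2.2
      have b2 := (hB 2).2.2
      norm_num at a1 b1 a2 b2
      have hfst : ∀ (A : PowerSeries (Module.End ℂ R × Module.End ℂ R)) (s : Idx n),
          MvPowerSeries.coeff 0 (MvPowerSeries.pderiv R s (𝔠.sig A).1) =
            adx (coeff 1 A).1 (𝔠.x s) 1 := fun A s => by
        rw [pderiv_sig_fst, constantCoeff_sig_fst, coeff_dz]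
      have hsnd : ∀ (A : PowerSeries (Module.End ℂ R × Module.End ℂ R)) (s : Idx n),
          MvPowerSeries.coeff 0 (MvPowerSeries.pderiv R s (𝔠.sig A).2) =
            adx ((coeff 2 A).1 - (coeff 2 A).2) (𝔠.x s) 1 := fun A s => by
        rw [pderiv_sig_snd, constantCoeff_sig_snd, coeff_dz]
        simp [adx, mul_sub]
        ring
      constructor
      · rw [constantCoeff_sig_fst, pbEps, coeff_zero_pb]
        simp only [hfst, constantCoeff_sig_fst]
        rw [coeff_br, map_sub, coeff_one_mul, coeff_one_mul]
        generalize hf : (coeff 0 A).1 1 = f at *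
        generalize hg : (coeff 0 B).1 1 = g at *
        have ea := 𝔠.adx_apply_one a1 g
        have eb := 𝔠.adx_apply_one b1 f
        rw [hA0, hB0, Finset.sum_sub_distrib, ← ea,
          Finset.sum_congr rfl fun s _ => mul_comm (𝔠.d s f) _, ← eb]
        simp [mulPair, Module.End.mul_apply]
        ring
      · rw [constantCoeff_sig_snd, pbEps, map_add, coeff_zero_pb, coeff_zero_pb]
        simp only [hfst, hsnd, constantCoeff_sig_fst, constantCoeff_sig_snd]
        rw [coeff_br, map_sub, coeff_two_mul, coeff_two_mul]
        generalize hf : (coeff 0 A).1 1 = f at *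
        generalize hg : (coeff 0 B).1 1 = g at *
        generalize hp : ((coeff 1 A).1 - (coeff 1 A).2) 1 = p at *
        generalize hq : ((coeff 1 B).1 - (coeff 1 B).2) 1 = q at *
        have e1 := 𝔠.adx_apply_one a1 q
        have e2 := 𝔠.adx_apply_one b1 p
        have e3 := 𝔠.adx_apply_one a2 g
        have e4 := 𝔠.adx_apply_one b2 f
        rw [hA0, hB0, Finset.sum_sub_distrib, Finset.sum_sub_distrib, ← e1, ← e3,
          Finset.sum_congr rfl fun s _ => mul_comm (𝔠.d s f) _, ← e4,
          Finset.sum_congr rfl fun s _ => mul_comm (𝔠.d s p) _, ← e2]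
        have hA2 : (coeff 1 A).2 = (coeff 1 A).1 - mulOp p := by rw [← hA1]; abel
        have hB2 : (coeff 1 B).2 = (coeff 1 B).1 - mulOp q := by rw [← hB1]; abel
        simp [mulPair, Module.End.mul_apply, hA2, hB2]
        ring
    | succ d ih =>
      intro A B hA hB α hα
      have hα0 : α ≠ 0 := by rintro rfl; simp at hα
      obtain ⟨s, β, rfl⟩ := exists_eq_add_single hα0
      have hβ : β.degree = d := by
        rw [map_add, Finsupp.degree_single] at hα; omega
      obtain ⟨h1, h2⟩ := ih _ _ (hA.dz s) hB β hβ
      obtain ⟨h3, h4⟩ := ih _ _ hA (hB.dz s) β hβ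
      constructor
      · refine coeff_add_single_eq ?_
        rw [pderiv_sig_fst, dz_br hA hB, sig_add, Prod.fst_add, map_add, h1, h3]
        simp only [pbEps, pderiv_pb, pderiv_sig_fst, map_add]
      · refine coeff_add_single_eq ?_
        rw [pderiv_sig_snd, dz_br hA hB, sig_add, Prod.snd_add, map_add, h2, h4]
        simp only [pbEps, pderiv_pb, pderiv_sig_fst, pderiv_sig_snd, map_add]
        ring
  refine Prod.ext ?_ ?_
  · ext α; exact (key _ A B hA hB α rfl).1
  · ext α; exact (key _ A B hA hB α rfl).2

end CoordAlg
end BerezinLog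
end
noncomputable section
set_option linter.unusedSectionVars false
namespace BerezinLog
namespace CoordAlg

open PowerSeries (coeff)

variable {n : ℕ} {R : Type*} [CommRing R] [Algebra ℂ R] {𝔠 : CoordAlg n R}
variable {A B P : PowerSeries (Module.End ℂ R × Module.End ℂ R)}

theorem coeff_commutator {A : Type*} [Ring A] (f g : PowerSeries A) (r : ℕ) :
    coeff r (f * g - g * f) = ∑ p ∈ Finset.HasAntidiagonal.antidiagonal r,
      (coeff p.1 f * coeff p.2 g - coeff p.2 g * coeff p.1 f) := by
  rw [map_sub, PowerSeries.coeff_mul, PowerSeries.coeff_mul, Finset.sum_sub_distrib]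
  congr 1
  exact (Finset.Nat.sum_antidiagonal_swap (n := r) (f := fun p => coeff p.1 g * coeff p.2 f)).symm

/-! ### Naturality -/

/-- `P_i` has order `i + 1`, and each commutator gives one order back. The bound `m` is there
because in the naturality induction only the lower coefficients of `P` are under control. -/
theorem coeff_adS_pow_mem (c : R) {m : ℕ} (h : ∀ i ≤ m, coeff i P ∈ 𝔠.pairLE (i + 1)) (j : ℕ) :
    ∀ k ≤ m, coeff k ((adS P ^ j) (PowerSeries.C (mulPair c))) ∈ 𝔠.pairLE k := by
  induction j with
  | zero =>
    intro k _
    rw [pow_zero, Module.End.one_apply]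
    exact isNat_C c k
  | succ j ih =>
    intro k hk
    rw [pow_succ', Module.End.mul_apply, adS_apply, coeff_commutator]
    refine Submodule.sum_mem _ fun p hp => ?_
    rw [Finset.HasAntidiagonal.mem_antidiagonal] at hp
    exact 𝔠.pairLE_mono (by omega) (𝔠.pairLE_comm (h p.1 (by omega)) (ih p.2 (by omega)))

theorem coeff_adS_pow_eq_zero (hP : coeff 0 P = 0) (c : PowerSeries (Module.End ℂ R × Module.End ℂ R))
    {j m : ℕ} (h : m < j) : coeff m ((adS P ^ j) c) = 0 := by
  have h1 := ascending_adS hP c j m h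
  rw [PowerSeries.coeff_smul] at h1
  have h2 := congrArg (fun q => (j.factorial : ℂ) • q) h1
  have : (j.factorial : ℂ) ≠ 0 := by exact_mod_cast j.factorial_ne_zero
  simpa [smul_smul, this] using h2

/-- For `r = 2` the difference must have order one, which is below the reach of the same-type
argument (it needs degree three); there the two components are required to coincide. -/
theorem mem_pairLE_of_adx_adx {p : Module.End ℂ R × Module.End ℂ R} (h1 : p.1 ∈ 𝔠.diffOps)
    (h2 : p.2 ∈ 𝔠.diffOps) {r : ℤ} (hr : 2 ≤ r) (hr' : r = 2 → p.1 = p.2)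
    (h : ∀ s t, SameType s t → (adx (adx p.1 (𝔠.x s)) (𝔠.x t), adx (adx p.2 (𝔠.x s)) (𝔠.x t)) ∈
      𝔠.pairLE (r - 2)) : p ∈ 𝔠.pairLE r := by
  refine ⟨𝔠.mem_ordLE_of_adx_adx h1 hr fun s t hst => (h s t hst).1,
    𝔠.mem_ordLE_of_adx_adx h2 hr fun s t hst => (h s t hst).2.1, ?_⟩
  rcases eq_or_lt_of_le hr with h3 | h3
  · rw [hr' h3.symm, sub_self]; exact Submodule.zero_mem _
  · refine 𝔠.mem_ordLE_of_adx_adx (𝔠.diffOps.sub_mem h1 h2) (by omega) fun s t hst => ?_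
    have h4 := (h s t hst).2.2
    have h5 : adx (adx (p.1 - p.2) (𝔠.x s)) (𝔠.x t) =
        adx (adx p.1 (𝔠.x s)) (𝔠.x t) - adx (adx p.2 (𝔠.x s)) (𝔠.x t) := by
      simp only [adx, mul_sub, sub_mul]; abel
    rw [h5]
    exact 𝔠.ordLE_mono (by omega) h4

/-- The logarithm of an operator whose adjoint action maps holomorphic coordinates to operators
commuting with holomorphic coordinates, and likewise for antiholomorphic ones, is natural. -/
theorem coeff_mem_pairLE_of_commute (hP : coeff 0 P = 0)
    (hd : ∀ r, (coeff r P).1 ∈ 𝔠.diffOps ∧ (coeff r P).2 ∈ 𝔠.diffOps)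
    (h1 : (coeff 1 P).1 = (coeff 1 P).2)
    (hc : ∀ s t, SameType s t → Commute (expAd P (PowerSeries.C (mulPair (𝔠.x s))))
      (PowerSeries.C (mulPair (𝔠.x t)))) (r : ℕ) : coeff r P ∈ 𝔠.pairLE (r + 1) := by
  induction r using Nat.strong_induction_on with
  | _ r ih =>
    rcases Nat.eq_zero_or_pos r with rfl | hr
    · rw [hP]; exact Submodule.zero_mem _
    refine mem_pairLE_of_adx_adx (hd r).1 (hd r).2 (by omega) (fun h => ?_) fun s t hst => ?_
    · obtain rfl : r = 1 := by omega
      exact h1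
    set c : PowerSeries (Module.End ℂ R × Module.End ℂ R) := PowerSeries.C (mulPair (𝔠.x s)) with hcdef
    -- The unknown `P_r` enters only through `j = 1`; the terms with `j ≥ 2` are the remainder
    -- estimated next.
    have hexp : coeff r (expAd P c) = (coeff r P * mulPair (𝔠.x s) - mulPair (𝔠.x s) * coeff r P) +
        ∑ j ∈ Finset.Ico 2 (r + 1), ((j.factorial : ℂ)⁻¹) • coeff r ((adS P ^ j) c) := by
      rw [expAd, coeff_formalSum, Finset.range_eq_Ico, Finset.sum_eq_sum_Ico_succ_bot (by omega),
        Finset.sum_eq_sum_Ico_succ_bot (by omega)]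
      have h0 : coeff r (PowerSeries.C (mulPair (𝔠.x s))) = 0 := by
        rw [PowerSeries.coeff_C, if_neg (by omega)]
      simp [h0, adS_apply, hcdef, PowerSeries.coeff_mul_C, PowerSeries.coeff_C_mul]
    have hrest : ∑ j ∈ Finset.Ico 2 (r + 1), ((j.factorial : ℂ)⁻¹) • coeff r ((adS P ^ j) c) ∈
        𝔠.pairLE r := by
      refine Submodule.sum_mem _ fun j hj => 𝔠.pairLE_csmul _ ?_
      rw [Finset.mem_Ico] at hj
      obtain ⟨i, rfl⟩ : ∃ i, j = (i + 1) + 1 := ⟨j - 2, by omega⟩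
      rw [pow_succ', Module.End.mul_apply, adS_apply, coeff_commutator]
      refine Submodule.sum_mem _ fun p hp => ?_
      rw [Finset.HasAntidiagonal.mem_antidiagonal] at hp
      -- Both extreme terms vanish because neither `P` nor a positive power of `ad P` applied to `c`
      -- has a constant term; hence `P_r` itself does not occur in the remainder.
      by_cases hp2 : p.2 = 0
      · rw [hp2, coeff_adS_pow_eq_zero hP _ (by omega)]; simp
      by_cases hp1 : p.1 = 0
      · rw [hp1, hP]; simp
      refine 𝔠.pairLE_mono (r := (p.1 + 1 : ℤ) + p.2 - 1) (by omega)
        (𝔠.pairLE_comm (ih p.1 (by omega)) ?_)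
      exact coeff_adS_pow_mem (𝔠.x s) (m := r - 1) (fun i hi => ih i (by omega)) _ p.2 (by omega)
    -- Commutation with `x_t` expresses the double commutator of `P_r` through the commutator of the
    -- remainder with `x_t`, which has order `r - 1 = (r + 1) - 2`.
    have hcc := congrArg (coeff r) (hc s t hst).eq
    rw [PowerSeries.coeff_mul_C, PowerSeries.coeff_C_mul] at hcc
    rw [← hcdef, hexp] at hcc
    have hm := 𝔠.pairLE_comm hrest (𝔠.mulPair_mem (𝔠.x t) le_rfl)
    have heq : (adx (adx (coeff r P).1 (𝔠.x s)) (𝔠.x t), adx (adx (coeff r P).2 (𝔠.x s)) (𝔠.x t)) =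
        -((∑ j ∈ Finset.Ico 2 (r + 1), ((j.factorial : ℂ)⁻¹) • coeff r ((adS P ^ j) c)) *
          mulPair (𝔠.x t) - mulPair (𝔠.x t) *
          (∑ j ∈ Finset.Ico 2 (r + 1), ((j.factorial : ℂ)⁻¹) • coeff r ((adS P ^ j) c))) := by
      have h2 : (adx (adx (coeff r P).1 (𝔠.x s)) (𝔠.x t), adx (adx (coeff r P).2 (𝔠.x s)) (𝔠.x t)) =
        (coeff r P * mulPair (𝔠.x s) - mulPair (𝔠.x s) * coeff r P) * mulPair (𝔠.x t) -
        mulPair (𝔠.x t) * (coeff r P * mulPair (𝔠.x s) - mulPair (𝔠.x s) * coeff r P) := rfl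
      rw [h2, eq_neg_iff_add_eq_zero]
      rw [add_mul, mul_add, ← sub_eq_zero] at hcc
      rw [← hcc]; abel
    rw [heq]
    exact Submodule.neg_mem _ (𝔠.pairLE_mono (by omega) hm)

theorem isNat_X_mul (h : ∀ r : ℕ, coeff r P ∈ 𝔠.pairLE (r + 1)) : 𝔠.IsNat (PowerSeries.X * P) := by
  intro r
  rcases r with _ | r
  · simp
  · rw [PowerSeries.coeff_succ_X_mul]
    exact_mod_cast h r

theorem isNat_adS_pow (h : ∀ r : ℕ, coeff r P ∈ 𝔠.pairLE (r + 1)) (c : R) (j : ℕ) :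
    𝔠.IsNat ((adS P ^ j) (PowerSeries.C (mulPair c))) := fun k =>
  coeff_adS_pow_mem c (m := k) (fun i _ => h i) j k le_rfl

theorem isNat_expAd (h : ∀ r : ℕ, coeff r P ∈ 𝔠.pairLE (r + 1)) (c : R) :
    𝔠.IsNat (expAd P (PowerSeries.C (mulPair c))) := by
  intro r
  rw [expAd, coeff_formalSum]
  refine Submodule.sum_mem _ fun j _ => ?_
  rw [PowerSeries.coeff_smul]
  exact 𝔠.pairLE_csmul _ (isNat_adS_pow h c j r)

variable (𝔠) in
/-- `e^{H_F} Q` over an algebra with coordinates. -/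
def expHam (F Q : Eps (MvPowerSeries (Idx n) R)) : Eps (MvPowerSeries (Idx n) R) :=
  (fun α => ∑ j ∈ Finset.range (α.degree + 1),
      ((j.factorial : ℂ)⁻¹) • MvPowerSeries.coeff α ((𝔠.pbEps F)^[j] Q).1,
    fun α => ∑ j ∈ Finset.range (α.degree + 1),
      ((j.factorial : ℂ)⁻¹) • MvPowerSeries.coeff α ((𝔠.pbEps F)^[j] Q).2)

theorem sig_adS_pow (h : ∀ r : ℕ, coeff r P ∈ 𝔠.pairLE (r + 1)) (c : R) (j : ℕ) :
    𝔠.sig ((adS P ^ j) (PowerSeries.C (mulPair c))) =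
      (𝔠.pbEps (𝔠.sig (PowerSeries.X * P)))^[j] (MvPowerSeries.C c, 0) := by
  induction j with
  | zero => simp [sig_C]
  | succ j ih =>
    rw [pow_succ', Module.End.mul_apply, adS_eq_br, sig_br (isNat_X_mul h) (isNat_adS_pow h c j), ih,
      Function.iterate_succ_apply']

/-- Only `P_1` can contribute to coefficient `j` of `(ad P)^j c`, and `P_1` is common to both
components. The `ε` part of `sig` in degree `d` reads coefficient `d + 1`, where the term `j = d +
1` lies beyond the truncation of `expHam`; this equality removes it. -/
theorem coeff_adS_pow_self (hP : coeff 0 P = 0) (h1 : (coeff 1 P).1 = (coeff 1 P).2) (c : R)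
    (j : ℕ) : (coeff j ((adS P ^ j) (PowerSeries.C (mulPair c)))).1 =
      (coeff j ((adS P ^ j) (PowerSeries.C (mulPair c)))).2 := by
  induction j with
  | zero => simp [mulPair]
  | succ j ih =>
    have h2 : coeff (j + 1) ((adS P ^ (j + 1)) (PowerSeries.C (mulPair c))) =
        coeff 1 P * coeff j ((adS P ^ j) (PowerSeries.C (mulPair c))) -
          coeff j ((adS P ^ j) (PowerSeries.C (mulPair c))) * coeff 1 P := by
      rw [pow_succ', Module.End.mul_apply, adS_apply, coeff_commutator, Finset.sum_eq_single (1, j)]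
      · rintro ⟨a, b⟩ hp hne
        rw [Finset.HasAntidiagonal.mem_antidiagonal] at hp
        dsimp only at hp ⊢
        by_cases ha : a = 0
        · rw [ha, hP]; simp
        · rw [coeff_adS_pow_eq_zero hP _ (m := b) (j := j)]
          · simp
          · by_contra hb
            exact hne (Prod.ext (by omega) (by omega))
      · intro hne
        exact absurd (Finset.HasAntidiagonal.mem_antidiagonal.2 (add_comm 1 j)) hne
    rw [h2]
    simp only [Prod.fst_sub, Prod.snd_sub, Prod.fst_mul, Prod.snd_mul, ih, h1]

/-- Termwise, `(ad P)^j` becomes `H_F^j` by repeated use of `sig_br`, with `F` the symbol of `νP`.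
-/
theorem sig_expAd (hP : coeff 0 P = 0) (h1 : (coeff 1 P).1 = (coeff 1 P).2)
    (h : ∀ r : ℕ, coeff r P ∈ 𝔠.pairLE (r + 1)) (c : R) :
    𝔠.sig (expAd P (PowerSeries.C (mulPair c))) =
      𝔠.expHam (𝔠.sig (PowerSeries.X * P)) (MvPowerSeries.C c, 0) := by
  refine Prod.ext ?_ ?_
  · ext α
    rw [coeff_sig_fst, expAd, coeff_formalSum, Prod.fst_sum, sym_sum, map_sum]
    refine Finset.sum_congr rfl fun j _ => ?_
    rw [← sig_adS_pow h, coeff_sig_fst, PowerSeries.coeff_smul, Prod.smul_fst, sym_csmul]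
    rfl
  · ext α
    rw [coeff_sig_snd, expAd, coeff_formalSum, Finset.sum_range_succ, Prod.fst_add, Prod.snd_add,
      PowerSeries.coeff_smul, Prod.smul_fst, Prod.smul_snd, coeff_adS_pow_self hP h1 c,
      add_sub_add_right_eq_sub, Prod.fst_sum, Prod.snd_sum, ← Finset.sum_sub_distrib, sym_sum,
      map_sum]
    refine Finset.sum_congr rfl fun j _ => ?_
    rw [← sig_adS_pow h, coeff_sig_snd, PowerSeries.coeff_smul, Prod.smul_fst, Prod.smul_snd,
      ← smul_sub, sym_csmul]
    rfl

theorem mem_pairLE_of_adx {p : Module.End ℂ R × Module.End ℂ R} (h1 : p.1 ∈ 𝔠.diffOps)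
    (h2 : p.2 ∈ 𝔠.diffOps) {r : ℤ} (hr : 1 ≤ r)
    (h : ∀ s, (adx p.1 (𝔠.x s), adx p.2 (𝔠.x s)) ∈ 𝔠.pairLE (r - 1)) : p ∈ 𝔠.pairLE r := by
  refine ⟨𝔠.mem_ordLE_of_adx h1 (by omega) fun s => (h s).1,
    𝔠.mem_ordLE_of_adx h2 (by omega) fun s => (h s).2.1,
    𝔠.mem_ordLE_of_adx (𝔠.diffOps.sub_mem h1 h2) (by omega) fun s => ?_⟩
  have h5 : adx (p.1 - p.2) (𝔠.x s) = adx p.1 (𝔠.x s) - adx p.2 (𝔠.x s) := by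
    simp only [adx, mul_sub, sub_mul]; abel
  rw [h5]
  exact (h s).2.2

/-- A series of pairs of differential operators that commutes with natural quantizations of all
coordinates is natural. -/
theorem isNat_of_commute {f : R} (hA0 : coeff 0 A = mulPair f)
    (hd : ∀ r, (coeff r A).1 ∈ 𝔠.diffOps ∧ (coeff r A).2 ∈ 𝔠.diffOps)
    (h : ∀ s, ∃ Q, 𝔠.IsNat Q ∧ coeff 0 Q = mulPair (𝔠.x s) ∧ Commute A Q) : 𝔠.IsNat A := by
  intro r
  induction r using Nat.strong_induction_on with
  | _ r ih =>
    rcases Nat.eq_zero_or_pos r with rfl | hr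
    · rw [hA0]; exact 𝔠.mulPair_mem f le_rfl
    refine mem_pairLE_of_adx (hd r).1 (hd r).2 (by omega) fun s => ?_
    obtain ⟨Q, hQ, hQ0, hAQ⟩ := h s
    have h1 : coeff r (A * Q - Q * A) = 0 := by rw [hAQ.eq, sub_self, map_zero]
    -- The pairing of `A_r` with the constant term of `Q` is the commutator with `x_s`; all other
    -- terms involve `A_i` with `i < r` and are bounded by induction.
    rw [coeff_commutator, ← Finset.add_sum_erase _ _
      (Finset.HasAntidiagonal.mem_antidiagonal.2 (show ((r, 0) : ℕ × ℕ).1 + ((r, 0) : ℕ × ℕ).2 = r from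
        add_zero r)), hQ0] at h1
    have h2 : (adx (coeff r A).1 (𝔠.x s), adx (coeff r A).2 (𝔠.x s)) =
        coeff r A * mulPair (𝔠.x s) - mulPair (𝔠.x s) * coeff r A := rfl
    rw [h2, eq_neg_of_add_eq_zero_left h1]
    refine Submodule.neg_mem _ (Submodule.sum_mem _ fun p hp => ?_)
    rw [Finset.mem_erase, Finset.HasAntidiagonal.mem_antidiagonal] at hp
    have hlt : p.1 < r := by
      by_contra hlt
      exact hp.1 (Prod.ext (by omega) (by simp; omega))
    exact 𝔠.pairLE_mono (by omega) (𝔠.pairLE_comm (ih p.1 hlt) (hQ p.2))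

/-! ### Symbols of sums along the formal parameter -/

/-- The symbol of `∑ ν^k L_{u_k}`. -/
theorem sig_of_coeff_sum {W : Type*} [AddCommGroup W] [Module ℂ W]
    (L : W →ₗ[ℂ] PowerSeries (Module.End ℂ R × Module.End ℂ R)) (hL : ∀ u, 𝔠.IsNat (L u))
    {u v : ℕ → W} (h0 : u 0 = v 0)
    (h1 : ∀ r, (coeff r A).1 = ∑ p ∈ Finset.HasAntidiagonal.antidiagonal r, (coeff p.1 (L (u p.2))).1)
    (h2 : ∀ r, (coeff r A).2 = ∑ p ∈ Finset.HasAntidiagonal.antidiagonal r, (coeff p.1 (L (v p.2))).2) :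
    𝔠.sig A = ((𝔠.sig (L (u 0))).1, (𝔠.sig (L (u 0))).2 + (𝔠.sig (L (u 1 - v 1))).1) := by
  refine Prod.ext ?_ ?_
  · ext α
    rw [coeff_sig_fst, coeff_sig_fst, h1, sym_sum, map_sum, Finset.sum_eq_single (α.degree, 0)]
    · rintro ⟨a, b⟩ hp hne
      rw [Finset.HasAntidiagonal.mem_antidiagonal] at hp
      refine 𝔠.coeff_sym_eq_zero (hL _ a).1 ?_
      have : b ≠ 0 := fun hb => hne (Prod.ext (by simp at hp ⊢; omega) hb)
      dsimp only at hp
      omega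
    · intro h
      exact absurd (Finset.HasAntidiagonal.mem_antidiagonal.2 (add_zero _)) h
  · ext α
    -- Only the indices `(d+1, 0)` and `(d, 1)` reach degree `d`. The first gives the `ε` part for
    -- `u 0 = v 0`. The second compares `u 1` and `v 1` in different components, but components of
    -- index `d` agree in degree `d`.
    rw [coeff_sig_snd, h1, h2, ← Finset.sum_sub_distrib, sym_sum, map_sum,
      Finset.sum_eq_add (α.degree + 1, 0) (α.degree, 1) (by simp)]
    · rw [map_add, coeff_sig_snd, coeff_sig_fst, ← h0, map_sub, map_sub, Prod.fst_sub]
      congr 1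
      have h3 := 𝔠.coeff_sym_eq_zero (hL (v 1) α.degree).2.2 (α := α) (by omega)
      rw [sym_sub, map_sub] at h3 ⊢
      rw [sym_sub, map_sub]
      linear_combination h3
    · rintro ⟨a, b⟩ hp hne
      rw [Finset.HasAntidiagonal.mem_antidiagonal] at hp
      dsimp only at hp ⊢
      have hb0 : b ≠ 0 := fun hb => hne.1 (Prod.ext (by simp; omega) hb)
      have hb1 : b ≠ 1 := fun hb => hne.2 (Prod.ext (by simp; omega) hb)
      exact 𝔠.coeff_sym_eq_zero (Submodule.sub_mem _ (hL _ a).1 (hL _ a).2.1) (by omega)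
    · intro h
      exact absurd (Finset.HasAntidiagonal.mem_antidiagonal.2 (add_zero _)) h
    · intro h
      exact absurd (Finset.HasAntidiagonal.mem_antidiagonal.2 (Eq.refl (α.degree + 1))) h

/-! ### Operators of low order -/

theorem apply_of_hol {D : Module.End ℂ R} (hD : D ∈ 𝔠.ordLE 1) (h1 : D 1 = 0)
    (h : ∀ l, D (𝔠.x (Sum.inr l)) = 0) (f : R) :
    D f = ∑ k, D (𝔠.x (Sum.inl k)) * 𝔠.d (Sum.inl k) f := by
  rw [𝔠.apply_of_ordLE_one hD f, Fintype.sum_sum_type]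
  simp [h1, h]

theorem apply_of_antihol {D : Module.End ℂ R} (hD : D ∈ 𝔠.ordLE 1) (h1 : D 1 = 0)
    (h : ∀ k, D (𝔠.x (Sum.inl k)) = 0) (f : R) :
    D f = ∑ l, D (𝔠.x (Sum.inr l)) * 𝔠.d (Sum.inr l) f := by
  rw [𝔠.apply_of_ordLE_one hD f, Fintype.sum_sum_type]
  simp [h1, h]

/-- Second order Taylor formula: the coefficients are iterated commutators with coordinates
evaluated at `1`, and the factor one half compensates for summing over ordered pairs. -/
theorem apply_of_ordLE_two {D : Module.End ℂ R} (hD : D ∈ 𝔠.ordLE 2) (f : R) :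
    D f = f * D 1 + ∑ s, (D (𝔠.x s) - 𝔠.x s * D 1) * 𝔠.d s f +
      (1 / 2 : ℂ) • ∑ s, ∑ t, (D (𝔠.x s * 𝔠.x t) - 𝔠.x s * D (𝔠.x t) - 𝔠.x t * D (𝔠.x s) +
        𝔠.x s * 𝔠.x t * D 1) * 𝔠.d s (𝔠.d t f) := by
  have base : ∀ D : Module.End ℂ R, D ∈ 𝔠.ordLE 1 → ∀ s t, D (𝔠.x s * 𝔠.x t) - 𝔠.x s * D (𝔠.x t)
      - 𝔠.x t * D (𝔠.x s) + 𝔠.x s * 𝔠.x t * D 1 = 0 := by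
    intro D hD s t
    rw [𝔠.apply_of_ordLE_one hD (𝔠.x s * 𝔠.x t)]
    simp only [Derivation.leibniz, 𝔠.d_x, smul_eq_mul, mul_add, Finset.sum_add_distrib, mul_ite,
      mul_one, mul_zero, Finset.sum_ite_eq', Finset.mem_univ, if_true]
    ring
  induction hD using ordLE_induction with
  | word w h =>
    by_cases hw : w.length ≤ 1
    · have hm : 𝔠.dWord w ∈ 𝔠.ordLE 1 := 𝔠.dWord_mem (by omega)
      rw [← 𝔠.apply_of_ordLE_one hm f]
      simp [base _ hm]
    · obtain ⟨a, b, rfl⟩ : ∃ a b, w = [a, b] := by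
        rw [← List.length_eq_two]; omega
      have e1 : ∀ u, 𝔠.dWord [a, b] u = 𝔠.d a (𝔠.d b u) := fun u => by
        simp [dWord_cons, dWord_nil, dOp_apply]
      have e2 : ∀ s, 𝔠.d a (𝔠.d b (𝔠.x s)) = 0 := fun s => by
        rw [𝔠.d_x]; split_ifs <;> simp
      have e3 : ∀ s t, 𝔠.d a (𝔠.d b (𝔠.x s * 𝔠.x t)) =
          (if b = t then 1 else 0) * (if a = s then 1 else 0) +
          (if a = t then 1 else 0) * (if b = s then 1 else 0) := fun s t => by
        simp only [Derivation.leibniz, map_add, 𝔠.d_x, smul_eq_mul]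
        ring_nf
        have : ∀ t, 𝔠.d a ((if b = t then 1 else 0 : R)) = 0 := fun t => by split_ifs <;> simp
        simp only [this]
        ring
      simp only [e1, e2, e3]
      simp only [Derivation.map_one_eq_zero, map_zero, mul_zero, sub_zero, zero_mul, add_zero,
        Finset.sum_const_zero, zero_add, add_mul, Finset.sum_add_distrib, ite_mul, one_mul,
        Finset.sum_ite_eq, Finset.mem_univ, if_true]
      rw [𝔠.comm b a, ← two_smul ℂ (𝔠.d a (𝔠.d b f)), smul_smul]
      norm_num
  | add D E _ _ h1 h2 =>
    simp only [LinearMap.add_apply]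
    rw [h1, h2]
    have e1 : ∀ s, (D (𝔠.x s) + E (𝔠.x s) - 𝔠.x s * (D 1 + E 1)) * 𝔠.d s f =
      (D (𝔠.x s) - 𝔠.x s * D 1) * 𝔠.d s f + (E (𝔠.x s) - 𝔠.x s * E 1) * 𝔠.d s f := by
      intro s; ring
    have e2 : ∀ s t, (D (𝔠.x s * 𝔠.x t) + E (𝔠.x s * 𝔠.x t) - 𝔠.x s * (D (𝔠.x t) + E (𝔠.x t)) -
        𝔠.x t * (D (𝔠.x s) + E (𝔠.x s)) + 𝔠.x s * 𝔠.x t * (D 1 + E 1)) * 𝔠.d s (𝔠.d t f) =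
      (D (𝔠.x s * 𝔠.x t) - 𝔠.x s * D (𝔠.x t) - 𝔠.x t * D (𝔠.x s) + 𝔠.x s * 𝔠.x t * D 1) *
        𝔠.d s (𝔠.d t f) +
      (E (𝔠.x s * 𝔠.x t) - 𝔠.x s * E (𝔠.x t) - 𝔠.x t * E (𝔠.x s) + 𝔠.x s * 𝔠.x t * E 1) *
        𝔠.d s (𝔠.d t f) := by
      intro s t; ring
    simp only [e1, e2, Finset.sum_add_distrib, smul_add]
    ring
  | zero => simp
  | smul a D hD h =>
    simp only [LinearMap.smul_apply, smul_eq_mul]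
    rw [h]
    simp only [mul_add, Finset.mul_sum, mul_smul_comm]
    congr 1
    · congr 1
      · ring
      · exact Finset.sum_congr rfl fun s _ => by ring
    · congr 1
      exact Finset.sum_congr rfl fun s _ => Finset.sum_congr rfl fun t _ => by ring

/-- An operator of order at most two that annihilates products of coordinates of the same type. -/
theorem eq_of_ordLE_two {D : Module.End ℂ R} (hD : D ∈ 𝔠.ordLE 2) (h0 : D 1 = 0)
    (h1 : ∀ s, D (𝔠.x s) = 0) (h2 : ∀ s t, SameType s t → D (𝔠.x s * 𝔠.x t) = 0) :
    D = ∑ l, ∑ k, D (𝔠.x (Sum.inl k) * 𝔠.x (Sum.inr l)) •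
      𝔠.dWord [Sum.inl k, Sum.inr l] := by
  ext f
  rw [𝔠.apply_of_ordLE_two hD f]
  have e1 : ∀ k l, D (𝔠.x (Sum.inl k) * 𝔠.x (Sum.inl l)) = 0 := fun k l => h2 _ _ rfl
  have e2 : ∀ k l, D (𝔠.x (Sum.inr k) * 𝔠.x (Sum.inr l)) = 0 := fun k l => h2 _ _ rfl
  have e3 : ∀ u k l, 𝔠.dWord [Sum.inl k, Sum.inr l] u = 𝔠.d (Sum.inl k) (𝔠.d (Sum.inr l) u) :=
    fun u k l => by simp [dWord_cons, dWord_nil, dOp_apply]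
  simp only [h0, h1, mul_zero, sub_zero, zero_mul, Finset.sum_const_zero, add_zero, zero_add,
    Fintype.sum_sum_type, e1, e2, Finset.sum_add_distrib, LinearMap.sum_apply,
    LinearMap.smul_apply, smul_eq_mul, e3]
  rw [Finset.sum_comm]
  have e4 : ∀ l k, D (𝔠.x (Sum.inr l) * 𝔠.x (Sum.inl k)) * 𝔠.d (Sum.inr l) (𝔠.d (Sum.inl k) f) =
      D (𝔠.x (Sum.inl k) * 𝔠.x (Sum.inr l)) * 𝔠.d (Sum.inl k) (𝔠.d (Sum.inr l) f) := fun l k => by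
    rw [mul_comm (𝔠.x _), 𝔠.comm]
  simp only [e4]
  rw [← two_smul ℂ, smul_smul]
  norm_num
  exact Finset.sum_comm

end CoordAlg
end BerezinLog
end
noncomputable section
set_option linter.unusedSectionVars false
namespace BerezinLog
namespace CoordAlg

open MvPowerSeries

variable {n : ℕ} {R : Type*} [CommRing R] [Algebra ℂ R] {𝔠 : CoordAlg n R}

/-! ### Uniqueness of the generating formal function -/

/-- All components of degree less than `m` vanish. -/
def OrdGE (m : ℕ) (P : MvPowerSeries (Idx n) R) : Prop := ∀ α, α.degree < m → coeff α P = 0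

theorem OrdGE.mono {m k : ℕ} {P : MvPowerSeries (Idx n) R} (h : OrdGE m P) (hk : k ≤ m) :
    OrdGE k P := fun α hα => h α (by omega)

theorem OrdGE.add {m : ℕ} {P Q : MvPowerSeries (Idx n) R} (hP : OrdGE m P) (hQ : OrdGE m Q) :
    OrdGE m (P + Q) := fun α hα => by rw [map_add, hP α hα, hQ α hα, add_zero]

theorem OrdGE.sub {m : ℕ} {P Q : MvPowerSeries (Idx n) R} (hP : OrdGE m P) (hQ : OrdGE m Q) :
    OrdGE m (P - Q) := fun α hα => by rw [map_sub, hP α hα, hQ α hα, sub_zero]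

theorem OrdGE.mul {a b : ℕ} {P Q : MvPowerSeries (Idx n) R} (hP : OrdGE a P) (hQ : OrdGE b Q) :
    OrdGE (a + b) (P * Q) := by
  intro α hα
  classical
  rw [coeff_mul]
  refine Finset.sum_eq_zero fun p hp => ?_
  rw [Finset.HasAntidiagonal.mem_antidiagonal] at hp
  rw [← hp, map_add] at hα
  by_cases h : p.1.degree < a
  · rw [hP _ h, zero_mul]
  · rw [hQ p.2 (by omega), mul_zero]

theorem OrdGE.pderiv {a : ℕ} {P : MvPowerSeries (Idx n) R} (hP : OrdGE a P) (s : Idx n) :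
    OrdGE (a - 1) (MvPowerSeries.pderiv R s P) := by
  intro α hα
  rw [coeff_pderiv, hP, zero_mul]
  rw [map_add, Finsupp.degree_single]
  omega

theorem OrdGE.mapCoeff {a : ℕ} {P : MvPowerSeries (Idx n) R} (hP : OrdGE a P)
    (D : Module.End ℂ R) : OrdGE a (mapCoeff D P) := by
  intro α hα
  rw [coeff_mapCoeff, hP α hα, map_zero]

/-- Each term of the bracket contains one fibre derivative, which costs one degree, and one base
derivative, which costs none. -/
theorem OrdGE.pb {a b c : ℕ} {P Q : MvPowerSeries (Idx n) R} (hP : OrdGE a P) (hQ : OrdGE b Q)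
    (h : c + 1 ≤ a + b) : OrdGE c (𝔠.pb P Q) := by
  intro α hα
  rw [CoordAlg.pb, map_sum]
  refine Finset.sum_eq_zero fun s _ => ?_
  rw [map_sub, ((hP.pderiv s).mul (hQ.mapCoeff _)) α (by omega),
    ((hP.mapCoeff _).mul (hQ.pderiv s)) α (by omega), sub_zero]

/-- All components of degree less than `m` vanish. -/
def OrdGE2 (m : ℕ) (P : Eps (MvPowerSeries (Idx n) R)) : Prop := OrdGE m P.1 ∧ OrdGE m P.2

theorem OrdGE2.pbEps {a b c : ℕ} {P Q : Eps (MvPowerSeries (Idx n) R)} (hP : OrdGE2 a P)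
    (hQ : OrdGE2 b Q) (h : c + 1 ≤ a + b) : OrdGE2 c (𝔠.pbEps P Q) :=
  ⟨hP.1.pb hQ.1 h, (hP.1.pb hQ.2 h).add (hP.2.pb hQ.1 h)⟩

theorem pbEps_sub (F F' Q Q' : Eps (MvPowerSeries (Idx n) R)) :
    𝔠.pbEps F Q - 𝔠.pbEps F' Q' = 𝔠.pbEps (F - F') Q + 𝔠.pbEps F' (Q - Q') := by
  refine Prod.ext ?_ ?_
  · simp only [pbEps, Prod.fst_sub, Prod.fst_add, pb_sub_left, pb_sub_right]; abel
  · simp only [pbEps, Prod.snd_sub, Prod.fst_sub, Prod.snd_add, pb_sub_left, pb_sub_right]; abel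

theorem ordGE2_iterate {F : Eps (MvPowerSeries (Idx n) R)} (hF : OrdGE2 2 F)
    (Q : Eps (MvPowerSeries (Idx n) R)) (j : ℕ) : OrdGE2 j ((𝔠.pbEps F)^[j] Q) := by
  induction j with
  | zero => exact ⟨fun α hα => absurd hα (by omega), fun α hα => absurd hα (by omega)⟩
  | succ j ih =>
    rw [Function.iterate_succ_apply']
    exact hF.pbEps ih (by omega)

/-- Bracketing with an element that starts in degree two raises the degree by one, and `H_F^j Q`
already starts in degree `j`. Telescoping over the iterates, a change of `F` from degree `d + 1` on
can affect degree `d` only in the first iterate. -/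
theorem ordGE2_iterate_sub {F F' : Eps (MvPowerSeries (Idx n) R)} (hF : OrdGE2 2 F)
    (hF' : OrdGE2 2 F') {d : ℕ} (hd : OrdGE2 (d + 1) (F - F'))
    (Q : Eps (MvPowerSeries (Idx n) R)) (j : ℕ) :
    OrdGE2 d ((𝔠.pbEps F)^[j] Q - (𝔠.pbEps F')^[j] Q) ∧
      (j ≠ 1 → OrdGE2 (d + 1) ((𝔠.pbEps F)^[j] Q - (𝔠.pbEps F')^[j] Q)) := by
  induction j with
  | zero =>
    have h0 : ∀ m, OrdGE2 m ((𝔠.pbEps F)^[0] Q - (𝔠.pbEps F')^[0] Q) := fun m => by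
      simp only [Function.iterate_zero, id_eq, sub_self]
      exact ⟨fun _ _ => map_zero _, fun _ _ => map_zero _⟩
    exact ⟨h0 _, fun _ => h0 _⟩
  | succ j ih =>
    rw [Function.iterate_succ_apply', Function.iterate_succ_apply', pbEps_sub]
    have h1 : ∀ c, c + 1 ≤ d + 1 + j → OrdGE2 c (𝔠.pbEps (F - F') ((𝔠.pbEps F)^[j] Q)) :=
      fun c hc => hd.pbEps (ordGE2_iterate hF Q j) hc
    have h2 : OrdGE2 (d + 1) (𝔠.pbEps F' ((𝔠.pbEps F)^[j] Q - (𝔠.pbEps F')^[j] Q)) :=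
      hF'.pbEps ih.1 (by omega)
    refine ⟨⟨((h1 d (by omega)).1).add (h2.1.mono (by omega)),
      ((h1 d (by omega)).2).add (h2.2.mono (by omega))⟩, fun hj => ?_⟩
    exact ⟨((h1 (d + 1) (by omega)).1).add h2.1, ((h1 (d + 1) (by omega)).2).add h2.2⟩

theorem pb_C_x (P : MvPowerSeries (Idx n) R) (s : Idx n) :
    𝔠.pb P (C (𝔠.x s)) = MvPowerSeries.pderiv R s P := by
  have h1 : ∀ t, mapCoeff (𝔠.dOp t) (C (𝔠.x s)) = if t = s then (1 : MvPowerSeries (Idx n) R) else 0 := by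
    intro t
    ext α
    rw [coeff_mapCoeff, coeff_C, dOp_apply]
    have := 𝔠.d_x t s
    split_ifs at this ⊢ with h2 h3 <;> simp_all [coeff_one]
  simp [pb, h1]

theorem pbEps_C_x (P : Eps (MvPowerSeries (Idx n) R)) (s : Idx n) :
    𝔠.pbEps P (C (𝔠.x s), 0) = (MvPowerSeries.pderiv R s P.1, MvPowerSeries.pderiv R s P.2) := by
  have h : ∀ P : MvPowerSeries (Idx n) R, 𝔠.pb P 0 = 0 := fun P => by
    have := 𝔠.pb_sub_right P 0 0; simpa using this
  simp [pbEps, pb_C_x, h]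

/-- The conditions on an element of `𝒦[ε]`, in terms of coordinates. -/
structure IsGenerating (𝔠 : CoordAlg n R) (F : Eps (MvPowerSeries (Idx n) R)) : Prop where
  quadratic : OrdGE2 2 F
  commute : ∀ s t, SameType s t →
    𝔠.pbEps (𝔠.expHam F (C (𝔠.x s), 0)) (C (𝔠.x t), 0) = 0

/-- The defining condition kills all coefficients of `e^{H_F} x_s` at monomials divisible by `ζ_t`
with `t` of the type of `s`. Subtracting the conditions for `F` and `F'`, only `{F - F', x_s}`
survives in degree `d`; in degree at least three the same-type argument then reaches every monomial
of `F - F'`. -/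
theorem IsGenerating.step {F F' : Eps (MvPowerSeries (Idx n) R)} (hF : IsGenerating 𝔠 F)
    (hF' : IsGenerating 𝔠 F') {d : ℕ} (h2 : 2 ≤ d) (hd : OrdGE2 (d + 1) (F - F')) :
    OrdGE2 (d + 2) (F - F') := by
  have key : ∀ α : Idx n →₀ ℕ, α.degree = d + 1 →
      coeff α F.1 = coeff α F'.1 ∧ coeff α F.2 = coeff α F'.2 := by
    intro α hα
    obtain ⟨s, t, β, hst, rfl⟩ := exists_eq_add_sameType (α := α) (by omega)
    have hβ : (β + Finsupp.single t 1).degree = d := by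
      simp only [map_add, Finsupp.degree_single] at hα ⊢; omega
    have hz : ∀ G, IsGenerating 𝔠 G →
        coeff (β + Finsupp.single t 1) (𝔠.expHam G (C (𝔠.x s), 0)).1 = 0 ∧
        coeff (β + Finsupp.single t 1) (𝔠.expHam G (C (𝔠.x s), 0)).2 = 0 := by
      intro G hG
      have h := hG.commute s t hst
      rw [pbEps_C_x, Prod.mk_eq_zero] at h
      constructor
      · have h1 := coeff_add_single_eq (P := (𝔠.expHam G (C (𝔠.x s), 0)).1) (Q := 0) (s := t) (α := β)
          (by rw [h.1, map_zero, map_zero, map_zero])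
        rw [h1, map_zero]
      · have h1 := coeff_add_single_eq (P := (𝔠.expHam G (C (𝔠.x s), 0)).2) (Q := 0) (s := t) (α := β)
          (by rw [h.2, map_zero, map_zero, map_zero])
        rw [h1, map_zero]
    have hsum : ∀ (G : Eps (MvPowerSeries (Idx n) R)),
        coeff (β + Finsupp.single t 1) (𝔠.expHam G (C (𝔠.x s), 0)).1 =
          ∑ j ∈ Finset.range (d + 1), ((j.factorial : ℂ)⁻¹) •
            coeff (β + Finsupp.single t 1) ((𝔠.pbEps G)^[j] (C (𝔠.x s), 0)).1 ∧
        coeff (β + Finsupp.single t 1) (𝔠.expHam G (C (𝔠.x s), 0)).2 =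
          ∑ j ∈ Finset.range (d + 1), ((j.factorial : ℂ)⁻¹) •
            coeff (β + Finsupp.single t 1) ((𝔠.pbEps G)^[j] (C (𝔠.x s), 0)).2 := by
      intro G
      rw [← hβ]
      exact ⟨rfl, rfl⟩
    have hdiff := fun j => (ordGE2_iterate_sub (𝔠 := 𝔠) hF.quadratic hF'.quadratic hd
      ((C (𝔠.x s), 0) : Eps (MvPowerSeries (Idx n) R)) j).2
    have hone : 1 ∈ Finset.range (d + 1) := Finset.mem_range.2 (by omega)
    constructor
    · have h1 := ((hz F hF).1).trans ((hz F' hF').1).symm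
      rw [(hsum F).1, (hsum F').1, ← sub_eq_zero, ← Finset.sum_sub_distrib,
        Finset.sum_eq_single_of_mem 1 hone] at h1
      · simp only [Nat.factorial_one, Nat.cast_one, inv_one, one_smul, Function.iterate_one,
          pbEps_C_x, sub_eq_zero] at h1
        exact coeff_add_single_eq h1
      · intro j _ hj
        rw [← smul_sub, ← map_sub, ← Prod.fst_sub, (hdiff j hj).1 _ (by omega), smul_zero]
    · have h1 := ((hz F hF).2).trans ((hz F' hF').2).symm
      rw [(hsum F).2, (hsum F').2, ← sub_eq_zero, ← Finset.sum_sub_distrib,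
        Finset.sum_eq_single_of_mem 1 hone] at h1
      · simp only [Nat.factorial_one, Nat.cast_one, inv_one, one_smul, Function.iterate_one,
          pbEps_C_x, sub_eq_zero] at h1
        exact coeff_add_single_eq h1
      · intro j _ hj
        rw [← smul_sub, ← map_sub, ← Prod.snd_sub, (hdiff j hj).2 _ (by omega), smul_zero]
  constructor
  · intro α hα
    rcases Nat.lt_succ_iff_lt_or_eq.1 hα with h | h
    · exact hd.1 α h
    · rw [Prod.fst_sub, map_sub, (key α h).1, sub_self]
  · intro α hα
    rcases Nat.lt_succ_iff_lt_or_eq.1 hα with h | h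
    · exact hd.2 α h
    · rw [Prod.snd_sub, map_sub, (key α h).2, sub_self]

/-- A generating formal function is determined by its quadratic part. -/
theorem IsGenerating.unique {F F' : Eps (MvPowerSeries (Idx n) R)} (hF : IsGenerating 𝔠 F)
    (hF' : IsGenerating 𝔠 F')
    (h : ∀ α : Idx n →₀ ℕ, α.degree = 2 → coeff α F.1 = coeff α F'.1 ∧ coeff α F.2 = coeff α F'.2) :
    F = F' := by
  have h3 : OrdGE2 3 (F - F') := by
    constructor
    · intro α hα
      rcases Nat.lt_succ_iff_lt_or_eq.1 hα with h1 | h1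
      · exact (hF.quadratic.1.sub hF'.quadratic.1) α h1
      · rw [Prod.fst_sub, map_sub, (h α h1).1, sub_self]
    · intro α hα
      rcases Nat.lt_succ_iff_lt_or_eq.1 hα with h1 | h1
      · exact (hF.quadratic.2.sub hF'.quadratic.2) α h1
      · rw [Prod.snd_sub, map_sub, (h α h1).2, sub_self]
  have hall : ∀ d, OrdGE2 (d + 3) (F - F') := by
    intro d
    induction d with
    | zero => exact h3
    | succ d ih => exact hF.step hF' (d := d + 2) (by omega) ih
  rw [← sub_eq_zero]
  refine Prod.ext ?_ ?_
  · ext α; exact (hall α.degree).1 α (by omega)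
  · ext α; exact (hall α.degree).2 α (by omega)

end CoordAlg

/-! ### The dual product -/

section Dual

open PowerSeries Finset

/-- The extension of a linear mapping with values in formal series to formal series. -/
def extS {W V : Type*} [CommRing W] [Algebra ℂ W] [Ring V] [Algebra ℂ V]
    (Φ : W →ₗ[ℂ] PowerSeries V) : PowerSeries W →ₗ[ℂ] PowerSeries V where
  toFun f := PowerSeries.mk fun r => ∑ p ∈ HasAntidiagonal.antidiagonal r,
    coeff p.1 (Φ (coeff p.2 f))
  map_add' f g := by ext r; simp [Finset.sum_add_distrib]
  map_smul' c f := by ext r; simp [Finset.smul_sum]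

variable {W V : Type*} [CommRing W] [Algebra ℂ W] [Ring V] [Algebra ℂ V]

theorem coeff_extS (Φ : W →ₗ[ℂ] PowerSeries V) (f : PowerSeries W) (r : ℕ) :
    coeff r (extS Φ f) = ∑ p ∈ HasAntidiagonal.antidiagonal r, coeff p.1 (Φ (coeff p.2 f)) := by
  simp [extS]

theorem extS_C (Φ : W →ₗ[ℂ] PowerSeries V) (u : W) : extS Φ (C u) = Φ u := by
  ext r
  rw [coeff_extS, Finset.sum_eq_single (r, 0)]
  · simp
  · rintro ⟨a, b⟩ hp hne
    rw [HasAntidiagonal.mem_antidiagonal] at hp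
    rw [coeff_C, if_neg, map_zero, map_zero]
    rintro rfl
    exact hne (Prod.ext (by simpa using hp) rfl)
  · intro h
    exact absurd (HasAntidiagonal.mem_antidiagonal.2 (add_zero _)) h

theorem extS_X_mul (Φ : W →ₗ[ℂ] PowerSeries V) (f : PowerSeries W) :
    extS Φ (X * f) = X * extS Φ f := by
  ext r
  rcases r with _ | r
  · rw [coeff_extS]; simp
  · rw [coeff_succ_X_mul, coeff_extS, coeff_extS, Finset.Nat.antidiagonal_succ']
    simp [coeff_succ_X_mul]

/-- Additive mappings of formal series that commute with the multiplication by the formal parameter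
and agree on constants are equal. -/
theorem eq_of_eq_on_C {Φ Ψ : PowerSeries W →+ PowerSeries V} (h1 : ∀ f, Φ (X * f) = X * Φ f)
    (h2 : ∀ f, Ψ (X * f) = X * Ψ f) (h : ∀ u, Φ (C u) = Ψ (C u)) (f : PowerSeries W) :
    Φ f = Ψ f := by
  ext r
  induction r generalizing f with
  | zero =>
    have hf : f = C (coeff 0 f) + X * shift f := by
      ext m
      rcases m with _ | m
      · simp
      · rw [map_add, coeff_C, if_neg (Nat.succ_ne_zero _), coeff_succ_X_mul, coeff_shift, zero_add]
    rw [hf, map_add Φ, map_add Ψ, h1, h2, h, map_add, map_add]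
    simp
  | succ r ih =>
    have hf : f = C (coeff 0 f) + X * shift f := by
      ext m
      rcases m with _ | m
      · simp
      · rw [map_add, coeff_C, if_neg (Nat.succ_ne_zero _), coeff_succ_X_mul, coeff_shift, zero_add]
    rw [hf, map_add Φ, map_add Ψ, h1, h2, h, map_add, map_add, coeff_succ_X_mul, coeff_succ_X_mul,
      ih]

/-- The coefficients of a formal operator applied to a function. -/
def evalS (A : PowerSeries (Module.End ℂ W)) : W →ₗ[ℂ] PowerSeries W where
  toFun u := PowerSeries.mk fun r => coeff r A u
  map_add' u v := by ext; simp
  map_smul' c u := by ext; simp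

theorem coeff_evalS (A : PowerSeries (Module.End ℂ W)) (u : W) (r : ℕ) :
    coeff r (evalS A u) = coeff r A u := by simp [evalS]

/-- The action of formal operators on formal functions. -/
def act (A : PowerSeries (Module.End ℂ W)) : PowerSeries W →ₗ[ℂ] PowerSeries W := extS (evalS A)

theorem act_C (A : PowerSeries (Module.End ℂ W)) (u : W) : act A (C u) = evalS A u := extS_C _ _

theorem coeff_act (A : PowerSeries (Module.End ℂ W)) (f : PowerSeries W) (r : ℕ) :
    coeff r (act A f) = ∑ p ∈ HasAntidiagonal.antidiagonal r, coeff p.1 A (coeff p.2 f) := by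
  simp [act, coeff_extS, coeff_evalS]

theorem act_X_mul (A : PowerSeries (Module.End ℂ W)) (f : PowerSeries W) :
    act A (X * f) = X * act A f := extS_X_mul _ _

theorem act_mul (A B : PowerSeries (Module.End ℂ W)) (f : PowerSeries W) :
    act (A * B) f = act A (act B f) := by
  refine eq_of_eq_on_C (Φ := (act (A * B)).toAddMonoidHom)
    (Ψ := ((act A).comp (act B)).toAddMonoidHom) (act_X_mul _) (fun f => ?_) (fun u => ?_) f
  · change act A (act B (X * f)) = X * act A (act B f)
    rw [act_X_mul, act_X_mul]
  · change act (A * B) (C u) = act A (act B (C u))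
    ext r
    rw [act_C, act_C, coeff_evalS, coeff_act, coeff_mul, LinearMap.sum_apply]
    simp [coeff_evalS, Module.End.mul_apply]

/-- Operators of left multiplication. -/
def lser (c : ℕ → W →ₗ[ℂ] W →ₗ[ℂ] W) : W →ₗ[ℂ] PowerSeries (Module.End ℂ W) where
  toFun u := PowerSeries.mk fun r => c r u
  map_add' u v := by ext; simp
  map_smul' a u := by ext; simp

/-- Operators of right multiplication. -/
def rser (c : ℕ → W →ₗ[ℂ] W →ₗ[ℂ] W) : W →ₗ[ℂ] PowerSeries (Module.End ℂ W) :=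
  lser fun r => (c r).flip

theorem coeff_lser (c : ℕ → W →ₗ[ℂ] W →ₗ[ℂ] W) (u : W) (r : ℕ) : coeff r (lser c u) = c r u := by
  simp [lser]

theorem coeff_rser (c : ℕ → W →ₗ[ℂ] W →ₗ[ℂ] W) (u : W) (r : ℕ) :
    coeff r (rser c u) = (c r).flip u := by
  simp [rser, lser]

/-- Associativity of a formal product. -/
def IsAssoc (c : ℕ → W →ₗ[ℂ] W →ₗ[ℂ] W) : Prop := ∀ (r : ℕ) (u v w : W),
  ∑ p ∈ HasAntidiagonal.antidiagonal r, c p.1 (c p.2 u v) w =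
    ∑ p ∈ HasAntidiagonal.antidiagonal r, c p.1 u (c p.2 v w)

/-- This is `(u * v) * w = u * (v * w)` read as an identity of operators in the middle argument. -/
theorem IsAssoc.commute {c : ℕ → W →ₗ[ℂ] W →ₗ[ℂ] W} (hc : IsAssoc c) (u w : W) :
    Commute (lser c u) (rser c w) := by
  ext r v
  rw [coeff_mul, coeff_mul, LinearMap.sum_apply, LinearMap.sum_apply]
  simp only [Module.End.mul_apply, coeff_lser, coeff_rser, LinearMap.flip_apply]
  exact (hc r u v w).symm

theorem isAssoc_of_commute {c : ℕ → W →ₗ[ℂ] W →ₗ[ℂ] W}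
    (h : ∀ u w, Commute (lser c u) (rser c w)) : IsAssoc c := by
  intro r u v w
  have h1 := congrArg (fun f : PowerSeries (Module.End ℂ W) => coeff r f v) (h u w).eq
  simp only [coeff_mul, LinearMap.sum_apply, Module.End.mul_apply, coeff_lser, coeff_rser,
    LinearMap.flip_apply] at h1
  exact h1.symm

theorem IsAssoc.lser_mul {c : ℕ → W →ₗ[ℂ] W →ₗ[ℂ] W} (hc : IsAssoc c) (u v : W) (r : ℕ) :
    coeff r (lser c u * lser c v) =
      ∑ p ∈ HasAntidiagonal.antidiagonal r, coeff p.1 (lser c (c p.2 u v)) := by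
  ext w
  rw [coeff_mul, LinearMap.sum_apply, LinearMap.sum_apply]
  simp only [Module.End.mul_apply, coeff_lser]
  exact (hc r u v w).symm

theorem IsAssoc.rser_mul {c : ℕ → W →ₗ[ℂ] W →ₗ[ℂ] W} (hc : IsAssoc c) (u v : W) (r : ℕ) :
    coeff r (rser c u * rser c v) =
      ∑ p ∈ HasAntidiagonal.antidiagonal r, coeff p.1 (rser c (c p.2 v u)) := by
  ext w
  rw [coeff_mul, LinearMap.sum_apply, LinearMap.sum_apply]
  simp only [Module.End.mul_apply, coeff_rser, LinearMap.flip_apply]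
  exact hc r w v u

theorem extS_lser_commute {c : ℕ → W →ₗ[ℂ] W →ₗ[ℂ] W} (hc : IsAssoc c) (f g : PowerSeries W) :
    Commute (extS (lser c) f) (extS (rser c) g) := by
  have hXc : ∀ A : PowerSeries (Module.End ℂ W), A * X = X * A := fun A => (commute_X A).eq
  have h1 : ∀ (u : W) (g : PowerSeries W), Commute (lser c u) (extS (rser c) g) := by
    intro u g
    refine eq_of_eq_on_C
      (Φ := ((LinearMap.mulLeft ℂ (lser c u)).comp (extS (rser c))).toAddMonoidHom)
      (Ψ := ((LinearMap.mulRight ℂ (lser c u)).comp (extS (rser c))).toAddMonoidHom)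
      (fun f => ?_) (fun f => ?_) (fun w => ?_) g
    · change lser c u * extS (rser c) (X * f) = X * (lser c u * extS (rser c) f)
      rw [extS_X_mul, ← mul_assoc, hXc, mul_assoc]
    · change extS (rser c) (X * f) * lser c u = X * (extS (rser c) f * lser c u)
      rw [extS_X_mul, mul_assoc]
    · change lser c u * extS (rser c) (C w) = extS (rser c) (C w) * lser c u
      rw [extS_C]
      exact hc.commute u w
  refine eq_of_eq_on_C
    (Φ := ((LinearMap.mulRight ℂ (extS (rser c) g)).comp (extS (lser c))).toAddMonoidHom)
    (Ψ := ((LinearMap.mulLeft ℂ (extS (rser c) g)).comp (extS (lser c))).toAddMonoidHom)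
    (fun f => ?_) (fun f => ?_) (fun w => ?_) f
  · change extS (lser c) (X * f) * extS (rser c) g = X * (extS (lser c) f * extS (rser c) g)
    rw [extS_X_mul, mul_assoc]
  · change extS (rser c) g * extS (lser c) (X * f) = X * (extS (rser c) g * extS (lser c) f)
    rw [extS_X_mul, ← mul_assoc, hXc, mul_assoc]
  · change extS (lser c) (C w) * extS (rser c) g = extS (rser c) g * extS (lser c) (C w)
    rw [extS_C]
    exact h1 w g

theorem act_X_mul_left (A : PowerSeries (Module.End ℂ W)) (f : PowerSeries W) :
    act (X * A) f = X * act A f := by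
  refine eq_of_eq_on_C (Φ := (act (X * A)).toAddMonoidHom)
    (Ψ := ((LinearMap.mulLeft ℂ (X : PowerSeries W)).comp (act A)).toAddMonoidHom) (act_X_mul _)
    (fun f => ?_) (fun u => ?_) f
  · change X * act A (X * f) = X * (X * act A f)
    rw [act_X_mul]
  · change act (X * A) (C u) = X * act A (C u)
    ext r
    rw [act_C, act_C, coeff_evalS]
    rcases r with _ | r
    · simp
    · rw [coeff_succ_X_mul, coeff_succ_X_mul, coeff_evalS]

theorem act_add_left (A B : PowerSeries (Module.End ℂ W)) (f : PowerSeries W) :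
    act (A + B) f = act A f + act B f := by
  ext r; simp [coeff_act, Finset.sum_add_distrib]

/-- Both sides are the product of `f` and `g` extended linearly in `ν`, so it suffices to compare
them on constants. -/
theorem act_extS_flip (c : ℕ → W →ₗ[ℂ] W →ₗ[ℂ] W) (f g : PowerSeries W) :
    act (extS (lser c) f) g = act (extS (rser c) g) f := by
  have h0 : ∀ g : PowerSeries W, act (0 : PowerSeries (Module.End ℂ W)) g = 0 := fun g => by
    ext r; simp [coeff_act]
  have h1 : ∀ (u : W) (g : PowerSeries W), act (lser c u) g = act (extS (rser c) g) (C u) := by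
    intro u g
    refine eq_of_eq_on_C (Φ := (act (lser c u)).toAddMonoidHom)
      (Ψ := { toFun := fun g => act (extS (rser c) g) (C u)
              map_zero' := by rw [map_zero, h0]
              map_add' := fun A B => by rw [map_add, act_add_left] })
      (act_X_mul _) (fun f => ?_) (fun w => ?_) g
    · change act (extS (rser c) (X * f)) (C u) = X * act (extS (rser c) f) (C u)
      rw [extS_X_mul, act_X_mul_left]
    · change act (lser c u) (C w) = act (extS (rser c) (C w)) (C u)
      rw [extS_C, act_C, act_C]
      ext r
      rw [coeff_evalS, coeff_evalS, coeff_lser, coeff_rser, LinearMap.flip_apply]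
  refine eq_of_eq_on_C
    (Φ := { toFun := fun f => act (extS (lser c) f) g
            map_zero' := by rw [map_zero, h0]
            map_add' := fun A B => by rw [map_add, act_add_left] })
    (Ψ := (act (extS (rser c) g)).toAddMonoidHom)
    (fun f => ?_) (act_X_mul _) (fun w => ?_) f
  · change act (extS (lser c) (X * f)) g = X * act (extS (lser c) f) g
    rw [extS_X_mul, act_X_mul_left]
  · change act (extS (lser c) (C w)) g = act (extS (rser c) g) (C w)
    rw [extS_C, h1]

theorem coeff_negNu_of_even {r : ℕ} (hr : Even r) (A : PowerSeries V) :
    coeff r (negNu A) = coeff r A := by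
  rw [coeff_negNu, hr.neg_one_pow, one_mul]

theorem coeff_negNu_of_odd {r : ℕ} (hr : Odd r) (A : PowerSeries V) :
    coeff r (negNu A) = -coeff r A := by
  rw [coeff_negNu, hr.neg_one_pow, neg_one_mul]

/-- The conjugation `A ↦ (e^{-P} A e^P)(-ν)`. -/
def conjS (P : PowerSeries V) : PowerSeries V →ₗ[ℂ] PowerSeries V where
  toFun A := negNu (pexp (-P) * A * pexp P)
  map_add' A B := by rw [mul_add, add_mul, map_add]
  map_smul' a A := by
    ext r
    simp only [mul_smul_comm, smul_mul_assoc, coeff_negNu, PowerSeries.coeff_smul, RingHom.id_apply]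

theorem conjS_apply (P A : PowerSeries V) : conjS P A = negNu (pexp (-P) * A * pexp P) := rfl

theorem conjS_mul {P : PowerSeries V} (hP : coeff 0 P = 0) (A B : PowerSeries V) :
    conjS P (A * B) = conjS P A * conjS P B := by
  have h := pexp_mul_pexp_neg hP
  rw [conjS_apply, conjS_apply, conjS_apply, ← map_mul]
  congr 1
  have : pexp P * (pexp (-P) * (B * pexp P)) = B * pexp P := by rw [← mul_assoc, h, one_mul]
  simp only [mul_assoc, this]

variable (c : ℕ → W →ₗ[ℂ] W →ₗ[ℂ] W) (P : PowerSeries (Module.End ℂ W))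

/-- The operators of left multiplication of the dual product. -/
def dualL : W →ₗ[ℂ] PowerSeries (Module.End ℂ W) :=
  (conjS P).comp ((extS (rser c)).comp (evalS (pexp P)))

/-- The operators of right multiplication of the dual product. -/
def dualR : W →ₗ[ℂ] PowerSeries (Module.End ℂ W) :=
  (conjS P).comp ((extS (lser c)).comp (evalS (pexp P)))

theorem dualL_apply (u : W) :
    dualL c P u = negNu (pexp (-P) * extS (rser c) (evalS (pexp P) u) * pexp P) := rfl

theorem dualR_apply (u : W) :
    dualR c P u = negNu (pexp (-P) * extS (lser c) (evalS (pexp P) u) * pexp P) := rfl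

/-- Both sides are `e^{-P}(e^P v * e^P u)` with the sign of `ν` reversed, so the two families of
operators come from a single product. -/
theorem coeff_dualL_apply (u v : W) (r : ℕ) :
    coeff r (dualL c P u) v = coeff r (dualR c P v) u := by
  have h : ∀ A : PowerSeries (Module.End ℂ W), ∀ w, coeff r (negNu A) w =
      (-1) ^ r * coeff r (act A (C w)) := by
    intro A w
    rw [act_C, coeff_evalS]
    rcases Nat.even_or_odd r with he | he
    · rw [coeff_negNu_of_even he, he.neg_one_pow, one_mul]
    · rw [coeff_negNu_of_odd he, he.neg_one_pow, neg_one_mul, LinearMap.neg_apply]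
  rw [dualL_apply, dualR_apply, h, h, act_mul, act_mul, act_mul, act_mul, act_C, act_C,
    act_extS_flip]

/-- The dual product. -/
def dualC (r : ℕ) : W →ₗ[ℂ] W →ₗ[ℂ] W := (PowerSeries.coeff r).restrictScalars ℂ ∘ₗ dualL c P

theorem lser_dualC (u : W) : lser (dualC c P) u = dualL c P u := by
  ext r v
  rw [coeff_lser]
  rfl

theorem rser_dualC (u : W) : rser (dualC c P) u = dualR c P u := by
  ext r v
  rw [coeff_rser, LinearMap.flip_apply, ← coeff_dualL_apply]
  rfl

variable {c P}

/-- Conjugation is multiplicative, so it preserves the commutation of left with right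
multiplications. The two sides exchange roles, and this commutation is equivalent to associativity.
-/
theorem isAssoc_dualC (hP : coeff 0 P = 0) (hc : IsAssoc c) : IsAssoc (dualC c P) := by
  refine isAssoc_of_commute fun u w => ?_
  rw [lser_dualC, rser_dualC]
  have h := (extS_lser_commute hc (evalS (pexp P) w) (evalS (pexp P) u)).eq
  have h1 := congrArg (conjS P) h
  rw [conjS_mul hP, conjS_mul hP] at h1
  exact h1.symm

end Dual

end BerezinLog
end
noncomputable section
set_option linter.unusedSectionVars false
namespace BerezinLog

/-! ### Wirtinger derivatives as commuting derivations -/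

section Wirtinger

variable {n : ℕ} {U : TopologicalSpace.Opens (Fin n → ℂ)}

/-- The index of a coordinate. -/
def idx (s : Idx n) : Fin n := Sum.elim id id s

/-- The sign in the definition of the Wirtinger derivative, times `i`. -/
def wsgn (s : Idx n) : ℂ := Sum.elim (fun _ => -Complex.I) (fun _ => Complex.I) s

theorem wirtinger_eq (s : Idx n) (F : (Fin n → ℂ) → ℂ) (z : Fin n → ℂ) :
    wirtinger s F z = (1 / 2 : ℂ) * (fderiv ℝ F z (Pi.single (idx s) 1) +
      wsgn s * fderiv ℝ F z (Pi.single (idx s) Complex.I)) := by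
  rcases s with k | l
  · simp [wirtinger, idx, wsgn, sub_eq_add_neg]
  · simp [wirtinger, idx, wsgn]

theorem zeroExt_mul (f g : U → ℂ) : zeroExt (f * g) = zeroExt f * zeroExt g := by
  funext w
  by_cases hw : w ∈ U
  · simpa [zeroExt_apply f ⟨w, hw⟩, zeroExt_apply g ⟨w, hw⟩] using zeroExt_apply (f * g) ⟨w, hw⟩
  · simp [zeroExt_of_notMem _ hw]

theorem pd_apply (s : Idx n) (f : LocSmooth U) (z : U) :
    (pd s f).1 z = wirtinger s (zeroExt f.1) z := rfl

theorem pd_mul (s : Idx n) (f g : LocSmooth U) : pd s (f * g) = f * pd s g + g * pd s f := by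
  ext z
  have h : zeroExt (f * g).1 = zeroExt f.1 * zeroExt g.1 := zeroExt_mul f.1 g.1
  have hf := differentiableAt_zeroExt f z
  have hg := differentiableAt_zeroExt g z
  change wirtinger s (zeroExt (f * g).1) z
    = f.1 z * wirtinger s (zeroExt g.1) z + g.1 z * wirtinger s (zeroExt f.1) z
  rw [h, wirtinger_eq, wirtinger_eq, wirtinger_eq, fderiv_mul hf hg]
  simp only [add_apply, smul_apply, smul_eq_mul, zeroExt_apply]
  ring

theorem zeroExt_eventuallyEq {f : U → ℂ} {F : (Fin n → ℂ) → ℂ} {z : U}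
    (h : ∀ᶠ w : U in 𝓝 z, f w = F w) : zeroExt f =ᶠ[𝓝 (z : Fin n → ℂ)] F := by
  have h1 : ∀ᶠ w in 𝓝 (z : Fin n → ℂ), ∀ hw : w ∈ U, f ⟨w, hw⟩ = F w := by
    rw [← map_nhds_subtype_coe_eq_nhds z.2 (U.isOpen.mem_nhds z.2), Filter.eventually_map]
    exact h.mono fun w hw _ => hw
  filter_upwards [h1, U.isOpen.mem_nhds z.2] with w hw hwU
  rw [zeroExt_apply f ⟨w, hwU⟩, hw hwU]

theorem wirtinger_congr {F G : (Fin n → ℂ) → ℂ} {z : Fin n → ℂ} (h : F =ᶠ[𝓝 z] G) (s : Idx n) :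
    wirtinger s F z = wirtinger s G z := by
  rw [wirtinger_eq, wirtinger_eq, h.fderiv_eq]

theorem pd_apply_of_eventuallyEq (s : Idx n) {f : LocSmooth U} {F : (Fin n → ℂ) → ℂ} {z : U}
    (h : ∀ᶠ w : U in 𝓝 z, f.1 w = F w) : (pd s f).1 z = wirtinger s F z := by
  rw [pd_apply, wirtinger_congr (zeroExt_eventuallyEq h)]

theorem wirtinger_wirtinger {F : (Fin n → ℂ) → ℂ} {z : Fin n → ℂ} (hF : ContDiffAt ℝ ∞ F z)
    (s t : Idx n) : wirtinger s (wirtinger t F) z = wirtinger t (wirtinger s F) z := by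
  have hd : DifferentiableAt ℝ (fderiv ℝ F) z :=
    (hF.fderiv_right (m := 1) (by norm_cast)).differentiableAt (by simp)
  have h1 : ∀ v, HasFDerivAt (fun w => fderiv ℝ F w v) ((fderiv ℝ (fderiv ℝ F) z).flip v) z := by
    intro v
    simpa using hd.hasFDerivAt.clm_apply (hasFDerivAt_const v z)
  have h2 : ∀ t : Idx n, HasFDerivAt (wirtinger t F) ((1 / 2 : ℂ) •
      ((fderiv ℝ (fderiv ℝ F) z).flip (Pi.single (idx t) 1) +
        wsgn t • (fderiv ℝ (fderiv ℝ F) z).flip (Pi.single (idx t) Complex.I))) z := by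
    intro t
    have h3 := ((h1 (Pi.single (idx t) 1)).add
      ((h1 (Pi.single (idx t) Complex.I)).const_smul (wsgn t))).const_smul (1 / 2 : ℂ)
    refine h3.congr_of_eventuallyEq (Filter.Eventually.of_forall fun w => ?_)
    simp [wirtinger_eq]
  have hs : ∀ u v, fderiv ℝ (fderiv ℝ F) z u v = fderiv ℝ (fderiv ℝ F) z v u := fun u v =>
    (hF.isSymmSndFDerivAt (by simpa using WithTop.coe_le_coe.2 (le_top : (2 : ℕ∞) ≤ ⊤))).eq u v
  rw [wirtinger_eq s, wirtinger_eq t, (h2 t).fderiv, (h2 s).fderiv]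
  simp only [smul_apply, add_apply, ContinuousLinearMap.flip_apply, smul_eq_mul]
  rw [hs (Pi.single (idx s) 1) (Pi.single (idx t) 1),
    hs (Pi.single (idx s) 1) (Pi.single (idx t) Complex.I),
    hs (Pi.single (idx s) Complex.I) (Pi.single (idx t) 1),
    hs (Pi.single (idx s) Complex.I) (Pi.single (idx t) Complex.I)]
  ring

theorem pd_comm (s t : Idx n) (f : LocSmooth U) : pd s (pd t f) = pd t (pd s f) := by
  ext z
  have h : ∀ s t : Idx n, (pd s (pd t f)).1 z = wirtinger s (wirtinger t (zeroExt f.1)) z :=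
    fun s t => pd_apply_of_eventuallyEq s (Filter.Eventually.of_forall fun w => rfl)
  rw [h, h, wirtinger_wirtinger (f.2.contDiffAt (U.isOpen.mem_nhds z.2))]

/-- The coordinates `z^k`, `z̄^l` as real linear functions. -/
def coordCLM (s : Idx n) : (Fin n → ℂ) →L[ℝ] ℂ :=
  Sum.elim (fun k => ContinuousLinearMap.proj k)
    (fun l => (Complex.conjCLE : ℂ →L[ℝ] ℂ).comp (ContinuousLinearMap.proj l)) s

variable (U) in
/-- The coordinate functions on `U`. -/
def coordFn (s : Idx n) : LocSmooth U :=
  ⟨fun z => coordCLM s z, contDiffOn_zeroExt (coordCLM s).contDiff.contDiffOn fun _ => rfl⟩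

theorem pd_coordFn (s t : Idx n) : pd s (coordFn U t) = if s = t then 1 else 0 := by
  ext z
  rw [pd_apply_of_eventuallyEq s (F := coordCLM t) (Filter.Eventually.of_forall fun w => rfl),
    wirtinger_eq, ContinuousLinearMap.fderiv]
  rcases s with k | k <;> rcases t with l | l <;> rcases eq_or_ne k l with rfl | h <;>
    simp [coordCLM, wsgn, idx, *] <;> norm_num

variable (U) in
/-- Smooth functions on `U` with the Wirtinger derivatives. -/
def locAlg : CoordAlg n (LocSmooth U) where
  d s := Derivation.mk' (pd s) fun f g => pd_mul s f g
  comm s t f := pd_comm s t f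
  x := coordFn U
  d_x := pd_coordFn

theorem cotBracketEps_eq (P Q : Eps (LocFormal U)) : cotBracketEps P Q = (locAlg U).pbEps P Q := rfl

theorem expHam_eq (P Q : Eps (LocFormal U)) : expHam P Q = (locAlg U).expHam P Q := rfl

end Wirtinger

/-! ### Descending operators along a surjective mapping -/

section Push

variable {A B : Type*} [CommRing A] [Algebra ℂ A] [CommRing B] [Algebra ℂ B]

/-- The operator on the image induced by an operator preserving the kernel. -/
def pushEnd (π : A →ₐ[ℂ] B) (hπ : Function.Surjective π) (D : Module.End ℂ A)
    (h : ∀ a, π a = 0 → π (D a) = 0) : Module.End ℂ B  where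
  toFun b := π (D (Function.surjInv hπ b))
  map_add' a b := by
    have e := Function.surjInv_eq hπ
    rw [← map_add, ← map_add, ← sub_eq_zero, ← map_sub, ← map_sub]
    exact h _ (by rw [map_sub, map_add, e, e, e, sub_self])
  map_smul' c a := by
    have e := Function.surjInv_eq hπ
    rw [RingHom.id_apply, ← map_smul, ← map_smul, ← sub_eq_zero, ← map_sub, ← map_sub]
    exact h _ (by rw [map_sub, map_smul, e, e, sub_self])

theorem pushEnd_apply {π : A →ₐ[ℂ] B} (hπ : Function.Surjective π) {D : Module.End ℂ A}
    (h : ∀ a, π a = 0 → π (D a) = 0) (a : A) : pushEnd π hπ D h (π a) = π (D a) := by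
  have e := Function.surjInv_eq hπ
  change π (D (Function.surjInv hπ (π a))) = π (D a)
  rw [← sub_eq_zero, ← map_sub, ← map_sub]
  exact h _ (by rw [map_sub, e, sub_self])

end Push

/-! ### Morphisms of algebras with coordinates -/

namespace CoordAlg

open MvPowerSeries

variable {n : ℕ} {R R' : Type*} [CommRing R] [Algebra ℂ R] [CommRing R'] [Algebra ℂ R']

/-- A homomorphism that intertwines derivations and preserves coordinates. -/
structure IsMor (𝔠 : CoordAlg n R) (𝔠' : CoordAlg n R') (π : R →ₐ[ℂ] R') : Prop where
  d : ∀ s f, π (𝔠.d s f) = 𝔠'.d s (π f)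
  x : ∀ s, π (𝔠.x s) = 𝔠'.x s

/-- The induced mapping of formal series. -/
def mapF (π : R →ₐ[ℂ] R') : MvPowerSeries (Idx n) R →+* MvPowerSeries (Idx n) R' :=
  MvPowerSeries.map (π : R →+* R')

theorem coeff_mapF (π : R →ₐ[ℂ] R') (α : Idx n →₀ ℕ) (P : MvPowerSeries (Idx n) R) :
    coeff α (mapF π P) = π (coeff α P) := rfl

theorem mapF_C (π : R →ₐ[ℂ] R') (f : R) : mapF (n := n) π (C f) = C (π f) := MvPowerSeries.map_C _ _

/-- The induced mapping of pairs of formal series. -/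
def mapEps (π : R →ₐ[ℂ] R') (P : Eps (MvPowerSeries (Idx n) R)) : Eps (MvPowerSeries (Idx n) R') :=
  (mapF π P.1, mapF π P.2)

theorem pderiv_mapF (π : R →ₐ[ℂ] R') (s : Idx n) (P : MvPowerSeries (Idx n) R) :
    pderiv R' s (mapF π P) = mapF π (pderiv R s P) := by
  ext α
  simp [coeff_pderiv, coeff_mapF]

theorem mapEps_epsMul (π : R →ₐ[ℂ] R') (P Q : Eps (MvPowerSeries (Idx n) R)) :
    mapEps π (epsMul P Q) = epsMul (mapEps π P) (mapEps π Q) := by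
  simp [mapEps, epsMul]

variable {𝔠 : CoordAlg n R} {𝔠' : CoordAlg n R'} {π : R →ₐ[ℂ] R'}

theorem IsMor.mapCoeff (h : IsMor 𝔠 𝔠' π) (s : Idx n) (P : MvPowerSeries (Idx n) R) :
    CoordAlg.mapCoeff (𝔠'.dOp s) (mapF π P) = mapF π (CoordAlg.mapCoeff (𝔠.dOp s) P) := by
  ext α
  exact (h.d s _).symm

theorem IsMor.pb (h : IsMor 𝔠 𝔠' π) (P Q : MvPowerSeries (Idx n) R) :
    mapF π (𝔠.pb P Q) = 𝔠'.pb (mapF π P) (mapF π Q) := by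
  simp only [CoordAlg.pb, map_sum, map_sub, map_mul, pderiv_mapF, h.mapCoeff]

theorem IsMor.pbEps (h : IsMor 𝔠 𝔠' π) (P Q : Eps (MvPowerSeries (Idx n) R)) :
    mapEps π (𝔠.pbEps P Q) = 𝔠'.pbEps (mapEps π P) (mapEps π Q) := by
  simp only [mapEps, CoordAlg.pbEps, map_add, h.pb]

theorem IsMor.iterate (h : IsMor 𝔠 𝔠' π) (F Q : Eps (MvPowerSeries (Idx n) R)) (j : ℕ) :
    mapEps π ((𝔠.pbEps F)^[j] Q) = (𝔠'.pbEps (mapEps π F))^[j] (mapEps π Q) := by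
  induction j with
  | zero => rfl
  | succ j ih => rw [Function.iterate_succ_apply', Function.iterate_succ_apply', h.pbEps, ih]

theorem IsMor.expHam (h : IsMor 𝔠 𝔠' π) (F Q : Eps (MvPowerSeries (Idx n) R)) :
    mapEps π (𝔠.expHam F Q) = 𝔠'.expHam (mapEps π F) (mapEps π Q) := by
  refine Prod.ext ?_ ?_
  · ext α
    change π (∑ j ∈ Finset.range (α.degree + 1),
      ((j.factorial : ℂ)⁻¹) • coeff α ((𝔠.pbEps F)^[j] Q).1) = ∑ j ∈ Finset.range (α.degree + 1),
      ((j.factorial : ℂ)⁻¹) • coeff α ((𝔠'.pbEps (mapEps π F))^[j] (mapEps π Q)).1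
    rw [map_sum]
    refine Finset.sum_congr rfl fun j _ => ?_
    rw [map_smul, ← h.iterate]
    rfl
  · ext α
    change π (∑ j ∈ Finset.range (α.degree + 1),
      ((j.factorial : ℂ)⁻¹) • coeff α ((𝔠.pbEps F)^[j] Q).2) = ∑ j ∈ Finset.range (α.degree + 1),
      ((j.factorial : ℂ)⁻¹) • coeff α ((𝔠'.pbEps (mapEps π F))^[j] (mapEps π Q)).2
    rw [map_sum]
    refine Finset.sum_congr rfl fun j _ => ?_
    rw [map_smul, ← h.iterate]
    rfl

theorem IsMor.dWord (h : IsMor 𝔠 𝔠' π) (w : List (Idx n)) (f : R) :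
    π (𝔠.dWord w f) = 𝔠'.dWord w (π f) := by
  induction w with
  | nil => rfl
  | cons s w ih =>
    rw [dWord_cons, dWord_cons, Module.End.mul_apply, Module.End.mul_apply, ← ih]
    exact h.d s _

end CoordAlg

/-! ### Germs of smooth functions -/

section Germ

variable {n : ℕ} {U : TopologicalSpace.Opens (Fin n → ℂ)}

/-- The ideal of functions that vanish near `z`. -/
def germIdeal (z : U) : Ideal (LocSmooth U) where
  carrier := {f | ∀ᶠ w : U in 𝓝 z, f.1 w = 0}
  add_mem' := fun {f g} hf hg => by
    filter_upwards [hf, hg] with w h1 h2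
    change f.1 w + g.1 w = 0
    rw [h1, h2, add_zero]
  zero_mem' := Filter.Eventually.of_forall fun _ => rfl
  smul_mem' := fun c f hf => by
    filter_upwards [hf] with w h1
    change c.1 w * f.1 w = 0
    rw [h1, mul_zero]

/-- Germs at `z` of smooth functions. -/
def Germ (z : U) : Type := LocSmooth U ⧸ germIdeal z

instance (z : U) : CommRing (Germ z) := inferInstanceAs (CommRing (LocSmooth U ⧸ germIdeal z))

instance (z : U) : Algebra ℂ (Germ z) := inferInstanceAs (Algebra ℂ (LocSmooth U ⧸ germIdeal z))

/-- The germ of a function. -/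
def germ (z : U) : LocSmooth U →ₐ[ℂ] Germ z := Ideal.Quotient.mkₐ ℂ (germIdeal z)

theorem germ_surjective (z : U) : Function.Surjective (germ z) := Ideal.Quotient.mkₐ_surjective ℂ _

theorem germ_eq_zero_iff {z : U} {f : LocSmooth U} : germ z f = 0 ↔ ∀ᶠ w : U in 𝓝 z, f.1 w = 0 :=
  Ideal.Quotient.eq_zero_iff_mem

theorem germ_eq_iff {z : U} {f g : LocSmooth U} :
    germ z f = germ z g ↔ ∀ᶠ w : U in 𝓝 z, f.1 w = g.1 w := by
  rw [← sub_eq_zero, ← map_sub, germ_eq_zero_iff]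
  refine Filter.eventually_congr (Filter.Eventually.of_forall fun w => ?_)
  change f.1 w - g.1 w = 0 ↔ _
  rw [sub_eq_zero]

theorem eq_at_of_germ_eq {z : U} {f g : LocSmooth U} (h : germ z f = germ z g) : f.1 z = g.1 z :=
  (germ_eq_iff.1 h).self_of_nhds

theorem eq_of_germ_eq {f g : LocSmooth U} (h : ∀ z, germ z f = germ z g) : f = g := by
  ext z
  exact eq_at_of_germ_eq (h z)

theorem germ_pd {z : U} (s : Idx n) {f : LocSmooth U} (h : germ z f = 0) : germ z (pd s f) = 0 := by
  rw [germ_eq_zero_iff] at h ⊢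
  filter_upwards [h.eventually_nhds] with w hw
  rw [pd_apply_of_eventuallyEq s (F := fun _ => 0) hw, wirtinger_eq]
  simp

/-- The Wirtinger derivatives of germs. -/
def germD (z : U) (s : Idx n) : Module.End ℂ (Germ z) :=
  pushEnd (germ z) (germ_surjective z) (pd s) fun _ => germ_pd s

theorem germD_germ (z : U) (s : Idx n) (f : LocSmooth U) : germD z s (germ z f) = germ z (pd s f) :=
  pushEnd_apply _ _ _

/-- Germs with the Wirtinger derivatives. -/
def germAlg (z : U) : CoordAlg n (Germ z) where
  d s := Derivation.mk' (germD z s) fun f g => by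
    obtain ⟨f, rfl⟩ := germ_surjective z f
    obtain ⟨g, rfl⟩ := germ_surjective z g
    rw [← map_mul, germD_germ, germD_germ, germD_germ, pd_mul, map_add, map_mul, map_mul]
    rfl
  comm s t f := by
    obtain ⟨f, rfl⟩ := germ_surjective z f
    change germD z s (germD z t (germ z f)) = germD z t (germD z s (germ z f))
    rw [germD_germ, germD_germ, germD_germ, germD_germ, pd_comm]
  x s := germ z (coordFn U s)
  d_x s t := by
    change germD z s (germ z (coordFn U t)) = _
    rw [germD_germ, pd_coordFn]
    split_ifs
    · exact map_one _
    · exact map_zero _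

theorem germAlg_d (z : U) (s : Idx n) (f : LocSmooth U) :
    (germAlg z).d s (germ z f) = germ z (pd s f) := germD_germ z s f

theorem isMor_germ (z : U) : CoordAlg.IsMor (locAlg U) (germAlg z) (germ z) :=
  ⟨fun s f => (germD_germ z s f).symm, fun _ => rfl⟩

theorem germ_pdWord (z : U) (w : List (Idx n)) (f : LocSmooth U) :
    germ z (pdWord w f) = (germAlg z).dWord w (germ z f) := (isMor_germ z).dWord w f

/-- The value of a germ. -/
def germEval (z : U) : Germ z →ₐ[ℂ] ℂ :=
  Ideal.Quotient.liftₐ (germIdeal z) ((Pi.evalAlgHom ℂ (fun _ : U => ℂ) z).comp (LocSmooth U).val)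
    fun f ha => Filter.Eventually.self_of_nhds (p := fun w => f.1 w = 0) ha

theorem germEval_germ (z : U) (f : LocSmooth U) : germEval z (germ z f) = f.1 z := rfl

end Germ

end BerezinLog
end
noncomputable section
set_option linter.unusedSectionVars false
namespace BerezinLog

/-! ### Germs of smooth functions on the manifold and local holomorphic coordinates -/

section Geometry

variable {n : ℕ} {M : Type*} [TopologicalSpace M] [ChartedSpace (Fin n → ℂ) M]

theorem map_pt_nhds (φ : Chart n M) (z : dom φ) : Filter.map (pt φ) (𝓝 z) = 𝓝 (pt φ z) := by
  have h1 : Filter.map (Subtype.val : dom φ → Fin n → ℂ) (𝓝 z) = 𝓝 (z : Fin n → ℂ) :=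
    map_nhds_subtype_coe_eq_nhds z.2 ((dom φ).isOpen.mem_nhds z.2)
  have h2 : Filter.map φ.1.symm (𝓝 (z : Fin n → ℂ)) = 𝓝 (φ.1.symm z) :=
    φ.1.symm.map_nhds_eq z.2
  rw [← h1, Filter.map_map] at h2
  exact h2

theorem eventually_pt {φ : Chart n M} {z : dom φ} {p : M → Prop} :
    (∀ᶠ w in 𝓝 z, p (pt φ w)) ↔ ∀ᶠ x in 𝓝 (pt φ z), p x := by
  rw [← map_pt_nhds, Filter.eventually_map]

theorem pt_mem_source (φ : Chart n M) (z : dom φ) : pt φ z ∈ φ.1.source := φ.1.map_target z.2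

theorem chart_pt (φ : Chart n M) (z : dom φ) : φ.1 (pt φ z) = z := φ.1.right_inv z.2

theorem pt_coord (φ : Chart n M) (x : M) (hx : x ∈ φ.1.source) : pt φ (coord φ x hx) = x :=
  φ.1.left_inv hx

variable [IsManifold 𝓘(ℂ, Fin n → ℂ) ω M]

variable (n M) in
/-- The algebra of smooth functions on `M`, as a type of its own. -/
def Fn : Type _ := Smooth n M

instance : CommRing (Fn n M) := inferInstanceAs (CommRing (Smooth n M))

instance : Algebra ℂ (Fn n M) := inferInstanceAs (Algebra ℂ (Smooth n M))

/-- The identification of both descriptions of smooth functions. -/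
def Fn.of : Smooth n M ≃ₐ[ℂ] Fn n M := (AlgEquiv.refl : Smooth n M ≃ₐ[ℂ] Smooth n M)

/-- The underlying function. -/
def Fn.fn (f : Fn n M) : M → ℂ := (Fn.of.symm f).1

theorem Fn.fn_of (f : Smooth n M) : Fn.fn (Fn.of f) = f.1 := rfl

theorem Fn.fn_mul (f g : Fn n M) : Fn.fn (f * g) = Fn.fn f * Fn.fn g := rfl

theorem Fn.fn_one : Fn.fn (1 : Fn n M) = 1 := rfl

theorem Fn.ext {f g : Fn n M} (h : ∀ x, Fn.fn f x = Fn.fn g x) : f = g := by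
  have h1 : Fn.of.symm f = Fn.of.symm g := Subtype.ext (funext h)
  exact Fn.of.symm.injective h1

/-- The local representative of a smooth function. -/
def locF (φ : Chart n M) : Fn n M →ₐ[ℂ] LocSmooth (dom φ) :=
  (loc φ).comp (Fn.of (n := n) (M := M)).symm.toAlgHom

theorem locF_of (φ : Chart n M) (f : Smooth n M) : locF φ (Fn.of f) = loc φ f := rfl

theorem locF_apply (φ : Chart n M) (f : Fn n M) (z : dom φ) :
    (locF φ f).1 z = Fn.fn f (pt φ z) := rfl

/-- The germ of a smooth function on `M`, in a chart. -/
def gm (φ : Chart n M) (z : dom φ) : Fn n M →ₐ[ℂ] Germ z := (germ z).comp (locF φ)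

theorem gm_apply (φ : Chart n M) (z : dom φ) (f : Fn n M) : gm φ z f = germ z (locF φ f) := rfl

theorem gm_eq_iff {φ : Chart n M} {z : dom φ} {f g : Fn n M} :
    gm φ z f = gm φ z g ↔ ∀ᶠ x in 𝓝 (pt φ z), Fn.fn f x = Fn.fn g x := by
  rw [gm_apply, gm_apply, germ_eq_iff, ← eventually_pt]
  rfl

theorem gm_eq_zero_iff {φ : Chart n M} {z : dom φ} {f : Fn n M} :
    gm φ z f = 0 ↔ ∀ᶠ x in 𝓝 (pt φ z), Fn.fn f x = 0 := by
  rw [← map_zero (gm φ z), gm_eq_iff]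
  rfl

theorem germEval_gm (φ : Chart n M) (z : dom φ) (f : Fn n M) :
    germEval z (gm φ z f) = Fn.fn f (pt φ z) := rfl

theorem fn_ext_of_loc {f g : Fn n M} (h : ∀ φ, locF φ f = locF φ g) : f = g := by
  refine Fn.ext fun x => ?_
  have e : pt (n := n) (chartOf x) (coord (chartOf x) x (mem_chart_source _ x)) = x :=
    pt_coord (chartOf x) x (mem_chart_source _ x)
  have h1 := congrArg (fun u : LocSmooth (dom (chartOf x)) => u.1 (coord (chartOf x) x
    (mem_chart_source _ x))) (h (chartOf x))
  simp only [locF_apply, e] at h1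
  exact h1

theorem fn_ext_of_gm {f g : Fn n M} (h : ∀ φ z, gm φ z f = gm φ z g) : f = g :=
  fn_ext_of_loc fun φ => eq_of_germ_eq (h φ)

/-- Every germ of a smooth function is the germ of a smooth function on `M`. -/
theorem exists_gm_eq [T2Space M] (φ : Chart n M) (z : dom φ) (f : LocSmooth (dom φ)) :
    ∃ F : Fn n M, gm φ z F = germ z f := by
  have : IsManifold 𝓘(ℝ, Fin n → ℂ) ∞ M := isManifold_real
  -- A bump function equal to one near the point, with closed support inside the chart domain,
  -- allows extension by zero to all of `M`.
  obtain ⟨b, -, hb⟩ := (SmoothBumpFunction.nhds_basis_tsupport (I := 𝓘(ℝ, Fin n → ℂ))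
    (pt φ z)).mem_iff.1 (φ.1.open_source.mem_nhds (pt_mem_source φ z))
  refine ⟨Fn.of ⟨fun y => b y • zeroExt f.1 (φ.1 y), ?_⟩, ?_⟩
  · refine contMDiff_of_tsupport fun y hy => ?_
    have hy1 : y ∈ φ.1.source := hb (tsupport_smul_subset_left b _ hy)
    have h1 : ContMDiffOn 𝓘(ℝ, Fin n → ℂ) 𝓘(ℝ, Fin n → ℂ) ∞ φ.1 φ.1.source :=
      contMDiffOn_of_mem_maximalAtlas (IsManifold.subset_maximalAtlas φ.2)
    have h2 : ContMDiffOn 𝓘(ℝ, Fin n → ℂ) 𝓘(ℝ, ℂ) ∞ (zeroExt f.1) φ.1.target :=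
      contMDiffOn_iff_contDiffOn.2 f.2
    have h3 := (h2.comp h1 fun y hy => φ.1.map_source hy).contMDiffAt
      (φ.1.open_source.mem_nhds hy1)
    exact ContMDiffAt.smul b.contMDiffAt h3
  · rw [gm_apply, germ_eq_iff]
    have h1 : ∀ᶠ w in 𝓝 z, b (pt φ w) = 1 := eventually_pt.2 b.eventuallyEq_one
    filter_upwards [h1] with w hw
    change b (pt φ w) • zeroExt f.1 (φ.1 (pt φ w)) = f.1 w
    rw [hw, one_smul, chart_pt, zeroExt_apply]

theorem gm_surjective [T2Space M] (φ : Chart n M) (z : dom φ) : Function.Surjective (gm φ z) :=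
  fun q => by
    obtain ⟨f, rfl⟩ := germ_surjective z q
    exact exists_gm_eq φ z f

/-! ### Holomorphic and antiholomorphic functions -/

theorem differentiableAt_of_holOn {φ : Chart n M} {z : dom φ} {a : M → ℂ} {U : Set M}
    (hU : IsOpen U) (hz : pt φ z ∈ U) (ha : HolOn (n := n) a U) :
    DifferentiableAt ℂ (a ∘ φ.1.symm) z := by
  have : IsManifold 𝓘(ℂ, Fin n → ℂ) 1 M := IsManifold.of_le (n := ω) le_top
  rw [← mdifferentiableAt_iff_differentiableAt]
  have h1 : MDifferentiableAt 𝓘(ℂ, Fin n → ℂ) 𝓘(ℂ, ℂ) a (φ.1.symm z) :=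
    (ha (pt φ z) hz).mdifferentiableAt (hU.mem_nhds hz)
  exact h1.comp _ (mdifferentiableAt_atlas_symm φ.2 z.2)

/-- Cauchy–Riemann: the derivative is complex linear, so its value in the direction `i e_l` is `i`
times that in the direction `e_l`, and the two terms of the Wirtinger derivative cancel. -/
theorem pd_eq_zero_of_holOn {φ : Chart n M} {U : Set M} (hU : IsOpen U) {a : Fn n M}
    (ha : HolOn (n := n) (Fn.fn a) U) {z : dom φ} (hz : pt φ z ∈ U) (l : Fin n) :
    (pd (Sum.inr l) (locF φ a)).1 z = 0 := by
  have h1 := differentiableAt_of_holOn hU hz ha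
  rw [pd_apply_of_eventuallyEq (F := Fn.fn a ∘ φ.1.symm) _ (Filter.Eventually.of_forall fun w => rfl),
    wirtinger_eq, h1.fderiv_restrictScalars ℝ]
  have h2 : (Pi.single l Complex.I : Fin n → ℂ) = Complex.I • Pi.single l 1 := by
    rw [← Pi.single_smul, smul_eq_mul, mul_one]
  simp only [idx, wsgn, Sum.elim_inr, id_eq, ContinuousLinearMap.coe_restrictScalars', h2, map_smul,
    smul_eq_mul, ← mul_assoc, Complex.I_mul_I]
  ring

/-- The function is the conjugate of one with complex linear derivative, so its own derivative is
conjugate linear, and the cancellation happens with the opposite sign. -/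
theorem pd_eq_zero_of_antiholOn {φ : Chart n M} {U : Set M} (hU : IsOpen U) {b : Fn n M}
    (hb : AntiholOn (n := n) (Fn.fn b) U) {z : dom φ} (hz : pt φ z ∈ U) (k : Fin n) :
    (pd (Sum.inl k) (locF φ b)).1 z = 0 := by
  have h1 := differentiableAt_of_holOn hU hz hb
  have h3 : HasFDerivAt (Fn.fn b ∘ φ.1.symm) ((Complex.conjCLE : ℂ →L[ℝ] ℂ).comp
      ((fderiv ℂ ((fun x => starRingEnd ℂ (Fn.fn b x)) ∘ φ.1.symm) z).restrictScalars ℝ))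
      (z : Fin n → ℂ) := by
    have h4 := (Complex.conjCLE : ℂ →L[ℝ] ℂ).hasFDerivAt.comp (z : Fin n → ℂ)
      (h1.hasFDerivAt.restrictScalars ℝ)
    refine h4.congr_of_eventuallyEq (Filter.Eventually.of_forall fun w => ?_)
    simp
  rw [pd_apply_of_eventuallyEq (F := Fn.fn b ∘ φ.1.symm) _ (Filter.Eventually.of_forall fun w => rfl),
    wirtinger_eq, h3.fderiv]
  have h2 : (Pi.single k Complex.I : Fin n → ℂ) = Complex.I • Pi.single k 1 := by
    rw [← Pi.single_smul, smul_eq_mul, mul_one]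
  simp only [idx, wsgn, Sum.elim_inl, id_eq, ContinuousLinearMap.coe_restrictScalars', h2, map_smul,
    smul_eq_mul, ContinuousLinearMap.comp_apply, ContinuousLinearEquiv.coe_coe, Complex.conjCLE_apply,
    map_mul, Complex.conj_I, neg_mul, mul_neg, neg_neg, ← mul_assoc, Complex.I_mul_I]
  ring

/-- The germ is annihilated by the antiholomorphic derivatives. -/
def HolGerm {U : TopologicalSpace.Opens (Fin n → ℂ)} {z : U} (q : Germ z) : Prop :=
  ∀ l, (germAlg z).d (Sum.inr l) q = 0

/-- The germ is annihilated by the holomorphic derivatives. -/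
def AntiholGerm {U : TopologicalSpace.Opens (Fin n → ℂ)} {z : U} (q : Germ z) : Prop :=
  ∀ k, (germAlg z).d (Sum.inl k) q = 0

theorem holGerm_of_holOn {φ : Chart n M} {U : Set M} (hU : IsOpen U) {a : Fn n M}
    (ha : HolOn (n := n) (Fn.fn a) U) {z : dom φ} (hz : pt φ z ∈ U) : HolGerm (gm φ z a) := by
  intro l
  rw [gm_apply, germAlg_d, germ_eq_zero_iff]
  filter_upwards [eventually_pt.2 (hU.mem_nhds hz)] with w hw
  exact pd_eq_zero_of_holOn hU ha hw l

theorem antiholGerm_of_antiholOn {φ : Chart n M} {U : Set M} (hU : IsOpen U) {b : Fn n M}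
    (hb : AntiholOn (n := n) (Fn.fn b) U) {z : dom φ} (hz : pt φ z ∈ U) : AntiholGerm (gm φ z b) := by
  intro l
  rw [gm_apply, germAlg_d, germ_eq_zero_iff]
  filter_upwards [eventually_pt.2 (hU.mem_nhds hz)] with w hw
  exact pd_eq_zero_of_antiholOn hU hb hw l

/-- Near each point there are smooth functions on `M` that coincide with given local coordinates. -/
theorem exists_coordinates [T2Space M] (φ : Chart n M) (z : dom φ) :
    ∃ (X : Idx n → Fn n M) (U : Set M), IsOpen U ∧ pt φ z ∈ U ∧
      (∀ s, gm φ z (X s) = (germAlg z).x s) ∧ (∀ k, HolOn (n := n) (Fn.fn (X (Sum.inl k))) U) ∧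
      ∀ l, AntiholOn (n := n) (Fn.fn (X (Sum.inr l))) U := by
  have : IsManifold 𝓘(ℂ, Fin n → ℂ) 1 M := IsManifold.of_le (n := ω) le_top
  choose X hX using fun s => exists_gm_eq φ z (coordFn (dom φ) s)
  have h1 : ∀ᶠ x in 𝓝 (pt φ z), x ∈ φ.1.source ∧ ∀ s, Fn.fn (X s) x = coordCLM s (φ.1 x) := by
    refine (φ.1.open_source.eventually_mem (pt_mem_source φ z)).and ?_
    rw [Filter.eventually_all]
    intro s
    rw [← eventually_pt]
    filter_upwards [germ_eq_iff.1 (hX s)] with w hw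
    rw [chart_pt]
    exact hw
  obtain ⟨U, hU, hUo, hz⟩ := eventually_nhds_iff.1 h1
  have hproj : ∀ k : Fin n, MDifferentiable 𝓘(ℂ, Fin n → ℂ) 𝓘(ℂ, ℂ) (fun w : Fin n → ℂ => w k) :=
    fun k => (ContinuousLinearMap.proj (R := ℂ) (φ := fun _ : Fin n => ℂ) k).differentiable.mdifferentiable
  have hφ : ∀ k : Fin n, MDifferentiableOn 𝓘(ℂ, Fin n → ℂ) 𝓘(ℂ, ℂ) (fun x => φ.1 x k) U :=
    fun k x hx => ((hproj k (φ.1 x)).comp x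
      (mdifferentiableAt_atlas φ.2 (hU x hx).1)).mdifferentiableWithinAt
  refine ⟨X, U, hUo, hz, hX, fun k => ?_, fun l => ?_⟩
  · exact (hφ k).congr fun x hx => (hU x hx).2 (Sum.inl k)
  · refine (hφ l).congr fun x hx => ?_
    rw [(hU x hx).2 (Sum.inr l)]
    simp [coordCLM]

theorem HolOn.mul' {a b : M → ℂ} {U : Set M} (ha : HolOn (n := n) a U) (hb : HolOn (n := n) b U) :
    HolOn (n := n) (a * b) U := MDifferentiableOn.mul ha hb

theorem AntiholOn.mul' {a b : M → ℂ} {U : Set M} (ha : AntiholOn (n := n) a U)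
    (hb : AntiholOn (n := n) b U) : AntiholOn (n := n) (a * b) U := by
  have h := MDifferentiableOn.mul ha hb
  refine h.congr fun x _ => ?_
  simp

theorem holOn_one (U : Set M) : HolOn (n := n) (1 : M → ℂ) U := mdifferentiableOn_const

theorem antiholOn_one (U : Set M) : AntiholOn (n := n) (1 : M → ℂ) U := by
  have h : MDifferentiableOn 𝓘(ℂ, Fin n → ℂ) 𝓘(ℂ, ℂ) (fun _ : M => (1 : ℂ)) U :=
    mdifferentiableOn_const
  exact h.congr fun x _ => by simp

theorem HolOn.pow' {a : M → ℂ} {U : Set M} (ha : HolOn (n := n) a U) (m : ℕ) :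
    HolOn (n := n) (a ^ m) U := by
  induction m with
  | zero => rw [pow_zero]; exact holOn_one U
  | succ m ih => rw [pow_succ]; exact ih.mul' ha

theorem AntiholOn.pow' {a : M → ℂ} {U : Set M} (ha : AntiholOn (n := n) a U) (m : ℕ) :
    AntiholOn (n := n) (a ^ m) U := by
  induction m with
  | zero => rw [pow_zero]; exact antiholOn_one U
  | succ m ih => rw [pow_succ]; exact ih.mul' ha

theorem holOn_prod {U : Set M} {ι : Type*} (t : Finset ι) (a : ι → Fn n M)
    (h : ∀ i, HolOn (n := n) (Fn.fn (a i)) U) : HolOn (n := n) (Fn.fn (∏ i ∈ t, a i)) U := by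
  classical
  induction t using Finset.induction_on with
  | empty => exact holOn_one U
  | insert i t hi ih => rw [Finset.prod_insert hi]; exact (h i).mul' ih

theorem antiholOn_prod {U : Set M} {ι : Type*} (t : Finset ι) (a : ι → Fn n M)
    (h : ∀ i, AntiholOn (n := n) (Fn.fn (a i)) U) : AntiholOn (n := n) (Fn.fn (∏ i ∈ t, a i)) U := by
  classical
  induction t using Finset.induction_on with
  | empty => exact antiholOn_one U
  | insert i t hi ih => rw [Finset.prod_insert hi]; exact (h i).mul' ih

/-! ### Equality over open sets in terms of germs -/

/-- Openness of `U` turns pointwise equality into equality of germs. All later identities are then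
checked over the algebra of germs at one point. -/
theorem eqOver_iff {φ : Chart n M} {U : Set M} (hU : IsOpen U) {P Q : Eps (LocFormal (dom φ))} :
    EqOver φ U P Q ↔ ∀ z : dom φ, pt φ z ∈ U →
      CoordAlg.mapEps (germ z) P = CoordAlg.mapEps (germ z) Q := by
  constructor
  · intro h z hz
    have h1 := eventually_pt.2 (hU.mem_nhds hz)
    refine Prod.ext ?_ ?_
    · ext α
      refine germ_eq_iff.2 ?_
      filter_upwards [h1] with w hw
      exact (h w hw α).1
    · ext α
      refine germ_eq_iff.2 ?_
      filter_upwards [h1] with w hw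
      exact (h w hw α).2
  · intro h z hz α
    have h1 := h z hz
    exact ⟨eq_at_of_germ_eq (congrArg (MvPowerSeries.coeff α) (congrArg Prod.fst h1)),
      eq_at_of_germ_eq (congrArg (MvPowerSeries.coeff α) (congrArg Prod.snd h1))⟩

theorem eq_of_mapEps_eq {φ : Chart n M} {P Q : Eps (LocFormal (dom φ))}
    (h : ∀ z, CoordAlg.mapEps (germ z) P = CoordAlg.mapEps (germ z) Q) : P = Q := by
  refine Prod.ext ?_ ?_
  · ext1 α
    exact eq_of_germ_eq fun z => congrArg (MvPowerSeries.coeff α) (congrArg Prod.fst (h z))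
  · ext1 α
    exact eq_of_germ_eq fun z => congrArg (MvPowerSeries.coeff α) (congrArg Prod.snd (h z))

theorem mapEps_liftFn (φ : Chart n M) (z : dom φ) (f : Smooth n M) :
    CoordAlg.mapEps (germ z) (liftFn φ f) = (MvPowerSeries.C (gm φ z (Fn.of f)), 0) := by
  simp only [CoordAlg.mapEps, liftFn, CoordAlg.mapF_C, map_zero]
  rfl

end Geometry

end BerezinLog
end
noncomputable section
set_option linter.unusedSectionVars false
namespace BerezinLog

/-! ### Differential operators under morphisms, and principal symbols -/

namespace CoordAlg

open MvPowerSeries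

variable {n : ℕ} {R R' : Type*} [CommRing R] [Algebra ℂ R] [CommRing R'] [Algebra ℂ R']
variable {𝔠 : CoordAlg n R} {𝔠' : CoordAlg n R'} {π : R →ₐ[ℂ] R'}

theorem mem_ordLE_iff {r : ℤ} {D : Module.End ℂ R} : D ∈ 𝔠.ordLE r ↔
    ∃ c : List (Idx n) →₀ R, (∀ w ∈ c.support, (w.length : ℤ) ≤ r) ∧
      Finsupp.linearCombination R 𝔠.dWord c = D := by
  have h : {D | ∃ w : List (Idx n), (w.length : ℤ) ≤ r ∧ D = 𝔠.dWord w} =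
      𝔠.dWord '' {w | (w.length : ℤ) ≤ r} := by
    ext D
    simp only [Set.mem_ofPred_eq, Set.mem_image, eq_comm]
  rw [ordLE, h, Finsupp.mem_span_image_iff_linearCombination]
  simp only [Finsupp.mem_supported, Set.subset_def, Finset.mem_coe, Set.mem_ofPred_eq]

theorem IsMor.mapF_expSeries (y : Idx n → R) :
    mapF π (expSeries y) = expSeries fun s => π (y s) := by
  ext α
  simp [coeff_mapF, coeff_expSeries]

/-- The symbol is natural. -/
theorem IsMor.sym (h : IsMor 𝔠 𝔠' π) {D : Module.End ℂ R} {D' : Module.End ℂ R'}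
    (hD : ∀ f, π (D f) = D' (π f)) : mapF π (𝔠.sym D) = 𝔠'.sym D' := by
  have h1 : mapF π (CoordAlg.mapCoeff D (expSeries 𝔠.x)) =
      CoordAlg.mapCoeff D' (mapF π (expSeries 𝔠.x)) := by
    ext α
    exact hD _
  rw [CoordAlg.sym, CoordAlg.sym, map_mul, h1, IsMor.mapF_expSeries, IsMor.mapF_expSeries]
  simp only [Pi.neg_apply, map_neg, h.x]
  rfl

/-- Differential operators descend along morphisms. -/
theorem IsMor.exists_push (h : IsMor 𝔠 𝔠' π) {r : ℤ} {D : Module.End ℂ R} (hD : D ∈ 𝔠.ordLE r) :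
    ∃ D' ∈ 𝔠'.ordLE r, ∀ f, π (D f) = D' (π f) := by
  induction hD using ordLE_induction with
  | word w hw => exact ⟨𝔠'.dWord w, 𝔠'.dWord_mem hw, h.dWord w⟩
  | add D E _ _ h1 h2 =>
    obtain ⟨D', hD', e1⟩ := h1
    obtain ⟨E', hE', e2⟩ := h2
    exact ⟨D' + E', Submodule.add_mem _ hD' hE', fun f => by simp [e1, e2]⟩
  | zero => exact ⟨0, Submodule.zero_mem _, fun f => by simp⟩
  | smul a D _ h1 =>
    obtain ⟨D', hD', e1⟩ := h1
    exact ⟨π a • D', Submodule.smul_mem _ _ hD', fun f => by simp [e1]⟩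

/-- Modulo one further power of `h`, each derivative must consume a fresh factor `h`, whence the
falling factorial; all other Leibniz terms retain more factors. -/
theorem dWord_pow (w : List (Idx n)) (h : R) (k : ℕ) : ∃ q : R, 𝔠.dWord w (h ^ (k + w.length)) =
    (((k + w.length).descFactorial w.length : ℕ) : R) * h ^ k * (w.map fun s => 𝔠.d s h).prod +
      h ^ (k + 1) * q := by
  induction w generalizing k with
  | nil => exact ⟨0, by simp [dWord_nil]⟩
  | cons s w ih =>
    obtain ⟨q, hq⟩ := ih (k + 1)
    have e : k + (s :: w).length = k + 1 + w.length := by simp; omega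
    rw [dWord_cons, Module.End.mul_apply, e, hq, dOp_apply]
    have e2 : (k + 1 + w.length).descFactorial (s :: w).length =
        (k + 1) * (k + 1 + w.length).descFactorial w.length := by
      rw [List.length_cons, Nat.descFactorial_succ]
      congr 1
      omega
    rw [e2]
    set c : R := (((k + 1 + w.length).descFactorial w.length : ℕ) : R) with hc
    have hdc : 𝔠.d s c = 0 := by rw [hc]; exact Derivation.map_natCast _ _
    refine ⟨c * 𝔠.d s (w.map fun s => 𝔠.d s h).prod + (k + 2 : ℕ) * 𝔠.d s h * q + h * 𝔠.d s q, ?_⟩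
    simp only [map_add, Derivation.leibniz, Derivation.leibniz_pow, hdc, smul_eq_mul, nsmul_eq_mul,
      List.map_cons, List.prod_cons, Nat.add_sub_cancel]
    push_cast
    rw [← hc]
    ring

/-- At a zero of `h` a word shorter than `r` leaves a factor `h`, while a word of length `r`
contributes `r!` times a product of first derivatives. -/
theorem eval_dWord_pow (e : R →ₐ[ℂ] ℂ) {h : R} (he : e h = 0) {w : List (Idx n)} {r : ℕ}
    (hr : w.length ≤ r) : e (𝔠.dWord w (h ^ r)) =
      if w.length = r then (r.factorial : ℂ) * (w.map fun s => e (𝔠.d s h)).prod else 0 := by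
  obtain ⟨k, rfl⟩ : ∃ k, r = k + w.length := ⟨r - w.length, by omega⟩
  obtain ⟨q, hq⟩ := 𝔠.dWord_pow w h k
  rw [hq, map_add, map_mul e (h ^ (k + 1)), map_pow, he, zero_pow (Nat.succ_ne_zero k), zero_mul,
    add_zero]
  split_ifs with h1
  · have : k = 0 := by omega
    subst this
    simp [map_list_prod, Nat.descFactorial_self, Function.comp_def]
  · have : k ≠ 0 := by omega
    simp [he, zero_pow this]

theorem prod_expWord (α : Idx n →₀ ℕ) (v : Idx n → ℂ) :
    ((expWord α).map v).prod = ∏ s, v s ^ α s := by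
  have h : ((expWord α : Multiset (Idx n)).map v).prod = ∏ s, v s ^ α s := by
    rw [expWord, Multiset.coe_toList, Finsupp.toMultiset_map, Finsupp.prod_toMultiset,
      Finsupp.prod_mapDomain_index (fun _ => pow_zero _) (fun _ _ _ => pow_add _ _ _),
      Finsupp.prod_fintype _ _ fun _ => pow_zero _]
  rw [← h]
  simp

/-- The principal symbol in coordinates. -/
theorem eval_apply_pow (e : R →ₐ[ℂ] ℂ) {h : R} (he : e h = 0) {r : ℕ} {D : Module.End ℂ R}
    (hD : D ∈ 𝔠.ordLE r) : ((r.factorial : ℂ)⁻¹) * e (D (h ^ r)) =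
      ∑ α ∈ Finset.finsuppAntidiag Finset.univ r,
        e (coeff α (𝔠.sym D)) * ∏ s : Idx n, e (𝔠.d s h) ^ α s := by
  have hsub : Finset.finsuppAntidiag Finset.univ r ⊆ degLE (n := n) r := by
    intro α hα
    rw [mem_degLE, Finsupp.degree_eq_sum]
    exact (Finset.mem_finsuppAntidiag.1 hα).1.le
  conv_lhs => rw [𝔠.eq_sum_sym hD]
  rw [LinearMap.sum_apply, map_sum, Finset.mul_sum, ← Finset.sum_subset hsub]
  · refine Finset.sum_congr rfl fun α hα => ?_
    have hα' : α.degree = r := by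
      rw [Finsupp.degree_eq_sum]; exact (Finset.mem_finsuppAntidiag.1 hα).1
    have hl : (expWord α).length = r := by rw [length_expWord, hα']
    rw [LinearMap.smul_apply, smul_eq_mul, map_mul, eval_dWord_pow e he hl.le, if_pos hl,
      prod_expWord]
    have := Nat.factorial_ne_zero r
    field_simp
  · intro α hα hα2
    rw [mem_degLE] at hα
    have hl : (expWord α).length ≠ r := by
      rw [length_expWord]
      intro h1
      exact hα2 (Finset.mem_finsuppAntidiag.2 ⟨by rw [← h1, Finsupp.degree_eq_sum], by simp⟩)
    rw [LinearMap.smul_apply, smul_eq_mul, map_mul,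
      eval_dWord_pow e he (by rw [length_expWord]; exact hα), if_neg hl, mul_zero, mul_zero]

end CoordAlg

open CoordAlg

/-! ### Differential operators on the manifold, their action on germs and their symbols -/

section DiffOp

variable {n : ℕ} {M : Type*} [TopologicalSpace M] [ChartedSpace (Fin n → ℂ) M]
  [IsManifold 𝓘(ℂ, Fin n → ℂ) ω M]

theorem linearCombination_apply_apply {U : TopologicalSpace.Opens (Fin n → ℂ)}
    (c : List (Idx n) →₀ LocSmooth U) (f : LocSmooth U) (z : U) :
    (Finsupp.linearCombination (LocSmooth U) (locAlg U).dWord c f).1 z =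
      c.sum fun w a => a.1 z * (pdWord w f).1 z := by
  rw [Finsupp.linearCombination_apply, Finsupp.sum, Finsupp.sum, LinearMap.sum_apply,
    AddSubmonoidClass.coe_finsetSum, Finset.sum_apply]
  rfl

/-- The operator `D` is represented by `Q` near the point `z`. -/
def RepAt (D : Module.End ℂ (Fn n M)) (φ : Chart n M) (z₀ : dom φ)
    (Q : Module.End ℂ (LocSmooth (dom φ))) : Prop :=
  ∀ᶠ z in 𝓝 z₀, ∀ f : Fn n M, (locF φ (D f)).1 z = (Q (locF φ f)).1 z

/-- An operator on smooth functions. -/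
def unFn (D : Module.End ℂ (Fn n M)) : Module.End ℂ (Smooth n M) :=
  (Fn.of (n := n) (M := M)).symm.toLinearMap ∘ₗ D ∘ₗ (Fn.of (n := n) (M := M)).toLinearMap

theorem isDiffOp_iff {D : Module.End ℂ (Fn n M)} : IsDiffOp (unFn D) ↔
    ∀ (φ : Chart n M) (z₀ : dom φ), ∃ Q ∈ (locAlg (dom φ)).diffOps, RepAt D φ z₀ Q := by
  refine forall_congr' fun φ => forall_congr' fun z₀ => ?_
  constructor
  · rintro ⟨c, hc⟩
    refine ⟨Finsupp.linearCombination (LocSmooth (dom φ)) (locAlg (dom φ)).dWord c,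
      ⟨(c.support.sup List.length : ℕ), mem_ordLE_iff.2 ⟨c, fun w hw => ?_, rfl⟩⟩, ?_⟩
    · exact_mod_cast Finset.le_sup (f := List.length) hw
    · filter_upwards [hc] with z hz f
      rw [linearCombination_apply_apply]
      exact hz (Fn.of.symm f)
  · rintro ⟨Q, ⟨N, hN⟩, hQ⟩
    obtain ⟨c, -, rfl⟩ := mem_ordLE_iff.1 hN
    refine ⟨c, ?_⟩
    filter_upwards [hQ] with z hz f
    rw [← linearCombination_apply_apply]
    exact hz (Fn.of f)

theorem germ_diffOps {U : TopologicalSpace.Opens (Fin n → ℂ)} {Q : Module.End ℂ (LocSmooth U)}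
    (hQ : Q ∈ (locAlg U).diffOps) {z : U} {f g : LocSmooth U} (h : germ z f = germ z g) :
    germ z (Q f) = germ z (Q g) := by
  obtain ⟨N, hN⟩ := hQ
  obtain ⟨D, -, hD⟩ := (isMor_germ z).exists_push hN
  rw [hD, hD, h]

theorem RepAt.germ_eq {D : Module.End ℂ (Fn n M)} {φ : Chart n M} {z : dom φ}
    {Q : Module.End ℂ (LocSmooth (dom φ))} (h : RepAt D φ z Q) (f : Fn n M) :
    gm φ z (D f) = germ z (Q (locF φ f)) := by
  rw [gm_apply, germ_eq_iff]
  filter_upwards [h] with w hw using hw f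

variable (n M) in
/-- The algebra of differential operators on `M`. -/
def diffOpAlg : Subalgebra ℂ (Module.End ℂ (Fn n M)) where
  carrier := {D | IsDiffOp (unFn D)}
  mul_mem' {D E} hD hE := by
    refine isDiffOp_iff.2 fun φ z₀ => ?_
    obtain ⟨Q, hQ, h1⟩ := isDiffOp_iff.1 hD φ z₀
    obtain ⟨P, hP, h2⟩ := isDiffOp_iff.1 hE φ z₀
    refine ⟨Q * P, Subalgebra.mul_mem _ hQ hP, ?_⟩
    filter_upwards [h1, h2.eventually_nhds] with z hz1 hz2 f
    rw [Module.End.mul_apply, Module.End.mul_apply, hz1]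
    exact eq_at_of_germ_eq (germ_diffOps hQ (RepAt.germ_eq (n := n) hz2 f))
  add_mem' {D E} hD hE := by
    refine isDiffOp_iff.2 fun φ z₀ => ?_
    obtain ⟨Q, hQ, h1⟩ := isDiffOp_iff.1 hD φ z₀
    obtain ⟨P, hP, h2⟩ := isDiffOp_iff.1 hE φ z₀
    refine ⟨Q + P, Subalgebra.add_mem _ hQ hP, ?_⟩
    filter_upwards [h1, h2] with z hz1 hz2 f
    rw [LinearMap.add_apply, LinearMap.add_apply, map_add]
    exact congrArg₂ (· + ·) (hz1 f) (hz2 f)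
  algebraMap_mem' c := by
    refine isDiffOp_iff.2 fun φ z₀ => ⟨algebraMap ℂ _ c, Subalgebra.algebraMap_mem _ c, ?_⟩
    refine Filter.Eventually.of_forall fun z f => ?_
    rw [Module.algebraMap_end_apply, Module.algebraMap_end_apply, map_smul]

theorem gm_diffOp {D : Module.End ℂ (Fn n M)} (hD : D ∈ diffOpAlg n M) {φ : Chart n M}
    {z : dom φ} {f : Fn n M} (h : gm φ z f = 0) : gm φ z (D f) = 0 := by
  obtain ⟨Q, hQ, h1⟩ := isDiffOp_iff.1 hD φ z
  have h2 : germ z (locF φ f) = germ z 0 := by rw [map_zero]; exact h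
  rw [h1.germ_eq, germ_diffOps hQ h2, map_zero, map_zero]

variable (n M) in
/-- Differential operators on `M`. -/
def DOp : Type _ := diffOpAlg n M

instance : Ring (diffOpAlg n M) :=
  @Subalgebra.toRing ℂ (Module.End ℂ (Fn n M)) _ _ _ (diffOpAlg n M)

instance : Ring (DOp n M) := inferInstanceAs (Ring (diffOpAlg n M))

instance : Algebra ℂ (DOp n M) := inferInstanceAs (Algebra ℂ (diffOpAlg n M))

/-- The underlying operator. -/
def DOp.val : DOp n M →ₐ[ℂ] Module.End ℂ (Fn n M) := (diffOpAlg n M).val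

/-- The differential operator with a given underlying operator. -/
def DOp.mk (D : Module.End ℂ (Fn n M)) (h : D ∈ diffOpAlg n M) : DOp n M := ⟨D, h⟩

theorem DOp.val_mk (D : Module.End ℂ (Fn n M)) (h : D ∈ diffOpAlg n M) : DOp.val (DOp.mk D h) = D :=
  rfl

theorem DOp.val_mem (D : DOp n M) : DOp.val D ∈ diffOpAlg n M := D.2

theorem DOp.val_injective : Function.Injective (DOp.val : DOp n M → _) := Subtype.val_injective

variable [T2Space M]

/-- The operator on germs induced by a differential operator. -/
def germOp (φ : Chart n M) (z : dom φ) (D : DOp n M) : Module.End ℂ (Germ z) :=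
  pushEnd (gm φ z) (gm_surjective φ z) (DOp.val D) fun _ => gm_diffOp D.2

theorem germOp_gm (φ : Chart n M) (z : dom φ) (D : DOp n M) (f : Fn n M) :
    germOp φ z D (gm φ z f) = gm φ z (DOp.val D f) := pushEnd_apply (gm_surjective φ z) _ f

theorem end_ext_of_gm {φ : Chart n M} {z : dom φ} {D E : Module.End ℂ (Germ z)}
    (h : ∀ f : Fn n M, D (gm φ z f) = E (gm φ z f)) : D = E := by
  refine LinearMap.ext fun q => ?_
  obtain ⟨f, rfl⟩ := gm_surjective φ z q
  exact h f

/-- The action of differential operators on germs. -/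
def gop (φ : Chart n M) (z : dom φ) : DOp n M →ₐ[ℂ] Module.End ℂ (Germ z) where
  toFun := germOp φ z
  map_one' := end_ext_of_gm fun f => by
    rw [germOp_gm]
    rfl
  map_mul' D E := end_ext_of_gm fun f => by
    rw [Module.End.mul_apply, germOp_gm, germOp_gm, germOp_gm]
    rfl
  map_zero' := end_ext_of_gm fun f => by
    rw [germOp_gm]
    exact map_zero _
  map_add' D E := end_ext_of_gm fun f => by
    rw [LinearMap.add_apply, germOp_gm, germOp_gm, germOp_gm, ← map_add]
    rfl
  commutes' c := end_ext_of_gm fun f => by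
    rw [germOp_gm, Module.algebraMap_end_apply, ← map_smul]
    rfl

theorem gop_gm (φ : Chart n M) (z : dom φ) (D : DOp n M) (f : Fn n M) :
    gop φ z D (gm φ z f) = gm φ z (DOp.val D f) := germOp_gm φ z D f

/-- One local expression `Q` serves at all points near `z₀`, so its symbol, which has smooth
coefficients, represents the symbols at all nearby germs. This is what makes `symF` smooth. -/
theorem RepAt.gop_eq {D : DOp n M} {φ : Chart n M} {z₀ : dom φ}
    {Q : Module.End ℂ (LocSmooth (dom φ))} (h : RepAt (DOp.val D) φ z₀ Q)
    (hQ : Q ∈ (locAlg (dom φ)).diffOps) :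
    ∀ᶠ z in 𝓝 z₀, gop φ z D ∈ (germAlg z).diffOps ∧
      mapF (germ z) ((locAlg (dom φ)).sym Q) = (germAlg z).sym (gop φ z D) := by
  obtain ⟨N, hN⟩ := hQ
  filter_upwards [h.eventually_nhds] with z hz
  obtain ⟨E, hE, h1⟩ := (isMor_germ z).exists_push hN
  have h2 : gop φ z D = E := by
    refine end_ext_of_gm fun f => ?_
    rw [gop_gm, RepAt.germ_eq (n := n) hz f, h1]
    rfl
  rw [h2]
  exact ⟨⟨N, hE⟩, (isMor_germ z).sym h1⟩

theorem gop_mem (φ : Chart n M) (z : dom φ) (D : DOp n M) :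
    gop φ z D ∈ (germAlg z).diffOps := by
  obtain ⟨Q, hQ, h1⟩ := isDiffOp_iff.1 D.val_mem φ z
  exact (h1.gop_eq hQ).self_of_nhds.1

/-- The total symbol of a differential operator in a chart. -/
def symF (φ : Chart n M) (D : DOp n M) : LocFormal (dom φ) := fun α =>
  ⟨fun z => germEval z (MvPowerSeries.coeff α ((germAlg z).sym (gop φ z D))), by
    intro z₀ hz₀
    obtain ⟨Q, hQ, h1⟩ := isDiffOp_iff.1 D.val_mem φ ⟨z₀, hz₀⟩
    have h2 := h1.gop_eq hQ
    have h3 := (MvPowerSeries.coeff α ((locAlg (dom φ)).sym Q)).2 z₀ hz₀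
    have h4 := h3.contDiffAt ((dom φ).isOpen.mem_nhds hz₀)
    refine ContDiffAt.contDiffWithinAt (h4.congr_of_eventuallyEq ?_)
    refine zeroExt_eventuallyEq (z := ⟨z₀, hz₀⟩) ?_
    filter_upwards [h2] with z hz
    rw [← hz.2, zeroExt_apply]
    rfl⟩

theorem germ_symF (φ : Chart n M) (z : dom φ) (D : DOp n M) (α : Idx n →₀ ℕ) :
    germ z (MvPowerSeries.coeff α (symF φ D)) =
      MvPowerSeries.coeff α ((germAlg z).sym (gop φ z D)) := by
  obtain ⟨Q, hQ, h1⟩ := isDiffOp_iff.1 D.val_mem φ z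
  have h2 := h1.gop_eq hQ
  rw [← h2.self_of_nhds.2]
  refine germ_eq_iff.2 ?_
  filter_upwards [h2] with w hw
  change germEval w (MvPowerSeries.coeff α ((germAlg w).sym (gop φ w D))) = _
  rw [← hw.2]
  rfl

/-- The operator has order at most `r` at each point. -/
def OrdLE (r : ℤ) (D : DOp n M) : Prop :=
  ∀ (φ : Chart n M) (z : dom φ), gop φ z D ∈ (germAlg z).ordLE r

/-- An order bound at every germ is enough, because `symF` supplies smooth coefficients over the
whole chart for the expansion `eq_sum_sym`. -/
theorem OrdLE.isDiffOpOfOrderLE {r : ℕ} {D : DOp n M} (h : OrdLE r D) :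
    IsDiffOpOfOrderLE r (unFn (DOp.val D)) := by
  intro φ z₀
  set Q : Module.End ℂ (LocSmooth (dom φ)) := ∑ α ∈ degLE r,
    MvPowerSeries.coeff α (symF φ D) • (locAlg (dom φ)).dWord (expWord α) with hQ
  have hQr : Q ∈ (locAlg (dom φ)).ordLE r := Submodule.sum_mem _ fun α hα =>
    Submodule.smul_mem _ _ ((locAlg (dom φ)).dWord_mem (by
      rw [length_expWord]; exact_mod_cast mem_degLE.1 hα))
  obtain ⟨c, hc, hcQ⟩ := mem_ordLE_iff.1 hQr
  refine ⟨c, fun w hw => by exact_mod_cast hc w hw, Filter.Eventually.of_forall fun z f => ?_⟩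
  rw [← linearCombination_apply_apply, hcQ]
  refine eq_at_of_germ_eq ?_
  change gm φ z (DOp.val D (Fn.of f)) = germ z (Q (locF φ (Fn.of f)))
  rw [← gop_gm, (germAlg z).eq_sum_sym (h φ z), hQ, LinearMap.sum_apply,
    LinearMap.sum_apply, map_sum]
  refine Finset.sum_congr rfl fun α _ => ?_
  rw [LinearMap.smul_apply, LinearMap.smul_apply, smul_eq_mul, smul_eq_mul, map_mul, germ_symF,
    (isMor_germ z).dWord]
  rfl

/-- `eval_apply_pow` applies to `f - f(x)`, which vanishes at the point and has the same
differential as `f`. The right side makes no reference to the chart, which later shows that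
assembled symbols are globally defined. -/
theorem homEval_eq {r : ℕ} {D : DOp n M} (h : OrdLE r D) {φ : Chart n M} {P : LocFormal (dom φ)}
    (hP : ∀ α : Idx n →₀ ℕ, α.degree = r →
      MvPowerSeries.coeff α P = MvPowerSeries.coeff α (symF φ D)) (z : dom φ) (f : Smooth n M) :
    homEval r P z (grad φ f z) = ((r.factorial : ℂ)⁻¹) *
      (unFn (DOp.val D) ((f - algebraMap ℂ (Smooth n M) (f.1 (pt φ z))) ^ r)).1 (pt φ z) := by
  set u : Smooth n M := f - algebraMap ℂ (Smooth n M) (f.1 (pt φ z)) with hu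
  have he : germEval z (gm φ z (Fn.of u)) = 0 := by
    rw [germEval_gm]
    change f.1 (pt φ z) - f.1 (pt φ z) = 0
    rw [sub_self]
  have h1 := eval_apply_pow (germEval z) he (h φ z)
  rw [← map_pow, gop_gm, germEval_gm] at h1
  refine Eq.trans ?_ h1.symm
  rw [homEval]
  refine Finset.sum_congr rfl fun α hα => ?_
  have hα' : α.degree = r := by
    rw [Finsupp.degree_eq_sum]; exact (Finset.mem_finsuppAntidiag.1 hα).1
  have hd : ∀ s, germEval z ((germAlg z).d s (gm φ z (Fn.of u))) = grad φ f z s := by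
    intro s
    have h2 : pd s (loc φ u) = pd s (loc φ f) := by
      rw [hu, map_sub, map_sub, AlgHom.commutes, sub_eq_self]
      exact ((locAlg (dom φ)).d s).map_algebraMap _
    rw [gm_apply, locF_of, germAlg_d, germEval_germ, h2]
    rfl
  rw [hP α hα', ← germ_symF, germEval_germ]
  simp only [hd]

/-- The formal series assembled from the homogeneous components of the symbols of a sequence of
differential operators. -/
def assemble (φ : Chart n M) (D : ℕ → DOp n M) : LocFormal (dom φ) := fun α =>
  MvPowerSeries.coeff α (symF φ (D α.degree))

theorem coeff_assemble (φ : Chart n M) (D : ℕ → DOp n M) (α : Idx n →₀ ℕ) :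
    MvPowerSeries.coeff α (assemble φ D) = MvPowerSeries.coeff α (symF φ (D α.degree)) := rfl

theorem homEval_assemble {D : ℕ → DOp n M} (h : ∀ r : ℕ, OrdLE r (D r)) (r : ℕ)
    (φ : Chart n M) (z : dom φ) (f : Smooth n M) :
    homEval r (assemble φ D) z (grad φ f z) = ((r.factorial : ℂ)⁻¹) *
      (unFn (DOp.val (D r)) ((f - algebraMap ℂ (Smooth n M) (f.1 (pt φ z))) ^ r)).1 (pt φ z) :=
  homEval_eq (h r) (fun α hα => by rw [coeff_assemble, hα]) z f

/-- The formal function with the homogeneous components given by the principal symbols of a sequence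
of differential operators. -/
def mkFormal (D : ℕ → DOp n M) (h : ∀ r : ℕ, OrdLE r (D r)) : FormalFn n M :=
  ⟨fun φ => assemble φ D, fun φ ψ z w hzw r f => by
    rw [homEval_assemble h, homEval_assemble h, hzw]⟩

theorem mkFormal_apply (D : ℕ → DOp n M) (h : ∀ r : ℕ, OrdLE r (D r)) (φ : Chart n M) :
    (mkFormal D h).1 φ = assemble φ D := rfl

theorem germ_coeff_assemble (D : ℕ → DOp n M) (φ : Chart n M)
    (z : dom φ) (α : Idx n →₀ ℕ) : germ z (MvPowerSeries.coeff α (assemble φ D)) =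
      MvPowerSeries.coeff α ((germAlg z).sym (gop φ z (D α.degree))) := by
  rw [coeff_assemble, germ_symF]

theorem formalFn_ext {P Q : FormalFn n M} (h : ∀ (φ : Chart n M) (z : dom φ) (α : Idx n →₀ ℕ),
    germ z (MvPowerSeries.coeff α (P.1 φ)) = germ z (MvPowerSeries.coeff α (Q.1 φ))) : P = Q := by
  refine Subtype.ext (funext fun φ => ?_)
  ext1 α
  exact eq_of_germ_eq fun z => h φ z α

theorem eps_ext_of_locEps {P Q : Eps (FormalFn n M)} (h : ∀ (φ : Chart n M) (z : dom φ),
    mapEps (germ z) (locEps φ P) = mapEps (germ z) (locEps φ Q)) : P = Q := by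
  refine Prod.ext (formalFn_ext fun φ z α => ?_) (formalFn_ext fun φ z α => ?_)
  · exact congrArg (MvPowerSeries.coeff α) (congrArg Prod.fst (h φ z))
  · exact congrArg (MvPowerSeries.coeff α) (congrArg Prod.snd (h φ z))

end DiffOp

end BerezinLog
end
noncomputable section
set_option linter.unusedSectionVars false
namespace BerezinLog

/-! ### Pairs of formal series -/

section Pair

open PowerSeries

variable {V : Type*} [Ring V] [Algebra ℂ V]

/-- The series of pairs with given components. -/
def pairS (A B : PowerSeries V) : PowerSeries (V × V) := PowerSeries.mk fun r => (coeff r A, coeff r B)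

theorem coeff_pairS (A B : PowerSeries V) (r : ℕ) :
    coeff r (pairS A B) = (coeff r A, coeff r B) := by simp [pairS]

theorem pairS_mul (A B A' B' : PowerSeries V) :
    pairS A A' * pairS B B' = pairS (A * B) (A' * B') := by
  ext1 r
  rw [coeff_pairS, coeff_mul, coeff_mul, coeff_mul]
  refine Prod.ext ?_ ?_
  · simp only [coeff_pairS, Prod.fst_sum, Prod.fst_mul]
  · simp only [coeff_pairS, Prod.snd_sum, Prod.snd_mul]

theorem pairS_one : pairS (1 : PowerSeries V) 1 = 1 := by
  ext r <;> simp only [coeff_pairS, coeff_one] <;> split_ifs <;> rfl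

theorem pairS_pow (A B : PowerSeries V) (j : ℕ) : pairS A B ^ j = pairS (A ^ j) (B ^ j) := by
  induction j with
  | zero => simp [pairS_one]
  | succ j ih => rw [pow_succ, ih, pairS_mul, pow_succ, pow_succ]

theorem pairS_pexp (A B : PowerSeries V) : pexp (pairS A B) = pairS (pexp A) (pexp B) := by
  ext r
  · simp [coeff_pexp, coeff_pairS, pairS_pow, Prod.fst_sum]
  · simp [coeff_pexp, coeff_pairS, pairS_pow, Prod.snd_sum]

theorem pairS_C (a b : V) : pairS (C a) (C b) = C (a, b) := by
  ext r <;> simp only [coeff_pairS, coeff_C] <;> split_ifs <;> rfl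

theorem pairS_X_mul (A B : PowerSeries V) : X * pairS A B = pairS (X * A) (X * B) := by
  ext r <;> rcases r with _ | r <;> simp [coeff_pairS, coeff_succ_X_mul]

theorem commute_pairS {A B A' B' : PowerSeries V} (h : Commute A B) (h' : Commute A' B') :
    Commute (pairS A A') (pairS B B') := by
  rw [commute_iff_eq, pairS_mul, pairS_mul, h.eq, h'.eq]

end Pair

open CoordAlg

/-! ### Formal differential operators acting on germs, and natural pairs -/

section Lift

variable {n : ℕ} {M : Type*} [TopologicalSpace M] [ChartedSpace (Fin n → ℂ) M]
  [IsManifold 𝓘(ℂ, Fin n → ℂ) ω M]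

variable (n M) in
/-- Formal differential operators. -/
abbrev FDO : Type _ := PowerSeries (DOp n M)

/-- The underlying formal operator. -/
def FDO.val : FDO n M →+* PowerSeries (Module.End ℂ (Fn n M)) := PowerSeries.map
  ((DOp.val : DOp n M →ₐ[ℂ] Module.End ℂ (Fn n M)) : DOp n M →+* Module.End ℂ (Fn n M))

theorem FDO.coeff_val (A : FDO n M) (r : ℕ) :
    PowerSeries.coeff r (FDO.val A) = DOp.val (PowerSeries.coeff r A) := PowerSeries.coeff_map _ _ _

theorem FDO.val_injective : Function.Injective (FDO.val : FDO n M → PowerSeries (Module.End ℂ (Fn n M))) := by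
  intro A B h
  ext1 r
  refine DOp.val_injective ?_
  rw [← FDO.coeff_val, ← FDO.coeff_val, h]

theorem FDO.val_pexp (A : FDO n M) : FDO.val (pexp A) = pexp (FDO.val A) :=
  map_pexp (DOp.val : DOp n M →ₐ[ℂ] Module.End ℂ (Fn n M)) A

theorem FDO.val_negNu (A : FDO n M) : FDO.val (negNu A) = negNu (FDO.val A) :=
  map_negNu (DOp.val : DOp n M →ₐ[ℂ] Module.End ℂ (Fn n M)).toRingHom A

/-- A formal operator whose coefficients are differential operators. -/
def FDO.lift (A : PowerSeries (Module.End ℂ (Fn n M))) (h : ∀ r, PowerSeries.coeff r A ∈ diffOpAlg n M) : FDO n M :=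
  PowerSeries.mk fun r => DOp.mk (PowerSeries.coeff r A) (h r)

theorem FDO.coeff_lift (A : PowerSeries (Module.End ℂ (Fn n M))) (h : ∀ r, PowerSeries.coeff r A ∈ diffOpAlg n M) (r : ℕ) :
    PowerSeries.coeff r (FDO.lift A h) = DOp.mk (PowerSeries.coeff r A) (h r) := PowerSeries.coeff_mk _ _

theorem FDO.val_lift (A : PowerSeries (Module.End ℂ (Fn n M))) (h : ∀ r, PowerSeries.coeff r A ∈ diffOpAlg n M) :
    FDO.val (FDO.lift A h) = A := by
  ext1 r
  rw [FDO.coeff_val, FDO.coeff_lift, DOp.val_mk]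

variable [T2Space M]

/-- The action of formal differential operators on germs. -/
def gS (φ : Chart n M) (z : dom φ) : FDO n M →+* PowerSeries (Module.End ℂ (Germ z)) :=
  PowerSeries.map (gop φ z : DOp n M →+* Module.End ℂ (Germ z))

theorem coeff_gS (φ : Chart n M) (z : dom φ) (A : FDO n M) (r : ℕ) :
    PowerSeries.coeff r (gS φ z A) = gop φ z (PowerSeries.coeff r A) := PowerSeries.coeff_map _ _ _

theorem coeff_gS_gm (φ : Chart n M) (z : dom φ) (A : FDO n M) (r : ℕ) (f : Fn n M) :
    PowerSeries.coeff r (gS φ z A) (gm φ z f) = gm φ z (PowerSeries.coeff r (FDO.val A) f) := by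
  rw [coeff_gS, gop_gm, FDO.coeff_val]

theorem gS_pexp (φ : Chart n M) (z : dom φ) (A : FDO n M) : gS φ z (pexp A) = pexp (gS φ z A) :=
  map_pexp _ _

theorem gS_negNu (φ : Chart n M) (z : dom φ) (A : FDO n M) : gS φ z (negNu A) = negNu (gS φ z A) :=
  map_negNu _ _

/-- The action of pairs of formal differential operators on germs. -/
def gP (φ : Chart n M) (z : dom φ) (A A' : FDO n M) :
    PowerSeries (Module.End ℂ (Germ z) × Module.End ℂ (Germ z)) := pairS (gS φ z A) (gS φ z A')

theorem coeff_gP (φ : Chart n M) (z : dom φ) (A A' : FDO n M) (r : ℕ) :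
    PowerSeries.coeff r (gP φ z A A') =
      (gop φ z (PowerSeries.coeff r A), gop φ z (PowerSeries.coeff r A')) := by
  rw [gP, coeff_pairS, coeff_gS, coeff_gS]

theorem coeff_gP_mem (φ : Chart n M) (z : dom φ) (A A' : FDO n M) (r : ℕ) :
    (PowerSeries.coeff r (gP φ z A A')).1 ∈ (germAlg z).diffOps ∧
      (PowerSeries.coeff r (gP φ z A A')).2 ∈ (germAlg z).diffOps := by
  rw [coeff_gP]
  exact ⟨gop_mem _ _ _, gop_mem _ _ _⟩

/-- A pair of formal differential operators that is natural at each point. -/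
def IsNatPair (A A' : FDO n M) : Prop :=
  ∀ (φ : Chart n M) (z : dom φ), (germAlg z).IsNat (gP φ z A A')

theorem IsNatPair.ordLE {A A' : FDO n M} (h : IsNatPair A A') (r : ℕ) :
    OrdLE r (PowerSeries.coeff r A) := fun φ z => by
  have h1 := (h φ z r).1
  rwa [coeff_gP] at h1

theorem IsNatPair.ordLE_sub {A A' : FDO n M} (h : IsNatPair A A') (r : ℕ) :
    OrdLE r (PowerSeries.coeff (r + 1) A - PowerSeries.coeff (r + 1) A') := fun φ z => by
  have h1 := (h φ z (r + 1)).2.2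
  rw [coeff_gP] at h1
  rw [map_sub]
  simpa using h1

/-- The symbol of a natural pair of formal differential operators. -/
def pairSymbol (A A' : FDO n M) (h : IsNatPair A A') : Eps (FormalFn n M) :=
  (mkFormal (fun r => PowerSeries.coeff r A) h.ordLE,
    mkFormal (fun r => PowerSeries.coeff (r + 1) A - PowerSeries.coeff (r + 1) A') h.ordLE_sub)

theorem mapEps_pairSymbol {A A' : FDO n M} (h : IsNatPair A A') (φ : Chart n M) (z : dom φ) :
    mapEps (germ z) (locEps φ (pairSymbol A A' h)) = (germAlg z).sig (gP φ z A A') := by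
  refine Prod.ext ?_ ?_
  · ext1 α
    rw [coeff_sig_fst, coeff_gP]
    change germ z (MvPowerSeries.coeff α (assemble φ fun r => PowerSeries.coeff r A)) = _
    rw [germ_coeff_assemble]
  · ext1 α
    rw [coeff_sig_snd, coeff_gP]
    change germ z (MvPowerSeries.coeff α (assemble φ fun r =>
      PowerSeries.coeff (r + 1) A - PowerSeries.coeff (r + 1) A')) = _
    rw [germ_coeff_assemble, map_sub]

end Lift

/-! ### Products with separation of variables -/

section SepProduct

variable {n : ℕ} {M : Type*} [TopologicalSpace M] [ChartedSpace (Fin n → ℂ) M]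
  [IsManifold 𝓘(ℂ, Fin n → ℂ) ω M] [T2Space M]

/-- The operators of left multiplication of a formal product given by differential operators. -/
def opL (c : ℕ → Fn n M →ₗ[ℂ] Fn n M →ₗ[ℂ] Fn n M)
    (h : ∀ r u, c r u ∈ diffOpAlg n M) : Fn n M →ₗ[ℂ] FDO n M where
  toFun u := PowerSeries.mk fun r => DOp.mk (c r u) (h r u)
  map_add' u v := by
    ext1 r
    refine DOp.val_injective ?_
    rw [map_add]
    simp only [PowerSeries.coeff_mk, map_add]
    rfl
  map_smul' a u := by
    ext1 r
    refine DOp.val_injective ?_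
    rw [RingHom.id_apply, PowerSeries.coeff_smul]
    simp only [PowerSeries.coeff_mk, map_smul]
    rfl

theorem coeff_opL {c : ℕ → Fn n M →ₗ[ℂ] Fn n M →ₗ[ℂ] Fn n M}
    (h : ∀ r u, c r u ∈ diffOpAlg n M) (r : ℕ) (u : Fn n M) :
    PowerSeries.coeff r (opL c h u) = DOp.mk (c r u) (h r u) :=
  PowerSeries.coeff_mk r fun r => DOp.mk (c r u) (h r u)

theorem val_opL {c : ℕ → Fn n M →ₗ[ℂ] Fn n M →ₗ[ℂ] Fn n M}
    (h : ∀ r u, c r u ∈ diffOpAlg n M) (u : Fn n M) : FDO.val (opL c h u) = lser c u := by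
  ext1 r
  rw [FDO.coeff_val, coeff_opL, coeff_lser, DOp.val_mk]

/-- An associative formal product with separation of variables, for which the multiplication by
local antiholomorphic functions on the left and by local holomorphic functions on the right are
conjugated to pointwise multiplications by `exp P`. -/
structure IsSepProduct (c : ℕ → Fn n M →ₗ[ℂ] Fn n M →ₗ[ℂ] Fn n M) (P : FDO n M) :
    Prop where
  memL : ∀ r u, c r u ∈ diffOpAlg n M
  memR : ∀ r u, (c r).flip u ∈ diffOpAlg n M
  assoc : IsAssoc c
  zero : ∀ u v, c 0 u v = u * v
  hol_left : ∀ (φ : Chart n M) (z : dom φ) (U : Set M), IsOpen U → pt φ z ∈ U → ∀ a : Fn n M,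
    HolOn (n := n) (Fn.fn a) U → ∀ r, 1 ≤ r → ∀ v, gm φ z (c r a v) = 0
  antihol_right : ∀ (φ : Chart n M) (z : dom φ) (U : Set M), IsOpen U → pt φ z ∈ U →
    ∀ b : Fn n M, AntiholOn (n := n) (Fn.fn b) U → ∀ r, 1 ≤ r → ∀ u, gm φ z (c r u b) = 0
  coeff_zero : PowerSeries.coeff 0 P = 0
  exp_left : ∀ (φ : Chart n M) (z : dom φ) (U : Set M), IsOpen U → pt φ z ∈ U →
    ∀ b : Fn n M, AntiholOn (n := n) (Fn.fn b) U →
      gS φ z (opL c memL b) * pexp (gS φ z P) = pexp (gS φ z P) * PowerSeries.C (mulOp (gm φ z b))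
  exp_right : ∀ (φ : Chart n M) (z : dom φ) (U : Set M), IsOpen U → pt φ z ∈ U →
    ∀ a : Fn n M, HolOn (n := n) (Fn.fn a) U →
      gS φ z (opL (fun r => (c r).flip) memR a) * pexp (gS φ z P) =
        pexp (gS φ z P) * PowerSeries.C (mulOp (gm φ z a))
  hol_apply : ∀ (φ : Chart n M) (z : dom φ) (U : Set M), IsOpen U → pt φ z ∈ U → ∀ a : Fn n M,
    HolOn (n := n) (Fn.fn a) U → ∀ r, PowerSeries.coeff r (gS φ z P) (gm φ z a) = 0
  antihol_apply : ∀ (φ : Chart n M) (z : dom φ) (U : Set M), IsOpen U → pt φ z ∈ U →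
    ∀ b : Fn n M, AntiholOn (n := n) (Fn.fn b) U →
      ∀ r, PowerSeries.coeff r (gS φ z P) (gm φ z b) = 0

namespace IsSepProduct

variable {c c' : ℕ → Fn n M →ₗ[ℂ] Fn n M →ₗ[ℂ] Fn n M} {P P' : FDO n M}

/-- Left multiplication operators. -/
def L (h : IsSepProduct c P) : Fn n M →ₗ[ℂ] FDO n M := opL c h.memL

/-- Right multiplication operators. -/
def R (h : IsSepProduct c P) : Fn n M →ₗ[ℂ] FDO n M := opL (fun r => (c r).flip) h.memR

theorem coeff_gS_L (h : IsSepProduct c P) (φ : Chart n M) (z : dom φ) (r : ℕ) (u v : Fn n M) :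
    PowerSeries.coeff r (gS φ z (h.L u)) (gm φ z v) = gm φ z (c r u v) := by
  rw [coeff_gS_gm, L, val_opL, coeff_lser]

theorem coeff_gS_R (h : IsSepProduct c P) (φ : Chart n M) (z : dom φ) (r : ℕ) (u v : Fn n M) :
    PowerSeries.coeff r (gS φ z (h.R u)) (gm φ z v) = gm φ z (c r v u) := by
  rw [coeff_gS_gm, R, val_opL, coeff_lser, LinearMap.flip_apply]

theorem commute (h : IsSepProduct c P) (u v : Fn n M) : Commute (h.L u) (h.R v) := by
  refine FDO.val_injective ?_
  rw [map_mul, map_mul, L, R, val_opL, val_opL]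
  exact h.assoc.commute u v

theorem coeff_zero_L (h : IsSepProduct c P) (φ : Chart n M) (z : dom φ) (u : Fn n M) :
    PowerSeries.coeff 0 (gS φ z (h.L u)) = mulOp (gm φ z u) := by
  refine end_ext_of_gm fun f => ?_
  rw [coeff_gS_L, h.zero, map_mul]
  rfl

theorem coeff_zero_R (h : IsSepProduct c P) (φ : Chart n M) (z : dom φ) (u : Fn n M) :
    PowerSeries.coeff 0 (gS φ z (h.R u)) = mulOp (gm φ z u) := by
  refine end_ext_of_gm fun f => ?_
  rw [coeff_gS_R, h.zero, map_mul, mul_comm]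
  rfl

theorem gS_L_hol (h : IsSepProduct c P) {φ : Chart n M} {z : dom φ} {U : Set M} (hU : IsOpen U)
    (hz : pt φ z ∈ U) {a : Fn n M} (ha : HolOn (n := n) (Fn.fn a) U) :
    gS φ z (h.L a) = PowerSeries.C (mulOp (gm φ z a)) := by
  ext1 r
  rw [PowerSeries.coeff_C]
  split_ifs with hr
  · rw [hr, coeff_zero_L]
  · refine end_ext_of_gm fun f => ?_
    rw [coeff_gS_L, h.hol_left φ z U hU hz a ha r (by omega)]
    rfl

theorem gS_R_antihol (h : IsSepProduct c P) {φ : Chart n M} {z : dom φ} {U : Set M} (hU : IsOpen U)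
    (hz : pt φ z ∈ U) {b : Fn n M} (hb : AntiholOn (n := n) (Fn.fn b) U) :
    gS φ z (h.R b) = PowerSeries.C (mulOp (gm φ z b)) := by
  ext1 r
  rw [PowerSeries.coeff_C]
  split_ifs with hr
  · rw [hr, coeff_zero_R]
  · refine end_ext_of_gm fun f => ?_
    rw [coeff_gS_R, h.antihol_right φ z U hU hz b hb r (by omega)]
    rfl

theorem coeff_zero_gS (h : IsSepProduct c P) (φ : Chart n M) (z : dom φ) :
    PowerSeries.coeff 0 (gS φ z P) = 0 := by
  rw [coeff_gS, h.coeff_zero, map_zero]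

/-! ### A pair of products with separation of variables -/

variable (h : IsSepProduct c P) (h' : IsSepProduct c' P')

theorem coeff_zero_gP (h : IsSepProduct c P) (h' : IsSepProduct c' P') (φ : Chart n M) (z : dom φ) :
    PowerSeries.coeff 0 (gP φ z P P') = 0 := by
  rw [coeff_gP, h.coeff_zero, h'.coeff_zero, map_zero]
  rfl

theorem gP_L_hol {φ : Chart n M} {z : dom φ} {U : Set M} (hU : IsOpen U)
    (hz : pt φ z ∈ U) {a : Fn n M} (ha : HolOn (n := n) (Fn.fn a) U) :
    gP φ z (h.L a) (h'.L a) = PowerSeries.C (mulPair (gm φ z a)) := by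
  rw [gP, h.gS_L_hol hU hz ha, h'.gS_L_hol hU hz ha, pairS_C]
  rfl

theorem gP_R_antihol {φ : Chart n M} {z : dom φ} {U : Set M} (hU : IsOpen U)
    (hz : pt φ z ∈ U) {b : Fn n M} (hb : AntiholOn (n := n) (Fn.fn b) U) :
    gP φ z (h.R b) (h'.R b) = PowerSeries.C (mulPair (gm φ z b)) := by
  rw [gP, h.gS_R_antihol hU hz hb, h'.gS_R_antihol hU hz hb, pairS_C]
  rfl

/-- Each product satisfies its own conjugation relation by `exp P`, so the pair of operators is a
single exponential of the pair of logarithms. -/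
theorem gP_L_antihol {φ : Chart n M} {z : dom φ} {U : Set M} (hU : IsOpen U)
    (hz : pt φ z ∈ U) {b : Fn n M} (hb : AntiholOn (n := n) (Fn.fn b) U) :
    gP φ z (h.L b) (h'.L b) = expAd (gP φ z P P') (PowerSeries.C (mulPair (gm φ z b))) := by
  refine expAd_eq (coeff_zero_gP h h' φ z) ?_
  have h1 : (PowerSeries.C (mulPair (gm φ z b)) : PowerSeries (_ × _)) =
    pairS (PowerSeries.C (mulOp (gm φ z b))) (PowerSeries.C (mulOp (gm φ z b))) := (pairS_C _ _).symm
  rw [gP, gP, pairS_pexp, pairS_mul, h1, pairS_mul]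
  congr 1
  · exact h.exp_left φ z U hU hz b hb
  · exact h'.exp_left φ z U hU hz b hb

theorem gP_R_hol {φ : Chart n M} {z : dom φ} {U : Set M} (hU : IsOpen U)
    (hz : pt φ z ∈ U) {a : Fn n M} (ha : HolOn (n := n) (Fn.fn a) U) :
    gP φ z (h.R a) (h'.R a) = expAd (gP φ z P P') (PowerSeries.C (mulPair (gm φ z a))) := by
  refine expAd_eq (coeff_zero_gP h h' φ z) ?_
  have h1 : (PowerSeries.C (mulPair (gm φ z a)) : PowerSeries (_ × _)) =
    pairS (PowerSeries.C (mulOp (gm φ z a))) (PowerSeries.C (mulOp (gm φ z a))) := (pairS_C _ _).symm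
  rw [gP, gP, pairS_pexp, pairS_mul, h1, pairS_mul]
  congr 1
  · exact h.exp_right φ z U hU hz a ha
  · exact h'.exp_right φ z U hU hz a ha

theorem commute_gP (φ : Chart n M) (z : dom φ) (u v : Fn n M) :
    Commute (gP φ z (h.L u) (h'.L u)) (gP φ z (h.R v) (h'.R v)) :=
  commute_pairS ((h.commute u v).map (gS φ z)) ((h'.commute u v).map (gS φ z))

variable (h1 : PowerSeries.coeff 1 P = PowerSeries.coeff 1 P')

theorem coeff_one_gP (h1 : PowerSeries.coeff 1 P = PowerSeries.coeff 1 P') (φ : Chart n M)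
    (z : dom φ) : (PowerSeries.coeff 1 (gP φ z P P')).1 = (PowerSeries.coeff 1 (gP φ z P P')).2 := by
  rw [coeff_gP, h1]

-- For holomorphic coordinates `e^{ad P} z^k` is a right multiplication and `z^p` a left one, so
-- they commute; for antiholomorphic coordinates the sides are exchanged. This is the hypothesis of
-- `coeff_mem_pairLE_of_commute`.
include h h' h1 in
theorem coeff_gP_mem_pairLE (φ : Chart n M) (z : dom φ) (r : ℕ) :
    PowerSeries.coeff r (gP φ z P P') ∈ (germAlg z).pairLE (r + 1) := by
  refine coeff_mem_pairLE_of_commute (coeff_zero_gP h h' φ z) (coeff_gP_mem φ z P P')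
    (coeff_one_gP h1 φ z) (fun s t hst => ?_) r
  obtain ⟨X, U, hU, hz, hX, hX1, hX2⟩ := exists_coordinates φ z
  rw [← hX s, ← hX t]
  rcases s with s | s <;> rcases t with t | t
  · rw [← gP_R_hol h h' hU hz (hX1 s), ← gP_L_hol h h' hU hz (hX1 t)]
    exact (commute_gP h h' φ z _ _).symm
  · simp [SameType] at hst
  · simp [SameType] at hst
  · rw [← gP_L_antihol h h' hU hz (hX2 s), ← gP_R_antihol h h' hU hz (hX2 t)]
    exact commute_gP h h' φ z _ _

-- `L_u` commutes with the right multiplications by all coordinates, and these are natural: constant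
-- in `ν` for `z̄^l`, and `e^{ad P} z^k` for `z^k`.
include h1 in
theorem isNatPair_L (u : Fn n M) : IsNatPair (h.L u) (h'.L u) := by
  intro φ z
  obtain ⟨X, U, hU, hz, hX, hX1, hX2⟩ := exists_coordinates φ z
  have h0 : ∀ v, PowerSeries.coeff 0 (gP φ z (h.R v) (h'.R v)) = mulPair (gm φ z v) := fun v => by
    rw [gP, coeff_pairS, coeff_zero_R, coeff_zero_R]
    rfl
  refine isNat_of_commute (f := gm φ z u) ?_ (coeff_gP_mem _ _ _ _) fun s =>
    ⟨gP φ z (h.R (X s)) (h'.R (X s)), ?_, by rw [h0, hX], commute_gP h h' φ z u (X s)⟩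
  · rw [gP, coeff_pairS, coeff_zero_L, coeff_zero_L]
    rfl
  · rcases s with k | l
    · rw [gP_R_hol h h' hU hz (hX1 k)]
      exact isNat_expAd (coeff_gP_mem_pairLE h h' h1 φ z) _
    · rw [gP_R_antihol h h' hU hz (hX2 l)]
      exact isNat_C _

include h1 in
theorem isNatPair_R (u : Fn n M) : IsNatPair (h.R u) (h'.R u) := by
  intro φ z
  obtain ⟨X, U, hU, hz, hX, hX1, hX2⟩ := exists_coordinates φ z
  have h0 : ∀ v, PowerSeries.coeff 0 (gP φ z (h.L v) (h'.L v)) = mulPair (gm φ z v) := fun v => by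
    rw [gP, coeff_pairS, coeff_zero_L, coeff_zero_L]
    rfl
  refine isNat_of_commute (f := gm φ z u) ?_ (coeff_gP_mem _ _ _ _) fun s =>
    ⟨gP φ z (h.L (X s)) (h'.L (X s)), ?_, by rw [h0, hX], (commute_gP h h' φ z (X s) u).symm⟩
  · rw [gP, coeff_pairS, coeff_zero_R, coeff_zero_R]
    rfl
  · rcases s with k | l
    · rw [gP_L_hol h h' hU hz (hX1 k)]
      exact isNat_C _
    · rw [gP_L_antihol h h' hU hz (hX2 l)]
      exact isNat_expAd (coeff_gP_mem_pairLE h h' h1 φ z) _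

include h h' h1 in
theorem isNatPair_X_mul : IsNatPair (PowerSeries.X * P) (PowerSeries.X * P') := by
  intro φ z
  have e : gP φ z (PowerSeries.X * P) (PowerSeries.X * P') = PowerSeries.X * gP φ z P P' := by
    rw [gP, gP, map_mul, map_mul, pairS_X_mul, gS, PowerSeries.map_X]
  rw [e]
  exact isNat_X_mul (coeff_gP_mem_pairLE h h' h1 φ z)

end IsSepProduct

end SepProduct

end BerezinLog
end
noncomputable section
set_option linter.unusedSectionVars false
namespace BerezinLog

open CoordAlg

/-! ### From the Berezin transform to conjugation formulas; the dual product -/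

section Star

variable {n : ℕ} {M : Type*} [TopologicalSpace M] [ChartedSpace (Fin n → ℂ) M]
  [IsManifold 𝓘(ℂ, Fin n → ℂ) ω M] [T2Space M]

theorem HolOn.mono' {a : M → ℂ} {U V : Set M} (h : HolOn (n := n) a U) (hV : V ⊆ U) :
    HolOn (n := n) a V := MDifferentiableOn.mono h hV

theorem AntiholOn.mono' {a : M → ℂ} {U V : Set M} (h : AntiholOn (n := n) a U) (hV : V ⊆ U) :
    AntiholOn (n := n) a V := MDifferentiableOn.mono h hV

theorem coeff_zero_pexp {A : Type*} [Ring A] [Algebra ℂ A] (P : PowerSeries A) :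
    PowerSeries.coeff 0 (pexp P) = 1 := by
  rw [coeff_pexp]
  simp

theorem coeff_zero_mul_eq {A : Type*} [Ring A] (P Q : PowerSeries A) :
    PowerSeries.coeff 0 (P * Q) = PowerSeries.coeff 0 P * PowerSeries.coeff 0 Q := by
  rw [PowerSeries.coeff_mul]
  simp

/-- An associative product with separation of variables, together with the logarithm of its formal
Berezin transform. -/
structure IsBerezinPair (c : ℕ → Fn n M →ₗ[ℂ] Fn n M →ₗ[ℂ] Fn n M) (P : FDO n M) : Prop where
  memL : ∀ r u, c r u ∈ diffOpAlg n M
  memR : ∀ r u, (c r).flip u ∈ diffOpAlg n M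
  assoc : IsAssoc c
  zero : ∀ u v, c 0 u v = u * v
  hol_left : ∀ (φ : Chart n M) (z : dom φ) (U : Set M), IsOpen U → pt φ z ∈ U → ∀ a : Fn n M,
    HolOn (n := n) (Fn.fn a) U → ∀ r, 1 ≤ r → ∀ v, gm φ z (c r a v) = 0
  antihol_right : ∀ (φ : Chart n M) (z : dom φ) (U : Set M), IsOpen U → pt φ z ∈ U →
    ∀ b : Fn n M, AntiholOn (n := n) (Fn.fn b) U → ∀ r, 1 ≤ r → ∀ u, gm φ z (c r u b) = 0
  coeff_zero : PowerSeries.coeff 0 P = 0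
  apply_mul : ∀ (φ : Chart n M) (z : dom φ) (U : Set M), IsOpen U → pt φ z ∈ U → ∀ a b : Fn n M,
    HolOn (n := n) (Fn.fn a) U → AntiholOn (n := n) (Fn.fn b) U → ∀ r,
      PowerSeries.coeff r (pexp (gS φ z P)) (gm φ z a * gm φ z b) = gm φ z (c r b a)

namespace IsBerezinPair

variable {c : ℕ → Fn n M →ₗ[ℂ] Fn n M →ₗ[ℂ] Fn n M} {P : FDO n M}

theorem gm_left (h : IsBerezinPair c P) {φ : Chart n M} {z : dom φ} {w : Fn n M}
    (hw : gm φ z w = 0) (r : ℕ) (v : Fn n M) : gm φ z (c r w v) = 0 :=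
  gm_diffOp (h.memR r v) hw

theorem gm_right (h : IsBerezinPair c P) {φ : Chart n M} {z : dom φ} {w : Fn n M}
    (hw : gm φ z w = 0) (r : ℕ) (u : Fn n M) : gm φ z (c r u w) = 0 :=
  gm_diffOp (h.memL r u) hw

theorem coeff_gS_opL {c : ℕ → Fn n M →ₗ[ℂ] Fn n M →ₗ[ℂ] Fn n M} (h : ∀ r u, c r u ∈ diffOpAlg n M)
    (φ : Chart n M) (z : dom φ) (r : ℕ) (u v : Fn n M) :
    PowerSeries.coeff r (gS φ z (opL c h u)) (gm φ z v) = gm φ z (c r u v) := by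
  rw [coeff_gS_gm, val_opL, coeff_lser]

/-- Two series of differential operators coincide at a point if they do so on products of
holomorphic and antiholomorphic functions. -/
theorem gS_ext {φ : Chart n M} {z : dom φ} {A B : PowerSeries (Module.End ℂ (Germ z))}
    (hA : ∀ r, PowerSeries.coeff r A ∈ (germAlg z).diffOps)
    (hB : ∀ r, PowerSeries.coeff r B ∈ (germAlg z).diffOps) {U : Set M} (hU : IsOpen U)
    (hz : pt φ z ∈ U)
    (h : ∀ V, IsOpen V → pt φ z ∈ V → V ⊆ U → ∀ a b : Fn n M, HolOn (n := n) (Fn.fn a) V →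
      AntiholOn (n := n) (Fn.fn b) V → ∀ r,
      PowerSeries.coeff r A (gm φ z a * gm φ z b) = PowerSeries.coeff r B (gm φ z a * gm φ z b)) :
    A = B := by
  ext1 r
  rw [← sub_eq_zero]
  refine (germAlg z).eq_zero_of_monomials (Subalgebra.sub_mem _ (hA r) (hB r)) fun α => ?_
  obtain ⟨X, V, hV, hzV, hX, hX1, hX2⟩ := exists_coordinates φ z
  have h1 := h (V ∩ U) (hV.inter hU) ⟨hzV, hz⟩ Set.inter_subset_right
    (∏ k, X (Sum.inl k) ^ α (Sum.inl k)) (∏ l, X (Sum.inr l) ^ α (Sum.inr l))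
    (holOn_prod _ _ fun k => ((hX1 k).mono' Set.inter_subset_left).pow' _)
    (antiholOn_prod _ _ fun l => ((hX2 l).mono' Set.inter_subset_left).pow' _) r
  rw [LinearMap.sub_apply, sub_eq_zero, Fintype.prod_sum_type]
  simp only [map_prod, map_pow, hX] at h1
  exact h1

theorem coeff_pexp_gS_mem (φ : Chart n M) (z : dom φ) (P : FDO n M) (r : ℕ) :
    PowerSeries.coeff r (pexp (gS φ z P)) ∈ (germAlg z).diffOps := by
  rw [← gS_pexp, coeff_gS]
  exact gop_mem _ _ _

theorem coeff_mul_mem {φ : Chart n M} {z : dom φ} {A B : PowerSeries (Module.End ℂ (Germ z))}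
    (hA : ∀ r, PowerSeries.coeff r A ∈ (germAlg z).diffOps)
    (hB : ∀ r, PowerSeries.coeff r B ∈ (germAlg z).diffOps) (r : ℕ) :
    PowerSeries.coeff r (A * B) ∈ (germAlg z).diffOps := by
  rw [PowerSeries.coeff_mul]
  exact Subalgebra.sum_mem _ fun p _ => Subalgebra.mul_mem _ (hA _) (hB _)

theorem coeff_C_mem {φ : Chart n M} {z : dom φ} (f : Germ z) (r : ℕ) :
    PowerSeries.coeff r (PowerSeries.C (mulOp f)) ∈ (germAlg z).diffOps := by
  rw [PowerSeries.coeff_C]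
  split_ifs
  · exact (germAlg z).mulOp_mem_diffOps f
  · exact Subalgebra.zero_mem _

theorem coeff_mul_apply {W : Type*} [AddCommGroup W] [Module ℂ W]
    (A B : PowerSeries (Module.End ℂ W)) (r : ℕ) (f : W) : PowerSeries.coeff r (A * B) f =
      ∑ p ∈ Finset.HasAntidiagonal.antidiagonal r,
        PowerSeries.coeff p.1 A (PowerSeries.coeff p.2 B f) := by
  rw [PowerSeries.coeff_mul, LinearMap.sum_apply]
  rfl

theorem coeff_mul_C_apply {W : Type*} [AddCommGroup W] [Module ℂ W]
    (A : PowerSeries (Module.End ℂ W)) (D : Module.End ℂ W) (r : ℕ) (f : W) :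
    PowerSeries.coeff r (A * PowerSeries.C D) f = PowerSeries.coeff r A (D f) := by
  rw [PowerSeries.coeff_mul_C]
  rfl

theorem sum_antidiagonal_eq_last {N : Type*} [AddCommMonoid N] (f : ℕ × ℕ → N) (r : ℕ)
    (h : ∀ p, 1 ≤ p.2 → f p = 0) :
    ∑ p ∈ Finset.HasAntidiagonal.antidiagonal r, f p = f (r, 0) := by
  refine Finset.sum_eq_single (r, 0) (fun p hp hne => h p ?_) fun hn => ?_
  · rw [Finset.HasAntidiagonal.mem_antidiagonal] at hp
    by_contra hc
    refine hne (Prod.ext ?_ ?_)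
    · change p.1 = r
      omega
    · change p.2 = 0
      omega
  · exact absurd (Finset.HasAntidiagonal.mem_antidiagonal.2 (by simp)) hn

/-- On products `a b₀` one has `L_b B(a b₀) = b * (b₀ * a) = (b b₀) * a = B(b a b₀)`, and by
`gS_ext` such products determine a differential operator; the right multiplications are treated
symmetrically. Taking one factor equal to `1` shows that `B` fixes holomorphic and antiholomorphic
functions, so its logarithm annihilates them. -/
theorem isSepProduct (h : IsBerezinPair c P) : IsSepProduct c P where
  memL := h.memL
  memR := h.memR
  assoc := h.assoc
  zero := h.zero
  hol_left := h.hol_left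
  antihol_right := h.antihol_right
  coeff_zero := h.coeff_zero
  exp_left φ z U hU hz b hb := by
    refine gS_ext (coeff_mul_mem (fun r => by rw [coeff_gS]; exact gop_mem _ _ _)
      (coeff_pexp_gS_mem φ z P)) (coeff_mul_mem (coeff_pexp_gS_mem φ z P) (coeff_C_mem (φ := φ) _))
      hU hz fun V hV hzV hVU a b₀ ha hb₀ r => ?_
    have hb' := hb.mono' hVU
    rw [coeff_mul_apply, coeff_mul_C_apply]
    simp only [h.apply_mul φ z V hV hzV a b₀ ha hb₀, coeff_gS_opL]
    rw [← map_sum, ← h.assoc, map_sum, sum_antidiagonal_eq_last]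
    · rw [h.zero, ← h.apply_mul φ z V hV hzV a (b * b₀) ha (hb'.mul' hb₀), map_mul (gm φ z)]
      congr 1
      rw [LinearMap.mulLeft_apply]
      ring
    · intro p hp
      exact h.gm_left (h.antihol_right φ z V hV hzV b₀ hb₀ _ hp _) _ _
  exp_right φ z U hU hz a ha := by
    refine gS_ext (coeff_mul_mem (fun r => by rw [coeff_gS]; exact gop_mem _ _ _)
      (coeff_pexp_gS_mem φ z P)) (coeff_mul_mem (coeff_pexp_gS_mem φ z P) (coeff_C_mem (φ := φ) _))
      hU hz fun V hV hzV hVU a₀ b ha₀ hb r => ?_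
    have ha' := ha.mono' hVU
    rw [coeff_mul_apply, coeff_mul_C_apply]
    simp only [h.apply_mul φ z V hV hzV a₀ b ha₀ hb, coeff_gS_opL, LinearMap.flip_apply]
    rw [← map_sum, h.assoc, map_sum, sum_antidiagonal_eq_last]
    · rw [h.zero, ← h.apply_mul φ z V hV hzV (a₀ * a) b (ha₀.mul' ha') hb, map_mul (gm φ z)]
      congr 1
      rw [LinearMap.mulLeft_apply]
      ring
    · intro p hp
      exact h.gm_right (h.hol_left φ z V hV hzV a₀ ha₀ _ hp _) _ _
  hol_apply φ z U hU hz a ha r := by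
    refine coeff_apply_eq_zero_of_pexp (by rw [coeff_gS, h.coeff_zero, map_zero])
      (fun m hm => ?_) r
    have h1 := h.apply_mul φ z U hU hz a 1 ha (antiholOn_one U) m
    rwa [map_one, mul_one, h.hol_left φ z U hU hz 1 (holOn_one U) m hm] at h1
  antihol_apply φ z U hU hz b hb r := by
    refine coeff_apply_eq_zero_of_pexp (by rw [coeff_gS, h.coeff_zero, map_zero])
      (fun m hm => ?_) r
    have h1 := h.apply_mul φ z U hU hz 1 b (holOn_one U) hb m
    rwa [map_one, one_mul, h.antihol_right φ z U hU hz 1 (antiholOn_one U) m hm] at h1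

/-! ### The dual product -/

theorem val_extS {c : ℕ → Fn n M →ₗ[ℂ] Fn n M →ₗ[ℂ] Fn n M} (h : ∀ r u, c r u ∈ diffOpAlg n M)
    (f : PowerSeries (Fn n M)) : FDO.val (extS (opL c h) f) = extS (lser c) f := by
  ext1 r
  rw [FDO.coeff_val, coeff_extS, coeff_extS, map_sum]
  refine Finset.sum_congr rfl fun p _ => ?_
  rw [coeff_opL, DOp.val_mk, coeff_lser]

/-- The series of multiplication operators of the dual product. -/
def dualOp {c : ℕ → Fn n M →ₗ[ℂ] Fn n M →ₗ[ℂ] Fn n M} (h : ∀ r u, c r u ∈ diffOpAlg n M)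
    (P : FDO n M) (u : Fn n M) : FDO n M :=
  negNu (pexp (-P) * extS (opL c h) (evalS (pexp (FDO.val P)) u) * pexp P)

theorem val_dualOp {c : ℕ → Fn n M →ₗ[ℂ] Fn n M →ₗ[ℂ] Fn n M} (h : ∀ r u, c r u ∈ diffOpAlg n M)
    (P : FDO n M) (u : Fn n M) : FDO.val (dualOp h P u) =
      negNu (pexp (-FDO.val P) * extS (lser c) (evalS (pexp (FDO.val P)) u) * pexp (FDO.val P)) := by
  rw [dualOp, FDO.val_negNu, map_mul FDO.val, map_mul FDO.val, FDO.val_pexp, FDO.val_pexp, val_extS, map_neg]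

/-- The dual of a formal product. -/
abbrev dual (c : ℕ → Fn n M →ₗ[ℂ] Fn n M →ₗ[ℂ] Fn n M) (P : FDO n M) :
    ℕ → Fn n M →ₗ[ℂ] Fn n M →ₗ[ℂ] Fn n M := dualC c (FDO.val P)

theorem val_coeff_dualOp_L (h : IsBerezinPair c P) (r : ℕ) (u : Fn n M) :
    DOp.val (PowerSeries.coeff r (dualOp h.memR P u)) = dual c P r u := by
  rw [← FDO.coeff_val, val_dualOp, ← coeff_lser (dual c P), lser_dualC, dualL_apply]
  rfl

theorem val_coeff_dualOp_R (h : IsBerezinPair c P) (r : ℕ) (u : Fn n M) :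
    DOp.val (PowerSeries.coeff r (dualOp h.memL P u)) = (dual c P r).flip u := by
  rw [← FDO.coeff_val, val_dualOp, ← coeff_rser (dual c P), rser_dualC, dualR_apply]

theorem dual_memL (h : IsBerezinPair c P) (r : ℕ) (u : Fn n M) : dual c P r u ∈ diffOpAlg n M := by
  rw [← h.val_coeff_dualOp_L]
  exact DOp.val_mem _

theorem dual_memR (h : IsBerezinPair c P) (r : ℕ) (u : Fn n M) :
    (dual c P r).flip u ∈ diffOpAlg n M := by
  rw [← h.val_coeff_dualOp_R]
  exact DOp.val_mem _

theorem opL_dual (h : IsBerezinPair c P) (u : Fn n M) :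
    opL (dual c P) h.dual_memL u = dualOp h.memR P u := by
  ext1 r
  refine DOp.val_injective ?_
  rw [coeff_opL, DOp.val_mk, h.val_coeff_dualOp_L]

theorem opR_dual (h : IsBerezinPair c P) (u : Fn n M) :
    opL (fun r => (dual c P r).flip) h.dual_memR u = dualOp h.memL P u := by
  ext1 r
  refine DOp.val_injective ?_
  rw [coeff_opL, DOp.val_mk, h.val_coeff_dualOp_R]

/-- If the higher coefficients of `f` vanish near the point, only its constant term multiplies. It
is needed because `B u = u` for `u` holomorphic or antiholomorphic near the point. -/
theorem gS_extS {c : ℕ → Fn n M →ₗ[ℂ] Fn n M →ₗ[ℂ] Fn n M} (h : ∀ r u, c r u ∈ diffOpAlg n M)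
    (h2 : ∀ r u, (c r).flip u ∈ diffOpAlg n M)
    {φ : Chart n M} {z : dom φ} {f : PowerSeries (Fn n M)}
    (hf : ∀ r, 1 ≤ r → gm φ z (PowerSeries.coeff r f) = 0) :
    gS φ z (extS (opL c h) f) = gS φ z (opL c h (PowerSeries.coeff 0 f)) := by
  ext1 r
  rw [coeff_gS, coeff_extS, map_sum, sum_antidiagonal_eq_last]
  · rw [coeff_gS]
  · intro p hp
    refine end_ext_of_gm fun v => ?_
    rw [← coeff_gS, coeff_gS_opL]
    exact gm_diffOp (h2 p.1 v) (hf _ hp)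

theorem gS_dualOp {c : ℕ → Fn n M →ₗ[ℂ] Fn n M →ₗ[ℂ] Fn n M} (h : ∀ r u, c r u ∈ diffOpAlg n M)
    (h2 : ∀ r u, (c r).flip u ∈ diffOpAlg n M) {φ : Chart n M} {z : dom φ} {u : Fn n M}
    (hu : ∀ r, 1 ≤ r → PowerSeries.coeff r (pexp (gS φ z P)) (gm φ z u) = 0) :
    gS φ z (dualOp h P u) =
      negNu (pexp (-gS φ z P) * gS φ z (opL c h u) * pexp (gS φ z P)) := by
  rw [dualOp, gS_negNu, map_mul (gS φ z), map_mul (gS φ z), gS_pexp, gS_pexp, map_neg, gS_extS h h2]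
  · rw [coeff_evalS, coeff_zero_pexp]
    rfl
  · intro r hr
    rw [coeff_evalS, ← hu r hr, ← gS_pexp, coeff_gS_gm, FDO.val_pexp]

theorem pexp_gS_dual (φ : Chart n M) (z : dom φ) (P : FDO n M) :
    pexp (gS φ z (-negNu P)) = negNu (pexp (-gS φ z P)) := by
  rw [negNu_pexp, map_neg, gS_negNu, map_neg]

theorem coeff_gS_dual_apply {φ : Chart n M} {z : dom φ} {r : ℕ} {f : Germ z}
    (h : PowerSeries.coeff r (gS φ z P) f = 0) :
    PowerSeries.coeff r (gS φ z (-negNu P)) f = 0 := by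
  rw [map_neg, gS_negNu, map_neg, LinearMap.neg_apply, neg_eq_zero]
  rcases Nat.even_or_odd r with hr | hr
  · rw [coeff_negNu_of_even hr, h]
  · rw [coeff_negNu_of_odd hr, LinearMap.neg_apply, h, neg_zero]

theorem pexp_hol (h : IsBerezinPair c P) {φ : Chart n M} {z : dom φ} {U : Set M} (hU : IsOpen U)
    (hz : pt φ z ∈ U) {a : Fn n M} (ha : HolOn (n := n) (Fn.fn a) U) (r : ℕ) (hr : 1 ≤ r) :
    PowerSeries.coeff r (pexp (gS φ z P)) (gm φ z a) = 0 := by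
  have h1 := h.apply_mul φ z U hU hz a 1 ha (antiholOn_one U) r
  rwa [map_one, mul_one, h.hol_left φ z U hU hz 1 (holOn_one U) r hr] at h1

theorem pexp_antihol (h : IsBerezinPair c P) {φ : Chart n M} {z : dom φ} {U : Set M}
    (hU : IsOpen U) (hz : pt φ z ∈ U) {b : Fn n M} (hb : AntiholOn (n := n) (Fn.fn b) U) (r : ℕ)
    (hr : 1 ≤ r) : PowerSeries.coeff r (pexp (gS φ z P)) (gm φ z b) = 0 := by
  have h1 := h.apply_mul φ z U hU hz 1 b (holOn_one U) hb r
  rwa [map_one, one_mul, h.antihol_right φ z U hU hz 1 (antiholOn_one U) r hr] at h1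

theorem coeff_zero_gS (h : IsBerezinPair c P) (φ : Chart n M) (z : dom φ) :
    PowerSeries.coeff 0 (gS φ z P) = 0 := by rw [coeff_gS, h.coeff_zero, map_zero]

theorem coeff_zero_val (h : IsBerezinPair c P) : PowerSeries.coeff 0 (FDO.val P) = 0 := by
  rw [FDO.coeff_val, h.coeff_zero, map_zero]

/-- If `V = e^P f e^{-P}`, conjugating back leaves `f`, which contains no `ν` to reverse. Hence the
dual product separates variables in the same way as the original one. -/
theorem gS_dual_eq_C {A : Type*} [Ring A] [Algebra ℂ A] {P V : PowerSeries A} {f : A}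
    (hP : PowerSeries.coeff 0 P = 0) (h : V * pexp P = pexp P * PowerSeries.C f) :
    negNu (pexp (-P) * V * pexp P) = PowerSeries.C f := by
  rw [mul_assoc, h, ← mul_assoc, pexp_neg_mul_pexp hP, one_mul, negNu_C]

/-- A pointwise multiplication becomes, after the dual conjugation, conjugated by `e^{P'}` with `P'
= -P(-ν)`; this identifies the logarithm belonging to the dual product. -/
theorem gS_dual_mul_pexp {A : Type*} [Ring A] [Algebra ℂ A] {P : PowerSeries A} (f : A)
    (hP : PowerSeries.coeff 0 P = 0) :
    negNu (pexp (-P) * PowerSeries.C f * pexp P) * negNu (pexp (-P)) =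
      negNu (pexp (-P)) * PowerSeries.C f := by
  rw [← map_mul, mul_assoc, pexp_mul_pexp_neg hP, mul_one, map_mul, negNu_C]

theorem dual_zero (h : IsBerezinPair c P) (u v : Fn n M) : dual c P 0 u v = u * v := by
  rw [← coeff_lser (dual c P), lser_dualC, dualL_apply, coeff_negNu_of_even Even.zero,
    coeff_zero_mul_eq, coeff_zero_mul_eq, coeff_zero_pexp, coeff_zero_pexp,
    one_mul, mul_one, coeff_extS]
  simp [coeff_rser, coeff_evalS, coeff_zero_pexp, h.zero, mul_comm]

/-- Duality exchanges the two kinds of operators: `R_a = e^P a e^{-P}` turns into the pointwise left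
multiplication by `a`, and the pointwise `R_b` turns into a conjugated left multiplication by `b`.
-/
theorem isSepProduct_dual (h : IsBerezinPair c P) : IsSepProduct (dual c P) (-negNu P) where
  memL := h.dual_memL
  memR := h.dual_memR
  assoc := isAssoc_dualC h.coeff_zero_val h.assoc
  zero := h.dual_zero
  hol_left φ z U hU hz a ha r hr v := by
    rw [← coeff_gS_opL h.dual_memL, opL_dual h, gS_dualOp h.memR h.memL (h.pexp_hol hU hz ha),
      gS_dual_eq_C (h.coeff_zero_gS φ z) (h.isSepProduct.exp_right φ z U hU hz a ha),
      PowerSeries.coeff_C, if_neg (by omega), LinearMap.zero_apply]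
  antihol_right φ z U hU hz b hb r hr u := by
    rw [← LinearMap.flip_apply, ← coeff_gS_opL h.dual_memR, opR_dual h,
      gS_dualOp h.memL h.memR (h.pexp_antihol hU hz hb),
      gS_dual_eq_C (h.coeff_zero_gS φ z) (h.isSepProduct.exp_left φ z U hU hz b hb),
      PowerSeries.coeff_C, if_neg (by omega), LinearMap.zero_apply]
  coeff_zero := by
    rw [map_neg, coeff_negNu_of_even Even.zero, h.coeff_zero, neg_zero]
  exp_left φ z U hU hz b hb := by
    have h1 := h.isSepProduct.gS_R_antihol hU hz hb
    rw [IsSepProduct.R] at h1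
    rw [opL_dual h, gS_dualOp h.memR h.memL (h.pexp_antihol hU hz hb), pexp_gS_dual, h1,
      gS_dual_mul_pexp _ (h.coeff_zero_gS φ z)]
  exp_right φ z U hU hz a ha := by
    have h1 := h.isSepProduct.gS_L_hol hU hz ha
    rw [IsSepProduct.L] at h1
    rw [opR_dual h, gS_dualOp h.memL h.memR (h.pexp_hol hU hz ha), pexp_gS_dual, h1,
      gS_dual_mul_pexp _ (h.coeff_zero_gS φ z)]
  hol_apply φ z U hU hz a ha r :=
    coeff_gS_dual_apply (h.isSepProduct.hol_apply φ z U hU hz a ha r)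
  antihol_apply φ z U hU hz b hb r :=
    coeff_gS_dual_apply (h.isSepProduct.antihol_apply φ z U hU hz b hb r)

end IsBerezinPair

end Star

end BerezinLog
end
noncomputable section
set_option linter.unusedSectionVars false
namespace BerezinLog

open CoordAlg

namespace CoordAlg

variable {n : ℕ} {R : Type*} [CommRing R] [Algebra ℂ R] (𝔠 : CoordAlg n R)

theorem dWord_map_apply {f : Fin n → Idx n} {q : R} (h : ∀ i, 𝔠.d (f i) q = 0)
    (w : List (Fin n)) : 𝔠.dWord (w.map f) q = if w = [] then q else 0 := by
  rcases w.eq_nil_or_concat' with rfl | ⟨w, i, rfl⟩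
  · rfl
  · rw [if_neg (by simp), List.map_append, List.map_singleton,
      𝔠.dWord_perm (List.perm_append_singleton (f i) (w.map f)), dWord_cons, dOp_dWord_comm,
      Module.End.mul_apply, dOp_apply, h, map_zero]

end CoordAlg

/-! ### A star product and its Berezin transform in the algebraic framework -/

section Transport

variable {n : ℕ} {M : Type*} [TopologicalSpace M] [ChartedSpace (Fin n → ℂ) M]
  [IsManifold 𝓘(ℂ, Fin n → ℂ) ω M]

/-- The coefficients of a formal product, as bilinear operations on `Fn`. -/
def fnC (C : ℕ → Smooth n M →ₗ[ℂ] Smooth n M →ₗ[ℂ] Smooth n M) :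
    ℕ → Fn n M →ₗ[ℂ] Fn n M →ₗ[ℂ] Fn n M := C

theorem fnC_apply (C : ℕ → Smooth n M →ₗ[ℂ] Smooth n M →ₗ[ℂ] Smooth n M) (r : ℕ) (u v : Fn n M) :
    fnC C r u v = Fn.of (C r (Fn.of.symm u) (Fn.of.symm v)) := rfl

/-- A formal operator, acting on `Fn`. -/
def fnOp (A : FormalOp n M) : PowerSeries (Module.End ℂ (Fn n M)) := A

theorem fnOp_formalExp (P : FormalOp n M) : fnOp (formalExp P) = pexp (fnOp P) := rfl

theorem coeff_fnOp_divNu (X : FormalOp n M) (r : ℕ) :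
    PowerSeries.coeff r (fnOp (divNu X)) = (PowerSeries.coeff (r + 1) X : Module.End ℂ (Smooth n M)) :=
  PowerSeries.coeff_mk r fun r => PowerSeries.coeff (r + 1) X

theorem exists_gm_eq_sum {C : Smooth n M →ₗ[ℂ] Smooth n M →ₗ[ℂ] Smooth n M}
    (hC : SeparatesVariables C) (φ : Chart n M) (z : dom φ) :
    ∃ c : (List (Fin n) × List (Fin n)) →₀ LocSmooth (dom φ), ∀ u v : Fn n M,
      gm φ z (Fn.of (C (Fn.of.symm u) (Fn.of.symm v))) = c.sum fun w a => germ z a *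
        (germAlg z).dWord (w.1.map Sum.inr) (gm φ z u) *
          (germAlg z).dWord (w.2.map Sum.inl) (gm φ z v) := by
  obtain ⟨c, hc⟩ := hC φ z
  refine ⟨c, fun u v => ?_⟩
  have h1 : gm φ z (Fn.of (C (Fn.of.symm u) (Fn.of.symm v))) = germ z (c.sum fun w a =>
      a * pdWord (w.1.map Sum.inr) (locF φ u) * pdWord (w.2.map Sum.inl) (locF φ v)) := by
    rw [gm_apply, germ_eq_iff]
    filter_upwards [hc] with w hw
    refine (hw (Fn.of.symm u) (Fn.of.symm v)).trans ?_
    rw [Finsupp.sum, Finsupp.sum, AddSubmonoidClass.coe_finsetSum, Finset.sum_apply]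
    rfl
  rw [h1, Finsupp.sum, Finsupp.sum, map_sum]
  refine Finset.sum_congr rfl fun w _ => ?_
  rw [map_mul, map_mul, germ_pdWord, germ_pdWord]
  rfl

/-- The first slot carries only antiholomorphic derivatives, which kill both `a` and `1`, so `a`
acts as `a` times the unit. The unit axiom then makes the higher coefficients vanish. -/
theorem gm_apply_holGerm {C : Smooth n M →ₗ[ℂ] Smooth n M →ₗ[ℂ] Smooth n M}
    (hC : SeparatesVariables C) {φ : Chart n M} {z : dom φ} {a : Fn n M} (ha : HolGerm (gm φ z a))
    (v : Fn n M) : gm φ z (Fn.of (C (Fn.of.symm a) (Fn.of.symm v))) =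
      gm φ z a * gm φ z (Fn.of (C 1 (Fn.of.symm v))) := by
  obtain ⟨c, hc⟩ := exists_gm_eq_sum hC φ z
  have h1 := hc 1 v
  rw [map_one Fn.of.symm] at h1
  have hone : ∀ l, (germAlg z).d (Sum.inr l) (1 : Germ z) = 0 := fun l =>
    ((germAlg z).d (Sum.inr l)).map_one_eq_zero
  rw [hc, h1, Finsupp.sum, Finsupp.sum, Finset.mul_sum]
  refine Finset.sum_congr rfl fun w _ => ?_
  rw [map_one, dWord_map_apply _ ha, dWord_map_apply _ hone]
  split_ifs <;> ring

theorem gm_apply_antiholGerm {C : Smooth n M →ₗ[ℂ] Smooth n M →ₗ[ℂ] Smooth n M}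
    (hC : SeparatesVariables C) {φ : Chart n M} {z : dom φ} {b : Fn n M}
    (hb : AntiholGerm (gm φ z b)) (u : Fn n M) :
    gm φ z (Fn.of (C (Fn.of.symm u) (Fn.of.symm b))) =
      gm φ z b * gm φ z (Fn.of (C (Fn.of.symm u) 1)) := by
  obtain ⟨c, hc⟩ := exists_gm_eq_sum hC φ z
  have h1 := hc u 1
  rw [map_one Fn.of.symm] at h1
  have hone : ∀ l, (germAlg z).d (Sum.inl l) (1 : Germ z) = 0 := fun l =>
    ((germAlg z).d (Sum.inl l)).map_one_eq_zero
  rw [hc, h1, Finsupp.sum, Finsupp.sum, Finset.mul_sum]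
  refine Finset.sum_congr rfl fun w _ => ?_
  rw [map_one, dWord_map_apply _ hb, dWord_map_apply _ hone]
  split_ifs <;> ring

theorem diffOps_sum_smul {φ : Chart n M} {ι : Type*} (t : Finset ι) (a : ι → LocSmooth (dom φ))
    (w : ι → List (Idx n)) :
    ∑ i ∈ t, a i • (locAlg (dom φ)).dWord (w i) ∈ (locAlg (dom φ)).diffOps := by
  refine Subalgebra.sum_mem _ fun i _ => ⟨(w i).length, ?_⟩
  exact Submodule.smul_mem _ _ ((locAlg (dom φ)).dWord_mem le_rfl)

theorem mem_diffOpAlg_left {C : Smooth n M →ₗ[ℂ] Smooth n M →ₗ[ℂ] Smooth n M}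
    (hC : IsBidiffOp C) (u : Smooth n M) : (C u : Module.End ℂ (Fn n M)) ∈ diffOpAlg n M := by
  refine isDiffOp_iff.2 fun φ z₀ => ?_
  obtain ⟨c, hc⟩ := hC φ z₀
  refine ⟨_, diffOps_sum_smul c.support (fun w => c w * pdWord w.1 (loc φ u)) fun w => w.2, ?_⟩
  filter_upwards [hc] with z hz f
  refine (hz u (Fn.of.symm f)).trans ?_
  rw [LinearMap.sum_apply, AddSubmonoidClass.coe_finsetSum, Finset.sum_apply]
  rfl

theorem mem_diffOpAlg_right {C : Smooth n M →ₗ[ℂ] Smooth n M →ₗ[ℂ] Smooth n M}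
    (hC : IsBidiffOp C) (v : Smooth n M) :
    (C.flip v : Module.End ℂ (Fn n M)) ∈ diffOpAlg n M := by
  refine isDiffOp_iff.2 fun φ z₀ => ?_
  obtain ⟨c, hc⟩ := hC φ z₀
  refine ⟨_, diffOps_sum_smul c.support (fun w => c w * pdWord w.2 (loc φ v)) fun w => w.1, ?_⟩
  filter_upwards [hc] with z hz f
  refine (hz (Fn.of.symm f) v).trans ?_
  rw [LinearMap.sum_apply, AddSubmonoidClass.coe_finsetSum, Finset.sum_apply]
  refine Finset.sum_congr rfl fun w _ => ?_
  exact mul_right_comm _ _ _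

/-- The logarithm is taken formally among all endomorphisms; by `coeff_mem_of_pexp` its coefficients
stay in the subalgebra that contains those of `B`. -/
theorem coeff_fnOp_mem {C : ℕ → Smooth n M →ₗ[ℂ] Smooth n M →ₗ[ℂ] Smooth n M} {B X : FormalOp n M}
    (hB : IsBerezinTransform C B) (hX1 : PowerSeries.coeff 1 X = 0)
    (hX : B = formalExp (divNu X)) (r : ℕ) :
    PowerSeries.coeff r (fnOp (divNu X)) ∈ diffOpAlg n M := by
  refine coeff_mem_of_pexp ((coeff_fnOp_divNu X 0).trans hX1) _ (fun m => ?_) r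
  rw [← fnOp_formalExp, ← hX]
  exact hB.diffOp m

/-- The logarithm of the formal Berezin transform. -/
def logOp {C : ℕ → Smooth n M →ₗ[ℂ] Smooth n M →ₗ[ℂ] Smooth n M} {B X : FormalOp n M}
    (hB : IsBerezinTransform C B) (hX1 : PowerSeries.coeff 1 X = 0)
    (hX : B = formalExp (divNu X)) : FDO n M :=
  FDO.lift (fnOp (divNu X)) (coeff_fnOp_mem hB hX1 hX)

variable [T2Space M]

theorem isBerezinPair {g : Tensor11 n M}
    {C : ℕ → Smooth n M →ₗ[ℂ] Smooth n M →ₗ[ℂ] Smooth n M} (hC : IsStarProductSep g C)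
    {B X : FormalOp n M} (hB : IsBerezinTransform C B) (hX1 : PowerSeries.coeff 1 X = 0)
    (hX : B = formalExp (divNu X)) : IsBerezinPair (fnC C) (logOp hB hX1 hX) where
  memL r u := mem_diffOpAlg_left (hC.bidiff r) (Fn.of.symm u)
  memR r u := mem_diffOpAlg_right (hC.bidiff r) (Fn.of.symm u)
  assoc := hC.assoc
  zero := hC.zero
  hol_left φ z U hU hz a ha r hr v := by
    rw [fnC_apply, gm_apply_holGerm (hC.sep r) (holGerm_of_holOn hU ha hz), hC.one_left r hr,
      map_zero, map_zero, mul_zero]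
  antihol_right φ z U hU hz b hb r hr u := by
    rw [fnC_apply, gm_apply_antiholGerm (hC.sep r) (antiholGerm_of_antiholOn hU hb hz),
      hC.one_right r hr, map_zero, map_zero, mul_zero]
  coeff_zero := DOp.val_injective (by
    rw [logOp, FDO.coeff_lift, DOp.val_mk, map_zero]
    exact (coeff_fnOp_divNu X 0).trans hX1)
  apply_mul φ z U hU hz a b ha hb r := by
    rw [← gS_pexp, ← map_mul, coeff_gS_gm, FDO.val_pexp, logOp, FDO.val_lift, ← fnOp_formalExp, ← hX,
      gm_eq_iff]
    filter_upwards [hU.mem_nhds hz] with x hx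
    exact hB.apply_mul U hU (Fn.of.symm a) (Fn.of.symm b) ha hb r x hx

end Transport

end BerezinLog
end
noncomputable section
set_option linter.unusedSectionVars false
namespace BerezinLog

open CoordAlg

/-! ### Low order coefficients of exponentials and commutators -/

section Algebra

theorem coeff_one_pexp {A : Type*} [Ring A] [Algebra ℂ A] (P : PowerSeries A) :
    PowerSeries.coeff 1 (pexp P) = PowerSeries.coeff 1 P := by
  rw [coeff_pexp_eq le_rfl]
  simp

theorem coeff_two_pexp {A : Type*} [Ring A] [Algebra ℂ A] {P : PowerSeries A}
    (hP : PowerSeries.coeff 0 P = 0) : PowerSeries.coeff 2 (pexp P) =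
      PowerSeries.coeff 2 P + (1 / 2 : ℂ) • (PowerSeries.coeff 1 P * PowerSeries.coeff 1 P) := by
  rw [coeff_pexp_eq (by norm_num), Finset.sum_Ico_eq_sum_range]
  simp [pow_two, PowerSeries.coeff_mul, Finset.Nat.antidiagonal_succ, hP]

theorem coeff_pexp_apply_eq_zero {W : Type*} [AddCommGroup W] [Module ℂ W]
    {P : PowerSeries (Module.End ℂ W)} {a : W} (h : ∀ m, PowerSeries.coeff m P a = 0) {m : ℕ}
    (hm : 1 ≤ m) : PowerSeries.coeff m (pexp P) a = 0 := by
  rw [coeff_pexp, LinearMap.sum_apply]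
  refine Finset.sum_eq_zero fun j _ => ?_
  rw [LinearMap.smul_apply]
  rcases j with _ | j
  · rw [pow_zero, PowerSeries.coeff_one, if_neg (by omega), LinearMap.zero_apply, smul_zero]
  · rw [pow_succ, IsBerezinPair.coeff_mul_apply]
    simp [h]

/-- The consequence in the third order of the commutation of two multiplication operators. -/
theorem cross_symm_of_commute {R : Type*} [CommRing R] [Algebra ℂ R]
    {V W : PowerSeries (Module.End ℂ R)} (hc : Commute V W) {x y p : R}
    (hV0 : PowerSeries.coeff 0 V = mulOp x) (hW0 : PowerSeries.coeff 0 W = mulOp y)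
    (hV : PowerSeries.coeff 3 V (y * p) = y * PowerSeries.coeff 3 V p)
    (hW : PowerSeries.coeff 3 W (x * p) = x * PowerSeries.coeff 3 W p) :
    PowerSeries.coeff 1 V (PowerSeries.coeff 2 W p) + PowerSeries.coeff 2 V (PowerSeries.coeff 1 W p) =
      PowerSeries.coeff 1 W (PowerSeries.coeff 2 V p) +
        PowerSeries.coeff 2 W (PowerSeries.coeff 1 V p) := by
  -- In coefficient three the outer terms pair index three with index zero. By `hV` and `hW` they
  -- cancel between the two products, leaving only the terms that mix indices one and two.
  have h := congrArg (fun A : PowerSeries (Module.End ℂ R) => PowerSeries.coeff 3 A p) hc.eq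
  simp only [IsBerezinPair.coeff_mul_apply, Finset.Nat.antidiagonal_succ, Finset.Nat.antidiagonal_zero,
    Finset.sum_cons, Finset.map_singleton, Finset.sum_singleton,
    Finset.map_cons, hV0, hW0] at h
  simp [hV0, hW0, -PowerSeries.coeff_zero_eq_constantCoeff] at h
  rw [hV, hW] at h
  linear_combination h

end Algebra

/-! ### Mixed second order operators and Poisson brackets at germs -/

section Formulas

variable {n : ℕ} {M : Type*} [TopologicalSpace M] [ChartedSpace (Fin n → ℂ) M]
  [IsManifold 𝓘(ℂ, Fin n → ℂ) ω M] [T2Space M]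

/-- In `v` the operation has order one and kills `1` and antiholomorphic coordinates, so only the
derivatives `∂_k` remain; the same argument in `u` leaves the conjugate derivatives. -/
theorem bilinear_formula {φ : Chart n M} {z : dom φ} {Δ : Fn n M → Fn n M → Germ z}
    {DL DR : Fn n M → Module.End ℂ (Germ z)} (hL : ∀ u v, DL u (gm φ z v) = Δ u v)
    (hR : ∀ u v, DR v (gm φ z u) = Δ u v) (oL : ∀ u, DL u ∈ (germAlg z).ordLE 1)
    (oR : ∀ u, DR u ∈ (germAlg z).ordLE 1) {U : Set M}
    (hol : ∀ a, HolOn (n := n) (Fn.fn a) U → ∀ v, Δ a v = 0)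
    (anti : ∀ b, AntiholOn (n := n) (Fn.fn b) U → ∀ u, Δ u b = 0) {X : Idx n → Fn n M}
    (hX : ∀ s, gm φ z (X s) = (germAlg z).x s)
    (hX1 : ∀ k, HolOn (n := n) (Fn.fn (X (Sum.inl k))) U)
    (hX2 : ∀ l, AntiholOn (n := n) (Fn.fn (X (Sum.inr l))) U) (u v : Fn n M) :
    Δ u v = ∑ l, ∑ k, Δ (X (Sum.inr l)) (X (Sum.inl k)) *
      (germAlg z).d (Sum.inr l) (gm φ z u) * (germAlg z).d (Sum.inl k) (gm φ z v) := by
  have h1 : Δ u v = ∑ k, Δ u (X (Sum.inl k)) * (germAlg z).d (Sum.inl k) (gm φ z v) := by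
    rw [← hL, apply_of_hol (oL u) (by rw [← map_one (gm φ z), hL, anti 1 (antiholOn_one U)])
      fun l => by rw [← hX, hL, anti _ (hX2 l)]]
    simp only [← hX, hL]
  have h2 : ∀ w, Δ u w = ∑ l, Δ (X (Sum.inr l)) w * (germAlg z).d (Sum.inr l) (gm φ z u) := by
    intro w
    rw [← hR, apply_of_antihol (oR w) (by rw [← map_one (gm φ z), hR, hol 1 (holOn_one U)])
      fun l => by rw [← hX, hR, hol _ (hX1 l)]]
    simp only [← hX, hR]
  rw [h1, Finset.sum_comm]
  refine Finset.sum_congr rfl fun k _ => ?_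
  rw [h2, Finset.sum_mul]

theorem coeff_quadratic {R : Type*} [CommRing R] (t : Fin n → Fin n → R) (l k : Fin n) :
    MvPowerSeries.coeff (Finsupp.single (Sum.inl k : Idx n) 1 + Finsupp.single (Sum.inr l) 1)
      (∑ l, ∑ k, MvPowerSeries.C (t l k) * MvPowerSeries.X (Sum.inl k : Idx n) *
        MvPowerSeries.X (Sum.inr l : Idx n)) = t l k := by
  classical
  have h1 : ∀ l' k', MvPowerSeries.C (t l' k') * MvPowerSeries.X (Sum.inl k' : Idx n) *
      MvPowerSeries.X (Sum.inr l' : Idx n) = MvPowerSeries.monomial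
        (Finsupp.single (Sum.inl k' : Idx n) 1 + Finsupp.single (Sum.inr l') 1) (t l' k') := by
    intro l' k'
    rw [MvPowerSeries.X, MvPowerSeries.X, ← MvPowerSeries.monomial_zero_eq_C_apply,
      MvPowerSeries.monomial_mul_monomial, MvPowerSeries.monomial_mul_monomial]
    simp
  have h2 : ∀ l' k', (Finsupp.single (Sum.inl k : Idx n) 1 + Finsupp.single (Sum.inr l) 1 =
      Finsupp.single (Sum.inl k' : Idx n) 1 + Finsupp.single (Sum.inr l') 1) ↔ (l = l' ∧ k = k') := by
    intro l' k'
    constructor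
    · intro h
      have ha := DFunLike.congr_fun h (Sum.inl k)
      have hb := DFunLike.congr_fun h (Sum.inr l)
      simp [Finsupp.single_apply] at ha hb
      exact ⟨hb.symm, ha.symm⟩
    · rintro ⟨rfl, rfl⟩
      rfl
  simp only [map_sum, h1, MvPowerSeries.coeff_monomial, h2]
  rw [Finset.sum_eq_single l, Finset.sum_eq_single k]
  · simp
  · intro b _ hb
    rw [if_neg fun h => hb h.2.symm]
  · simp
  · intro b _ hb
    exact Finset.sum_eq_zero fun c _ => if_neg fun h => hb h.1.symm
  · simp

/-- A second order operator that vanishes on holomorphic and on antiholomorphic functions. -/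
structure IsMixed (D : DOp n M) : Prop where
  ordLE : OrdLE 2 D
  hol : ∀ (φ : Chart n M) (z : dom φ) (U : Set M), IsOpen U → pt φ z ∈ U → ∀ a : Fn n M,
    HolOn (n := n) (Fn.fn a) U → gop φ z D (gm φ z a) = 0
  antihol : ∀ (φ : Chart n M) (z : dom φ) (U : Set M), IsOpen U → pt φ z ∈ U → ∀ b : Fn n M,
    AntiholOn (n := n) (Fn.fn b) U → gop φ z D (gm φ z b) = 0

/-- The components of a mixed second order operator. -/
def mixComp (D : DOp n M) (φ : Chart n M) (l k : Fin n) : LocSmooth (dom φ) :=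
  MvPowerSeries.coeff (Finsupp.single (Sum.inl k : Idx n) 1 + Finsupp.single (Sum.inr l) 1) (symF φ D)

namespace IsMixed

variable {D : DOp n M} (h : IsMixed D)
include h

/-- A product of two coordinates of the same type is again holomorphic or antiholomorphic and is
therefore annihilated; `eq_of_ordLE_two` leaves only mixed derivatives. -/
theorem gop_eq (φ : Chart n M) (z : dom φ) : gop φ z D =
    ∑ l, ∑ k, gop φ z D ((germAlg z).x (Sum.inl k) * (germAlg z).x (Sum.inr l)) •
      (germAlg z).dWord [Sum.inl k, Sum.inr l] := by
  obtain ⟨X, U, hU, hz, hX, hX1, hX2⟩ := exists_coordinates φ z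
  refine eq_of_ordLE_two (h.ordLE φ z) ?_ (fun s => ?_) fun s t hst => ?_
  · rw [← map_one (gm φ z)]
    exact h.hol φ z U hU hz 1 (holOn_one U)
  · rw [← hX]
    rcases s with k | l
    · exact h.hol φ z U hU hz _ (hX1 k)
    · exact h.antihol φ z U hU hz _ (hX2 l)
  · rw [← hX, ← hX, ← map_mul (gm φ z)]
    rcases s with s | s <;> rcases t with t | t
    · exact h.hol φ z U hU hz _ ((hX1 s).mul' (hX1 t))
    · simp [SameType] at hst
    · simp [SameType] at hst
    · exact h.antihol φ z U hU hz _ ((hX2 s).mul' (hX2 t))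

theorem sym_eq (φ : Chart n M) (z : dom φ) : (germAlg z).sym (gop φ z D) =
    ∑ l, ∑ k, MvPowerSeries.C (gop φ z D ((germAlg z).x (Sum.inl k) * (germAlg z).x (Sum.inr l))) *
      MvPowerSeries.X (Sum.inl k : Idx n) * MvPowerSeries.X (Sum.inr l : Idx n) := by
  conv_lhs => rw [h.gop_eq φ z]
  simp only [sym_sum, sym_smul, sym_dWord, wordMon, List.map_cons, List.map_nil, List.prod_cons,
    List.prod_nil, mul_one, mul_assoc]

theorem germ_mixComp (φ : Chart n M) (z : dom φ) (l k : Fin n) : germ z (mixComp D φ l k) =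
    gop φ z D ((germAlg z).x (Sum.inl k) * (germAlg z).x (Sum.inr l)) := by
  rw [mixComp, germ_symF, h.sym_eq, coeff_quadratic fun l k =>
    gop φ z D ((germAlg z).x (Sum.inl k) * (germAlg z).x (Sum.inr l))]

theorem locF_apply_eq (φ : Chart n M) (f : Fn n M) : locF φ (DOp.val D f) =
    ∑ l, ∑ k, mixComp D φ l k * pd (Sum.inl k) (pd (Sum.inr l) (locF φ f)) := by
  refine eq_of_germ_eq fun z => ?_
  rw [← gm_apply, ← gop_gm, h.gop_eq]
  simp only [LinearMap.sum_apply, map_sum, LinearMap.smul_apply, map_mul, ← h.germ_mixComp]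
  refine Finset.sum_congr rfl fun l _ => Finset.sum_congr rfl fun k _ => ?_
  rw [smul_eq_mul, gm_apply, ← germ_pdWord]
  rfl

end IsMixed

/-! ### The bracket of a tensor at germs -/

theorem loc_bracket (t : Tensor11 n M) (φ : Chart n M) (u v : Smooth n M) :
    loc φ (bracket t u v) = locBracket t φ u v := by
  refine Subtype.ext (funext fun z => ?_)
  exact locBracket_compat t _ φ u v _ z (pt_coord _ _ _)

theorem gm_bracket (t : Tensor11 n M) (φ : Chart n M) (z : dom φ) (u v : Smooth n M) :
    gm φ z (Fn.of (bracket t u v)) = ∑ l, ∑ k, germ z (t.comp φ l k) *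
      ((germAlg z).d (Sum.inr l) (gm φ z (Fn.of u)) * (germAlg z).d (Sum.inl k) (gm φ z (Fn.of v)) -
        (germAlg z).d (Sum.inl k) (gm φ z (Fn.of u)) *
          (germAlg z).d (Sum.inr l) (gm φ z (Fn.of v))) := by
  rw [gm_apply, locF_of, loc_bracket, locBracket]
  simp only [map_sum, map_mul, map_sub, gm_apply, locF_of, germAlg_d]

end Formulas

end BerezinLog
end
noncomputable section
set_option linter.unusedSectionVars false
namespace BerezinLog

open CoordAlg

/-! ### Coefficients of orders one and two, and the deformation tensor -/

section Low

variable {n : ℕ} {M : Type*} [TopologicalSpace M] [ChartedSpace (Fin n → ℂ) M]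
  [IsManifold 𝓘(ℂ, Fin n → ℂ) ω M] [T2Space M]
  {c : ℕ → Fn n M →ₗ[ℂ] Fn n M →ₗ[ℂ] Fn n M} {P : FDO n M}

theorem ordLE_csmul {R : Type*} [CommRing R] [Algebra ℂ R] {𝔠 : CoordAlg n R} {r : ℤ} (a : ℂ)
    {D : Module.End ℂ R} (hD : D ∈ 𝔠.ordLE r) : a • D ∈ 𝔠.ordLE r := by
  rw [← algebraMap_smul R a D]
  exact Submodule.smul_mem _ _ hD

namespace IsSepProduct

/-- A product with separation of variables is determined by `exp P`. -/
theorem apply_mul (h : IsSepProduct c P) {φ : Chart n M} {z : dom φ} {U : Set M} (hU : IsOpen U)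
    (hz : pt φ z ∈ U) {a b : Fn n M} (ha : HolOn (n := n) (Fn.fn a) U)
    (hb : AntiholOn (n := n) (Fn.fn b) U) (r : ℕ) :
    PowerSeries.coeff r (pexp (gS φ z P)) (gm φ z a * gm φ z b) = gm φ z (c r b a) := by
  have h1 := congrArg (fun A : PowerSeries (Module.End ℂ (Germ z)) =>
    PowerSeries.coeff r A (gm φ z a)) (h.exp_left φ z U hU hz b hb)
  simp only [IsBerezinPair.coeff_mul_C_apply] at h1
  rw [IsBerezinPair.coeff_mul_apply, IsBerezinPair.sum_antidiagonal_eq_last] at h1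
  · rw [coeff_zero_pexp, Module.End.one_apply, IsBerezinPair.coeff_gS_opL, LinearMap.mulLeft_apply]
      at h1
    rw [h1, mul_comm]
  · intro p hp
    rw [coeff_pexp_apply_eq_zero (h.hol_apply φ z U hU hz a ha) hp, map_zero]

/-- `L_u` commutes with `R_b`, and `R_b` is pointwise multiplication by `b`. -/
theorem mul_antihol (h : IsSepProduct c P) {φ : Chart n M} {z : dom φ} {U : Set M} (hU : IsOpen U)
    (hz : pt φ z ∈ U) {b : Fn n M} (hb : AntiholOn (n := n) (Fn.fn b) U) (r : ℕ) (u : Fn n M)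
    (f : Germ z) : PowerSeries.coeff r (gS φ z (h.L u)) (gm φ z b * f) =
      gm φ z b * PowerSeries.coeff r (gS φ z (h.L u)) f := by
  have h1 := ((h.commute u b).map (gS φ z)).eq
  rw [h.gS_R_antihol hU hz hb] at h1
  have h2 := congrArg (PowerSeries.coeff r) h1
  rw [PowerSeries.coeff_mul_C, PowerSeries.coeff_C_mul] at h2
  exact LinearMap.congr_fun h2 f

theorem mul_hol (h : IsSepProduct c P) {φ : Chart n M} {z : dom φ} {U : Set M} (hU : IsOpen U)
    (hz : pt φ z ∈ U) {a : Fn n M} (ha : HolOn (n := n) (Fn.fn a) U) (r : ℕ) (u : Fn n M)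
    (f : Germ z) : PowerSeries.coeff r (gS φ z (h.R u)) (gm φ z a * f) =
      gm φ z a * PowerSeries.coeff r (gS φ z (h.R u)) f := by
  have h1 := ((h.commute a u).map (gS φ z)).eq
  rw [h.gS_L_hol hU hz ha] at h1
  have h2 := congrArg (PowerSeries.coeff r) h1
  rw [PowerSeries.coeff_mul_C, PowerSeries.coeff_C_mul] at h2
  exact (LinearMap.congr_fun h2 f).symm

theorem commute_of_conj {A : Type*} [Ring A] [Algebra ℂ A] {P V W : PowerSeries A} {v w : A}
    (hP : PowerSeries.coeff 0 P = 0) (hV : V * pexp P = pexp P * PowerSeries.C v)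
    (hW : W * pexp P = pexp P * PowerSeries.C w) (h : v * w = w * v) : Commute V W := by
  have h1 : V * W * pexp P = W * V * pexp P := by
    rw [mul_assoc, hW, ← mul_assoc, hV, mul_assoc W, hV, ← mul_assoc, hW, mul_assoc, mul_assoc,
      ← map_mul, ← map_mul, h]
  have h2 := congrArg (· * pexp (-P)) h1
  simp only [mul_assoc, pexp_mul_pexp_neg hP, mul_one] at h2
  exact h2

theorem commute_L_antihol (h : IsSepProduct c P) {φ : Chart n M} {z : dom φ} {U : Set M}
    (hU : IsOpen U) (hz : pt φ z ∈ U) {b b' : Fn n M} (hb : AntiholOn (n := n) (Fn.fn b) U)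
    (hb' : AntiholOn (n := n) (Fn.fn b') U) : Commute (gS φ z (h.L b)) (gS φ z (h.L b')) :=
  commute_of_conj (h.coeff_zero_gS φ z) (h.exp_left φ z U hU hz b hb)
    (h.exp_left φ z U hU hz b' hb') (LinearMap.ext fun f => by simp [mul_left_comm])

theorem commute_R_hol (h : IsSepProduct c P) {φ : Chart n M} {z : dom φ} {U : Set M}
    (hU : IsOpen U) (hz : pt φ z ∈ U) {a a' : Fn n M} (ha : HolOn (n := n) (Fn.fn a) U)
    (ha' : HolOn (n := n) (Fn.fn a') U) : Commute (gS φ z (h.R a)) (gS φ z (h.R a')) :=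
  commute_of_conj (h.coeff_zero_gS φ z) (h.exp_right φ z U hU hz a ha)
    (h.exp_right φ z U hU hz a' ha') (LinearMap.ext fun f => by simp [mul_left_comm])

theorem L_cross (h : IsSepProduct c P) {φ : Chart n M} {z : dom φ} {U : Set M} (hU : IsOpen U)
    (hz : pt φ z ∈ U) {b b' : Fn n M} (hb : AntiholOn (n := n) (Fn.fn b) U)
    (hb' : AntiholOn (n := n) (Fn.fn b') U) (f : Germ z) :
    PowerSeries.coeff 1 (gS φ z (h.L b)) (PowerSeries.coeff 2 (gS φ z (h.L b')) f) +
      PowerSeries.coeff 2 (gS φ z (h.L b)) (PowerSeries.coeff 1 (gS φ z (h.L b')) f) =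
    PowerSeries.coeff 1 (gS φ z (h.L b')) (PowerSeries.coeff 2 (gS φ z (h.L b)) f) +
      PowerSeries.coeff 2 (gS φ z (h.L b')) (PowerSeries.coeff 1 (gS φ z (h.L b)) f) :=
  cross_symm_of_commute (h.commute_L_antihol hU hz hb hb') (h.coeff_zero_L φ z b)
    (h.coeff_zero_L φ z b') (h.mul_antihol hU hz hb' _ _ _) (h.mul_antihol hU hz hb _ _ _)

theorem R_cross (h : IsSepProduct c P) {φ : Chart n M} {z : dom φ} {U : Set M} (hU : IsOpen U)
    (hz : pt φ z ∈ U) {a a' : Fn n M} (ha : HolOn (n := n) (Fn.fn a) U)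
    (ha' : HolOn (n := n) (Fn.fn a') U) (f : Germ z) :
    PowerSeries.coeff 1 (gS φ z (h.R a)) (PowerSeries.coeff 2 (gS φ z (h.R a')) f) +
      PowerSeries.coeff 2 (gS φ z (h.R a)) (PowerSeries.coeff 1 (gS φ z (h.R a')) f) =
    PowerSeries.coeff 1 (gS φ z (h.R a')) (PowerSeries.coeff 2 (gS φ z (h.R a)) f) +
      PowerSeries.coeff 2 (gS φ z (h.R a')) (PowerSeries.coeff 1 (gS φ z (h.R a)) f) :=
  cross_symm_of_commute (h.commute_R_hol hU hz ha ha') (h.coeff_zero_R φ z a)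
    (h.coeff_zero_R φ z a') (h.mul_hol hU hz ha' _ _ _) (h.mul_hol hU hz ha _ _ _)

end IsSepProduct

namespace IsBerezinPair

/-- In odd coefficients the sign of the logarithm and the sign of `ν` cancel. -/
theorem coeff_one_dual (P : FDO n M) : PowerSeries.coeff 1 P = PowerSeries.coeff 1 (-negNu P) := by
  rw [map_neg, coeff_negNu_of_odd odd_one, neg_neg]

variable (h : IsBerezinPair c P)

theorem natL (u : Fn n M) : IsNatPair (h.isSepProduct.L u) (h.isSepProduct_dual.L u) :=
  IsSepProduct.isNatPair_L _ _ (coeff_one_dual P) u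

theorem natR (u : Fn n M) : IsNatPair (h.isSepProduct.R u) (h.isSepProduct_dual.R u) :=
  IsSepProduct.isNatPair_R _ _ (coeff_one_dual P) u

include h in
theorem natX : IsNatPair (PowerSeries.X * P) (PowerSeries.X * -negNu P) :=
  IsSepProduct.isNatPair_X_mul h.isSepProduct h.isSepProduct_dual (coeff_one_dual P)

/-- In even coefficients the two signs do not cancel, so comparison with the dual isolates exactly
the operators that make up `Y`. -/
theorem coeff_sub_dual_of_even {r : ℕ} (hr : Even r) (P : FDO n M) :
    PowerSeries.coeff (r + 1) (PowerSeries.X * P) -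
      PowerSeries.coeff (r + 1) (PowerSeries.X * -negNu P) = (2 : ℂ) • PowerSeries.coeff r P := by
  rw [PowerSeries.coeff_succ_X_mul, PowerSeries.coeff_succ_X_mul, map_neg, coeff_negNu_of_even hr,
    sub_neg_eq_add, two_smul]

theorem coeff_sub_dual_of_odd {r : ℕ} (hr : Odd r) (P : FDO n M) :
    PowerSeries.coeff (r + 1) (PowerSeries.X * P) -
      PowerSeries.coeff (r + 1) (PowerSeries.X * -negNu P) = 0 := by
  rw [PowerSeries.coeff_succ_X_mul, PowerSeries.coeff_succ_X_mul, map_neg, coeff_negNu_of_odd hr,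
    neg_neg, sub_self]

include h

/-- The general bound for `P_r` is `r + 1`. One order is gained because `2P_r` is a difference in
the natural pair `(νP, νP')`. -/
theorem ordLE_of_even {r : ℕ} (hr : Even r) : OrdLE r (PowerSeries.coeff r P) := by
  intro φ z
  have h1 := h.natX.ordLE_sub r φ z
  rw [coeff_sub_dual_of_even hr, map_smul] at h1
  have h2 := ordLE_csmul (1 / 2 : ℂ) h1
  rwa [smul_smul, one_div, inv_mul_cancel₀ two_ne_zero, one_smul] at h2

theorem isMixed_one : IsMixed (PowerSeries.coeff 1 P) where
  ordLE φ z := by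
    have h1 := h.natX.ordLE 2 φ z
    rwa [PowerSeries.coeff_succ_X_mul] at h1
  hol φ z U hU hz a ha := by
    rw [← coeff_gS]
    exact h.isSepProduct.hol_apply φ z U hU hz a ha 1
  antihol φ z U hU hz a ha := by
    rw [← coeff_gS]
    exact h.isSepProduct.antihol_apply φ z U hU hz a ha 1

theorem isMixed_two : IsMixed (PowerSeries.coeff 2 P) where
  ordLE := h.ordLE_of_even even_two
  hol φ z U hU hz a ha := by
    rw [← coeff_gS]
    exact h.isSepProduct.hol_apply φ z U hU hz a ha 2
  antihol φ z U hU hz a ha := by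
    rw [← coeff_gS]
    exact h.isSepProduct.antihol_apply φ z U hU hz a ha 2

theorem gm_one (φ : Chart n M) (z : dom φ) (u v : Fn n M) : gm φ z (c 1 u v) =
    ∑ l, ∑ k, germ z (mixComp (PowerSeries.coeff 1 P) φ l k) *
      (germAlg z).d (Sum.inr l) (gm φ z u) * (germAlg z).d (Sum.inl k) (gm φ z v) := by
  obtain ⟨X, U, hU, hz, hX, hX1, hX2⟩ := exists_coordinates φ z
  rw [bilinear_formula (Δ := fun u v => gm φ z (c 1 u v))
    (DL := fun u => gop φ z (PowerSeries.coeff 1 (h.isSepProduct.L u)))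
    (DR := fun u => gop φ z (PowerSeries.coeff 1 (h.isSepProduct.R u)))
    (fun u v => by rw [← coeff_gS, IsSepProduct.coeff_gS_L])
    (fun u v => by rw [← coeff_gS, IsSepProduct.coeff_gS_R])
    (fun u => (h.natL u).ordLE 1 φ z) (fun u => (h.natR u).ordLE 1 φ z)
    (fun a ha v => h.hol_left φ z U hU hz a ha 1 le_rfl v)
    (fun b hb u => h.antihol_right φ z U hU hz b hb 1 le_rfl u) hX hX1 hX2]
  refine Finset.sum_congr rfl fun l _ => Finset.sum_congr rfl fun k _ => ?_
  rw [h.isMixed_one.germ_mixComp, ← h.apply_mul φ z U hU hz _ _ (hX1 k) (hX2 l), coeff_one_pexp, hX,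
    hX, coeff_gS]

/-- The operators `L_u` of the product and its dual differ in index one by an operator of order
zero, and this operator annihilates `1`. -/
theorem gm_dual_one (φ : Chart n M) (z : dom φ) (u v : Fn n M) :
    gm φ z (dual c P 1 u v) = gm φ z (c 1 u v) := by
  have h1 := (h.natL u).ordLE_sub 0 φ z
  have h2 := LinearMap.congr_fun ((germAlg z).apply_of_ordLE_zero h1) (gm φ z v)
  have h3 : (gop φ z (PowerSeries.coeff 1 (h.isSepProduct.L u) -
      PowerSeries.coeff 1 (h.isSepProduct_dual.L u))) 1 = 0 := by
    rw [map_sub, LinearMap.sub_apply, ← map_one (gm φ z), ← coeff_gS, ← coeff_gS,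
      IsSepProduct.coeff_gS_L, IsSepProduct.coeff_gS_L,
      h.antihol_right φ z Set.univ isOpen_univ trivial 1 (antiholOn_one _) 1 le_rfl,
      h.isSepProduct_dual.antihol_right φ z Set.univ isOpen_univ trivial 1 (antiholOn_one _) 1 le_rfl,
      sub_zero]
  rw [zero_add, h3, map_sub, LinearMap.sub_apply, ← coeff_gS, ← coeff_gS, IsSepProduct.coeff_gS_L,
    IsSepProduct.coeff_gS_L] at h2
  simp only [LinearMap.mulLeft_apply, zero_mul] at h2
  exact (sub_eq_zero.1 h2).symm

theorem coeff_two_pexp_sub (φ : Chart n M) (z : dom φ) :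
    PowerSeries.coeff 2 (pexp (gS φ z P)) - PowerSeries.coeff 2 (pexp (gS φ z (-negNu P))) =
      (2 : ℂ) • gop φ z (PowerSeries.coeff 2 P) := by
  rw [coeff_two_pexp (h.coeff_zero_gS φ z), coeff_two_pexp (h.isSepProduct_dual.coeff_zero_gS φ z),
    coeff_gS, coeff_gS, coeff_gS, coeff_gS, ← coeff_one_dual, map_neg (PowerSeries.coeff 2),
    coeff_negNu_of_even even_two, map_neg, two_smul]
  abel

/-- The components of the deformation of the Poisson tensor. -/
def defComp (P : FDO n M) (φ : Chart n M) (l k : Fin n) : LocSmooth (dom φ) :=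
  (2 : ℂ) • mixComp (PowerSeries.coeff 2 P) φ l k

/-- The difference of index two has order at most one in each argument. Its value on `z̄^l, z^k`
comes from the second coefficients of the two transforms, where the squares of `P_1` cancel and
`2P_2` remains. -/
theorem gm_two (φ : Chart n M) (z : dom φ) (u v : Fn n M) : gm φ z (c 2 u v - dual c P 2 u v) =
    ∑ l, ∑ k, germ z (defComp P φ l k) *
      (germAlg z).d (Sum.inr l) (gm φ z u) * (germAlg z).d (Sum.inl k) (gm φ z v) := by
  obtain ⟨X, U, hU, hz, hX, hX1, hX2⟩ := exists_coordinates φ z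
  rw [bilinear_formula (Δ := fun u v => gm φ z (c 2 u v - dual c P 2 u v))
    (DL := fun u => gop φ z (PowerSeries.coeff 2 (h.isSepProduct.L u) -
      PowerSeries.coeff 2 (h.isSepProduct_dual.L u)))
    (DR := fun u => gop φ z (PowerSeries.coeff 2 (h.isSepProduct.R u) -
      PowerSeries.coeff 2 (h.isSepProduct_dual.R u)))
    (fun u v => by
      rw [map_sub, map_sub, LinearMap.sub_apply, ← coeff_gS, ← coeff_gS, IsSepProduct.coeff_gS_L,
        IsSepProduct.coeff_gS_L])
    (fun u v => by
      rw [map_sub, map_sub, LinearMap.sub_apply, ← coeff_gS, ← coeff_gS, IsSepProduct.coeff_gS_R,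
        IsSepProduct.coeff_gS_R])
    (fun u => (h.natL u).ordLE_sub 1 φ z) (fun u => (h.natR u).ordLE_sub 1 φ z)
    (fun a ha v => by
      rw [map_sub, h.hol_left φ z U hU hz a ha 2 one_le_two v,
        h.isSepProduct_dual.hol_left φ z U hU hz a ha 2 one_le_two v, sub_zero])
    (fun b hb u => by
      rw [map_sub, h.antihol_right φ z U hU hz b hb 2 one_le_two u,
        h.isSepProduct_dual.antihol_right φ z U hU hz b hb 2 one_le_two u, sub_zero]) hX hX1 hX2]
  refine Finset.sum_congr rfl fun l _ => Finset.sum_congr rfl fun k _ => ?_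
  rw [defComp, map_smul, h.isMixed_two.germ_mixComp, map_sub,
    ← h.apply_mul φ z U hU hz _ _ (hX1 k) (hX2 l),
    ← h.isSepProduct_dual.apply_mul hU hz (hX1 k) (hX2 l), ← LinearMap.sub_apply,
    h.coeff_two_pexp_sub, LinearMap.smul_apply, hX, hX]

theorem germEval_d_gm (φ : Chart n M) (z : dom φ) (u : Smooth n M) (s : Idx n) :
    germEval z ((germAlg z).d s (gm φ z (Fn.of u))) = grad φ u z s := by
  rw [gm_apply, locF_of, germAlg_d, germEval_germ]
  rfl

/-- The tensor of the deformation. -/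
def defTensor : Tensor11 n M where
  comp φ l k := defComp P φ l k
  compat := by
    -- The contraction is the value of an operation defined on `M` itself, so it cannot depend on
    -- the chart.
    have key : ∀ (φ : Chart n M) (z : dom φ) (u v : Smooth n M),
        ∑ l, ∑ k, (defComp P φ l k).1 z * grad φ u z (Sum.inr l) * grad φ v z (Sum.inl k) =
          Fn.fn (c 2 (Fn.of u) (Fn.of v) - dual c P 2 (Fn.of u) (Fn.of v)) (pt φ z) := by
      intro φ z u v
      rw [← germEval_gm, h.gm_two]
      simp only [map_sum, map_mul, germEval_germ, h.germEval_d_gm]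
    intro φ ψ z w hzw u v
    rw [key, key, hzw]

theorem L_one {φ : Chart n M} {z : dom φ} {X : Fn n M} {l : Fin n}
    (hX : gm φ z X = (germAlg z).x (Sum.inr l)) (f : Germ z) :
    PowerSeries.coeff 1 (gS φ z (h.isSepProduct.L X)) f =
      ∑ k, germ z (mixComp (PowerSeries.coeff 1 P) φ l k) * (germAlg z).d (Sum.inl k) f := by
  obtain ⟨v, rfl⟩ := gm_surjective φ z f
  rw [IsSepProduct.coeff_gS_L, h.gm_one, Finset.sum_eq_single l]
  · simp [hX, (germAlg z).d_x]
  · intro l' _ hl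
    simp [hX, (germAlg z).d_x, hl]
  · simp

theorem R_one {φ : Chart n M} {z : dom φ} {X : Fn n M} {k : Fin n}
    (hX : gm φ z X = (germAlg z).x (Sum.inl k)) (f : Germ z) :
    PowerSeries.coeff 1 (gS φ z (h.isSepProduct.R X)) f =
      ∑ l, germ z (mixComp (PowerSeries.coeff 1 P) φ l k) * (germAlg z).d (Sum.inr l) f := by
  obtain ⟨v, rfl⟩ := gm_surjective φ z f
  rw [IsSepProduct.coeff_gS_R, h.gm_one]
  refine Finset.sum_congr rfl fun l _ => ?_
  rw [Finset.sum_eq_single k]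
  · simp [hX, (germAlg z).d_x]
  · intro l' _ hl
    simp [hX, (germAlg z).d_x, hl]
  · simp

theorem L_two {φ : Chart n M} {z : dom φ} {X : Fn n M} {l : Fin n}
    (hX : gm φ z X = (germAlg z).x (Sum.inr l)) (f : Germ z) :
    PowerSeries.coeff 2 (gS φ z (h.isSepProduct.L X)) f =
      PowerSeries.coeff 2 (gS φ z (h.isSepProduct_dual.L X)) f +
      ∑ k, germ z (defComp P φ l k) * (germAlg z).d (Sum.inl k) f := by
  obtain ⟨v, rfl⟩ := gm_surjective φ z f
  rw [IsSepProduct.coeff_gS_L, IsSepProduct.coeff_gS_L, ← sub_eq_iff_eq_add', ← map_sub, h.gm_two,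
    Finset.sum_eq_single l]
  · simp [hX, (germAlg z).d_x]
  · intro l' _ hl
    simp [hX, (germAlg z).d_x, hl]
  · simp

theorem R_two {φ : Chart n M} {z : dom φ} {X : Fn n M} {k : Fin n}
    (hX : gm φ z X = (germAlg z).x (Sum.inl k)) (f : Germ z) :
    PowerSeries.coeff 2 (gS φ z (h.isSepProduct.R X)) f =
      PowerSeries.coeff 2 (gS φ z (h.isSepProduct_dual.R X)) f +
      ∑ l, germ z (defComp P φ l k) * (germAlg z).d (Sum.inr l) f := by
  obtain ⟨v, rfl⟩ := gm_surjective φ z f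
  rw [IsSepProduct.coeff_gS_R, IsSepProduct.coeff_gS_R, ← sub_eq_iff_eq_add', ← map_sub, h.gm_two]
  refine Finset.sum_congr rfl fun l _ => ?_
  rw [Finset.sum_eq_single k]
  · simp [hX, (germAlg z).d_x]
  · intro l' _ hl
    simp [hX, (germAlg z).d_x, hl]
  · simp

theorem L_dual_one (φ : Chart n M) (z : dom φ) (u : Fn n M) :
    PowerSeries.coeff 1 (gS φ z (h.isSepProduct_dual.L u)) =
      PowerSeries.coeff 1 (gS φ z (h.isSepProduct.L u)) := end_ext_of_gm fun v => by
  rw [IsSepProduct.coeff_gS_L, IsSepProduct.coeff_gS_L, h.gm_dual_one]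

theorem R_dual_one (φ : Chart n M) (z : dom φ) (u : Fn n M) :
    PowerSeries.coeff 1 (gS φ z (h.isSepProduct_dual.R u)) =
      PowerSeries.coeff 1 (gS φ z (h.isSepProduct.R u)) := end_ext_of_gm fun v => by
  rw [IsSepProduct.coeff_gS_R, IsSepProduct.coeff_gS_R, h.gm_dual_one]

/-- Order `ν³` of the commutation of `L` at `z̄^l` and `z̄^q`, applied to `z^p`, is taken for the
product and for its dual. The first coefficients agree and the second differ by `h^{lk} ∂_k`, so
subtraction leaves exactly the linearized Jacobi identity. -/
theorem jacobi_left (φ : Chart n M) (l q p : Fin n) :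
    ∑ k, (mixComp (PowerSeries.coeff 1 P) φ l k * pd (Sum.inl k) (defComp P φ q p) +
      defComp P φ l k * pd (Sum.inl k) (mixComp (PowerSeries.coeff 1 P) φ q p)) =
    ∑ k, (mixComp (PowerSeries.coeff 1 P) φ q k * pd (Sum.inl k) (defComp P φ l p) +
      defComp P φ q k * pd (Sum.inl k) (mixComp (PowerSeries.coeff 1 P) φ l p)) := by
  refine eq_of_germ_eq fun z => ?_
  obtain ⟨X, U, hU, hz, hX, hX1, hX2⟩ := exists_coordinates φ z
  have h1 := h.isSepProduct.L_cross hU hz (hX2 l) (hX2 q) ((germAlg z).x (Sum.inl p))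
  have h2 := h.isSepProduct_dual.L_cross hU hz (hX2 l) (hX2 q) ((germAlg z).x (Sum.inl p))
  simp only [h.L_dual_one, h.L_two (hX _), map_add] at h1 h2
  have h3 : ∀ l : Fin n, (∑ k, germ z (mixComp (PowerSeries.coeff 1 P) φ l k) *
      (germAlg z).d (Sum.inl k) ((germAlg z).x (Sum.inl p))) =
        germ z (mixComp (PowerSeries.coeff 1 P) φ l p) := fun l => by
    simp [(germAlg z).d_x]
  have h4 : ∀ l : Fin n, (∑ k, germ z (defComp P φ l k) *
      (germAlg z).d (Sum.inl k) ((germAlg z).x (Sum.inl p))) = germ z (defComp P φ l p) := fun l => by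
    simp [(germAlg z).d_x]
  have h5 := congrArg₂ (· - ·) h1 h2
  simp only [h.L_one (hX _), h3, h4, germAlg_d] at h5
  simp only [map_sum, map_add, map_mul, Finset.sum_add_distrib]
  linear_combination h5

theorem jacobi_right (φ : Chart n M) (k p q : Fin n) :
    ∑ l, (mixComp (PowerSeries.coeff 1 P) φ l k * pd (Sum.inr l) (defComp P φ q p) +
      defComp P φ l k * pd (Sum.inr l) (mixComp (PowerSeries.coeff 1 P) φ q p)) =
    ∑ l, (mixComp (PowerSeries.coeff 1 P) φ l p * pd (Sum.inr l) (defComp P φ q k) +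
      defComp P φ l p * pd (Sum.inr l) (mixComp (PowerSeries.coeff 1 P) φ q k)) := by
  refine eq_of_germ_eq fun z => ?_
  obtain ⟨X, U, hU, hz, hX, hX1, hX2⟩ := exists_coordinates φ z
  have h1 := h.isSepProduct.R_cross hU hz (hX1 k) (hX1 p) ((germAlg z).x (Sum.inr q))
  have h2 := h.isSepProduct_dual.R_cross hU hz (hX1 k) (hX1 p) ((germAlg z).x (Sum.inr q))
  simp only [h.R_dual_one, h.R_two (hX _), map_add] at h1 h2
  have h3 : ∀ k : Fin n, (∑ l, germ z (mixComp (PowerSeries.coeff 1 P) φ l k) *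
      (germAlg z).d (Sum.inr l) ((germAlg z).x (Sum.inr q))) =
        germ z (mixComp (PowerSeries.coeff 1 P) φ q k) := fun k => by
    simp [(germAlg z).d_x]
  have h4 : ∀ k : Fin n, (∑ l, germ z (defComp P φ l k) *
      (germAlg z).d (Sum.inr l) ((germAlg z).x (Sum.inr q))) = germ z (defComp P φ q k) := fun k => by
    simp [(germAlg z).d_x]
  have h5 := congrArg₂ (· - ·) h1 h2
  simp only [h.R_one (hX _), h3, h4, germAlg_d] at h5
  simp only [map_sum, map_add, map_mul, Finset.sum_add_distrib]
  linear_combination h5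

end IsBerezinPair

end Low

end BerezinLog
end
noncomputable section
set_option linter.unusedSectionVars false
namespace BerezinLog

open CoordAlg

/-! ### Symbol mappings and their `ε`-linear extension -/

section Symbols

variable {n : ℕ} {M : Type*} [TopologicalSpace M] [ChartedSpace (Fin n → ℂ) M]
  [IsManifold 𝓘(ℂ, Fin n → ℂ) ω M] [T2Space M]
  {c c' : ℕ → Fn n M →ₗ[ℂ] Fn n M →ₗ[ℂ] Fn n M} {P P' : FDO n M}

namespace CoordAlg

theorem sig_csmul {R : Type*} [CommRing R] [Algebra ℂ R] (𝔠 : CoordAlg n R) (a : ℂ)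
    (A : PowerSeries (Module.End ℂ R × Module.End ℂ R)) : 𝔠.sig (a • A) = a • 𝔠.sig A := by
  refine Prod.ext ?_ ?_
  · ext1 α
    rw [coeff_sig_fst, PowerSeries.coeff_smul, Prod.smul_fst, sym_csmul, Prod.smul_fst]
    change a • MvPowerSeries.coeff α (𝔠.sym (PowerSeries.coeff α.degree A).1) =
      a • MvPowerSeries.coeff α (𝔠.sig A).1
    rw [coeff_sig_fst]
  · ext1 α
    rw [coeff_sig_snd, PowerSeries.coeff_smul, Prod.smul_fst, Prod.smul_snd, ← smul_sub, sym_csmul,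
      Prod.smul_snd]
    change a • MvPowerSeries.coeff α (𝔠.sym ((PowerSeries.coeff (α.degree + 1) A).1 -
      (PowerSeries.coeff (α.degree + 1) A).2)) = a • MvPowerSeries.coeff α (𝔠.sig A).2
    rw [coeff_sig_snd]

end CoordAlg

theorem mapEps_locEps_add (φ : Chart n M) (z : dom φ) (F G : Eps (FormalFn n M)) :
    mapEps (germ z) (locEps φ (F + G)) =
      mapEps (germ z) (locEps φ F) + mapEps (germ z) (locEps φ G) := by
  refine Prod.ext ?_ ?_
  · exact map_add (mapF (germ z)) _ _
  · exact map_add (mapF (germ z)) _ _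

theorem mapEps_locEps_smul (φ : Chart n M) (z : dom φ) (a : ℂ) (F : Eps (FormalFn n M)) :
    mapEps (germ z) (locEps φ (a • F)) = a • mapEps (germ z) (locEps φ F) := by
  refine Prod.ext ?_ ?_
  · ext1 α
    exact map_smul (germ z) a _
  · ext1 α
    exact map_smul (germ z) a _

theorem gP_add (φ : Chart n M) (z : dom φ) (A A' B B' : FDO n M) :
    gP φ z (A + B) (A' + B') = gP φ z A A' + gP φ z B B' := by
  ext1 r
  rw [coeff_gP, map_add, map_add, map_add, map_add, map_add, coeff_gP, coeff_gP]
  rfl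

theorem gP_smul (φ : Chart n M) (z : dom φ) (a : ℂ) (A A' : FDO n M) :
    gP φ z (a • A) (a • A') = a • gP φ z A A' := by
  ext1 r
  rw [coeff_gP, PowerSeries.coeff_smul, PowerSeries.coeff_smul, PowerSeries.coeff_smul, map_smul,
    map_smul, coeff_gP]
  rfl

/-- The symbols of a linear family of natural pairs. -/
def symbolMap (A A' : Fn n M →ₗ[ℂ] FDO n M) (h : ∀ u, IsNatPair (A u) (A' u)) :
    Fn n M →ₗ[ℂ] Eps (FormalFn n M) where
  toFun u := pairSymbol (A u) (A' u) (h u)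
  map_add' u v := eps_ext_of_locEps fun φ z => by
    rw [mapEps_locEps_add, mapEps_pairSymbol, mapEps_pairSymbol, mapEps_pairSymbol, map_add, map_add,
      gP_add, sig_add]
  map_smul' a u := eps_ext_of_locEps fun φ z => by
    rw [RingHom.id_apply, mapEps_locEps_smul, mapEps_pairSymbol, mapEps_pairSymbol, map_smul, map_smul,
      gP_smul, sig_csmul]

theorem mapEps_symbolMap (A A' : Fn n M →ₗ[ℂ] FDO n M) (h : ∀ u, IsNatPair (A u) (A' u))
    (φ : Chart n M) (z : dom φ) (u : Fn n M) :
    mapEps (germ z) (locEps φ (symbolMap A A' h u)) = (germAlg z).sig (gP φ z (A u) (A' u)) :=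
  mapEps_pairSymbol (h u) φ z

/-- The extension of a mapping `σ₀ + ε σ₁` by linearity in `ε`. -/
def epsExt (σ : Fn n M →ₗ[ℂ] Eps (FormalFn n M)) : Eps (Smooth n M) →ₗ[ℂ] Eps (FormalFn n M) where
  toFun f := ((σ (Fn.of f.1)).1, (σ (Fn.of f.1)).2 + (σ (Fn.of f.2)).1)
  map_add' f g := by
    simp only [Prod.fst_add, Prod.snd_add, map_add]
    refine Prod.ext rfl ?_
    simp only [Prod.snd_add]
    abel
  map_smul' a f := by
    simp only [Prod.smul_fst, Prod.smul_snd, map_smul]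
    refine Prod.ext rfl ?_
    simp only [Prod.smul_snd, RingHom.id_apply, smul_add]

theorem epsExt_apply (σ : Fn n M →ₗ[ℂ] Eps (FormalFn n M)) (f : Eps (Smooth n M)) :
    epsExt σ f = ((σ (Fn.of f.1)).1, (σ (Fn.of f.1)).2 + (σ (Fn.of f.2)).1) := rfl

/-- The germ of the symbol. -/
def sgm (σ : Fn n M →ₗ[ℂ] Eps (FormalFn n M)) (φ : Chart n M) (z : dom φ) (u : Fn n M) :
    Eps (MvPowerSeries (Idx n) (Germ z)) := mapEps (germ z) (locEps φ (σ u))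

theorem sgm_add (σ : Fn n M →ₗ[ℂ] Eps (FormalFn n M)) (φ : Chart n M) (z : dom φ) (u v : Fn n M) :
    sgm σ φ z (u + v) = sgm σ φ z u + sgm σ φ z v := by
  rw [sgm, map_add, mapEps_locEps_add]
  rfl

theorem mapEps_epsExt (σ : Fn n M →ₗ[ℂ] Eps (FormalFn n M)) (φ : Chart n M) (z : dom φ)
    (f : Eps (Smooth n M)) : mapEps (germ z) (locEps φ (epsExt σ f)) =
      ((sgm σ φ z (Fn.of f.1)).1, (sgm σ φ z (Fn.of f.1)).2 + (sgm σ φ z (Fn.of f.2)).1) :=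
  Prod.ext rfl (map_add (mapF (germ z)) _ _)

theorem epsExt_eps (σ : Fn n M →ₗ[ℂ] Eps (FormalFn n M)) (f : Eps (Smooth n M)) :
    epsExt σ (epsMul (0, 1) f) = (0, (epsExt σ f).fst) := by
  simp only [epsExt_apply, epsMul, zero_mul, one_mul, zero_add, map_zero]
  refine Prod.ext rfl ?_
  simp

theorem epsExt_mul {σ : Fn n M →ₗ[ℂ] Eps (FormalFn n M)}
    (h : ∀ u v φ z, sgm σ φ z (u * v) = epsMul (sgm σ φ z u) (sgm σ φ z v))
    (u v : Eps (Smooth n M)) (φ : Chart n M) :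
    locEps φ (epsExt σ (epsMul u v)) = epsMul (locEps φ (epsExt σ u)) (locEps φ (epsExt σ v)) := by
  refine eq_of_mapEps_eq fun z => ?_
  rw [mapEps_epsMul, mapEps_epsExt, mapEps_epsExt, mapEps_epsExt]
  simp only [epsMul, map_add, map_mul, sgm_add, h, Prod.fst_add]
  refine Prod.ext rfl ?_
  simp only
  ring

/-- By `ε`-linearity only brackets of two functions on `M` matter; the second tensor enters there as
a correction in the `ε` component, through the leading part of the mapping. -/
theorem epsExt_bracket {σ : Fn n M →ₗ[ℂ] Eps (FormalFn n M)} {g k : Tensor11 n M}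
    (h : ∀ u v φ z, (germAlg z).pbEps (sgm σ φ z (Fn.of u)) (sgm σ φ z (Fn.of v)) =
      ((sgm σ φ z (Fn.of (bracket g u v))).1, (sgm σ φ z (Fn.of (bracket g u v))).2 +
        (sgm σ φ z (Fn.of (bracket k u v))).1))
    (u v : Eps (Smooth n M)) (φ : Chart n M) : locEps φ (epsExt σ (bracketEps g k u v)) =
      cotBracketEps (locEps φ (epsExt σ u)) (locEps φ (epsExt σ v)) := by
  refine eq_of_mapEps_eq fun z => ?_
  rw [cotBracketEps_eq, (isMor_germ z).pbEps, mapEps_epsExt, mapEps_epsExt, mapEps_epsExt]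
  have h1 := fun u v => congrArg Prod.fst (h u v φ z)
  have h2 := congrArg Prod.snd (h u.1 v.1 φ z)
  simp only [pbEps] at h1 h2
  refine Prod.ext ?_ ?_
  · exact (h1 u.1 v.1).symm
  · simp only [pbEps, bracketEps, map_add, sgm_add, Prod.fst_add, pb_add_left, pb_add_right, ← h1]
    linear_combination -h2

theorem epsExt_bracket_neg {σ : Fn n M →ₗ[ℂ] Eps (FormalFn n M)} {g k : Tensor11 n M}
    (h : ∀ u v φ z, -(germAlg z).pbEps (sgm σ φ z (Fn.of u)) (sgm σ φ z (Fn.of v)) =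
      ((sgm σ φ z (Fn.of (bracket g u v))).1, (sgm σ φ z (Fn.of (bracket g u v))).2 +
        (sgm σ φ z (Fn.of (bracket k u v))).1))
    (u v : Eps (Smooth n M)) (φ : Chart n M) : locEps φ (epsExt σ (bracketEps g k u v)) =
      -cotBracketEps (locEps φ (epsExt σ u)) (locEps φ (epsExt σ v)) := by
  refine eq_of_mapEps_eq fun z => ?_
  have e : ∀ Q : Eps (LocFormal (dom φ)), mapEps (germ z) (-Q) = -mapEps (germ z) Q := fun Q =>
    Prod.ext (map_neg (mapF (germ z)) _) (map_neg (mapF (germ z)) _)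
  rw [e, cotBracketEps_eq, (isMor_germ z).pbEps, mapEps_epsExt, mapEps_epsExt, mapEps_epsExt]
  have h1 := fun u v => congrArg Prod.fst (h u v φ z)
  have h2 := congrArg Prod.snd (h u.1 v.1 φ z)
  simp only [pbEps, Prod.fst_neg, Prod.snd_neg] at h1 h2
  refine Prod.ext ?_ ?_
  · exact (h1 u.1 v.1).symm
  · simp only [pbEps, bracketEps, map_add, sgm_add, Prod.fst_add, pb_add_left, pb_add_right, ← h1,
      Prod.snd_neg]
    linear_combination -h2

theorem epsExt_commute {σ τ : Fn n M →ₗ[ℂ] Eps (FormalFn n M)}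
    (h : ∀ u v φ z, (germAlg z).pbEps (sgm σ φ z u) (sgm τ φ z v) = 0)
    (u v : Eps (Smooth n M)) (φ : Chart n M) :
    cotBracketEps (locEps φ (epsExt σ u)) (locEps φ (epsExt τ v)) = 0 := by
  refine eq_of_mapEps_eq fun z => ?_
  have e : mapEps (n := n) (germ z) 0 = 0 := Prod.ext (map_zero (mapF (germ z))) (map_zero (mapF (germ z)))
  rw [e, cotBracketEps_eq, (isMor_germ z).pbEps, mapEps_epsExt, mapEps_epsExt]
  have h1 := fun u v => congrArg Prod.fst (h u v φ z)
  have h2 := fun u v => congrArg Prod.snd (h u v φ z)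
  simp only [pbEps, Prod.fst_zero, Prod.snd_zero] at h1 h2
  refine Prod.ext (h1 _ _) ?_
  simp only [pbEps, pb_add_left, pb_add_right, h1, Prod.snd_zero]
  linear_combination h2 (Fn.of u.1) (Fn.of v.1)

theorem epsExt_unit {σ : Fn n M →ₗ[ℂ] Eps (FormalFn n M)}
    (h1 : ∀ u φ z, MvPowerSeries.coeff 0 (sgm σ φ z u).1 = gm φ z u)
    (h2 : ∀ u φ z, MvPowerSeries.coeff 0 (sgm σ φ z u).2 = 0) (f : Eps (Smooth n M))
    (φ : Chart n M) :
    MvPowerSeries.constantCoeff (locEps φ (epsExt σ f)).fst = loc φ f.fst ∧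
      MvPowerSeries.constantCoeff (locEps φ (epsExt σ f)).snd = loc φ f.snd := by
  constructor
  · refine eq_of_germ_eq fun z => ?_
    exact h1 (Fn.of f.1) φ z
  · refine eq_of_germ_eq fun z => ?_
    have h3 := congrArg (MvPowerSeries.coeff 0) (congrArg Prod.snd (mapEps_epsExt σ φ z f))
    simp only [map_add, h1, h2, zero_add] at h3
    exact h3

theorem epsExt_zero_right {σ : Fn n M →ₗ[ℂ] Eps (FormalFn n M)} (φ : Chart n M) (z : dom φ)
    (f : Smooth n M) : mapEps (germ z) (locEps φ (epsExt σ (f, 0))) = sgm σ φ z (Fn.of f) := by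
  rw [mapEps_epsExt]
  refine Prod.ext rfl ?_
  have h : sgm σ φ z 0 = 0 := by
    have h1 := sgm_add σ φ z 0 0
    rwa [add_zero, left_eq_add] at h1
  simp only [map_zero, h]
  exact add_zero _

end Symbols

end BerezinLog
end
noncomputable section
set_option linter.unusedSectionVars false
namespace BerezinLog

open CoordAlg

/-! ### Source and target mappings and the generating function -/

section Groupoid

variable {n : ℕ} {M : Type*} [TopologicalSpace M] [ChartedSpace (Fin n → ℂ) M]
  [IsManifold 𝓘(ℂ, Fin n → ℂ) ω M] [T2Space M]
  {c c' : ℕ → Fn n M →ₗ[ℂ] Fn n M →ₗ[ℂ] Fn n M} {P P' : FDO n M}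

namespace IsSepProduct

theorem coeff_L_mul (h : IsSepProduct c P) (u v : Fn n M) (r : ℕ) :
    PowerSeries.coeff r (h.L u * h.L v) =
      ∑ p ∈ Finset.HasAntidiagonal.antidiagonal r, PowerSeries.coeff p.1 (h.L (c p.2 u v)) := by
  refine DOp.val_injective ?_
  rw [← FDO.coeff_val, map_mul FDO.val, L, val_opL, val_opL, h.assoc.lser_mul, map_sum]
  refine Finset.sum_congr rfl fun p _ => ?_
  rw [← FDO.coeff_val, val_opL]

theorem coeff_R_mul (h : IsSepProduct c P) (u v : Fn n M) (r : ℕ) :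
    PowerSeries.coeff r (h.R u * h.R v) =
      ∑ p ∈ Finset.HasAntidiagonal.antidiagonal r, PowerSeries.coeff p.1 (h.R (c p.2 v u)) := by
  refine DOp.val_injective ?_
  rw [← FDO.coeff_val, map_mul FDO.val, R, val_opL, val_opL, map_sum]
  refine (h.assoc.rser_mul u v r).trans (Finset.sum_congr rfl fun p _ => ?_)
  rw [← FDO.coeff_val, val_opL]
  rfl

end IsSepProduct

theorem sum_antidiagonal_succ_of_zero {N : Type*} [AddCommMonoid N] (f : ℕ × ℕ → N) (r : ℕ)
    (h : ∀ i, f (i, 0) = 0) : ∑ p ∈ Finset.HasAntidiagonal.antidiagonal (r + 1), f p =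
      ∑ p ∈ Finset.HasAntidiagonal.antidiagonal r, f (p.1, p.2 + 1) := by
  rw [Finset.Nat.sum_antidiagonal_succ', h, zero_add]

theorem gP_mul (φ : Chart n M) (z : dom φ) (A A' B B' : FDO n M) :
    gP φ z (A * B) (A' * B') = gP φ z A A' * gP φ z B B' := by
  rw [gP, gP, gP, pairS_mul, map_mul, map_mul]

/-- The symbol of the product of two multiplication operators. -/
theorem sig_gP_of_mul {A A' : Fn n M →ₗ[ℂ] FDO n M} (hA : ∀ u, IsNatPair (A u) (A' u))
    {Q Q' : FDO n M} {a a' : ℕ → Fn n M} (h0 : a 0 = a' 0)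
    (h1 : ∀ r, PowerSeries.coeff r Q =
      ∑ p ∈ Finset.HasAntidiagonal.antidiagonal r, PowerSeries.coeff p.1 (A (a p.2)))
    (h2 : ∀ r, PowerSeries.coeff r Q' =
      ∑ p ∈ Finset.HasAntidiagonal.antidiagonal r, PowerSeries.coeff p.1 (A' (a' p.2)))
    (φ : Chart n M) (z : dom φ) : (germAlg z).sig (gP φ z Q Q') =
      ((sgm (symbolMap A A' hA) φ z (a 0)).1, (sgm (symbolMap A A' hA) φ z (a 0)).2 +
        (sgm (symbolMap A A' hA) φ z (a 1 - a' 1)).1) := by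
  let Λ : Fn n M →ₗ[ℂ] PowerSeries (Module.End ℂ (Germ z) × Module.End ℂ (Germ z)) :=
    { toFun := fun u => gP φ z (A u) (A' u)
      map_add' := fun u v => by rw [map_add, map_add, gP_add]
      map_smul' := fun b u => by rw [map_smul, map_smul, gP_smul]; rfl }
  have h3 := sig_of_coeff_sum (𝔠 := germAlg z) (A := gP φ z Q Q') Λ (fun u => hA u φ z) h0
    (fun r => by
      rw [coeff_gP]
      change gop φ z (PowerSeries.coeff r Q) = _
      rw [h1, map_sum]
      refine Finset.sum_congr rfl fun p _ => ?_
      change _ = (PowerSeries.coeff p.1 (gP φ z (A (a p.2)) (A' (a p.2)))).1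
      rw [coeff_gP])
    (fun r => by
      rw [coeff_gP]
      change gop φ z (PowerSeries.coeff r Q') = _
      rw [h2, map_sum]
      refine Finset.sum_congr rfl fun p _ => ?_
      change _ = (PowerSeries.coeff p.1 (gP φ z (A (a' p.2)) (A' (a' p.2)))).2
      rw [coeff_gP])
  rw [h3]
  simp only [sgm, mapEps_symbolMap]
  rfl

theorem gP_shift_comm (φ : Chart n M) (z : dom φ) (A A' B B' : FDO n M) :
    br (gP φ z A A') (gP φ z B B') =
      gP φ z (PowerSeries.mk fun r => PowerSeries.coeff (r + 1) (A * B - B * A))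
        (PowerSeries.mk fun r => PowerSeries.coeff (r + 1) (A' * B' - B' * A')) := by
  ext1 r
  rw [coeff_br, ← gP_mul, ← gP_mul, coeff_gP, PowerSeries.coeff_mk, PowerSeries.coeff_mk, map_sub,
    coeff_gP, coeff_gP, map_sub, map_sub, map_sub, map_sub]
  rfl

namespace IsBerezinPair

variable (h : IsBerezinPair c P)

/-- The source mapping on functions. -/
def src : Fn n M →ₗ[ℂ] Eps (FormalFn n M) :=
  symbolMap h.isSepProduct.L h.isSepProduct_dual.L h.natL

/-- The target mapping on functions. -/
def tgt : Fn n M →ₗ[ℂ] Eps (FormalFn n M) :=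
  symbolMap h.isSepProduct.R h.isSepProduct_dual.R h.natR

/-- The generating function. -/
def gen : Eps (FormalFn n M) := pairSymbol (PowerSeries.X * P) (PowerSeries.X * -negNu P) h.natX

theorem sgm_src (φ : Chart n M) (z : dom φ) (u : Fn n M) : sgm h.src φ z u =
    (germAlg z).sig (gP φ z (h.isSepProduct.L u) (h.isSepProduct_dual.L u)) :=
  mapEps_symbolMap _ _ _ φ z u

theorem sgm_tgt (φ : Chart n M) (z : dom φ) (u : Fn n M) : sgm h.tgt φ z u =
    (germAlg z).sig (gP φ z (h.isSepProduct.R u) (h.isSepProduct_dual.R u)) :=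
  mapEps_symbolMap _ _ _ φ z u

include h in
theorem dual_one (u v : Fn n M) : dual c P 1 u v = c 1 u v :=
  fn_ext_of_gm fun φ z => h.gm_dual_one φ z u v

theorem sgm_sub_self (σ : Fn n M →ₗ[ℂ] Eps (FormalFn n M)) (φ : Chart n M) (z : dom φ)
    {u v : Fn n M} (huv : u = v) : (sgm σ φ z (u - v)).1 = 0 := by
  have h1 := sgm_add σ φ z 0 0
  rw [add_zero, left_eq_add] at h1
  rw [huv, sub_self, h1]
  rfl

/-- `L_u L_v = ∑ ν^k L_{C_k(u,v)}`. The possible `ε` correction comes from the difference of the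
first coefficients of the product and its dual, which is zero. -/
theorem src_mul (u v : Fn n M) (φ : Chart n M) (z : dom φ) :
    sgm h.src φ z (u * v) = epsMul (sgm h.src φ z u) (sgm h.src φ z v) := by
  rw [sgm_src h φ z u, sgm_src h φ z v, ← sig_mul (h.natL u φ z) (h.natL v φ z), ← gP_mul,
    sig_gP_of_mul h.natL (a := fun k => c k u v) (a' := fun k => dual c P k u v)
      (by simp only [h.zero, h.dual_zero]) (h.isSepProduct.coeff_L_mul u v)
      (h.isSepProduct_dual.coeff_L_mul u v),
    sgm_sub_self _ φ z (h.dual_one u v).symm, add_zero, h.zero]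
  rfl

theorem tgt_mul (u v : Fn n M) (φ : Chart n M) (z : dom φ) :
    sgm h.tgt φ z (u * v) = epsMul (sgm h.tgt φ z u) (sgm h.tgt φ z v) := by
  rw [sgm_tgt h φ z u, sgm_tgt h φ z v, ← sig_mul (h.natR u φ z) (h.natR v φ z), ← gP_mul,
    sig_gP_of_mul h.natR (a := fun k => c k v u) (a' := fun k => dual c P k v u)
      (by simp only [h.zero, h.dual_zero]) (h.isSepProduct.coeff_R_mul u v)
      (h.isSepProduct_dual.coeff_R_mul u v),
    sgm_sub_self _ φ z (h.dual_one v u).symm, add_zero, h.zero, mul_comm v u]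
  rfl

/-- `ν⁻¹[L_u, L_v]` is the sum of `ν^k L` at `C_{k+1}(u,v) - C_{k+1}(v,u)`. The term `k = 0` gives
the Poisson bracket, and the term `k = 1`, compared with the dual, gives the `ε` correction. -/
theorem src_bracket (u v : Fn n M) (φ : Chart n M) (z : dom φ) :
    (germAlg z).pbEps (sgm h.src φ z u) (sgm h.src φ z v) =
      ((sgm h.src φ z (c 1 u v - c 1 v u)).1, (sgm h.src φ z (c 1 u v - c 1 v u)).2 +
        (sgm h.src φ z (c 2 u v - c 2 v u - (dual c P 2 u v - dual c P 2 v u))).1) := by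
  have key : ∀ {c : ℕ → Fn n M →ₗ[ℂ] Fn n M →ₗ[ℂ] Fn n M} {P : FDO n M} (H : IsSepProduct c P)
      (r : ℕ), PowerSeries.coeff (r + 1) (H.L u * H.L v - H.L v * H.L u) =
        ∑ p ∈ Finset.HasAntidiagonal.antidiagonal r,
          PowerSeries.coeff p.1 (H.L (c (p.2 + 1) u v - c (p.2 + 1) v u)) := by
    intro c P H r
    rw [map_sub, H.coeff_L_mul, H.coeff_L_mul, ← Finset.sum_sub_distrib,
      sum_antidiagonal_succ_of_zero]
    · simp only [map_sub]
    · intro i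
      rw [H.zero, H.zero, mul_comm, sub_self]
  rw [sgm_src h φ z u, sgm_src h φ z v, ← sig_br (h.natL u φ z) (h.natL v φ z), gP_shift_comm,
    sig_gP_of_mul h.natL (a := fun k => c (k + 1) u v - c (k + 1) v u)
      (a' := fun k => dual c P (k + 1) u v - dual c P (k + 1) v u)
      (by simp only [zero_add, h.dual_one])
      (fun r => by rw [PowerSeries.coeff_mk, key]) (fun r => by rw [PowerSeries.coeff_mk, key])]
  rfl

theorem tgt_bracket (u v : Fn n M) (φ : Chart n M) (z : dom φ) :
    (germAlg z).pbEps (sgm h.tgt φ z u) (sgm h.tgt φ z v) =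
      ((sgm h.tgt φ z (c 1 v u - c 1 u v)).1, (sgm h.tgt φ z (c 1 v u - c 1 u v)).2 +
        (sgm h.tgt φ z (c 2 v u - c 2 u v - (dual c P 2 v u - dual c P 2 u v))).1) := by
  have key : ∀ {c : ℕ → Fn n M →ₗ[ℂ] Fn n M →ₗ[ℂ] Fn n M} {P : FDO n M} (H : IsSepProduct c P)
      (r : ℕ), PowerSeries.coeff (r + 1) (H.R u * H.R v - H.R v * H.R u) =
        ∑ p ∈ Finset.HasAntidiagonal.antidiagonal r,
          PowerSeries.coeff p.1 (H.R (c (p.2 + 1) v u - c (p.2 + 1) u v)) := by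
    intro c P H r
    rw [map_sub, H.coeff_R_mul, H.coeff_R_mul, ← Finset.sum_sub_distrib,
      sum_antidiagonal_succ_of_zero]
    · simp only [map_sub]
    · intro i
      rw [H.zero, H.zero, mul_comm, sub_self]
  rw [sgm_tgt h φ z u, sgm_tgt h φ z v, ← sig_br (h.natR u φ z) (h.natR v φ z), gP_shift_comm,
    sig_gP_of_mul h.natR (a := fun k => c (k + 1) v u - c (k + 1) u v)
      (a' := fun k => dual c P (k + 1) v u - dual c P (k + 1) u v)
      (by simp only [zero_add, h.dual_one])
      (fun r => by rw [PowerSeries.coeff_mk, key]) (fun r => by rw [PowerSeries.coeff_mk, key])]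
  rfl

theorem br_eq_zero_of_commute {A : Type*} [Ring A] {f g : PowerSeries A} (hc : Commute f g) :
    br f g = 0 := by
  ext1 r
  rw [coeff_br, hc.eq, sub_self, map_zero, map_zero]

theorem pbEps_src_tgt (u v : Fn n M) (φ : Chart n M) (z : dom φ) :
    (germAlg z).pbEps (sgm h.src φ z u) (sgm h.tgt φ z v) = 0 := by
  rw [sgm_src, sgm_tgt, ← sig_br (h.natL u φ z) (h.natR v φ z),
    br_eq_zero_of_commute (IsSepProduct.commute_gP _ _ φ z u v), sig_zero]

theorem pbEps_tgt_src (u v : Fn n M) (φ : Chart n M) (z : dom φ) :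
    (germAlg z).pbEps (sgm h.tgt φ z u) (sgm h.src φ z v) = 0 := by
  rw [sgm_src, sgm_tgt, ← sig_br (h.natR u φ z) (h.natL v φ z),
    br_eq_zero_of_commute (IsSepProduct.commute_gP _ _ φ z v u).symm, sig_zero]

theorem coeff_zero_src (u : Fn n M) (φ : Chart n M) (z : dom φ) :
    MvPowerSeries.coeff 0 (sgm h.src φ z u).1 = gm φ z u ∧
      MvPowerSeries.coeff 0 (sgm h.src φ z u).2 = 0 := by
  rw [sgm_src, constantCoeff_sig_fst, constantCoeff_sig_snd, coeff_gP, coeff_gP]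
  constructor
  · change gop φ z (PowerSeries.coeff 0 (h.isSepProduct.L u)) 1 = _
    rw [← coeff_gS, IsSepProduct.coeff_zero_L, LinearMap.mulLeft_apply, mul_one]
  · change (gop φ z (PowerSeries.coeff 1 (h.isSepProduct.L u)) -
      gop φ z (PowerSeries.coeff 1 (h.isSepProduct_dual.L u))) 1 = 0
    rw [← coeff_gS, ← coeff_gS, h.L_dual_one, sub_self, LinearMap.zero_apply]

theorem coeff_zero_tgt (u : Fn n M) (φ : Chart n M) (z : dom φ) :
    MvPowerSeries.coeff 0 (sgm h.tgt φ z u).1 = gm φ z u ∧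
      MvPowerSeries.coeff 0 (sgm h.tgt φ z u).2 = 0 := by
  rw [sgm_tgt, constantCoeff_sig_fst, constantCoeff_sig_snd, coeff_gP, coeff_gP]
  constructor
  · change gop φ z (PowerSeries.coeff 0 (h.isSepProduct.R u)) 1 = _
    rw [← coeff_gS, IsSepProduct.coeff_zero_R, LinearMap.mulLeft_apply, mul_one]
  · change (gop φ z (PowerSeries.coeff 1 (h.isSepProduct.R u)) -
      gop φ z (PowerSeries.coeff 1 (h.isSepProduct_dual.R u))) 1 = 0
    rw [← coeff_gS, ← coeff_gS, h.R_dual_one, sub_self, LinearMap.zero_apply]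

theorem src_hol {φ : Chart n M} {z : dom φ} {U : Set M} (hU : IsOpen U) (hz : pt φ z ∈ U)
    {a : Fn n M} (ha : HolOn (n := n) (Fn.fn a) U) :
    sgm h.src φ z a = (MvPowerSeries.C (gm φ z a), 0) := by
  rw [sgm_src, IsSepProduct.gP_L_hol _ _ hU hz ha, sig_C]

theorem tgt_antihol {φ : Chart n M} {z : dom φ} {U : Set M} (hU : IsOpen U) (hz : pt φ z ∈ U)
    {b : Fn n M} (hb : AntiholOn (n := n) (Fn.fn b) U) :
    sgm h.tgt φ z b = (MvPowerSeries.C (gm φ z b), 0) := by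
  rw [sgm_tgt, IsSepProduct.gP_R_antihol _ _ hU hz hb, sig_C]

theorem mapEps_gen (φ : Chart n M) (z : dom φ) : mapEps (germ z) (locEps φ h.gen) =
    (germAlg z).sig (PowerSeries.X * gP φ z P (-negNu P)) := by
  rw [gen, mapEps_pairSymbol, gP, gP, map_mul, map_mul, pairS_X_mul, gS, PowerSeries.map_X]

theorem germ_coeff_gen (φ : Chart n M) (z : dom φ) (α : Idx n →₀ ℕ) :
    germ z (MvPowerSeries.coeff α (h.gen.fst.1 φ)) = MvPowerSeries.coeff α ((germAlg z).sym
      (gop φ z (PowerSeries.coeff α.degree (PowerSeries.X * P)))) ∧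
    germ z (MvPowerSeries.coeff α (h.gen.snd.1 φ)) = MvPowerSeries.coeff α ((germAlg z).sym
      (gop φ z (PowerSeries.coeff (α.degree + 1) (PowerSeries.X * P) -
        PowerSeries.coeff (α.degree + 1) (PowerSeries.X * -negNu P)))) := by
  have h1 := mapEps_pairSymbol h.natX φ z
  constructor
  · have h2 := congrArg (MvPowerSeries.coeff α) (congrArg Prod.fst h1)
    rw [coeff_sig_fst, coeff_gP] at h2
    exact h2
  · have h2 := congrArg (MvPowerSeries.coeff α) (congrArg Prod.snd h1)
    rw [coeff_sig_snd, coeff_gP] at h2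
    rw [map_sub]
    exact h2

/-- `L_b = e^{ad P} b` for both products, and `sig_expAd` turns this exponential into `e^{H_F}`. -/
theorem src_antihol {φ : Chart n M} {z : dom φ} {U : Set M} (hU : IsOpen U) (hz : pt φ z ∈ U)
    {b : Fn n M} (hb : AntiholOn (n := n) (Fn.fn b) U) : sgm h.src φ z b =
      (germAlg z).expHam (mapEps (germ z) (locEps φ h.gen)) (MvPowerSeries.C (gm φ z b), 0) := by
  rw [sgm_src, IsSepProduct.gP_L_antihol _ _ hU hz hb,
    sig_expAd (IsSepProduct.coeff_zero_gP h.isSepProduct h.isSepProduct_dual φ z)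
      (IsSepProduct.coeff_one_gP (coeff_one_dual P) φ z)
      (IsSepProduct.coeff_gP_mem_pairLE h.isSepProduct h.isSepProduct_dual (coeff_one_dual P) φ z),
    mapEps_gen]

theorem tgt_hol {φ : Chart n M} {z : dom φ} {U : Set M} (hU : IsOpen U) (hz : pt φ z ∈ U)
    {a : Fn n M} (ha : HolOn (n := n) (Fn.fn a) U) : sgm h.tgt φ z a =
      (germAlg z).expHam (mapEps (germ z) (locEps φ h.gen)) (MvPowerSeries.C (gm φ z a), 0) := by
  rw [sgm_tgt, IsSepProduct.gP_R_hol _ _ hU hz ha,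
    sig_expAd (IsSepProduct.coeff_zero_gP h.isSepProduct h.isSepProduct_dual φ z)
      (IsSepProduct.coeff_one_gP (coeff_one_dual P) φ z)
      (IsSepProduct.coeff_gP_mem_pairLE h.isSepProduct h.isSepProduct_dual (coeff_one_dual P) φ z),
    mapEps_gen]

/-! ### The groupoid and its generating function -/

theorem sgm_neg (σ : Fn n M →ₗ[ℂ] Eps (FormalFn n M)) (φ : Chart n M) (z : dom φ) (u : Fn n M) :
    sgm σ φ z (-u) = -sgm σ φ z u := by
  have h1 := sgm_add σ φ z 0 0
  rw [add_zero, left_eq_add] at h1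
  rw [eq_neg_iff_add_eq_zero, ← sgm_add, neg_add_cancel, h1]

theorem of_bracket_defTensor (u v : Smooth n M) : Fn.of (bracket h.defTensor u v) =
    c 2 (Fn.of u) (Fn.of v) - c 2 (Fn.of v) (Fn.of u) -
      (dual c P 2 (Fn.of u) (Fn.of v) - dual c P 2 (Fn.of v) (Fn.of u)) := by
  refine fn_ext_of_gm fun φ z => ?_
  rw [gm_bracket, sub_sub_sub_comm, map_sub, h.gm_two, h.gm_two, ← Finset.sum_sub_distrib]
  refine Finset.sum_congr rfl fun l _ => ?_
  rw [← Finset.sum_sub_distrib]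
  refine Finset.sum_congr rfl fun k _ => ?_
  change germ z (defComp P φ l k) * _ = _
  ring

theorem neg_pair {A : Type*} [AddCommGroup A] (x y : A × A) :
    -((-x).1, (-x).2 + (-y).1) = (x.1, x.2 + y.1) := by
  refine Prod.ext ?_ ?_ <;> simp [add_comm]

theorem isDeformationGroupoidSep {g : Tensor11 n M}
    (hg : ∀ u v, Fn.of (bracket g u v) = c 1 (Fn.of u) (Fn.of v) - c 1 (Fn.of v) (Fn.of u)) :
    IsDeformationGroupoidSep g h.defTensor (epsExt h.src) (epsExt h.tgt) where
  eps_S := epsExt_eps _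
  eps_T := epsExt_eps _
  unit_S := epsExt_unit (fun u φ z => (h.coeff_zero_src u φ z).1)
    fun u φ z => (h.coeff_zero_src u φ z).2
  unit_T := epsExt_unit (fun u φ z => (h.coeff_zero_tgt u φ z).1)
    fun u φ z => (h.coeff_zero_tgt u φ z).2
  mul_S := epsExt_mul h.src_mul
  mul_T := epsExt_mul h.tgt_mul
  bracket_S := epsExt_bracket fun u v φ z => by
    rw [h.src_bracket, hg, h.of_bracket_defTensor]
  -- Right multiplications reverse the order of factors; this is the origin of the sign of an
  -- anti-Poisson morphism.
  bracket_T := epsExt_bracket_neg fun u v φ z => by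
    rw [h.tgt_bracket, hg, h.of_bracket_defTensor,
      ← neg_sub (c 1 (Fn.of u) (Fn.of v)), ← neg_sub (c 2 (Fn.of u) (Fn.of v)),
      ← neg_sub (dual c P 2 (Fn.of u) (Fn.of v)), ← neg_sub', sgm_neg, sgm_neg]
    exact neg_pair _ _
  commute := epsExt_commute h.pbEps_src_tgt
  sep_S φ U hU a ha := (eqOver_iff hU).2 fun z hz => by
    rw [epsExt_zero_right, mapEps_liftFn, h.src_hol (a := Fn.of a) hU hz ha]
  sep_T φ U hU b hb := (eqOver_iff hU).2 fun z hz => by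
    rw [epsExt_zero_right, mapEps_liftFn, h.tgt_antihol (b := Fn.of b) hU hz hb]

theorem isGeneratedBy : IsGeneratedBy (epsExt h.src) (epsExt h.tgt) h.gen := by
  intro φ U hU a b ha hb
  refine ⟨(eqOver_iff hU).2 fun z hz => ?_, (eqOver_iff hU).2 fun z hz => ?_⟩
  · rw [epsExt_zero_right, mapEps_epsMul, mapEps_liftFn, expHam_eq, (isMor_germ z).expHam,
      mapEps_liftFn, map_mul, h.src_mul, h.src_hol (a := Fn.of a) hU hz ha,
      h.src_antihol (b := Fn.of b) hU hz hb]
  · rw [epsExt_zero_right, mapEps_epsMul, mapEps_liftFn, expHam_eq, (isMor_germ z).expHam,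
      mapEps_liftFn, map_mul, h.tgt_mul, h.tgt_hol (a := Fn.of a) hU hz ha,
      h.tgt_antihol (b := Fn.of b) hU hz hb]

theorem mapEps_zero (φ : Chart n M) (z : dom φ) :
    mapEps (germ z) (0 : Eps (LocFormal (dom φ))) = 0 :=
  Prod.ext (map_zero (mapF (germ z))) (map_zero (mapF (germ z)))

/-- `e^{H_F} a` is the target image of `a`, while `ã` is its own source image, so the bracket is one
between commuting images. Degrees zero and one vanish because `P_0 = P'_0 = 0` and `P_1 = P'_1`. -/
theorem memKEps_gen : MemKEps h.gen where
  quadratic φ α hα := by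
    have h1 : PowerSeries.coeff 0 (-negNu P) = 0 := h.isSepProduct_dual.coeff_zero
    refine ⟨eq_of_germ_eq fun z => ?_, eq_of_germ_eq fun z => ?_⟩
    · rw [(h.germ_coeff_gen φ z α).1, map_zero]
      interval_cases α.degree
      · rw [PowerSeries.coeff_zero_X_mul, map_zero, sym_zero, map_zero]
      · rw [PowerSeries.coeff_succ_X_mul, h.coeff_zero, map_zero, sym_zero, map_zero]
    · rw [(h.germ_coeff_gen φ z α).2, map_zero]
      interval_cases α.degree
      · rw [PowerSeries.coeff_succ_X_mul, PowerSeries.coeff_succ_X_mul, h.coeff_zero, h1, sub_self,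
          map_zero, sym_zero, map_zero]
      · rw [PowerSeries.coeff_succ_X_mul, PowerSeries.coeff_succ_X_mul, ← coeff_one_dual, sub_self,
          map_zero, sym_zero, map_zero]
  hol φ U hU a a' ha ha' := (eqOver_iff hU).2 fun z hz => by
    rw [cotBracketEps_eq, (isMor_germ z).pbEps, expHam_eq, (isMor_germ z).expHam, mapEps_liftFn,
      mapEps_liftFn, mapEps_zero, ← h.tgt_hol (a := Fn.of a) hU hz ha,
      ← h.src_hol (a := Fn.of a') hU hz ha', h.pbEps_tgt_src]
  antihol φ U hU b b' hb hb' := (eqOver_iff hU).2 fun z hz => by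
    rw [cotBracketEps_eq, (isMor_germ z).pbEps, expHam_eq, (isMor_germ z).expHam, mapEps_liftFn,
      mapEps_liftFn, mapEps_zero, ← h.src_antihol (b := Fn.of b) hU hz hb,
      ← h.tgt_antihol (b := Fn.of b') hU hz hb', h.pbEps_src_tgt]

theorem hasQuadraticPart_fst {g : Tensor11 n M}
    (hg : ∀ φ l k, g.comp φ l k = mixComp (PowerSeries.coeff 1 P) φ l k) :
    HasQuadraticPart h.gen.fst g := by
  intro φ α hα
  refine eq_of_germ_eq fun z => ?_
  rw [← coeff_mapF (germ z) α (∑ l, ∑ k, _)]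
  simp only [map_sum, map_mul, mapF_C, hg, h.isMixed_one.germ_mixComp]
  rw [(h.germ_coeff_gen φ z α).1, hα, PowerSeries.coeff_succ_X_mul, h.isMixed_one.sym_eq]
  simp [mapF]

/-- In degree two the `ε` part is the symbol of `2P_2`, and the factor two is the one built into
`defComp`. -/
theorem hasQuadraticPart_snd : HasQuadraticPart h.gen.snd h.defTensor := by
  intro φ α hα
  refine eq_of_germ_eq fun z => ?_
  rw [← coeff_mapF (germ z) α (∑ l, ∑ k, _)]
  have e : ∀ l k, germ z (h.defTensor.comp φ l k) = (2 : ℂ) • gop φ z (PowerSeries.coeff 2 P)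
      ((germAlg z).x (Sum.inl k) * (germAlg z).x (Sum.inr l)) := fun l k => by
    rw [← h.isMixed_two.germ_mixComp, ← map_smul]
    rfl
  simp only [map_sum, map_mul, mapF_C, e]
  rw [(h.germ_coeff_gen φ z α).2, hα, coeff_sub_dual_of_even even_two, map_smul, two_smul, sym_add,
    h.isMixed_two.sym_eq]
  simp only [mapF, MvPowerSeries.map_X, two_smul, map_add, map_sum, add_mul, Finset.sum_add_distrib]

theorem isGenerating_of_memKEps {F : Eps (FormalFn n M)} (hF : MemKEps F) (φ : Chart n M)
    (z : dom φ) : IsGenerating (germAlg z) (mapEps (germ z) (locEps φ F)) where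
  quadratic := by
    refine ⟨fun α hα => ?_, fun α hα => ?_⟩
    · exact (congrArg (germ z) (hF.quadratic φ α hα).1).trans (map_zero _)
    · exact (congrArg (germ z) (hF.quadratic φ α hα).2).trans (map_zero _)
  commute s t hst := by
    obtain ⟨X, U, hU, hz, hX, hX1, hX2⟩ := exists_coordinates φ z
    rcases s with s | s <;> rcases t with t | t
    · have h1 := (eqOver_iff hU).1 (hF.hol φ U hU (Fn.of.symm (X (Sum.inl s)))
        (Fn.of.symm (X (Sum.inl t))) (hX1 s) (hX1 t)) z hz
      rwa [cotBracketEps_eq, (isMor_germ z).pbEps, expHam_eq, (isMor_germ z).expHam, mapEps_liftFn,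
        mapEps_liftFn, mapEps_zero, AlgEquiv.apply_symm_apply, AlgEquiv.apply_symm_apply, hX, hX] at h1
    · simp [SameType] at hst
    · simp [SameType] at hst
    · have h1 := (eqOver_iff hU).1 (hF.antihol φ U hU (Fn.of.symm (X (Sum.inr s)))
        (Fn.of.symm (X (Sum.inr t))) (hX2 s) (hX2 t)) z hz
      rwa [cotBracketEps_eq, (isMor_germ z).pbEps, expHam_eq, (isMor_germ z).expHam, mapEps_liftFn,
        mapEps_liftFn, mapEps_zero, AlgEquiv.apply_symm_apply, AlgEquiv.apply_symm_apply, hX, hX] at h1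

theorem memKEps_unique {g k : Tensor11 n M} {F F' : Eps (FormalFn n M)} (hF : MemKEps F)
    (hF' : MemKEps F') (h1 : HasQuadraticPart F.fst g) (h1' : HasQuadraticPart F'.fst g)
    (h2 : HasQuadraticPart F.snd k) (h2' : HasQuadraticPart F'.snd k) : F' = F := by
  refine eps_ext_of_locEps fun φ z => ?_
  refine (isGenerating_of_memKEps hF' φ z).unique (isGenerating_of_memKEps hF φ z) fun α hα => ⟨?_, ?_⟩
  · exact congrArg (germ z) ((h1' φ α hα).trans (h1 φ α hα).symm)
  · exact congrArg (germ z) ((h2' φ α hα).trans (h2 φ α hα).symm)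

end IsBerezinPair

end Groupoid

end BerezinLog
end
noncomputable section
set_option linter.unusedSectionVars false
namespace BerezinLog

/-! ### The Hadamard lemma for germs -/

/-- Differentiation under the integral sign over the unit interval, to all orders. -/
theorem contDiff_integral_unit {E V : Type*} [NormedAddCommGroup E] [NormedSpace ℝ E]
    [NormedAddCommGroup V] [NormedSpace ℝ V] {G : E → ℝ → V} (hG : ContDiff ℝ ∞ ↿G) :
    ContDiff ℝ ∞ fun p => ∫ t in (0 : ℝ)..1, G p t := by
  -- The integral over `[0,1]` is the value at `0` of a convolution with the indicator of `[-1,0]`.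
  -- The bump equals one for `|t| ≤ 2`, so it gives the integrand compact support without changing
  -- it on `[0,1]`.
  let χ : ContDiffBump (0 : ℝ) := ⟨2, 3, by norm_num, by norm_num⟩
  have hf : MeasureTheory.LocallyIntegrable ((Set.Icc (-1 : ℝ) 0).indicator fun _ => (1 : ℝ))
      MeasureTheory.volume :=
    (MeasureTheory.locallyIntegrable_const (1 : ℝ)).indicator measurableSet_Icc
  have h := MeasureTheory.contDiffOn_convolution_right_with_param_comp (n := ⊤) (𝕜 := ℝ)
    (μ := MeasureTheory.volume) (ContinuousLinearMap.lsmul ℝ ℝ) (s := (Set.univ : Set E))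
    (v := fun _ => (0 : ℝ)) contDiffOn_const (g := fun p t => χ t • G p t)
    (k := Metric.closedBall 0 3) isOpen_univ (isCompact_closedBall _ _)
    (fun p x _ hx => by
      have h3 : χ.rOut ≤ dist x 0 := (not_le.1 hx).le
      rw [χ.zero_of_le_dist h3, zero_smul]) hf ?_
  · rw [← contDiffOn_univ]
    refine h.congr fun p _ => ?_
    rw [MeasureTheory.convolution_lsmul, intervalIntegral.integral_of_le zero_le_one,
      ← MeasureTheory.integral_Icc_eq_integral_Ioc, ← MeasureTheory.integral_indicator measurableSet_Icc,
      ← MeasureTheory.integral_neg_eq_self]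
    refine MeasureTheory.integral_congr_ae (Filter.Eventually.of_forall fun t => ?_)
    simp only [Set.indicator, Set.mem_Icc, zero_sub]
    by_cases ht : -1 ≤ t ∧ t ≤ 0
    · rw [if_pos ht, if_pos ⟨by linarith, by linarith⟩, one_smul, χ.one_of_mem_closedBall, one_smul]
      rw [Metric.mem_closedBall, dist_zero_right, Real.norm_eq_abs, abs_le]
      constructor <;> simp only [χ] <;> linarith
    · rw [if_neg ht, if_neg fun h => ht ⟨by linarith [h.2], by linarith [h.1]⟩, zero_smul]
  · refine ContDiff.contDiffOn ?_
    exact (χ.contDiff.comp contDiff_snd).smul hG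

section Hadamard

variable {n : ℕ} {U : TopologicalSpace.Opens (Fin n → ℂ)}

/-- A real linear map in terms of the complex coordinates and their conjugates. -/
theorem clm_eq_sum_coord (A : (Fin n → ℂ) →L[ℝ] ℂ) (v : Fin n → ℂ) :
    A v = ∑ s, coordCLM s v * ((1 / 2 : ℂ) * (A (Pi.single (idx s) 1) +
      wsgn s * A (Pi.single (idx s) Complex.I))) := by
  have h1 : v = ∑ k, ((v k).re • (Pi.single k 1 : Fin n → ℂ) +
      (v k).im • (Pi.single k Complex.I : Fin n → ℂ)) := by
    funext j
    rw [Finset.sum_apply, Finset.sum_eq_single j]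
    · simp
    · intro k _ hk
      simp [hk.symm]
    · simp
  conv_lhs => rw [h1]
  simp only [map_sum, map_add, map_smul, Complex.real_smul]
  rw [Fintype.sum_sum_type, ← Finset.sum_add_distrib]
  refine Finset.sum_congr rfl fun k _ => ?_
  have h2 := Complex.re_add_im (v k)
  have h3 : starRingEnd ℂ (v k) = (v k).re - (v k).im * Complex.I := by
    apply Complex.ext <;> simp
  simp only [coordCLM, wsgn, idx, Sum.elim_inl, Sum.elim_inr, id_eq]
  simp
  rw [h3]
  conv_rhs => rw [← h2]
  ring_nf
  simp
  ring

/-- A germ of a smooth function is its value plus a combination of the coordinates with smooth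
coefficients. -/
theorem exists_hadamard (z : U) (f : LocSmooth U) :
    ∃ q : Idx n → Germ z, germ z f = algebraMap ℂ (Germ z) (f.1 z) +
      ∑ s, ((germAlg z).x s - algebraMap ℂ (Germ z) (germEval z ((germAlg z).x s))) * q s := by
  obtain ⟨r, hr, hrU⟩ := Metric.nhds_basis_closedBall.mem_iff.1 (U.isOpen.mem_nhds z.2)
  -- A cutoff supported in `U` replaces `f` by a globally smooth function with the same germ, so
  -- integrals along all segments from `z` are defined and smooth.
  let χ : ContDiffBump (z : Fin n → ℂ) := ⟨r / 2, r, by positivity, by linarith⟩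
  have hts : tsupport χ ⊆ U := by rw [χ.tsupport_eq]; exact hrU
  set F : (Fin n → ℂ) → ℂ := fun w => χ w • zeroExt f.1 w with hF
  have hFs : ContDiff ℝ ∞ F := by
    rw [contDiff_iff_contDiffAt]
    intro w
    by_cases hw : w ∈ U
    · exact χ.contDiff.contDiffAt.smul (f.2.contDiffAt (U.isOpen.mem_nhds hw))
    · have h0 : χ =ᶠ[𝓝 w] 0 := notMem_tsupport_iff_eventuallyEq.1 fun h => hw (hts h)
      refine (contDiffAt_const (c := (0 : ℂ))).congr_of_eventuallyEq ?_
      filter_upwards [h0] with y hy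
      simp [hF, hy]
  have hFf : ∀ᶠ w : U in 𝓝 z, F w = f.1 w := by
    have h1 : ∀ᶠ w : Fin n → ℂ in 𝓝 (z : Fin n → ℂ), χ w = 1 := χ.eventuallyEq_one
    filter_upwards [continuousAt_subtype_val.eventually h1] with w hw
    simp only [hF, hw, one_smul, zeroExt_apply]
  have hW : ∀ s, ContDiff ℝ ∞ (wirtinger s F) := fun s => by
    have h1 := contDiffOn_wirtinger (U := ⊤) s hFs.contDiffOn
    rwa [TopologicalSpace.Opens.coe_top, contDiffOn_univ] at h1
  have hQ : ∀ s, ContDiff ℝ ∞ fun w => ∫ t in (0 : ℝ)..1,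
      wirtinger s F ((z : Fin n → ℂ) + t • (w - z)) := fun s => by
    refine contDiff_integral_unit (G := fun w t => wirtinger s F ((z : Fin n → ℂ) + t • (w - z))) ?_
    exact (hW s).comp (contDiff_const.add (contDiff_snd.smul (contDiff_fst.sub contDiff_const)))
  refine ⟨fun s => germ z ⟨fun w => ∫ t in (0 : ℝ)..1,
      wirtinger s F ((z : Fin n → ℂ) + t • ((w : Fin n → ℂ) - z)),
      contDiffOn_zeroExt (hQ s).contDiffOn fun _ => rfl⟩, ?_⟩
  have hx : ∀ s, (germAlg z).x s = germ z (coordFn U s) := fun s => rfl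
  have hcm : ∀ c : ℂ, algebraMap ℂ (Germ z) c = germ z (algebraMap ℂ _ c) := fun c =>
    ((germ z).commutes c).symm
  simp only [hx, germEval_germ, hcm, ← map_sub, ← map_mul, ← map_sum, ← map_add]
  rw [germ_eq_iff]
  filter_upwards [hFf] with w hw
  have hz : F z = f.1 z := by
    simp only [hF, zeroExt_apply]
    rw [χ.one_of_mem_closedBall (Metric.mem_closedBall_self χ.rIn_pos.le), one_smul]
  set v : Fin n → ℂ := (w : Fin n → ℂ) - z with hv
  -- Fundamental theorem of calculus along the segment from `z` to `w`; the chain rule in Wirtinger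
  -- form produces the coordinate factors.
  have hd : ∀ t ∈ Set.uIcc (0 : ℝ) 1, HasDerivAt (fun t : ℝ => F ((z : Fin n → ℂ) + t • v))
      (∑ s, coordCLM s v * wirtinger s F ((z : Fin n → ℂ) + t • v)) t := fun t _ => by
    have h1 : HasDerivAt (fun t : ℝ => (z : Fin n → ℂ) + t • v) v t := by
      simpa using ((hasDerivAt_id t).smul_const v).const_add (z : Fin n → ℂ)
    have h2 := ((hFs.differentiable (by simp)) ((z : Fin n → ℂ) + t • v)).hasFDerivAt.comp_hasDerivAt
      t h1
    simp only [wirtinger_eq]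
    rw [← clm_eq_sum_coord]
    exact h2
  have hc : ∀ s, Continuous fun t : ℝ => wirtinger s F ((z : Fin n → ℂ) + t • v) := fun s =>
    (hW s).continuous.comp (by fun_prop)
  have h3 := intervalIntegral.integral_eq_sub_of_hasDerivAt hd
    (Continuous.intervalIntegrable (by fun_prop) _ _)
  rw [intervalIntegral.integral_finsetSum fun s _ =>
    Continuous.intervalIntegrable (by fun_prop) _ _] at h3
  simp only [intervalIntegral.integral_const_mul, zero_smul, add_zero, one_smul] at h3
  rw [hv, add_sub_cancel, hw, hz] at h3
  rw [eq_add_of_sub_eq' h3.symm]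
  simp only [AddMemClass.coe_add, AddSubmonoidClass.coe_finsetSum, MulMemClass.coe_mul,
    AddSubgroupClass.coe_sub, Pi.add_apply, Finset.sum_apply, Pi.mul_apply, Pi.sub_apply, map_sub]
  rfl

end Hadamard

end BerezinLog
end
noncomputable section
set_option linter.unusedSectionVars false
namespace BerezinLog

open CoordAlg

/-! ### Uniqueness of the source and target mappings -/

/-- In the lowest degree only the constant term of the other factor contributes; below, this turns
multiplicativity of a mapping into a Leibniz rule. -/
theorem CoordAlg.coeff_mul_of_ordGE {n : ℕ} {R : Type*} [CommRing R] [Algebra ℂ R] {m : ℕ}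
    {P Q : MvPowerSeries (Idx n) R} (hP : OrdGE m P) {α : Idx n →₀ ℕ} (hα : α.degree = m) :
    MvPowerSeries.coeff α (P * Q) = MvPowerSeries.coeff α P * MvPowerSeries.coeff 0 Q := by
  classical
  rw [MvPowerSeries.coeff_mul, Finset.sum_eq_single (α, 0)]
  · rintro ⟨β, γ⟩ hp hne
    rw [Finset.HasAntidiagonal.mem_antidiagonal] at hp
    have h1 : β.degree + γ.degree = m := by rw [← hα, ← hp, map_add]
    have h2 : γ ≠ 0 := by
      rintro rfl
      exact hne (by rw [← hp, add_zero])
    have h3 : γ.degree ≠ 0 := fun h => h2 ((Finsupp.degree_eq_zero_iff γ).1 h)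
    rw [hP β (by omega), zero_mul]
  · intro h
    exact absurd (Finset.HasAntidiagonal.mem_antidiagonal.2 (add_zero α)) h

section Uniqueness

variable {n : ℕ} {M : Type*} [TopologicalSpace M] [ChartedSpace (Fin n → ℂ) M]
  [IsManifold 𝓘(ℂ, Fin n → ℂ) ω M] [T2Space M]

theorem exists_cutoff {V : Set M} {x : M} (hV : V ∈ 𝓝 x) :
    ∃ χ : Fn n M, Fn.fn χ x = 1 ∧ ∀ y ∉ V, Fn.fn χ y = 0 := by
  have : IsManifold 𝓘(ℝ, Fin n → ℂ) ∞ M := isManifold_real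
  obtain ⟨b, -, hb⟩ := (SmoothBumpFunction.nhds_basis_tsupport (I := 𝓘(ℝ, Fin n → ℂ)) x).mem_iff.1 hV
  refine ⟨Fn.of ⟨fun y => b y • (1 : ℂ), ?_⟩, ?_, fun y hy => ?_⟩
  · exact ContMDiff.smul b.contMDiff contMDiff_const
  · rw [Fn.fn_of]
    simp
  · rw [Fn.fn_of]
    have h : b y = 0 := image_eq_zero_of_notMem_tsupport fun h => hy (hb h)
    simp [h]

/-- A derivation at a point that annihilates local coordinates is zero. -/
theorem pointDerivation_eq_zero {φ : Chart n M} {z : dom φ} {X : Idx n → Fn n M}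
    (hX : ∀ s, gm φ z (X s) = (germAlg z).x s) (δ : Fn n M →ₗ[ℂ] ℂ)
    (hδ : ∀ f g, δ (f * g) = δ f * Fn.fn g (pt φ z) + Fn.fn f (pt φ z) * δ g)
    (h : ∀ s, δ (X s) = 0) (f : Fn n M) : δ f = 0 := by
  have h1 : δ 1 = 0 := by
    have h2 := hδ 1 1
    rw [mul_one, Fn.fn_one] at h2
    simpa using h2
  have hc : ∀ c : ℂ, δ (algebraMap ℂ _ c) = 0 := fun c => by
    rw [Algebra.algebraMap_eq_smul_one, map_smul, h1, smul_zero]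
  -- A derivation at a point is local: multiply `u` by a cutoff that is one at the point and
  -- vanishes wherever `u` does not.
  have hloc : ∀ u : Fn n M, gm φ z u = 0 → δ u = 0 := fun u hu => by
    have hu1 := gm_eq_zero_iff.1 hu
    obtain ⟨χ, hχ1, hχ⟩ := exists_cutoff (n := n) hu1
    have h2 : χ * u = 0 := Fn.ext fun y => by
      rw [Fn.fn_mul, Pi.mul_apply]
      by_cases hy : Fn.fn u y = 0
      · rw [hy, mul_zero]; rfl
      · rw [hχ y hy, zero_mul]; rfl
    have h3 := hδ χ u
    rw [h2, map_zero, hχ1, hu1.self_of_nhds] at h3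
    simpa using h3.symm
  obtain ⟨q, hq⟩ := exists_hadamard z (locF φ f)
  choose Q hQ using fun s => gm_surjective φ z (q s)
  have hgm : ∀ c : ℂ, gm φ z (algebraMap ℂ _ c) = algebraMap ℂ _ c := fun c => (gm φ z).commutes c
  have h4 : gm φ z (f - (algebraMap ℂ _ ((locF φ f).1 z) +
      ∑ s, (X s - algebraMap ℂ _ (germEval z ((germAlg z).x s))) * Q s)) = 0 := by
    rw [map_sub, gm_apply φ z f, hq, map_add, map_sum, hgm, sub_eq_zero]
    congr 1
    refine Finset.sum_congr rfl fun s _ => ?_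
    rw [map_mul (gm φ z), map_sub, hX, hgm, hQ]
  have h5 := hloc _ h4
  rw [map_sub, map_add, hc, zero_add, map_sum, sub_eq_zero] at h5
  rw [h5]
  refine Finset.sum_eq_zero fun s _ => ?_
  rw [hδ, map_sub, h, hc, ← germEval_gm φ z (X s - _), map_sub (gm φ z), hX, hgm, map_sub (germEval z),
    AlgHom.commutes]
  simp

/-- The properties of a source or target mapping that determine it: the fibre derivatives of the
values on local coordinates are values of the mapping on prescribed functions. -/
structure IsRigid (X : ∀ φ : Chart n M, dom φ → Idx n → Fn n M)
    (w₀ w₁ : ∀ φ : Chart n M, dom φ → Idx n → Idx n → Fn n M)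
    (σ : Fn n M →ₗ[ℂ] Eps (FormalFn n M)) : Prop where
  unit_fst : ∀ φ z f, MvPowerSeries.coeff 0 (sgm σ φ z f).1 = gm φ z f
  unit_snd : ∀ φ z f, MvPowerSeries.coeff 0 (sgm σ φ z f).2 = 0
  mul : ∀ φ z f g, sgm σ φ z (f * g) = epsMul (sgm σ φ z f) (sgm σ φ z g)
  deriv : ∀ φ z s t, ((MvPowerSeries.pderiv (Germ z) s (sgm σ φ z (X φ z t)).1,
      MvPowerSeries.pderiv (Germ z) s (sgm σ φ z (X φ z t)).2) : Eps _) =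
    ((sgm σ φ z (w₀ φ z s t)).1, (sgm σ φ z (w₀ φ z s t)).2 + (sgm σ φ z (w₁ φ z s t)).1)

theorem sgm_smul (σ : Fn n M →ₗ[ℂ] Eps (FormalFn n M)) (φ : Chart n M) (z : dom φ) (a : ℂ)
    (u : Fn n M) : sgm σ φ z (a • u) = a • sgm σ φ z u := by
  rw [sgm, map_smul, mapEps_locEps_smul]
  rfl

/-- Evaluation at a point of a coefficient of the two components of the symbol. -/
def evalCoeff (σ : Fn n M →ₗ[ℂ] Eps (FormalFn n M)) (φ : Chart n M) (z : dom φ) (α : Idx n →₀ ℕ) :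
    Fn n M →ₗ[ℂ] ℂ × ℂ where
  toFun f := (germEval z (MvPowerSeries.coeff α (sgm σ φ z f).1),
    germEval z (MvPowerSeries.coeff α (sgm σ φ z f).2))
  map_add' f g := by
    rw [sgm_add]
    simp only [Prod.fst_add, Prod.snd_add, map_add]
    rfl
  map_smul' a f := by
    rw [sgm_smul]
    refine Prod.ext ?_ ?_
    · exact map_smul (germEval z) a (MvPowerSeries.coeff α (sgm σ φ z f).1)
    · exact map_smul (germEval z) a (MvPowerSeries.coeff α (sgm σ φ z f).2)

/-- Induction on the degree. In the first degree where the mappings may differ, the difference at a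
point is a derivation by multiplicativity. It kills coordinates, because their fibre derivatives are
values of the mapping in lower degree, and `pointDerivation_eq_zero` applies. -/
theorem IsRigid.ordGE_sub {X : ∀ φ : Chart n M, dom φ → Idx n → Fn n M}
    {w₀ w₁ : ∀ φ : Chart n M, dom φ → Idx n → Idx n → Fn n M}
    {σ σ' : Fn n M →ₗ[ℂ] Eps (FormalFn n M)} (hX : ∀ φ z s, gm φ z (X φ z s) = (germAlg z).x s)
    (hσ : IsRigid X w₀ w₁ σ) (hσ' : IsRigid X w₀ w₁ σ') (m : ℕ) :
    ∀ φ z f, OrdGE m ((sgm σ φ z f).1 - (sgm σ' φ z f).1) ∧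
      OrdGE m ((sgm σ φ z f).2 - (sgm σ' φ z f).2) := by
  induction m with
  | zero => exact fun φ z f => ⟨fun α hα => absurd hα (Nat.not_lt_zero _),
      fun α hα => absurd hα (Nat.not_lt_zero _)⟩
  | succ m ih =>
    have key : ∀ (φ : Chart n M) (z : dom φ) (f : Fn n M) (α : Idx n →₀ ℕ), α.degree = m →
        evalCoeff σ φ z α f = evalCoeff σ' φ z α f := by
      intro φ z f α hα
      by_cases hα0 : α = 0
      · subst hα0
        refine Prod.ext ?_ ?_
        · exact congrArg (germEval z) ((hσ.unit_fst φ z f).trans (hσ'.unit_fst φ z f).symm)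
        · exact congrArg (germEval z) ((hσ.unit_snd φ z f).trans (hσ'.unit_snd φ z f).symm)
      obtain ⟨s, β, rfl⟩ := exists_eq_add_single hα0
      have hβ : β.degree < m := by
        rw [map_add, Finsupp.degree_single] at hα
        omega
      have hX0 : ∀ t, evalCoeff σ φ z (β + Finsupp.single s 1) (X φ z t) =
          evalCoeff σ' φ z (β + Finsupp.single s 1) (X φ z t) := by
        intro t
        have e : ∀ u, MvPowerSeries.coeff β (sgm σ φ z u).1 = MvPowerSeries.coeff β (sgm σ' φ z u).1 ∧
            MvPowerSeries.coeff β (sgm σ φ z u).2 = MvPowerSeries.coeff β (sgm σ' φ z u).2 := fun u => by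
          have h1 := (ih φ z u).1 β hβ
          have h2 := (ih φ z u).2 β hβ
          rw [map_sub, sub_eq_zero] at h1 h2
          exact ⟨h1, h2⟩
        have d1 := Prod.ext_iff.1 (hσ.deriv φ z s t)
        have d2 := Prod.ext_iff.1 (hσ'.deriv φ z s t)
        simp only at d1 d2
        refine Prod.ext ?_ ?_
        · refine congrArg (germEval z) (coeff_add_single_eq ?_)
          rw [d1.1, d2.1, (e _).1]
        · refine congrArg (germEval z) (coeff_add_single_eq ?_)
          rw [d1.2, d2.2, map_add, map_add, (e _).1, (e _).2]
      generalize β + Finsupp.single s 1 = α at hα hX0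
      have hu := fun f => (hσ.unit_fst φ z f)
      have hu' := fun f => (hσ'.unit_fst φ z f)
      have hv := fun f => (hσ.unit_snd φ z f)
      have hv' := fun f => (hσ'.unit_snd φ z f)
      have h1 : ∀ f, (evalCoeff σ φ z α - evalCoeff σ' φ z α) f =
          (germEval z (MvPowerSeries.coeff α ((sgm σ φ z f).1 - (sgm σ' φ z f).1)),
            germEval z (MvPowerSeries.coeff α ((sgm σ φ z f).2 - (sgm σ' φ z f).2))) := fun f => by
        simp only [map_sub]
        rfl
      have h2 : ∀ f g, MvPowerSeries.coeff α ((sgm σ φ z (f * g)).1 - (sgm σ' φ z (f * g)).1) =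
          MvPowerSeries.coeff α ((sgm σ φ z f).1 - (sgm σ' φ z f).1) * gm φ z g +
          gm φ z f * MvPowerSeries.coeff α ((sgm σ φ z g).1 - (sgm σ' φ z g).1) := fun f g => by
        have e : (sgm σ φ z (f * g)).1 - (sgm σ' φ z (f * g)).1 =
            ((sgm σ φ z f).1 - (sgm σ' φ z f).1) * (sgm σ φ z g).1 +
            ((sgm σ φ z g).1 - (sgm σ' φ z g).1) * (sgm σ' φ z f).1 := by
          rw [hσ.mul, hσ'.mul]
          simp only [epsMul]
          ring
        rw [e, map_add, coeff_mul_of_ordGE (ih φ z f).1 hα, coeff_mul_of_ordGE (ih φ z g).1 hα, hu, hu',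
          mul_comm (MvPowerSeries.coeff α ((sgm σ φ z g).1 - _))]
      -- The cross terms pair a difference with an `ε` component, whose constant term is zero, so
      -- the Leibniz rule holds for the `ε` part separately.
      have h3 : ∀ f g, MvPowerSeries.coeff α ((sgm σ φ z (f * g)).2 - (sgm σ' φ z (f * g)).2) =
          MvPowerSeries.coeff α ((sgm σ φ z f).2 - (sgm σ' φ z f).2) * gm φ z g +
          gm φ z f * MvPowerSeries.coeff α ((sgm σ φ z g).2 - (sgm σ' φ z g).2) := fun f g => by
        have e : (sgm σ φ z (f * g)).2 - (sgm σ' φ z (f * g)).2 =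
            ((sgm σ φ z f).1 - (sgm σ' φ z f).1) * (sgm σ φ z g).2 +
            ((sgm σ φ z g).2 - (sgm σ' φ z g).2) * (sgm σ' φ z f).1 +
            ((sgm σ φ z f).2 - (sgm σ' φ z f).2) * (sgm σ φ z g).1 +
            ((sgm σ φ z g).1 - (sgm σ' φ z g).1) * (sgm σ' φ z f).2 := by
          rw [hσ.mul, hσ'.mul]
          simp only [epsMul]
          ring
        rw [e, map_add, map_add, map_add, coeff_mul_of_ordGE (ih φ z f).1 hα,
          coeff_mul_of_ordGE (ih φ z g).1 hα, coeff_mul_of_ordGE (ih φ z f).2 hα,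
          coeff_mul_of_ordGE (ih φ z g).2 hα, hu, hu', hv, hv']
        ring
      have hd1 := pointDerivation_eq_zero (hX φ z)
        ((LinearMap.fst ℂ ℂ ℂ).comp (evalCoeff σ φ z α - evalCoeff σ' φ z α))
        (fun f g => by
          rw [LinearMap.comp_apply, LinearMap.comp_apply, LinearMap.comp_apply, h1, h1, h1]
          simp only [LinearMap.fst_apply]
          rw [h2, map_add, map_mul, map_mul, germEval_gm, germEval_gm])
        (fun t => by
          rw [LinearMap.comp_apply, LinearMap.sub_apply, hX0, sub_self, map_zero]) f
      have hd2 := pointDerivation_eq_zero (hX φ z)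
        ((LinearMap.snd ℂ ℂ ℂ).comp (evalCoeff σ φ z α - evalCoeff σ' φ z α))
        (fun f g => by
          rw [LinearMap.comp_apply, LinearMap.comp_apply, LinearMap.comp_apply, h1, h1, h1]
          simp only [LinearMap.snd_apply]
          rw [h3, map_add, map_mul, map_mul, germEval_gm, germEval_gm])
        (fun t => by
          rw [LinearMap.comp_apply, LinearMap.sub_apply, hX0, sub_self, map_zero]) f
      exact sub_eq_zero.1 (Prod.ext hd1 hd2)
    intro φ z f
    -- Equality of values at every point of the chart gives equality of the coefficient functions,
    -- hence of their germs.
    have h1 : ∀ α : Idx n →₀ ℕ, α.degree = m →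
        MvPowerSeries.coeff α (locEps φ (σ f)).1 = MvPowerSeries.coeff α (locEps φ (σ' f)).1 ∧
        MvPowerSeries.coeff α (locEps φ (σ f)).2 = MvPowerSeries.coeff α (locEps φ (σ' f)).2 :=
      fun α hα => ⟨Subtype.ext (funext fun w => congrArg Prod.fst (key φ w f α hα)),
        Subtype.ext (funext fun w => congrArg Prod.snd (key φ w f α hα))⟩
    constructor
    · intro α hα
      rcases Nat.lt_succ_iff_lt_or_eq.1 hα with h | h
      · exact (ih φ z f).1 α h
      · rw [map_sub, sub_eq_zero]
        exact congrArg (germ z) (h1 α h).1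
    · intro α hα
      rcases Nat.lt_succ_iff_lt_or_eq.1 hα with h | h
      · exact (ih φ z f).2 α h
      · rw [map_sub, sub_eq_zero]
        exact congrArg (germ z) (h1 α h).2

theorem IsRigid.unique {X : ∀ φ : Chart n M, dom φ → Idx n → Fn n M}
    {w₀ w₁ : ∀ φ : Chart n M, dom φ → Idx n → Idx n → Fn n M}
    {σ σ' : Fn n M →ₗ[ℂ] Eps (FormalFn n M)} (hX : ∀ φ z s, gm φ z (X φ z s) = (germAlg z).x s)
    (hσ : IsRigid X w₀ w₁ σ) (hσ' : IsRigid X w₀ w₁ σ') : σ = σ' := by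
  refine LinearMap.ext fun f => eps_ext_of_locEps fun φ z => ?_
  have h := fun m => hσ.ordGE_sub hX hσ' m φ z f
  refine Prod.ext ?_ ?_
  · ext1 α
    have h1 := (h (α.degree + 1)).1 α (Nat.lt_succ_self _)
    rwa [map_sub, sub_eq_zero] at h1
  · ext1 α
    have h1 := (h (α.degree + 1)).2 α (Nat.lt_succ_self _)
    rwa [map_sub, sub_eq_zero] at h1

end Uniqueness

end BerezinLog
end
noncomputable section
set_option linter.unusedSectionVars false
namespace BerezinLog

open CoordAlg

/-! ### Rigidity of deformation groupoids with separation of variables -/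

section Groupoid

variable {n : ℕ} {M : Type*} [TopologicalSpace M] [ChartedSpace (Fin n → ℂ) M]
  [IsManifold 𝓘(ℂ, Fin n → ℂ) ω M] [T2Space M]

theorem bracket_zero_left (t : Tensor11 n M) (v : Smooth n M) : bracket t 0 v = 0 := by
  refine Fn.of.injective (fn_ext_of_loc fun φ => ?_)
  rw [locF_of, loc_bracket, map_zero, map_zero]
  simp [locBracket]

theorem bracket_zero_right (t : Tensor11 n M) (u : Smooth n M) : bracket t u 0 = 0 := by
  refine Fn.of.injective (fn_ext_of_loc fun φ => ?_)
  rw [locF_of, loc_bracket, map_zero, map_zero]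
  simp [locBracket]

theorem CoordAlg.pb_antisymm {R : Type*} [CommRing R] [Algebra ℂ R] (𝔠 : CoordAlg n R)
    (P Q : MvPowerSeries (Idx n) R) : 𝔠.pb P Q = -𝔠.pb Q P := by
  simp only [pb, ← Finset.sum_neg_distrib]
  exact Finset.sum_congr rfl fun s _ => by ring

theorem CoordAlg.pbEps_antisymm {R : Type*} [CommRing R] [Algebra ℂ R] (𝔠 : CoordAlg n R)
    (P Q : Eps (MvPowerSeries (Idx n) R)) : 𝔠.pbEps P Q = -𝔠.pbEps Q P := by
  refine Prod.ext (pb_antisymm 𝔠 _ _) ?_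
  simp only [pbEps, Prod.snd_neg]
  rw [pb_antisymm 𝔠 P.1, pb_antisymm 𝔠 P.2]
  ring

/-- The restriction to `C^∞(M)` of a mapping defined on `C^∞(M)[ε]`. -/
def epsBase (S : Eps (Smooth n M) →ₗ[ℂ] Eps (FormalFn n M)) : Fn n M →ₗ[ℂ] Eps (FormalFn n M) :=
  S.comp ((LinearMap.inl ℂ (Smooth n M) (Smooth n M)).comp
    (Fn.of (n := n) (M := M)).symm.toLinearMap)

theorem epsBase_of (S : Eps (Smooth n M) →ₗ[ℂ] Eps (FormalFn n M)) (f : Smooth n M) :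
    epsBase S (Fn.of f) = S (f, 0) := rfl

theorem epsExt_epsBase {S : Eps (Smooth n M) →ₗ[ℂ] Eps (FormalFn n M)}
    (hS : ∀ f, S (epsMul (0, 1) f) = (0, (S f).fst)) : epsExt (epsBase S) = S := by
  refine LinearMap.ext fun f => ?_
  rw [epsExt_apply, epsBase_of, epsBase_of]
  have h1 : f = (f.1, 0) + epsMul (0, 1) (f.2, 0) := by
    simp [epsMul]
  conv_rhs => rw [h1, map_add, hS]
  exact Prod.ext (add_zero _).symm rfl

namespace IsDeformationGroupoidSep

variable {g k : Tensor11 n M} {S T S' T' : Eps (Smooth n M) →ₗ[ℂ] Eps (FormalFn n M)}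
  (h : IsDeformationGroupoidSep g k S T)

include h

theorem sgm_bracket_S (u v : Smooth n M) (φ : Chart n M) (z : dom φ) :
    (germAlg z).pbEps (sgm (epsBase S) φ z (Fn.of u)) (sgm (epsBase S) φ z (Fn.of v)) =
      ((sgm (epsBase S) φ z (Fn.of (bracket g u v))).1,
        (sgm (epsBase S) φ z (Fn.of (bracket g u v))).2 +
          (sgm (epsBase S) φ z (Fn.of (bracket k u v))).1) := by
  have h1 := congrArg (mapEps (germ z)) (h.bracket_S (u, 0) (v, 0) φ)
  rw [cotBracketEps_eq, (isMor_germ z).pbEps] at h1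
  have h2 : bracketEps g k (u, 0) (v, 0) = (bracket g u v, bracket k u v) := by
    simp [bracketEps, bracket_zero_left, bracket_zero_right]
  rw [h2] at h1
  have h3 := mapEps_epsExt (epsBase S) φ z (bracket g u v, bracket k u v)
  rw [epsExt_epsBase h.eps_S] at h3
  exact h1.symm.trans h3

theorem sgm_bracket_T (u v : Smooth n M) (φ : Chart n M) (z : dom φ) :
    -(germAlg z).pbEps (sgm (epsBase T) φ z (Fn.of u)) (sgm (epsBase T) φ z (Fn.of v)) =
      ((sgm (epsBase T) φ z (Fn.of (bracket g u v))).1,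
        (sgm (epsBase T) φ z (Fn.of (bracket g u v))).2 +
          (sgm (epsBase T) φ z (Fn.of (bracket k u v))).1) := by
  have h1 := congrArg (mapEps (germ z)) (h.bracket_T (u, 0) (v, 0) φ)
  have e : ∀ Q : Eps (LocFormal (dom φ)), mapEps (germ z) (-Q) = -mapEps (germ z) Q := fun Q =>
    Prod.ext (map_neg (mapF (germ z)) _) (map_neg (mapF (germ z)) _)
  rw [e, cotBracketEps_eq, (isMor_germ z).pbEps] at h1
  have h2 : bracketEps g k (u, 0) (v, 0) = (bracket g u v, bracket k u v) := by
    simp [bracketEps, bracket_zero_left, bracket_zero_right]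
  rw [h2] at h1
  have h3 := mapEps_epsExt (epsBase T) φ z (bracket g u v, bracket k u v)
  rw [epsExt_epsBase h.eps_T] at h3
  exact h1.symm.trans h3

theorem sgm_commute (u v : Fn n M) (φ : Chart n M) (z : dom φ) :
    (germAlg z).pbEps (sgm (epsBase S) φ z u) (sgm (epsBase T) φ z v) = 0 := by
  have h1 := congrArg (mapEps (germ z)) (h.commute (Fn.of.symm u, 0) (Fn.of.symm v, 0) φ)
  rw [IsBerezinPair.mapEps_zero, cotBracketEps_eq, (isMor_germ z).pbEps] at h1
  exact h1

theorem sgm_S_hol {φ : Chart n M} {z : dom φ} {U : Set M} (hU : IsOpen U) (hz : pt φ z ∈ U)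
    {a : Fn n M} (ha : HolOn (n := n) (Fn.fn a) U) :
    sgm (epsBase S) φ z a = (MvPowerSeries.C (gm φ z a), 0) :=
  ((eqOver_iff hU).1 (h.sep_S φ U hU (Fn.of.symm a) ha) z hz).trans (mapEps_liftFn φ z _)

theorem sgm_T_antihol {φ : Chart n M} {z : dom φ} {U : Set M} (hU : IsOpen U) (hz : pt φ z ∈ U)
    {b : Fn n M} (hb : AntiholOn (n := n) (Fn.fn b) U) :
    sgm (epsBase T) φ z b = (MvPowerSeries.C (gm φ z b), 0) :=
  ((eqOver_iff hU).1 (h.sep_T φ U hU (Fn.of.symm b) hb) z hz).trans (mapEps_liftFn φ z _)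

/-- The `ζ_s`-derivative of `S x_t` is `{S x_t, x_s}`. For a holomorphic coordinate `x_s = S x_s`,
and the bracket is `S` of a Poisson bracket; for an antiholomorphic one `x_s = T x_s`, and it
vanishes. -/
theorem isRigid_S {X : ∀ φ : Chart n M, dom φ → Idx n → Fn n M}
    {U : ∀ φ : Chart n M, dom φ → Set M} (hU : ∀ φ z, IsOpen (U φ z)) (hz : ∀ φ z, pt φ z ∈ U φ z)
    (hX : ∀ φ z s, gm φ z (X φ z s) = (germAlg z).x s)
    (hol : ∀ φ z i, HolOn (n := n) (Fn.fn (X φ z (Sum.inl i))) (U φ z))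
    (antihol : ∀ φ z i, AntiholOn (n := n) (Fn.fn (X φ z (Sum.inr i))) (U φ z)) :
    IsRigid X
      (fun φ z s t => Sum.elim (fun i => Fn.of (bracket g (Fn.of.symm (X φ z t))
        (Fn.of.symm (X φ z (Sum.inl i))))) (fun _ => 0) s)
      (fun φ z s t => Sum.elim (fun i => Fn.of (bracket k (Fn.of.symm (X φ z t))
        (Fn.of.symm (X φ z (Sum.inl i))))) (fun _ => 0) s) (epsBase S) where
  unit_fst φ z f := congrArg (germ z) (h.unit_S (Fn.of.symm f, 0) φ).1
  unit_snd φ z f := (congrArg (germ z) (h.unit_S (Fn.of.symm f, 0) φ).2).trans (by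
    rw [map_zero, map_zero])
  mul φ z f f' := by
    have h1 := congrArg (mapEps (germ z)) (h.mul_S (Fn.of.symm f, 0) (Fn.of.symm f', 0) φ)
    rw [mapEps_epsMul] at h1
    have h2 : epsMul ((Fn.of.symm f, 0) : Eps (Smooth n M)) (Fn.of.symm f', 0) =
        (Fn.of.symm (f * f'), 0) := by
      simp [epsMul]
    rw [h2] at h1
    exact h1
  deriv φ z s t := by
    refine (pbEps_C_x (𝔠 := germAlg z) _ s).symm.trans ?_
    rcases s with i | i
    · rw [← hX φ z, ← h.sgm_S_hol (hU φ z) (hz φ z) (hol φ z i)]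
      exact h.sgm_bracket_S (Fn.of.symm (X φ z t)) (Fn.of.symm (X φ z (Sum.inl i))) φ z
    · rw [← hX φ z, ← h.sgm_T_antihol (hU φ z) (hz φ z) (antihol φ z i), h.sgm_commute]
      have e : sgm (epsBase S) φ z 0 = 0 := by rw [← zero_smul ℂ (0 : Fn n M), sgm_smul, zero_smul]
      simp only [Sum.elim_inr, e]
      exact Prod.ext rfl (add_zero _).symm

/-- The two types of coordinates exchange roles, and the anti-Poisson property supplies the sign. -/
theorem isRigid_T {X : ∀ φ : Chart n M, dom φ → Idx n → Fn n M}
    {U : ∀ φ : Chart n M, dom φ → Set M} (hU : ∀ φ z, IsOpen (U φ z)) (hz : ∀ φ z, pt φ z ∈ U φ z)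
    (hX : ∀ φ z s, gm φ z (X φ z s) = (germAlg z).x s)
    (hol : ∀ φ z i, HolOn (n := n) (Fn.fn (X φ z (Sum.inl i))) (U φ z))
    (antihol : ∀ φ z i, AntiholOn (n := n) (Fn.fn (X φ z (Sum.inr i))) (U φ z)) :
    IsRigid X
      (fun φ z s t => Sum.elim (fun _ => 0) (fun i => -Fn.of (bracket g (Fn.of.symm (X φ z t))
        (Fn.of.symm (X φ z (Sum.inr i))))) s)
      (fun φ z s t => Sum.elim (fun _ => 0) (fun i => -Fn.of (bracket k (Fn.of.symm (X φ z t))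
        (Fn.of.symm (X φ z (Sum.inr i))))) s) (epsBase T) where
  unit_fst φ z f := congrArg (germ z) (h.unit_T (Fn.of.symm f, 0) φ).1
  unit_snd φ z f := (congrArg (germ z) (h.unit_T (Fn.of.symm f, 0) φ).2).trans (by
    rw [map_zero, map_zero])
  mul φ z f f' := by
    have h1 := congrArg (mapEps (germ z)) (h.mul_T (Fn.of.symm f, 0) (Fn.of.symm f', 0) φ)
    rw [mapEps_epsMul] at h1
    have h2 : epsMul ((Fn.of.symm f, 0) : Eps (Smooth n M)) (Fn.of.symm f', 0) =
        (Fn.of.symm (f * f'), 0) := by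
      simp [epsMul]
    rw [h2] at h1
    exact h1
  deriv φ z s t := by
    refine (pbEps_C_x (𝔠 := germAlg z) _ s).symm.trans ?_
    rcases s with i | i
    · rw [← hX φ z, ← h.sgm_S_hol (hU φ z) (hz φ z) (hol φ z i), pbEps_antisymm, h.sgm_commute]
      have e : sgm (epsBase T) φ z 0 = 0 := by rw [← zero_smul ℂ (0 : Fn n M), sgm_smul, zero_smul]
      simp only [Sum.elim_inl, e, neg_zero]
      exact Prod.ext rfl (add_zero _).symm
    · rw [← hX φ z, ← h.sgm_T_antihol (hU φ z) (hz φ z) (antihol φ z i)]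
      simp only [Sum.elim_inr, IsBerezinPair.sgm_neg]
      have h1 := h.sgm_bracket_T (Fn.of.symm (X φ z t)) (Fn.of.symm (X φ z (Sum.inr i))) φ z
      rw [neg_eq_iff_eq_neg] at h1
      refine h1.trans (Prod.ext rfl (neg_add _ _))

/-- A deformation groupoid with separation of variables is determined by `g + ε h`. -/
theorem unique (h' : IsDeformationGroupoidSep g k S' T') : S' = S ∧ T' = T := by
  choose X U hU hz hX hol antihol using exists_coordinates (n := n) (M := M)
  have h1 := (h'.isRigid_S hU hz hX hol antihol).unique hX (h.isRigid_S hU hz hX hol antihol)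
  have h2 := (h'.isRigid_T hU hz hX hol antihol).unique hX (h.isRigid_T hU hz hX hol antihol)
  exact ⟨by rw [← epsExt_epsBase h'.eps_S, h1, epsExt_epsBase h.eps_S],
    by rw [← epsExt_epsBase h'.eps_T, h2, epsExt_epsBase h.eps_T]⟩

end IsDeformationGroupoidSep

end Groupoid

end BerezinLog
end
noncomputable section
set_option linter.unusedSectionVars false
namespace BerezinLog

open CoordAlg

/-! ### The odd part of the logarithm and its symbol -/

section Logarithm

variable {n : ℕ} {M : Type*} [TopologicalSpace M] [ChartedSpace (Fin n → ℂ) M]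
  [IsManifold 𝓘(ℂ, Fin n → ℂ) ω M]

theorem homEval_smul {U : TopologicalSpace.Opens (Fin n → ℂ)} (r : ℕ) (a : ℂ) (P : LocFormal U)
    (z : U) (v : Idx n → ℂ) : homEval r (a • P) z v = a * homEval r P z v := by
  simp only [homEval, Finset.mul_sum, ← mul_assoc]
  rfl

theorem coeff_oddPart (X : FormalOp n M) (r : ℕ) : PowerSeries.coeff r (oddPart X) =
    if 2 ≤ r ∧ Even r then PowerSeries.coeff (r + 1) X else 0 :=
  PowerSeries.coeff_mk r _

variable {C : ℕ → Smooth n M →ₗ[ℂ] Smooth n M →ₗ[ℂ] Smooth n M} {B X : FormalOp n M}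

theorem unFn_coeff_logOp (hB : IsBerezinTransform C B) (hX1 : PowerSeries.coeff 1 X = 0)
    (hX : B = formalExp (divNu X)) (r : ℕ) :
    unFn (DOp.val (PowerSeries.coeff r (logOp hB hX1 hX))) = PowerSeries.coeff (r + 1) X := by
  rw [logOp, FDO.coeff_lift, DOp.val_mk, coeff_fnOp_divNu]
  rfl

variable [T2Space M]

theorem isNatural_oddPart {g : Tensor11 n M} (hC : IsStarProductSep g C)
    (hB : IsBerezinTransform C B) (hX1 : PowerSeries.coeff 1 X = 0)
    (hX : B = formalExp (divNu X)) : IsNatural (oddPart X) := by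
  intro r
  rw [coeff_oddPart]
  split_ifs with hr
  · rw [← unFn_coeff_logOp hB hX1 hX]
    exact ((isBerezinPair hC hB hX1 hX).ordLE_of_even hr.2).isDiffOpOfOrderLE
  · intro φ z₀
    refine ⟨0, by simp, Filter.Eventually.of_forall fun z f => ?_⟩
    rw [Finsupp.sum_zero_index, LinearMap.zero_apply, map_zero]
    rfl

theorem IsBerezinPair.homEval_gen_snd {c : ℕ → Fn n M →ₗ[ℂ] Fn n M →ₗ[ℂ] Fn n M} {P : FDO n M}
    (h : IsBerezinPair c P) (r : ℕ) (φ : Chart n M) (z : dom φ) (f : Smooth n M) :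
    homEval r (h.gen.snd.1 φ) z (grad φ f z) = ((r.factorial : ℂ)⁻¹) *
      (unFn (DOp.val (PowerSeries.coeff (r + 1) (PowerSeries.X * P) -
        PowerSeries.coeff (r + 1) (PowerSeries.X * -negNu P)))
          ((f - algebraMap ℂ (Smooth n M) (f.1 (pt φ z))) ^ r)).1 (pt φ z) := by
  rw [gen, pairSymbol, mkFormal_apply]
  exact homEval_assemble h.natX.ordLE_sub r φ z f

theorem unFn_smul_apply (a : ℂ) (D : Module.End ℂ (Fn n M)) (u : Smooth n M) (x : M) :
    (unFn (a • D) u).1 x = a * (unFn D u).1 x := rfl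

/-- In degree `r` the `ε` part of the generating function is the symbol of `P_r - P'_r`, which is
`2X_{r+1}` for even `r` and zero for odd `r`. -/
theorem isSigmaSymbol_oddPart {g : Tensor11 n M} (hC : IsStarProductSep g C)
    (hB : IsBerezinTransform C B) (hX1 : PowerSeries.coeff 1 X = 0)
    (hX : B = formalExp (divNu X)) {F : FormalFn n M}
    (hF : F = (isBerezinPair hC hB hX1 hX).gen.snd) : IsSigmaSymbol (oddPart X) ((1 / 2 : ℂ) • F) := by
  intro r φ z f
  have h1 := (isBerezinPair hC hB hX1 hX).homEval_gen_snd r φ z f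
  rw [← hF] at h1
  refine (homEval_smul r (1 / 2) (F.1 φ) z _).trans ?_
  rw [h1, coeff_oddPart, mul_left_comm]
  congr 1
  rcases Nat.even_or_odd r with hr | hr
  · rw [IsBerezinPair.coeff_sub_dual_of_even hr, map_smul, unFn_smul_apply, unFn_coeff_logOp,
      ← mul_assoc, one_div, inv_mul_cancel₀ two_ne_zero, one_mul]
    split_ifs with h4
    · rfl
    · have h5 : r = 0 := by
        by_contra h5
        obtain ⟨m, rfl⟩ := hr
        exact h4 ⟨by omega, m, rfl⟩
      subst h5
      rw [zero_add, hX1]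
  · rw [IsBerezinPair.coeff_sub_dual_of_odd hr, map_zero,
      if_neg fun h4 => Nat.not_even_iff_odd.2 hr h4.2, ← zero_smul ℂ (0 : Module.End ℂ (Fn n M)),
      unFn_smul_apply, zero_mul, mul_zero]
    rfl

/-- Separation of variables kills `C_1(z^k, z̄^l)`, so the antisymmetrized product of coordinates
already gives `C_1(z̄^l, z^k)`, which is a coefficient of `X_2`. -/
theorem comp_eq_mixComp {g : Tensor11 n M} {c : ℕ → Fn n M →ₗ[ℂ] Fn n M →ₗ[ℂ] Fn n M} {P : FDO n M}
    (h : IsBerezinPair c P)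
    (hg : ∀ u v, Fn.of (bracket g u v) = c 1 (Fn.of u) (Fn.of v) - c 1 (Fn.of v) (Fn.of u))
    (φ : Chart n M) (l k : Fin n) : g.comp φ l k = mixComp (PowerSeries.coeff 1 P) φ l k := by
  refine eq_of_germ_eq fun z => ?_
  obtain ⟨X, U, hU, hz, hX, hX1, hX2⟩ := exists_coordinates φ z
  have h1 := congrArg (gm φ z) (hg (Fn.of.symm (X (Sum.inr l))) (Fn.of.symm (X (Sum.inl k))))
  have e : ∀ s t : Idx n, (germAlg z).d s ((germAlg z).x t) = if s = t then 1 else 0 :=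
    (germAlg z).d_x
  rw [gm_bracket, map_sub, h.gm_one, h.gm_one, AlgEquiv.apply_symm_apply, AlgEquiv.apply_symm_apply,
    hX, hX] at h1
  simp only [e] at h1
  simpa using h1

end Logarithm

end BerezinLog
end

/-! ### The theorem -/

theorem mainTheorem1 {n : ℕ} {M : Type*} [TopologicalSpace M] [T2Space M]
    [ChartedSpace (Fin n → ℂ) M] [IsManifold 𝓘(ℂ, Fin n → ℂ) ω M]
    (g : BerezinLog.Tensor11 n M) (hg : BerezinLog.IsKahlerPoisson g)
    (C : ℕ → BerezinLog.Smooth n M →ₗ[ℂ] BerezinLog.Smooth n M →ₗ[ℂ] BerezinLog.Smooth n M)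
    (hC : BerezinLog.IsStarProductSep g C)
    (B X : BerezinLog.FormalOp n M) (hB : BerezinLog.IsBerezinTransform C B)
    (hX0 : PowerSeries.coeff 0 X = 0) (hX1 : PowerSeries.coeff 1 X = 0)
    (hX : B = BerezinLog.formalExp (BerezinLog.divNu X)) :
    BerezinLog.IsNatural (BerezinLog.oddPart X) ∧
    ∃ h : BerezinLog.Tensor11 n M,
      (∀ (φ : BerezinLog.Chart n M) (f : BerezinLog.Smooth n M),
        BerezinLog.loc φ (PowerSeries.coeff 3 X f) =
          (1 / 2 : ℂ) • ∑ l, ∑ k, h.comp φ l k *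
            BerezinLog.pd (Sum.inl k) (BerezinLog.pd (Sum.inr l) (BerezinLog.loc φ f))) ∧
      BerezinLog.IsInfinitesimalDeformation g h ∧
      ∃ S T : BerezinLog.Eps (BerezinLog.Smooth n M) →ₗ[ℂ] BerezinLog.Eps (BerezinLog.FormalFn n M),
        BerezinLog.IsDeformationGroupoidSep g h S T ∧
        (∀ S' T', BerezinLog.IsDeformationGroupoidSep g h S' T' → S' = S ∧ T' = T) ∧
        ∃ F : BerezinLog.Eps (BerezinLog.FormalFn n M),
          BerezinLog.MemKEps F ∧
          BerezinLog.HasQuadraticPart F.fst g ∧ BerezinLog.HasQuadraticPart F.snd h ∧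
          (∀ F', BerezinLog.MemKEps F' → BerezinLog.HasQuadraticPart F'.fst g →
            BerezinLog.HasQuadraticPart F'.snd h → F' = F) ∧
          BerezinLog.IsGeneratedBy S T F ∧
          BerezinLog.IsSigmaSymbol (BerezinLog.oddPart X) ((1 / 2 : ℂ) • F.snd) := by
  have h := BerezinLog.isBerezinPair hC hB hX1 hX
  have hbr : ∀ u v, BerezinLog.Fn.of (BerezinLog.bracket g u v) =
      BerezinLog.fnC C 1 (BerezinLog.Fn.of u) (BerezinLog.Fn.of v) -
        BerezinLog.fnC C 1 (BerezinLog.Fn.of v) (BerezinLog.Fn.of u) := fun u v => by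
    rw [← hC.one, map_sub]
    rfl
  have hcomp := BerezinLog.comp_eq_mixComp h hbr
  refine ⟨BerezinLog.isNatural_oddPart hC hB hX1 hX, h.defTensor, fun φ f => ?_, fun φ => ?_,
    BerezinLog.epsExt h.src, BerezinLog.epsExt h.tgt, h.isDeformationGroupoidSep hbr,
    fun S' T' h' => (h.isDeformationGroupoidSep hbr).unique h', h.gen, h.memKEps_gen,
    h.hasQuadraticPart_fst hcomp, h.hasQuadraticPart_snd, fun F' hF' h1 h2 =>
      BerezinLog.IsBerezinPair.memKEps_unique h.memKEps_gen hF' (h.hasQuadraticPart_fst hcomp) h1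
        h.hasQuadraticPart_snd h2,
    h.isGeneratedBy, BerezinLog.isSigmaSymbol_oddPart hC hB hX1 hX rfl⟩
  · have h1 := h.isMixed_two.locF_apply_eq φ (BerezinLog.Fn.of f)
    have h2 : BerezinLog.loc φ (PowerSeries.coeff 3 X f) = BerezinLog.locF φ (BerezinLog.DOp.val
        (PowerSeries.coeff 2 (BerezinLog.logOp hB hX1 hX)) (BerezinLog.Fn.of f)) := by
      rw [← BerezinLog.unFn_coeff_logOp hB hX1 hX 2]
      rfl
    rw [h2, h1, Finset.smul_sum]
    refine Finset.sum_congr rfl fun l _ => ?_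
    rw [Finset.smul_sum]
    refine Finset.sum_congr rfl fun k _ => ?_
    -- The factor two in `defComp` meets the one half in `X_3 = ½ h^{lk} ∂_k ∂̄_l`.
    change _ = (1 / 2 : ℂ) • (((2 : ℂ) • _) * _)
    rw [smul_mul_assoc, smul_smul, one_div, inv_mul_cancel₀ two_ne_zero, one_smul]
    rfl
  -- The components of `g` are replaced by the coefficients of `X_2`, for which the linearized
  -- Jacobi identities were obtained.
  · simp only [hcomp]
    exact ⟨h.jacobi_left φ, h.jacobi_right φ⟩
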